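/- **Theorem.** Let $q\in\mathbb C^\times$ be not a root of unity, let $n\ge 1$, let $e_{ij}$ be the matrix units of $\operatorname{End}\mathbb C^n$, and let subscripts denote copies of $\operatorname{End}\mathbb C^n$ in a tensor product. *The algebra.* Let $f(x)=1+\sum_{k\ge1}f_kx^k$ be the formal power series determined by $f(xq^{2n})(1-x)(1-xq^{2n})=f(x)(1-xq^2)(1-xq^{2n-2})$, and put $R(x)=f(x)\overline R(x)$, where $$\overline R(x)=\sum_i e_{ii}\otimes e_{ii}+\frac{1-x}{q-q^{-1}x}\sum_{i\ne j}e_{ii}\otimes e_{jj}+\frac{(q-q^{-1})x}{q-q^{-1}x}\sum_{i>j}e_{ij}\otimes e_{ji}+\frac{q-q^{-1}}{q-q^{-1}x}\sum_{i<j}e_{ij}\otimes e_{ji},$$ expanded in powers of $x$. The quantum affine algebra $U_q(\widehat{\mathfrak{gl}}_n)$ is the associative $\mathbb C$-algebra generated by $l^+_{ij}[-r]$, $l^-_{ij}[r]$ ($1\le i,j\le n$, $r\ge0$) and an invertible central element $q^c$, subject to $l^+_{ji}[0]=l^-_{ij}[0]=0$ for $i<j$, $l^+_{ii}[0]l^-_{ii}[0]=l^-_{ii}[0]l^+_{ii}[0]=1$,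 and $$R(u/v)L_1^{\pm}(u)L_2^{\pm}(v)=L_2^{\pm}(v)L_1^{\pm}(u)R(u/v),\qquad R(uq^{-c}/v)L_1^{+}(u)L_2^{-}(v)=L_2^{-}(v)L_1^{+}(u)R(uq^{c}/v),$$ where $L^\pm(u)=\sum_{i,j}e_{ij}\otimes l^\pm_{ij}(u)$, $l^+_{ij}(u)=\sum_{r\ge0}l^+_{ij}[-r]u^r$ and $l^-_{ij}(u)=\sum_{r\ge0}l^-_{ij}[r]u^{-r}$. Let $U_{\rm cri}$ be its quotient by $q^c=q^{-n}$. For $p\ge 1$ let $J_p$ be the left ideal of $U_{\rm cri}$ generated by all products $l^-_{i_1j_1}[r_1]\cdots l^-_{i_sj_s}[r_s]$ with $r_1+\dots+r_s\ge p$, and let $\widetilde U_{\rm cri}=\varprojlim U_{\rm cri}/J_p$ be the completed quantum affine algebra at the critical level, with the multiplication extended by continuity. *The idempotents.* Let $H_m$ be the Hecke algebra over $\mathbb C$ with generators $T_1,\dots,T_{m-1}$ and relations $(T_i-q)(T_i+q^{-1})=0$, $T_iT_{i+1}T_i=T_{i+1}T_iT_{i+1}$, $T_iT_j=T_jT_i$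 for $|i-j|>1$, and let $T_\sigma$, $\sigma\in\mathfrak S_m$, be the product of the $T_i$ along a reduced decomposition of $\sigma$. For a partition $\lambda\vdash m$ let $V_\lambda$ have the orthonormal basis $v_\Lambda$ indexed by the standard $\lambda$-tableaux, with $$T_kv_\Lambda=\frac{q^{d}}{[d]_q}v_\Lambda+\sqrt{1-\frac1{[d]_q^2}}\;v_{\sigma_k\Lambda},\qquad d=c_{k+1}(\Lambda)-c_k(\Lambda),\qquad [d]_q=\frac{q^d-q^{-d}}{q-q^{-1}},$$ where $c_k(\Lambda)$ is the content $j-i$ of the box $(i,j)$ occupied by $k$ in $\Lambda$, the tableau $\sigma_k\Lambda$ is obtained from $\Lambda$ by exchanging $k$ and $k+1$, and $v_{\sigma_k\Lambda}=0$ if $\sigma_k\Lambda$ is not standard. The primitive idempotent of $\Lambda$ is $$e_\Lambda=\frac1{c_\lambda}\sum_{\sigma\in\mathfrak S_m}\langle T_{\sigma^{-1}}v_\Lambda,v_\Lambda\rangle\,T_\sigma\in H_m,\qquad c_\lambda=\prod_{\alpha\in\lambda}q^{c(\alpha)}[h(\alpha)]_q,$$ where $c(\alpha)$ and $h(\alpha)$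 are the content and the hook length of the box $\alpha$. Let $\mathcal E_\Lambda$ be the image of $e_\Lambda$ under the representation $T_k\mapsto P_{k,k+1}R_{k,k+1}$ of $H_m$ on $(\mathbb C^n)^{\otimes m}$, where $P=\sum_{i,j}e_{ij}\otimes e_{ji}$ and $R=q\sum_ie_{ii}\otimes e_{ii}+\sum_{i\ne j}e_{ii}\otimes e_{jj}+(q-q^{-1})\sum_{i<j}e_{ij}\otimes e_{ji}$. *The claim.* Let $\lambda$ be a Young diagram with $m$ boxes and at most $n$ rows, and let $D=\operatorname{diag}[q^{n-1},q^{n-3},\dots,q^{-n+1}]$. For a standard $\lambda$-tableau $\Lambda$ put $$S_\Lambda(z)=\operatorname{tr}_{1,\dots,m}L^+_1(zq^{-2c_1(\Lambda)})\cdots L^+_m(zq^{-2c_m(\Lambda)})\,L^-_m(zq^{-n-2c_m(\Lambda)})^{-1}\cdots L^-_1(zq^{-n-2c_1(\Lambda)})^{-1}D_1\cdots D_m\mathcal E_\Lambda .$$ Then the sums defining the coefficients of the (two-sided) Laurent series $S_\Lambda(z)$ converge in $\widetilde U_{\rm cri}$, all the coefficients belong to the center of $\widetilde U_{\rm cri}$,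 and $S_\Lambda(z)$ does not depend on the standard $\lambda$-tableau $\Lambda$ but only on $\lambda$. -/

import Mathlib

open scoped Kronecker

namespace QuantumAffine

noncomputable section

/-! ### The R-matrix -/

/-- The coefficients `f_k` of the normalizing series `f(x) = 1 + ∑_{k ≥ 1} f_k x^k`; the recursion
is the coefficient form of the functional equation `normSeries_functional_equation`. -/
def normCoeff (n : ℕ) (q : ℂˣ) : ℕ → ℂ
  | 0 => 1
  | 1 => ((q : ℂ) ^ (2 * n) + 1 - (q : ℂ) ^ 2 - (q : ℂ) ^ (2 * (n : ℤ) - 2)) /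
      ((q : ℂ) ^ (2 * n) - 1)
  | k + 2 => ((((q : ℂ) ^ (2 * n) + 1) * ((q : ℂ) ^ (2 * n)) ^ (k + 1)
        - (q : ℂ) ^ 2 - (q : ℂ) ^ (2 * (n : ℤ) - 2)) * normCoeff n q (k + 1)
      + ((q : ℂ) ^ (2 * n) - ((q : ℂ) ^ (2 * n)) ^ (k + 1)) * normCoeff n q k) /
      (((q : ℂ) ^ (2 * n)) ^ (k + 2) - 1)

/-- The normalizing power series `f(x)`. -/
def normSeries (n : ℕ) (q : ℂˣ) : PowerSeries ℂ := PowerSeries.mk (normCoeff n q)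

/-- The defining property of `f`:
`f(x q^{2n}) (1 - x) (1 - x q^{2n}) = f(x) (1 - x q^2) (1 - x q^{2n-2})`, together with `f(0) = 1`
(which holds by definition). -/
theorem normSeries_functional_equation (n : ℕ) (hn : 1 ≤ n) (q : ℂˣ)
    (hq : ∀ k : ℕ, 0 < k → q ^ k ≠ 1) :
    PowerSeries.rescale ((q : ℂ) ^ (2 * n)) (normSeries n q) *
        ((1 - PowerSeries.X) * (1 - PowerSeries.C ((q : ℂ) ^ (2 * n)) * PowerSeries.X)) =
      normSeries n q * ((1 - PowerSeries.C ((q : ℂ) ^ 2) * PowerSeries.X) *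
        (1 - PowerSeries.C ((q : ℂ) ^ (2 * (n : ℤ) - 2)) * PowerSeries.X)) := by
  have hQ : ∀ k : ℕ, 0 < k → ((q : ℂ) ^ (2 * n)) ^ k - 1 ≠ 0 := by
    intro k hk h
    apply hq (2 * n * k) (by positivity)
    ext
    push_cast
    rw [pow_mul]
    linear_combination h
  have hab : (q : ℂ) ^ 2 * (q : ℂ) ^ (2 * (n : ℤ) - 2) = (q : ℂ) ^ (2 * n) := by
    rw [← zpow_natCast (q : ℂ) 2, ← zpow_add₀ q.ne_zero, ← zpow_natCast]
    congr 1
    push_cast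
    ring
  set Q : ℂ := (q : ℂ) ^ (2 * n) with hQdef
  set b : ℂ := (q : ℂ) ^ (2 * (n : ℤ) - 2) with hb
  have e1 : ((1 - PowerSeries.X) * (1 - PowerSeries.C Q * PowerSeries.X) : PowerSeries ℂ) =
      1 - PowerSeries.C (Q + 1) * PowerSeries.X + PowerSeries.C Q * PowerSeries.X ^ 2 := by
    simp only [map_add, map_one]; ring
  have e2 : ((1 - PowerSeries.C ((q : ℂ) ^ 2) * PowerSeries.X) *
        (1 - PowerSeries.C b * PowerSeries.X) : PowerSeries ℂ) =
      1 - PowerSeries.C ((q : ℂ) ^ 2 + b) * PowerSeries.X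
        + PowerSeries.C Q * PowerSeries.X ^ 2 := by
    rw [← hab]; simp only [map_add, map_mul]; ring
  rw [e1, e2]
  have key : ∀ (g : PowerSeries ℂ) (s t : ℂ),
      g * (1 - PowerSeries.C s * PowerSeries.X + PowerSeries.C t * PowerSeries.X ^ 2) =
      g - PowerSeries.C s * (g * PowerSeries.X) + PowerSeries.C t * (g * PowerSeries.X ^ 2) := by
    intro g s t; ring
  have lin : ∀ (k : ℕ) (g h : PowerSeries ℂ) (g' : PowerSeries ℂ) (s t : ℂ),
      PowerSeries.coeff k (g - PowerSeries.C s * h + PowerSeries.C t * g') =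
      PowerSeries.coeff k g - s * PowerSeries.coeff k h + t * PowerSeries.coeff k g' := by
    intro k g h g' s t
    simp only [map_add, map_sub, PowerSeries.coeff_C_mul]
  rw [key, key]
  ext k
  rw [lin, lin, PowerSeries.coeff_rescale]
  match k with
  | 0 => simp [PowerSeries.coeff_mul_X_pow', normSeries]
  | 1 =>
    have h1 := hQ 1 one_pos
    have hX : ∀ g : PowerSeries ℂ, PowerSeries.coeff 1 (g * PowerSeries.X) =
      PowerSeries.coeff 0 g := fun g => PowerSeries.coeff_succ_mul_X 0 g
    rw [hX, hX]
    simp only [PowerSeries.coeff_mul_X_pow', normSeries, PowerSeries.coeff_rescale,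
      PowerSeries.coeff_mk, normCoeff]
    rw [pow_one] at h1
    norm_num
    rw [← hQdef, ← hb]
    field_simp
    ring
  | k + 2 =>
    have h2 := hQ (k + 2) (by omega)
    have hX : ∀ g : PowerSeries ℂ, PowerSeries.coeff (k + 2) (g * PowerSeries.X) =
      PowerSeries.coeff (k + 1) g := fun g => PowerSeries.coeff_succ_mul_X (k + 1) g
    have hX2 : ∀ g : PowerSeries ℂ, PowerSeries.coeff (k + 2) (g * PowerSeries.X ^ 2) =
      PowerSeries.coeff k g := fun g => PowerSeries.coeff_mul_X_pow g 2 k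
    rw [hX, hX, hX2, hX2]
    simp only [normSeries, PowerSeries.coeff_rescale, PowerSeries.coeff_mk]
    have e : normCoeff n q (k + 2) * (Q ^ (k + 2) - 1) =
        ((Q + 1) * Q ^ (k + 1) - (q : ℂ) ^ 2 - b) * normCoeff n q (k + 1)
      + (Q - Q ^ (k + 1)) * normCoeff n q k := by
      rw [normCoeff, ← hQdef, ← hb, div_mul_cancel₀ _ h2]
    linear_combination e

/-- The matrix `R̄(x)` with entries in `ℂ⟦x⟧`. The entry in row `(a, b)` and column `(c, d)` is the
coefficient of `e_{ac} ⊗ e_{bd}`, and `1 / (q - q⁻¹ x)` is expanded in powers of `x`. -/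
def RBar (n : ℕ) (q : ℂˣ) : Matrix (Fin n × Fin n) (Fin n × Fin n) (PowerSeries ℂ) :=
  let den : PowerSeries ℂ := PowerSeries.C (q : ℂ) - PowerSeries.C (q : ℂ)⁻¹ * PowerSeries.X
  Matrix.of fun s t =>
    if s = t then
      if s.1 = s.2 then 1 else (1 - PowerSeries.X) * den⁻¹
    else if s.1 = t.2 ∧ s.2 = t.1 then
      if s.2 < s.1 then PowerSeries.C ((q : ℂ) - (q : ℂ)⁻¹) * PowerSeries.X * den⁻¹
      else PowerSeries.C ((q : ℂ) - (q : ℂ)⁻¹) * den⁻¹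
    else 0

/-- The coefficient of `x^k` in the R-matrix `R(x) = f(x) R̄(x)`. -/
def RCoeff (n : ℕ) (q : ℂˣ) (k : ℕ) : Matrix (Fin n × Fin n) (Fin n × Fin n) ℂ :=
  (RBar n q).map fun g => PowerSeries.coeff k (normSeries n q * g)

/-! ### The quantum affine algebra -/

/-- The generators `l⁺_{ij}[-r]`, `l⁻_{ij}[r]`, `q^c` and `q^{-c}`. -/
inductive Gen (n : ℕ) : Type
  | plus (i j : Fin n) (r : ℕ) : Gen n
  | minus (i j : Fin n) (r : ℕ) : Gen n
  | qc : Gen n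
  | qcInv : Gen n

section RLL

variable {n : ℕ} {A : Type*} [Ring A] [Algebra ℂ A]

/-- The coefficient of `u^a` in the series `∑_{r ≥ 0} x_r u^r`. -/
def upCoeff {M : Type*} [Zero M] (x : ℕ → M) (a : ℤ) : M := if 0 ≤ a then x a.toNat else 0

/-- The coefficient of `u^a` in the series `∑_{r ≥ 0} x_r u^{-r}`. -/
def downCoeff {M : Type*} [Zero M] (x : ℕ → M) (a : ℤ) : M := if a ≤ 0 then x (-a).toNat else 0

/-- The coefficient of `u^a v^b` in `R(u g / v) X₁(u) Y₂(v)`, where `g` is central, `X(u)` is a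
Laurent series with coefficients `X a` and `Y(v)` is a Laurent series with coefficients `Y b`.
If `X a` vanishes for all `a < 0`, or `Y b` vanishes for all `b > 0`, then the summands with
`k > |a| + |b|` are zero. -/
def rllLeft (q : ℂˣ) (g : A) (X Y : ℤ → Matrix (Fin n) (Fin n) A) (a b : ℤ) :
    Matrix (Fin n × Fin n) (Fin n × Fin n) A :=
  ∑ k ∈ Finset.range (a.natAbs + b.natAbs + 1),
    g ^ k • ((RCoeff n q k).map (algebraMap ℂ A) * (X (a - k) ⊗ₖ 1) * (1 ⊗ₖ Y (b + k)))

/-- The coefficient of `u^a v^b` in `Y₂(v) X₁(u) R(u g / v)`, under the same conventions. -/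
def rllRight (q : ℂˣ) (g : A) (X Y : ℤ → Matrix (Fin n) (Fin n) A) (a b : ℤ) :
    Matrix (Fin n × Fin n) (Fin n × Fin n) A :=
  ∑ k ∈ Finset.range (a.natAbs + b.natAbs + 1),
    g ^ k • ((1 ⊗ₖ Y (b + k)) * (X (a - k) ⊗ₖ 1) * (RCoeff n q k).map (algebraMap ℂ A))

end RLL

/-- The coefficients of `L⁺(u)` over the free algebra. -/
def freePlus (n : ℕ) : ℤ → Matrix (Fin n) (Fin n) (FreeAlgebra ℂ (Gen n)) :=
  upCoeff fun r => Matrix.of fun i j => FreeAlgebra.ι ℂ (Gen.plus i j r)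

/-- The coefficients of `L⁻(u)` over the free algebra. -/
def freeMinus (n : ℕ) : ℤ → Matrix (Fin n) (Fin n) (FreeAlgebra ℂ (Gen n)) :=
  downCoeff fun r => Matrix.of fun i j => FreeAlgebra.ι ℂ (Gen.minus i j r)

open FreeAlgebra in
/-- The defining relations of the quantum affine algebra. -/
inductive Rel (n : ℕ) (q : ℂˣ) : FreeAlgebra ℂ (Gen n) → FreeAlgebra ℂ (Gen n) → Prop
  | plus_zero (i j : Fin n) (h : i < j) : Rel n q (ι ℂ (Gen.plus j i 0)) 0
  | minus_zero (i j : Fin n) (h : i < j) : Rel n q (ι ℂ (Gen.minus i j 0)) 0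
  | plus_minus (i : Fin n) : Rel n q (ι ℂ (Gen.plus i i 0) * ι ℂ (Gen.minus i i 0)) 1
  | minus_plus (i : Fin n) : Rel n q (ι ℂ (Gen.minus i i 0) * ι ℂ (Gen.plus i i 0)) 1
  | qc_central (x : Gen n) : Rel n q (ι ℂ Gen.qc * ι ℂ x) (ι ℂ x * ι ℂ Gen.qc)
  | qc_mul_inv : Rel n q (ι ℂ Gen.qc * ι ℂ Gen.qcInv) 1
  | qc_inv_mul : Rel n q (ι ℂ Gen.qcInv * ι ℂ Gen.qc) 1
  | rll_plus (a b : ℤ) (s t : Fin n × Fin n) :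
      Rel n q (rllLeft q 1 (freePlus n) (freePlus n) a b s t)
        (rllRight q 1 (freePlus n) (freePlus n) a b s t)
  | rll_minus (a b : ℤ) (s t : Fin n × Fin n) :
      Rel n q (rllLeft q 1 (freeMinus n) (freeMinus n) a b s t)
        (rllRight q 1 (freeMinus n) (freeMinus n) a b s t)
  | rll_mixed (a b : ℤ) (s t : Fin n × Fin n) :
      Rel n q (rllLeft q (ι ℂ Gen.qcInv) (freePlus n) (freeMinus n) a b s t)
        (rllRight q (ι ℂ Gen.qc) (freePlus n) (freeMinus n) a b s t)

/-- The quantum affine algebra `U_q(ĝl_n)`. -/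
def Uq (n : ℕ) (q : ℂˣ) : Type := RingQuot (Rel n q)

instance (n : ℕ) (q : ℂˣ) : Ring (Uq n q) := inferInstanceAs (Ring (RingQuot (Rel n q)))

instance (n : ℕ) (q : ℂˣ) : Algebra ℂ (Uq n q) :=
  inferInstanceAs (Algebra ℂ (RingQuot (Rel n q)))

/-- The image of a generator in the quantum affine algebra. -/
def Uq.gen (n : ℕ) (q : ℂˣ) (x : Gen n) : Uq n q :=
  RingQuot.mkAlgHom ℂ (Rel n q) (FreeAlgebra.ι ℂ x)

/-- The relation `q^c = q^{-n}`. -/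
inductive CriRel (n : ℕ) (q : ℂˣ) : Uq n q → Uq n q → Prop
  | level : CriRel n q (Uq.gen n q Gen.qc) (algebraMap ℂ (Uq n q) ((q : ℂ) ^ (-(n : ℤ))))

/-- The quantum affine algebra at the critical level: the quotient by `q^c = q^{-n}`. -/
def UqCri (n : ℕ) (q : ℂˣ) : Type := RingQuot (CriRel n q)

instance (n : ℕ) (q : ℂˣ) : Ring (UqCri n q) := inferInstanceAs (Ring (RingQuot (CriRel n q)))

instance (n : ℕ) (q : ℂˣ) : Algebra ℂ (UqCri n q) :=
  inferInstanceAs (Algebra ℂ (RingQuot (CriRel n q)))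

/-- The projection onto the critical level quotient. -/
def toCri (n : ℕ) (q : ℂˣ) : Uq n q →ₐ[ℂ] UqCri n q := RingQuot.mkAlgHom ℂ (CriRel n q)

/-- The matrix `[l⁺_{ij}[-r]]`, the coefficient of `u^r` in `L⁺(u)`, at the critical level. -/
def LPlus (n : ℕ) (q : ℂˣ) (r : ℕ) : Matrix (Fin n) (Fin n) (UqCri n q) :=
  Matrix.of fun i j => toCri n q (Uq.gen n q (Gen.plus i j r))

/-- The matrix `[l⁻_{ij}[r]]`, the coefficient of `u^{-r}` in `L⁻(u)`, at the critical level. -/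
def LMinus (n : ℕ) (q : ℂˣ) (r : ℕ) : Matrix (Fin n) (Fin n) (UqCri n q) :=
  Matrix.of fun i j => toCri n q (Uq.gen n q (Gen.minus i j r))

theorem map_rllLeft {n : ℕ} {A B : Type*} [Ring A] [Algebra ℂ A] [Ring B] [Algebra ℂ B]
    (φ : A →ₐ[ℂ] B) (q : ℂˣ) (g : A) (X Y : ℤ → Matrix (Fin n) (Fin n) A) (a b : ℤ)
    (s t : Fin n × Fin n) :
    φ (rllLeft q g X Y a b s t) =
      rllLeft q (φ g) (fun k => (X k).map φ) (fun k => (Y k).map φ) a b s t := by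
  simp [rllLeft, Matrix.sum_apply, Matrix.mul_apply, Matrix.kroneckerMap_apply, Matrix.one_apply,
    apply_ite φ]

theorem map_rllRight {n : ℕ} {A B : Type*} [Ring A] [Algebra ℂ A] [Ring B] [Algebra ℂ B]
    (φ : A →ₐ[ℂ] B) (q : ℂˣ) (g : A) (X Y : ℤ → Matrix (Fin n) (Fin n) A) (a b : ℤ)
    (s t : Fin n × Fin n) :
    φ (rllRight q g X Y a b s t) =
      rllRight q (φ g) (fun k => (X k).map φ) (fun k => (Y k).map φ) a b s t := by
  simp [rllRight, Matrix.sum_apply, Matrix.mul_apply, Matrix.kroneckerMap_apply, Matrix.one_apply,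
    apply_ite φ]

/-- The projection of the free algebra onto the algebra at the critical level. -/
def freeToCri (n : ℕ) (q : ℂˣ) : FreeAlgebra ℂ (Gen n) →ₐ[ℂ] UqCri n q :=
  (toCri n q).comp (RingQuot.mkAlgHom ℂ (Rel n q))

theorem freeToCri_rel {n : ℕ} {q : ℂˣ} {x y : FreeAlgebra ℂ (Gen n)} (h : Rel n q x y) :
    freeToCri n q x = freeToCri n q y :=
  congrArg (toCri n q) (RingQuot.mkAlgHom_rel ℂ h)

theorem freeToCri_surjective (n : ℕ) (q : ℂˣ) : Function.Surjective (freeToCri n q) :=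
  (RingQuot.mkAlgHom_surjective ℂ _).comp (RingQuot.mkAlgHom_surjective ℂ _)

theorem freeToCri_qc (n : ℕ) (q : ℂˣ) :
    freeToCri n q (FreeAlgebra.ι ℂ Gen.qc) = algebraMap ℂ _ ((q : ℂ) ^ (-(n : ℤ))) :=
  (RingQuot.mkAlgHom_rel ℂ (CriRel.level (n := n) (q := q))).trans (AlgHom.commutes _ _)

theorem freeToCri_qcInv (n : ℕ) (q : ℂˣ) :
    freeToCri n q (FreeAlgebra.ι ℂ Gen.qcInv) = algebraMap ℂ _ ((q : ℂ) ^ (n : ℤ)) := by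
  have h := freeToCri_rel (Rel.qc_inv_mul (n := n) (q := q))
  rw [map_mul, freeToCri_qc, map_one] at h
  calc freeToCri n q (FreeAlgebra.ι ℂ Gen.qcInv)
      = freeToCri n q (FreeAlgebra.ι ℂ Gen.qcInv) *
          (algebraMap ℂ _ ((q : ℂ) ^ (-(n : ℤ))) * algebraMap ℂ _ ((q : ℂ) ^ (n : ℤ))) := by
        rw [← map_mul, ← zpow_add₀ q.ne_zero]; simp
    _ = _ := by rw [← mul_assoc, h, one_mul]

theorem freeToCri_freePlus (n : ℕ) (q : ℂˣ) (k : ℤ) :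
    (freePlus n k).map (freeToCri n q) = upCoeff (LPlus n q) k := by
  unfold freePlus upCoeff
  split_ifs
  · rfl
  · ext; simp

theorem freeToCri_freeMinus (n : ℕ) (q : ℂˣ) (k : ℤ) :
    (freeMinus n k).map (freeToCri n q) = downCoeff (LMinus n q) k := by
  unfold freeMinus downCoeff
  split_ifs
  · rfl
  · ext; simp

/-- The relation between `L⁺(u)` and `L⁻(v)` at the critical level. -/
theorem cri_rll_mixed (n : ℕ) (q : ℂˣ) (a b : ℤ) (s t : Fin n × Fin n) :
    rllLeft q (algebraMap ℂ (UqCri n q) ((q : ℂ) ^ (n : ℤ)))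
        (upCoeff (LPlus n q)) (downCoeff (LMinus n q)) a b s t =
      rllRight q (algebraMap ℂ (UqCri n q) ((q : ℂ) ^ (-(n : ℤ))))
        (upCoeff (LPlus n q)) (downCoeff (LMinus n q)) a b s t := by
  have h := freeToCri_rel (Rel.rll_mixed (n := n) (q := q) a b s t)
  rw [map_rllLeft, map_rllRight, freeToCri_qc, freeToCri_qcInv] at h
  simpa only [freeToCri_freePlus, freeToCri_freeMinus] using h

/-! ### The completion -/

/-- The product of the generators `l⁻_{ij}[r]` listed in a word. -/
def minusWord (n : ℕ) (q : ℂˣ) (w : List (Fin n × Fin n × ℕ)) : UqCri n q :=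
  (w.map fun x => LMinus n q x.2.2 x.1 x.2.1).prod

/-- The total degree `r₁ + ⋯ + r_s` of the word `l⁻[r₁] ⋯ l⁻[r_s]`. -/
def wordDegree {n : ℕ} (w : List (Fin n × Fin n × ℕ)) : ℕ := (w.map fun x => x.2.2).sum

/-- The left ideal generated by all products of the `l⁻_{ij}[r]` of total degree at least `p`. The
coefficients of `u^{-r}` in the entries of `L⁻(u)⁻¹` belong to `J r`; they need not belong to the
smaller left ideals generated by the single elements `l⁻_{ij}[r]`, as the powers of `l⁻_{ij}[1]`
show. -/
def J (n : ℕ) (q : ℂˣ) (p : ℕ) : Ideal (UqCri n q) :=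
  Ideal.span {x | ∃ w : List (Fin n × Fin n × ℕ), p ≤ wordDegree w ∧ x = minusWord n q w}

theorem J_anti (n : ℕ) (q : ℂˣ) {p p' : ℕ} (h : p ≤ p') : J n q p' ≤ J n q p :=
  Ideal.span_mono fun _ ⟨w, hw, e⟩ => ⟨w, h.trans hw, e⟩

theorem minusWord_mem_J {n : ℕ} {q : ℂˣ} {p : ℕ} {w : List (Fin n × Fin n × ℕ)}
    (h : p ≤ wordDegree w) : minusWord n q w ∈ J n q p :=
  Ideal.subset_span ⟨w, h, rfl⟩

/-- To check that right multiplication by `x` maps `J p` into `J p'`, it is enough to consider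
the generators of `J p`. -/
theorem J_mul_of_words {n : ℕ} {q : ℂˣ} {p p' : ℕ} {x : UqCri n q}
    (h : ∀ w, p ≤ wordDegree w → minusWord n q w * x ∈ J n q p') {y : UqCri n q}
    (hy : y ∈ J n q p) : y * x ∈ J n q p' := by
  refine Submodule.span_induction ?_ ?_ ?_ ?_ hy
  · rintro _ ⟨w, hw, rfl⟩
    exact h w hw
  · simp
  · intro a b _ _ ha hb
    rw [add_mul]
    exact add_mem ha hb
  · intro c a _ ha
    rw [smul_eq_mul, mul_assoc]
    exact Ideal.mul_mem_left _ _ ha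

theorem J_mul_LMinus {n : ℕ} {q : ℂˣ} {p : ℕ} (r : ℕ) (i j : Fin n) {y : UqCri n q}
    (hy : y ∈ J n q p) : y * LMinus n q r i j ∈ J n q (p + r) := by
  refine J_mul_of_words (fun w hw => ?_) hy
  have : minusWord n q w * LMinus n q r i j = minusWord n q (w ++ [(i, j, r)]) := by
    simp [minusWord]
  rw [this]
  apply minusWord_mem_J
  simp only [wordDegree] at hw ⊢
  simp
  exact hw

theorem RCoeff_zero (n : ℕ) (q : ℂˣ) (s t : Fin n × Fin n) :
    RCoeff n q 0 s t = if s = t then (if s.1 = s.2 then 1 else (q : ℂ)⁻¹)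
      else if s.1 = t.2 ∧ s.2 = t.1 then (if s.2 < s.1 then 0 else ((q : ℂ) - (q : ℂ)⁻¹) * (q : ℂ)⁻¹)
      else 0 := by
  simp only [RCoeff, RBar, Matrix.map_apply, Matrix.of_apply]
  split_ifs <;> simp [normSeries, normCoeff]

/-- The span of the elements `l⁺_{ij}[-(s-k)] l⁻_{i'j'}[r-k]` with `k ≤ s` and `k ≤ r`. -/
def orderedSpan (n : ℕ) (q : ℂˣ) (s r : ℕ) : Submodule ℂ (UqCri n q) :=
  Submodule.span ℂ {x | ∃ (k : ℕ) (i j i' j' : Fin n), k ≤ s ∧ k ≤ r ∧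
    x = LPlus n q (s - k) i j * LMinus n q (r - k) i' j'}

theorem orderedSpan_sub (n : ℕ) (q : ℂˣ) {s r k : ℕ} (hs : k ≤ s) (hr : k ≤ r) :
    orderedSpan n q (s - k) (r - k) ≤ orderedSpan n q s r := by
  apply Submodule.span_mono
  rintro _ ⟨l, i, j, i', j', h1, h2, rfl⟩
  refine ⟨k + l, i, j, i', j', by omega, by omega, ?_⟩
  rw [Nat.sub_sub, Nat.sub_sub]

/-- Reordering of `l⁻_{ij}[r] l⁺_{i'j'}[-s]`. -/
theorem LMinus_mul_LPlus_mem (n : ℕ) (q : ℂˣ) (s : ℕ) : ∀ (r : ℕ) (i j i' j' : Fin n),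
    LMinus n q r i j * LPlus n q s i' j' ∈ orderedSpan n q s r := by
  induction s using Nat.strong_induction_on with
  | _ s ih =>
  intro r
  -- entries of `L₂⁻[r] L₁⁺[-s]`
  let X : Matrix (Fin n × Fin n) (Fin n × Fin n) (UqCri n q) :=
    (1 ⊗ₖ LMinus n q r) * (LPlus n q s ⊗ₖ 1)
  have hX : ∀ u v, X u v = LMinus n q r u.2 v.2 * LPlus n q s u.1 v.1 := by
    intro u v
    simp [X, Matrix.mul_apply, Matrix.kroneckerMap_apply, Fintype.sum_prod_type, Matrix.one_apply]
  have hup : ∀ k : ℕ, upCoeff (LPlus n q) ((s : ℤ) - k) =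
      if k ≤ s then LPlus n q (s - k) else 0 := by
    intro k
    unfold upCoeff
    by_cases h : k ≤ s
    · rw [if_pos (by omega), if_pos h]; congr 1; omega
    · rw [if_neg (by omega), if_neg h]
  have hdown : ∀ k : ℕ, downCoeff (LMinus n q) (-(r : ℤ) + k) =
      if k ≤ r then LMinus n q (r - k) else 0 := by
    intro k
    unfold downCoeff
    by_cases h : k ≤ r
    · rw [if_pos (by omega), if_pos h]; congr 1; omega
    · rw [if_neg (by omega), if_neg h]
  have hmem : ∀ u v, (X * (RCoeff n q 0).map (algebraMap ℂ (UqCri n q))) u v ∈ orderedSpan n q s r := by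
    intro u v
    have h := cri_rll_mixed n q s (-(r : ℤ)) u v
    have hR : rllLeft q (algebraMap ℂ (UqCri n q) ((q : ℂ) ^ (n : ℤ)))
        (upCoeff (LPlus n q)) (downCoeff (LMinus n q)) s (-(r : ℤ)) u v ∈ orderedSpan n q s r := by
      unfold rllLeft
      rw [Matrix.sum_apply]
      refine Submodule.sum_mem _ fun k _ => ?_
      rw [hup, hdown]
      by_cases hk : k ≤ s ∧ k ≤ r
      · rw [if_pos hk.1, if_pos hk.2, Matrix.smul_apply, ← map_pow, smul_eq_mul,
          ← Algebra.smul_def, mul_assoc, Matrix.mul_apply]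
        refine Submodule.smul_mem _ _ (Submodule.sum_mem _ fun w _ => ?_)
        rw [Matrix.map_apply, ← Algebra.smul_def]
        refine Submodule.smul_mem _ _ (Submodule.subset_span ⟨k, w.1, v.1, w.2, v.2, hk.1, hk.2, ?_⟩)
        simp [Matrix.mul_apply, Matrix.kroneckerMap_apply, Fintype.sum_prod_type, Matrix.one_apply]
      · have : k ≤ s → ¬ k ≤ r := fun h1 h2 => hk ⟨h1, h2⟩
        by_cases h1 : k ≤ s
        · rw [if_neg (this h1)]; simp
        · rw [if_neg h1]; simp
    rw [h] at hR
    unfold rllRight at hR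
    rw [Finset.sum_range_succ', Matrix.add_apply, Matrix.sum_apply] at hR
    have h2 := (Submodule.add_mem_iff_right _ (by
      refine Submodule.sum_mem _ fun k _ => ?_
      rw [hup, hdown]
      by_cases hk : k + 1 ≤ s ∧ k + 1 ≤ r
      · rw [if_pos hk.1, if_pos hk.2, Matrix.smul_apply, ← map_pow, smul_eq_mul,
          ← Algebra.smul_def, Matrix.mul_apply]
        refine Submodule.smul_mem _ _ (Submodule.sum_mem _ fun w _ => ?_)
        rw [Matrix.map_apply, ← Algebra.commutes, ← Algebra.smul_def]
        refine Submodule.smul_mem _ _ (orderedSpan_sub n q hk.1 hk.2 ?_)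
        have := ih (s - (k + 1)) (by omega) (r - (k + 1)) u.2 w.2 u.1 w.1
        convert this using 1
        simp [Matrix.mul_apply, Matrix.kroneckerMap_apply, Fintype.sum_prod_type, Matrix.one_apply]
      · have : k + 1 ≤ s → ¬ k + 1 ≤ r := fun h1 h2 => hk ⟨h1, h2⟩
        by_cases h1 : k + 1 ≤ s
        · rw [if_neg (this h1)]; simp
        · rw [if_neg h1]; simp)).1 hR
    rw [pow_zero, one_smul, hup, hdown] at h2
    simpa using h2
  -- `RCoeff 0` is triangular with a nonzero diagonal
  have hsum : ∀ u (a b : Fin n), (X * (RCoeff n q 0).map (algebraMap ℂ (UqCri n q))) u (a, b) =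
      if a = b then X u (a, b) else (q : ℂ)⁻¹ • X u (a, b) +
        (if b < a then (((q : ℂ) - (q : ℂ)⁻¹) * (q : ℂ)⁻¹) • X u (b, a) else 0) := by
    intro u a b
    rw [Matrix.mul_apply]
    simp only [Matrix.map_apply, RCoeff_zero, ← Algebra.commutes, ← Algebra.smul_def]
    by_cases hab : a = b
    · subst hab
      rw [if_pos rfl, Finset.sum_eq_single (a, a)]
      · simp
      · rintro ⟨c, d⟩ _ hcd
        rw [if_neg hcd, if_neg, zero_smul]
        rintro ⟨h1, h2⟩
        exact hcd (Prod.ext h1 h2)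
      · simp
    · rw [if_neg hab, ← Finset.add_sum_erase _ _ (Finset.mem_univ (a, b)),
        Finset.sum_eq_single (b, a)]
      · have hba : ¬ b = a := fun h => hab h.symm
        simp only [hab, hba, Prod.mk.injEq, and_self, if_true, if_false]
        rcases lt_or_gt_of_ne hab with h | h
        · simp [h, h.not_gt]
        · simp [h, h.not_gt]
      · rintro ⟨c, d⟩ h1 hcd
        have h1 : (c, d) ≠ (a, b) := (Finset.mem_erase.1 h1).1
        rw [if_neg h1, if_neg, zero_smul]
        rintro ⟨h1, h2⟩
        exact hcd (Prod.ext h1 h2)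
      · intro h
        exact absurd (Finset.mem_erase.2 ⟨by simp [Ne.symm hab, hab], Finset.mem_univ _⟩) h
  have hle : ∀ u (a b : Fin n), a ≤ b → X u (a, b) ∈ orderedSpan n q s r := by
    intro u a b hab
    have h := hmem u (a, b)
    rw [hsum, if_neg hab.not_gt, add_zero] at h
    split_ifs at h
    · exact h
    · exact (Submodule.smul_mem_iff _ (inv_ne_zero q.ne_zero)).1 h
  have hall : ∀ u (a b : Fin n), X u (a, b) ∈ orderedSpan n q s r := by
    intro u a b
    rcases le_or_gt a b with hab | hab
    · exact hle u a b hab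
    · have h := hmem u (a, b)
      rw [hsum, if_neg hab.ne', if_pos hab,
        Submodule.add_mem_iff_left _ (Submodule.smul_mem _ _ (hle u b a hab.le))] at h
      exact (Submodule.smul_mem_iff _ (inv_ne_zero q.ne_zero)).1 h
  intro i j i' j'
  have := hall (i', i) j' j
  rwa [hX] at this

theorem minusWord_mul_LPlus_mem (n : ℕ) (q : ℂˣ) (w : List (Fin n × Fin n × ℕ)) :
    ∀ (s : ℕ) (i j : Fin n), minusWord n q w * LPlus n q s i j ∈ J n q (wordDegree w - s) := by
  induction w using List.reverseRecOn with
  | nil =>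
    intro s i j
    have : (1 : UqCri n q) ∈ J n q (wordDegree ([] : List (Fin n × Fin n × ℕ)) - s) := by
      have := minusWord_mem_J (n := n) (q := q) (w := []) (Nat.sub_le (wordDegree []) s)
      simpa [minusWord] using this
    simpa [minusWord] using Ideal.mul_mem_left _ (LPlus n q s i j) this
  | append_singleton w x ih =>
    intro s i j
    have e : minusWord n q (w ++ [x]) * LPlus n q s i j =
        minusWord n q w * (LMinus n q x.2.2 x.1 x.2.1 * LPlus n q s i j) := by
      simp [minusWord, mul_assoc]
    have hd : wordDegree (w ++ [x]) = wordDegree w + x.2.2 := by simp [wordDegree]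
    rw [e, hd]
    refine Submodule.span_induction (p := fun y _ =>
      minusWord n q w * y ∈ J n q (wordDegree w + x.2.2 - s)) ?_ ?_ ?_ ?_
      (LMinus_mul_LPlus_mem n q s x.2.2 x.1 x.2.1 i j)
    · rintro _ ⟨k, a, b, a', b', hs, hr, rfl⟩
      rw [← mul_assoc]
      exact J_anti n q (by omega) (J_mul_LMinus (x.2.2 - k) a' b' (ih (s - k) a b))
    · simp
    · intro y z _ _ hy hz
      rw [mul_add]
      exact add_mem hy hz
    · intro c y _ hy
      rw [mul_smul_comm, Algebra.smul_def]
      exact Ideal.mul_mem_left _ _ hy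

/-- Right multiplication is continuous in the topology defined by the left ideals `J p`. -/
theorem exists_J_mul_mem (n : ℕ) (q : ℂˣ) (x : UqCri n q) :
    ∃ s : ℕ, ∀ p : ℕ, ∀ y ∈ J n q (p + s), y * x ∈ J n q p := by
  obtain ⟨x, rfl⟩ := freeToCri_surjective n q x
  induction x using FreeAlgebra.induction with
  | grade0 c =>
    refine ⟨0, fun p y hy => ?_⟩
    rw [AlgHom.commutes, ← Algebra.commutes]
    exact Ideal.mul_mem_left _ _ hy
  | grade1 g =>
    cases g with
    | plus i j r =>
      exact ⟨r, fun p y hy => J_mul_of_words (fun w hw =>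
        J_anti n q (by omega) (minusWord_mul_LPlus_mem n q w r i j)) hy⟩
    | minus i j r =>
      exact ⟨0, fun p y hy => J_anti n q (by omega) (J_mul_LMinus r i j hy)⟩
    | qc =>
      refine ⟨0, fun p y hy => ?_⟩
      rw [freeToCri_qc, ← Algebra.commutes]
      exact Ideal.mul_mem_left _ _ hy
    | qcInv =>
      refine ⟨0, fun p y hy => ?_⟩
      rw [freeToCri_qcInv, ← Algebra.commutes]
      exact Ideal.mul_mem_left _ _ hy
  | mul a b ha hb =>
    obtain ⟨s, hs⟩ := ha
    obtain ⟨t, ht⟩ := hb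
    refine ⟨t + s, fun p y hy => ?_⟩
    rw [map_mul, ← mul_assoc]
    exact ht p _ (hs (p + t) y (by rwa [add_assoc]))
  | add a b ha hb =>
    obtain ⟨s, hs⟩ := ha
    obtain ⟨t, ht⟩ := hb
    refine ⟨s + t, fun p y hy => ?_⟩
    rw [map_add, mul_add]
    exact add_mem (hs p y (J_anti n q (by omega) hy)) (ht p y (J_anti n q (by omega) hy))

theorem J_basis (n : ℕ) (q : ℂˣ) :
    RingSubgroupsBasis fun p : ℕ => (J n q p).toAddSubgroup where
  inter i j := ⟨i + j, le_inf (J_anti n q (by omega)) (J_anti n q (by omega))⟩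
  mul i := ⟨i, by
    rintro _ ⟨x, _, y, hy, rfl⟩
    exact Ideal.mul_mem_left _ x hy⟩
  leftMul x i := ⟨i, fun y hy => Ideal.mul_mem_left _ x hy⟩
  rightMul x i := by
    obtain ⟨s, hs⟩ := exists_J_mul_mem n q x
    exact ⟨i + s, fun y hy => hs i y hy⟩

/-- The topology on `U_q(ĝl_n)_cri` in which the left ideals `J p` form a basis of neighbourhoods
of zero. -/
instance (n : ℕ) (q : ℂˣ) : TopologicalSpace (UqCri n q) := (J_basis n q).topology

instance (n : ℕ) (q : ℂˣ) : IsTopologicalRing (UqCri n q) :=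
  (J_basis n q).toRingFilterBasis.isTopologicalRing

instance (n : ℕ) (q : ℂˣ) : UniformSpace (UqCri n q) :=
  IsTopologicalAddGroup.rightUniformSpace (UqCri n q)

instance (n : ℕ) (q : ℂˣ) : IsUniformAddGroup (UqCri n q) :=
  isUniformAddGroup_of_addCommGroup

/-- The completed quantum affine algebra at the critical level: the (Hausdorff) completion of
`U_q(ĝl_n)_cri` in the topology defined by the left ideals `J p`, that is, the inverse limit of the
quotients `U_q(ĝl_n)_cri / J p`, with the multiplication extended by continuity. -/
abbrev UqCriCompletion (n : ℕ) (q : ℂˣ) : Type := UniformSpace.Completion (UqCri n q)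


/-! ### The inverse of `L⁻(u)` -/

/-- A lower triangular matrix with invertible diagonal entries over an arbitrary ring is
invertible. -/
theorem isUnit_of_lowerTriangular {n : ℕ} {A : Type*} [Ring A] (T : Matrix (Fin n) (Fin n) A)
    (h0 : ∀ i j, i < j → T i j = 0) (h1 : ∀ i, IsUnit (T i i)) : IsUnit T := by
  choose d hd using h1
  let D : Matrix (Fin n) (Fin n) A := Matrix.diagonal fun i => (d i : A)
  let D' : Matrix (Fin n) (Fin n) A := Matrix.diagonal fun i => ((d i)⁻¹ : Aˣ)
  have hD : IsUnit D := ⟨⟨D, D', by simp [D, D'], by simp [D, D']⟩, rfl⟩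
  let N : Matrix (Fin n) (Fin n) A := D' * T - 1
  have hN : ∀ i j, i ≤ j → N i j = 0 := by
    intro i j hij
    rcases hij.eq_or_lt with rfl | hlt
    · simp [N, D', Matrix.sub_apply, Matrix.diagonal_mul, ← hd]
    · simp [N, D', Matrix.sub_apply, Matrix.diagonal_mul, h0 i j hlt, hlt.ne]
  have hpow : ∀ (k : ℕ) (i j : Fin n), (i : ℕ) < j + k → (N ^ k) i j = 0 := by
    intro k
    induction k with
    | zero =>
      intro i j hij
      have : i ≠ j := by rintro rfl; simp at hij
      simp [this]
    | succ k ih =>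
      intro i j hij
      rw [pow_succ, Matrix.mul_apply]
      refine Finset.sum_eq_zero fun l _ => ?_
      by_cases hl : l ≤ j
      · rw [hN l j hl, mul_zero]
      · rw [ih i l (by have := Fin.lt_def.1 (not_le.1 hl); omega), zero_mul]
  have hnil : IsNilpotent N := ⟨n, by ext i j; exact hpow n i j (by have := i.2; omega)⟩
  have hT : T = D * (N + 1) := by
    have hDD : D * D' = 1 := by simp [D, D']
    simp only [N, sub_add_cancel]
    rw [← mul_assoc, hDD, one_mul]
  rw [hT]
  exact hD.mul hnil.isUnit_add_one

theorem isUnit_LMinus_zero (n : ℕ) (q : ℂˣ) : IsUnit (LMinus n q 0) := by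
  refine isUnit_of_lowerTriangular _ (fun i j h => ?_) fun i => ?_
  · have := freeToCri_rel (Rel.minus_zero (q := q) i j h)
    rwa [map_zero] at this
  · have h1 := freeToCri_rel (Rel.plus_minus (q := q) i)
    have h2 := freeToCri_rel (Rel.minus_plus (q := q) i)
    rw [map_mul, map_one] at h1 h2
    exact ⟨⟨_, _, h2, h1⟩, rfl⟩

/-- The series `L⁺(u)`, a power series in the variable `u`. -/
def LPlusSeries (n : ℕ) (q : ℂˣ) : PowerSeries (Matrix (Fin n) (Fin n) (UqCri n q)) :=
  PowerSeries.mk (LPlus n q)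

/-- The series `L⁻(u)`, a power series in the variable `u⁻¹`. -/
def LMinusSeries (n : ℕ) (q : ℂˣ) : PowerSeries (Matrix (Fin n) (Fin n) (UqCri n q)) :=
  PowerSeries.mk (LMinus n q)

/-- The inverse series `L⁻(u)⁻¹`, a power series in the variable `u⁻¹`. -/
def LMinusInvSeries (n : ℕ) (q : ℂˣ) : PowerSeries (Matrix (Fin n) (Fin n) (UqCri n q)) :=
  PowerSeries.invOfUnit (LMinusSeries n q) (isUnit_LMinus_zero n q).unit

theorem LMinusSeries_mul_inv (n : ℕ) (q : ℂˣ) :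
    LMinusSeries n q * LMinusInvSeries n q = 1 ∧ LMinusInvSeries n q * LMinusSeries n q = 1 := by
  have h : PowerSeries.constantCoeff (LMinusSeries n q) = (isUnit_LMinus_zero n q).unit := by
    rw [← PowerSeries.coeff_zero_eq_constantCoeff_apply]
    simp [LMinusSeries]
  exact ⟨PowerSeries.mul_invOfUnit _ _ h, PowerSeries.invOfUnit_mul _ _ h⟩

/-! ### Tensor products of copies of `End ℂⁿ`

The algebra `(End ℂⁿ)^{⊗ m} ⊗ A` is realized as the algebra of matrices over `A` whose rows and
columns are indexed by the basis vectors `e_{w 0} ⊗ ⋯ ⊗ e_{w (m-1)}`, `w : Fin m → Fin n`, of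
`(ℂⁿ)^{⊗ m}`. -/

/-- The element `X_a = ∑ 1^{⊗(a-1)} ⊗ e_{ij} ⊗ 1^{⊗(m-a)} ⊗ X_{ij}`. -/
def site {n m : ℕ} {A : Type*} [Zero A] (a : Fin m) (X : Matrix (Fin n) (Fin n) A) :
    Matrix (Fin m → Fin n) (Fin m → Fin n) A :=
  Matrix.of fun w w' => if ∀ b, b ≠ a → w b = w' b then X (w a) (w' a) else 0

/-- The element `C_{ab}` acting as `C` in the copies `a ≠ b` of `End ℂⁿ`. -/
def twoSite {n m : ℕ} {A : Type*} [Zero A] (a b : Fin m)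
    (C : Matrix (Fin n × Fin n) (Fin n × Fin n) A) :
    Matrix (Fin m → Fin n) (Fin m → Fin n) A :=
  Matrix.of fun w w' =>
    if ∀ c, c ≠ a → c ≠ b → w c = w' c then C (w a, w b) (w' a, w' b) else 0

/-! ### The Hecke algebra -/

/-- The indices of the generators `T_1, …, T_{m-1}` of the Hecke algebra (numbered from zero). -/
abbrev HeckeIdx (m : ℕ) : Type := {k : ℕ // k + 1 < m}

/-- The first of the two positions exchanged by an adjacent transposition. -/
def HeckeIdx.lo {m : ℕ} (k : HeckeIdx m) : Fin m := ⟨k.1, by have := k.2; omega⟩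

/-- The second of the two positions exchanged by an adjacent transposition. -/
def HeckeIdx.hi {m : ℕ} (k : HeckeIdx m) : Fin m := ⟨k.1 + 1, k.2⟩

/-- The adjacent transpositions of the symmetric group. -/
def adjSwap {m : ℕ} (k : HeckeIdx m) : Equiv.Perm (Fin m) := Equiv.swap k.lo k.hi

open FreeAlgebra in
/-- The defining relations of the Hecke algebra. -/
inductive HeckeRel (m : ℕ) (q : ℂˣ) :
    FreeAlgebra ℂ (HeckeIdx m) → FreeAlgebra ℂ (HeckeIdx m) → Prop
  | quadratic (k : HeckeIdx m) :
      HeckeRel m q ((ι ℂ k - algebraMap ℂ _ (q : ℂ)) * (ι ℂ k + algebraMap ℂ _ (q : ℂ)⁻¹)) 0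
  | braid (k l : HeckeIdx m) (h : l.1 = k.1 + 1) :
      HeckeRel m q (ι ℂ k * ι ℂ l * ι ℂ k) (ι ℂ l * ι ℂ k * ι ℂ l)
  | comm (k l : HeckeIdx m) (h : k.1 + 1 < l.1) : HeckeRel m q (ι ℂ k * ι ℂ l) (ι ℂ l * ι ℂ k)

/-- The Hecke algebra `H_m`. -/
def Hecke (m : ℕ) (q : ℂˣ) : Type := RingQuot (HeckeRel m q)

instance (m : ℕ) (q : ℂˣ) : Ring (Hecke m q) := inferInstanceAs (Ring (RingQuot (HeckeRel m q)))

instance (m : ℕ) (q : ℂˣ) : Algebra ℂ (Hecke m q) :=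
  inferInstanceAs (Algebra ℂ (RingQuot (HeckeRel m q)))

/-- The generators `T_k` of the Hecke algebra. -/
def Hecke.T (m : ℕ) (q : ℂˣ) (k : HeckeIdx m) : Hecke m q :=
  RingQuot.mkAlgHom ℂ (HeckeRel m q) (FreeAlgebra.ι ℂ k)

theorem exists_word {m : ℕ} (σ : Equiv.Perm (Fin m)) :
    {w : List (HeckeIdx m) | (w.map adjSwap).prod = σ}.Nonempty := by
  match m, σ with
  | 0, σ => exact ⟨[], Subsingleton.elim _ _⟩
  | m + 1, σ =>
    have h : σ ∈ Submonoid.closure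
        (Set.range fun i : Fin m => Equiv.swap i.castSucc i.succ) := by
      rw [Equiv.Perm.mclosure_swap_castSucc_succ]; trivial
    induction h using Submonoid.closure_induction with
    | mem x hx =>
      obtain ⟨i, rfl⟩ := hx
      refine ⟨[⟨i.1, by omega⟩], ?_⟩
      simp only [Set.mem_ofPred_eq, List.map_cons, List.map_nil, List.prod_cons, List.prod_nil,
        mul_one]
      rfl
    | one => exact ⟨[], rfl⟩
    | mul x y _ _ hx hy =>
      obtain ⟨w, hw⟩ := hx
      obtain ⟨w', hw'⟩ := hy
      refine ⟨w ++ w', ?_⟩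
      rw [Set.mem_ofPred_eq] at *
      rw [List.map_append, List.prod_append, hw, hw']

/-- A chosen reduced decomposition of a permutation: a word of the smallest length among the words
in the adjacent transpositions with the product `σ`. -/
def reducedWord {m : ℕ} (σ : Equiv.Perm (Fin m)) : List (HeckeIdx m) :=
  Function.argminOn List.length {w : List (HeckeIdx m) | (w.map adjSwap).prod = σ} (exists_word σ)

/-- The product `g_{i_1} ⋯ g_{i_l}` along a reduced decomposition `σ = σ_{i_1} ⋯ σ_{i_l}`. If the
elements `g_k` satisfy the braid relations, it does not depend on the reduced decomposition. -/
def alongReduced {m : ℕ} {A : Type*} [Monoid A] (g : HeckeIdx m → A) (σ : Equiv.Perm (Fin m)) : A :=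
  ((reducedWord σ).map g).prod

/-- The basis elements `T_σ` of the Hecke algebra. -/
def Hecke.TPerm {m : ℕ} (q : ℂˣ) (σ : Equiv.Perm (Fin m)) : Hecke m q :=
  alongReduced (Hecke.T m q) σ

/-! ### Standard tableaux and primitive idempotents -/

/-- The content `j - i` of a box `(i, j)`. -/
def content (α : ℕ × ℕ) : ℤ := (α.2 : ℤ) - α.1

/-- The hook length of a box (rows and columns are numbered from zero). -/
def hookLength (μ : YoungDiagram) (α : ℕ × ℕ) : ℤ :=
  (μ.rowLen α.1 : ℤ) + μ.colLen α.2 - α.1 - α.2 - 1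

/-- The `q`-number `[d]_q`. -/
def qNum (q : ℂˣ) (d : ℤ) : ℂ := ((q : ℂ) ^ d - (q : ℂ) ^ (-d)) / ((q : ℂ) - (q : ℂ)⁻¹)

/-- A standard tableau of shape `μ`, encoded by the positions of the numbers `1, …, m`
(represented by the elements of `Fin m`): the entries increase along the rows and down the
columns. -/
@[ext]
structure StdTableau (μ : YoungDiagram) where
  /-- The box occupied by a number. -/
  box : Fin μ.card ≃ μ.cells
  /-- The entries strictly increase along the rows. -/
  row_lt : ∀ k l, (box k).1.1 = (box l).1.1 → (box k).1.2 < (box l).1.2 → k < l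
  /-- The entries strictly increase down the columns. -/
  col_lt : ∀ k l, (box k).1.2 = (box l).1.2 → (box k).1.1 < (box l).1.1 → k < l

instance (μ : YoungDiagram) : DecidableEq (StdTableau μ) := Classical.decEq _

instance (μ : YoungDiagram) : Fintype (StdTableau μ) :=
  Fintype.ofInjective StdTableau.box fun _ _ h => StdTableau.ext h

/-- The content `c_k(Λ)`. -/
def StdTableau.c {μ : YoungDiagram} (Λ : StdTableau μ) (k : Fin μ.card) : ℤ :=
  content (Λ.box k).1

/-- The matrix of `T_k` in the Young basis `{v_Λ}` of `V_μ`: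
`T_k v_Λ = q^d / [d]_q v_Λ + √(1 - 1/[d]_q²) v_{σ_k Λ}` with `d = c_{k+1}(Λ) - c_k(Λ)`. Here
`Γ = σ_k Λ` if and only if each number `l` occupies in `Γ` the box that is occupied by `σ_k(l)`
in `Λ`. -/
def youngMatrix (q : ℂˣ) (μ : YoungDiagram) (k : HeckeIdx μ.card) :
    Matrix (StdTableau μ) (StdTableau μ) ℂ :=
  open Classical in
  Matrix.of fun Γ Λ =>
    (if Γ = Λ then (q : ℂ) ^ (Λ.c k.hi - Λ.c k.lo) / qNum q (Λ.c k.hi - Λ.c k.lo) else 0) +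
    (if ∀ l, Γ.box l = Λ.box (adjSwap k l) then
      (1 - 1 / qNum q (Λ.c k.hi - Λ.c k.lo) ^ 2) ^ (1 / 2 : ℂ) else 0)

/-- The Schur element `c_μ = ∏ q^{c(α)} [h(α)]_q`. -/
def schurElement (q : ℂˣ) (μ : YoungDiagram) : ℂ :=
  ∏ α ∈ μ.cells, (q : ℂ) ^ content α * qNum q (hookLength μ α)

/-- The primitive idempotent
`e_Λ = (1 / c_μ) ∑_σ ⟨T_{σ⁻¹} v_Λ, v_Λ⟩ T_σ` of the Hecke algebra. -/
def primitiveIdempotent (q : ℂˣ) {μ : YoungDiagram} (Λ : StdTableau μ) : Hecke μ.card q :=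
  (schurElement q μ)⁻¹ • ∑ σ : Equiv.Perm (Fin μ.card),
    (alongReduced (youngMatrix q μ) σ⁻¹ Λ Λ) • Hecke.TPerm q σ

/-! ### The action of the Hecke algebra on tensors -/

/-- The matrix `R = q ∑ e_{ii} ⊗ e_{ii} + ∑_{i ≠ j} e_{ii} ⊗ e_{jj}
+ (q - q⁻¹) ∑_{i < j} e_{ij} ⊗ e_{ji}`. -/
def RFin (n : ℕ) (q : ℂˣ) : Matrix (Fin n × Fin n) (Fin n × Fin n) ℂ :=
  Matrix.of fun s t =>
    if s = t then (if s.1 = s.2 then (q : ℂ) else 1)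
    else if s.1 = t.2 ∧ s.2 = t.1 ∧ s.1 < s.2 then (q : ℂ) - (q : ℂ)⁻¹ else 0

/-- The permutation matrix `P = ∑ e_{ij} ⊗ e_{ji}`. -/
def PMat (n : ℕ) : Matrix (Fin n × Fin n) (Fin n × Fin n) ℂ :=
  Matrix.of fun s t => if s.1 = t.2 ∧ s.2 = t.1 then 1 else 0

/-- The operators `Ř_k = P_{k,k+1} R_{k,k+1}` on `(ℂⁿ)^{⊗ m}`. -/
def RCheck (n : ℕ) (q : ℂˣ) {m : ℕ} (k : HeckeIdx m) :
    Matrix (Fin m → Fin n) (Fin m → Fin n) ℂ :=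
  twoSite k.lo k.hi (PMat n) * twoSite k.lo k.hi (RFin n q)

theorem HeckeIdx.lo_ne_hi {m : ℕ} (k : HeckeIdx m) : k.lo ≠ k.hi := by
  simp [HeckeIdx.lo, HeckeIdx.hi, Fin.ext_iff]

theorem eq_comp_swap_iff {n m : ℕ} (a b : Fin m) (w w' : Fin m → Fin n) :
    w' = w ∘ Equiv.swap a b ↔
      (∀ c, c ≠ a → c ≠ b → w' c = w c) ∧ w' a = w b ∧ w' b = w a := by
  constructor
  · rintro rfl
    refine ⟨fun c h1 h2 => ?_, ?_, ?_⟩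
    · simp [Equiv.swap_apply_of_ne_of_ne h1 h2]
    · simp
    · simp
  · rintro ⟨h, ha, hb⟩
    funext c
    by_cases h1 : c = a
    · subst h1; simp [ha]
    · by_cases h2 : c = b
      · subst h2; simp [hb]
      · simp [Equiv.swap_apply_of_ne_of_ne h1 h2, h c h1 h2]

theorem eq_iff_agree {n m : ℕ} (a b : Fin m) (w w' : Fin m → Fin n) :
    w' = w ↔ (∀ c, c ≠ a → c ≠ b → w' c = w c) ∧ w' a = w a ∧ w' b = w b := by
  constructor
  · rintro rfl; simp
  · rintro ⟨h, ha, hb⟩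
    funext c
    by_cases h1 : c = a
    · subst h1; exact ha
    · by_cases h2 : c = b
      · subst h2; exact hb
      · exact h c h1 h2

theorem twoSite_PMat_mulVec {n m : ℕ} (a b : Fin m) (w : Fin m → Fin n) :
    (twoSite a b (PMat n)).mulVec (Pi.single w 1) = Pi.single (w ∘ Equiv.swap a b) 1 := by
  ext w'
  rw [Matrix.mulVec_single_one, Pi.single_apply]
  simp only [Matrix.col_apply, twoSite, PMat, Matrix.of_apply, eq_comp_swap_iff a b w w']
  by_cases h : ∀ c, c ≠ a → c ≠ b → w' c = w c
  · simp only [eq_true h, true_and, if_true]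
  · simp only [eq_false h, false_and, if_false]

theorem twoSite_RFin_mulVec {n m : ℕ} (q : ℂˣ) (a b : Fin m) (w : Fin m → Fin n) :
    (twoSite a b (RFin n q)).mulVec (Pi.single w 1) =
      (if w a = w b then (q : ℂ) else 1) • (Pi.single w 1 : (Fin m → Fin n) → ℂ) +
      (if w b < w a then (q : ℂ) - (q : ℂ)⁻¹ else 0) •
        (Pi.single (w ∘ Equiv.swap a b) 1 : (Fin m → Fin n) → ℂ) := by
  ext w'
  rw [Matrix.mulVec_single_one]
  simp only [Matrix.col_apply, twoSite, RFin, Matrix.of_apply, Pi.add_apply, Pi.smul_apply,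
    Pi.single_apply, eq_comp_swap_iff a b w w', eq_iff_agree a b w w', Prod.mk.injEq]
  by_cases h : ∀ c, c ≠ a → c ≠ b → w' c = w c
  · simp only [eq_true h, true_and, if_true]
    by_cases h1 : w' a = w a ∧ w' b = w b
    · obtain ⟨h1, h2⟩ := h1
      simp only [h1, h2]
      by_cases h3 : w a = w b
      · simp [h3]
      · simp [h3]
    · by_cases h2 : w' a = w b ∧ w' b = w a
      · obtain ⟨h3, h4⟩ := h2
        have h5 : ¬ (w b = w a ∧ w a = w b) := by rw [h3, h4] at h1; exact h1
        simp only [h3, h4]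
        simp [h5]
      · have h3 : ¬ (w' a = w b ∧ w' b = w a ∧ w' a < w' b) := fun h4 => h2 ⟨h4.1, h4.2.1⟩
        simp [h1, h2, h3]
  · simp only [eq_false h, false_and, if_false, smul_zero, add_zero]

/-- The action of `Ř_k` on the basis vectors. -/
theorem RCheck_mulVec (n : ℕ) (q : ℂˣ) {m : ℕ} (k : HeckeIdx m) (w : Fin m → Fin n) :
    (RCheck n q k).mulVec (Pi.single w 1) =
      (if w k.lo = w k.hi then (q : ℂ) else 1) •
        (Pi.single (w ∘ adjSwap k) 1 : (Fin m → Fin n) → ℂ) +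
      (if w k.hi < w k.lo then (q : ℂ) - (q : ℂ)⁻¹ else 0) •
        (Pi.single w 1 : (Fin m → Fin n) → ℂ) := by
  have hs : (w ∘ adjSwap k) ∘ adjSwap k = w := by
    funext c; simp [adjSwap]
  rw [RCheck, ← Matrix.mulVec_mulVec, twoSite_RFin_mulVec, Matrix.mulVec_add, Matrix.mulVec_smul,
    Matrix.mulVec_smul, twoSite_PMat_mulVec, twoSite_PMat_mulVec]
  change _ • Pi.single (w ∘ adjSwap k) 1 + _ • Pi.single ((w ∘ adjSwap k) ∘ adjSwap k) 1 = _
  rw [hs]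

theorem comp_adjSwap_of_eq {n m : ℕ} (k : HeckeIdx m) (w : Fin m → Fin n) (h : w k.lo = w k.hi) :
    w ∘ adjSwap k = w := by
  symm
  rw [adjSwap, eq_comp_swap_iff]
  exact ⟨fun _ _ _ => rfl, h, h.symm⟩

/-- The three cases of the action of `Ř_k`. -/
theorem RCheck_mulVec_cases (n : ℕ) (q : ℂˣ) {m : ℕ} (k : HeckeIdx m) (w : Fin m → Fin n) :
    (RCheck n q k).mulVec (Pi.single w 1) =
      if w k.lo = w k.hi then (q : ℂ) • (Pi.single w 1 : (Fin m → Fin n) → ℂ)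
      else if w k.lo < w k.hi then (Pi.single (w ∘ adjSwap k) 1 : (Fin m → Fin n) → ℂ)
      else (Pi.single (w ∘ adjSwap k) 1 : (Fin m → Fin n) → ℂ) +
        ((q : ℂ) - (q : ℂ)⁻¹) • (Pi.single w 1 : (Fin m → Fin n) → ℂ) := by
  rw [RCheck_mulVec]
  rcases lt_trichotomy (w k.lo) (w k.hi) with h | h | h
  · simp [h, h.ne, h.not_gt]
  · simp [h, comp_adjSwap_of_eq k w h]
  · simp [h, h.ne', h.not_gt]

theorem RCheck_quadratic (n : ℕ) (q : ℂˣ) {m : ℕ} (k : HeckeIdx m) :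
    (RCheck n q k - algebraMap ℂ _ (q : ℂ)) * (RCheck n q k + algebraMap ℂ _ (q : ℂ)⁻¹) = 0 := by
  have hq : (q : ℂ) ≠ 0 := q.ne_zero
  apply Matrix.ext_of_mulVec_single
  intro w
  have hs : (w ∘ adjSwap k) ∘ adjSwap k = w := by
    funext c; simp [adjSwap]
  have hlo : (w ∘ adjSwap k) k.lo = w k.hi := by simp [adjSwap]
  have hhi : (w ∘ adjSwap k) k.hi = w k.lo := by simp [adjSwap]
  simp only [Algebra.algebraMap_eq_smul_one, ← Matrix.mulVec_mulVec, Matrix.add_mulVec,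
    Matrix.sub_mulVec, Matrix.smul_mulVec, Matrix.one_mulVec, Matrix.mulVec_add,
    Matrix.mulVec_smul, RCheck_mulVec_cases, Matrix.zero_mulVec]
  rcases lt_trichotomy (w k.lo) (w k.hi) with h | h | h
  · simp only [h, h.ne, if_true, if_false, RCheck_mulVec_cases, hs, hlo, hhi, h.ne', h.not_gt]
    match_scalars <;> (field_simp; ring)
  · simp only [h, if_true, RCheck_mulVec_cases, Matrix.mulVec_smul]
    match_scalars <;> (field_simp; ring)
  · simp only [h, h.ne', if_true, if_false, RCheck_mulVec_cases, hs, hlo, hhi, h.ne, h.not_gt,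
      Matrix.mulVec_add, Matrix.mulVec_smul]
    match_scalars <;> (field_simp; ring)

theorem RCheck_comm (n : ℕ) (q : ℂˣ) {m : ℕ} (k l : HeckeIdx m) (h : k.1 + 1 < l.1) :
    RCheck n q k * RCheck n q l = RCheck n q l * RCheck n q k := by
  apply Matrix.ext_of_mulVec_single
  intro w
  have e1 : k.lo ≠ l.lo := by simp [HeckeIdx.lo, Fin.ext_iff]; omega
  have e2 : k.lo ≠ l.hi := by simp [HeckeIdx.lo, HeckeIdx.hi, Fin.ext_iff]; omega
  have e3 : k.hi ≠ l.lo := by simp [HeckeIdx.lo, HeckeIdx.hi, Fin.ext_iff]; omega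
  have e4 : k.hi ≠ l.hi := by simp [HeckeIdx.hi, Fin.ext_iff]; omega
  have f1 : ∀ w : Fin m → Fin n, (w ∘ adjSwap k) l.lo = w l.lo := fun w => by
    simp [adjSwap, Equiv.swap_apply_of_ne_of_ne e1.symm e3.symm]
  have f2 : ∀ w : Fin m → Fin n, (w ∘ adjSwap k) l.hi = w l.hi := fun w => by
    simp [adjSwap, Equiv.swap_apply_of_ne_of_ne e2.symm e4.symm]
  have f3 : ∀ w : Fin m → Fin n, (w ∘ adjSwap l) k.lo = w k.lo := fun w => by
    simp [adjSwap, Equiv.swap_apply_of_ne_of_ne e1 e2]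
  have f4 : ∀ w : Fin m → Fin n, (w ∘ adjSwap l) k.hi = w k.hi := fun w => by
    simp [adjSwap, Equiv.swap_apply_of_ne_of_ne e3 e4]
  have hc : (w ∘ adjSwap k) ∘ adjSwap l = (w ∘ adjSwap l) ∘ adjSwap k := by
    rw [Function.comp_assoc, Function.comp_assoc]
    congr 1
    rw [← Equiv.Perm.coe_mul, ← Equiv.Perm.coe_mul, adjSwap, adjSwap,
      (Equiv.Perm.disjoint_swap_swap (by simp [e1, e2, e3, e4, k.lo_ne_hi, l.lo_ne_hi])).commute.eq]
  simp only [← Matrix.mulVec_mulVec, RCheck_mulVec, Matrix.mulVec_add, Matrix.mulVec_smul,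
    f1, f2, f3, f4, hc]
  module

theorem RCheck_braid (n : ℕ) (q : ℂˣ) {m : ℕ} (k l : HeckeIdx m) (h : l.1 = k.1 + 1) :
    RCheck n q k * RCheck n q l * RCheck n q k = RCheck n q l * RCheck n q k * RCheck n q l := by
  have hq : (q : ℂ) ≠ 0 := q.ne_zero
  apply Matrix.ext_of_mulVec_single
  intro w
  have e0 : k.hi = l.lo := by simp [HeckeIdx.lo, HeckeIdx.hi, Fin.ext_iff]; omega
  have e1 : k.lo ≠ l.lo := by simp [HeckeIdx.lo, Fin.ext_iff]; omega
  have e2 : k.lo ≠ l.hi := by simp [HeckeIdx.lo, HeckeIdx.hi, Fin.ext_iff]; omega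
  have e3 : l.lo ≠ l.hi := l.lo_ne_hi
  have g1 : ∀ w : Fin m → Fin n, (w ∘ adjSwap k) k.lo = w l.lo := fun w => by
    simp [adjSwap, e0]
  have g2 : ∀ w : Fin m → Fin n, (w ∘ adjSwap k) l.lo = w k.lo := fun w => by
    simp [adjSwap, e0]
  have g3 : ∀ w : Fin m → Fin n, (w ∘ adjSwap k) l.hi = w l.hi := fun w => by
    simp [adjSwap, e0, Equiv.swap_apply_of_ne_of_ne e2.symm e3.symm]
  have g4 : ∀ w : Fin m → Fin n, (w ∘ adjSwap l) k.lo = w k.lo := fun w => by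
    simp [adjSwap, Equiv.swap_apply_of_ne_of_ne e1 e2]
  have g5 : ∀ w : Fin m → Fin n, (w ∘ adjSwap l) l.lo = w l.hi := fun w => by
    simp [adjSwap]
  have g6 : ∀ w : Fin m → Fin n, (w ∘ adjSwap l) l.hi = w l.lo := fun w => by
    simp [adjSwap]
  have s1 : ∀ w : Fin m → Fin n, (w ∘ adjSwap k) ∘ adjSwap k = w := fun w => by
    funext c; simp [adjSwap]
  have s2 : ∀ w : Fin m → Fin n, (w ∘ adjSwap l) ∘ adjSwap l = w := fun w => by
    funext c; simp [adjSwap]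
  have s3 : ∀ w : Fin m → Fin n, ((w ∘ adjSwap k) ∘ adjSwap l) ∘ adjSwap k =
      ((w ∘ adjSwap l) ∘ adjSwap k) ∘ adjSwap l := fun w => by
    have : adjSwap k * adjSwap l * adjSwap k = adjSwap l * adjSwap k * adjSwap l := by
      rw [adjSwap, adjSwap, e0, Equiv.swap_mul_swap_mul_swap e1 e2,
        Equiv.swap_comm k.lo l.lo, Equiv.swap_comm l.lo l.hi,
        Equiv.swap_mul_swap_mul_swap e3.symm e2.symm, Equiv.swap_comm]
    funext c
    exact congrArg w (DFunLike.congr_fun this c)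
  simp only [← Matrix.mulVec_mulVec, RCheck_mulVec_cases, e0]
  have tri : ∀ a b : Fin n, a = b ∨ (¬ a = b ∧ ¬ b = a ∧ a < b ∧ ¬ b < a) ∨
      (¬ a = b ∧ ¬ b = a ∧ ¬ a < b ∧ b < a) := by
    intro a b
    rcases lt_trichotomy a b with h | h | h
    · exact Or.inr (Or.inl ⟨h.ne, h.ne', h, h.not_gt⟩)
    · exact Or.inl h
    · exact Or.inr (Or.inr ⟨h.ne', h.ne, h.not_gt, h⟩)
  have c1 : w k.lo = w l.lo → w ∘ adjSwap k = w := fun h => comp_adjSwap_of_eq k w (e0 ▸ h)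
  rcases tri (w k.lo) (w l.lo) with h1 | ⟨h1, h1', h1a, h1b⟩ | ⟨h1, h1', h1a, h1b⟩ <;>
  rcases tri (w l.lo) (w l.hi) with h2 | ⟨h2, h2', h2a, h2b⟩ | ⟨h2, h2', h2a, h2b⟩ <;>
  rcases tri (w k.lo) (w l.hi) with h3 | ⟨h3, h3', h3a, h3b⟩ | ⟨h3, h3', h3a, h3b⟩ <;>
  first
  | (exfalso; order)
  | (simp only [*, if_true, if_false, RCheck_mulVec_cases,
      Matrix.mulVec_add, Matrix.mulVec_smul]
     try (match_scalars <;> field_simp <;> ring))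

/-- The representation `T_k ↦ Ř_k` of the Hecke algebra on `(ℂⁿ)^{⊗ m}`. -/
def heckeAction (n m : ℕ) (q : ℂˣ) :
    Hecke m q →ₐ[ℂ] Matrix (Fin m → Fin n) (Fin m → Fin n) ℂ :=
  RingQuot.liftAlgHom ℂ ⟨FreeAlgebra.lift ℂ (RCheck n q), by
    intro x y h
    cases h with
    | quadratic k =>
      simpa only [map_mul, map_sub, map_add, FreeAlgebra.lift_ι_apply, AlgHom.commutes, map_zero]
        using RCheck_quadratic n q k
    | braid k l h => simpa using RCheck_braid n q k l h
    | comm k l h => simpa using RCheck_comm n q k l h⟩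

/-- The image `E_Λ` of the primitive idempotent `e_Λ`. -/
def EMat (n : ℕ) (q : ℂˣ) {μ : YoungDiagram} (Λ : StdTableau μ) :
    Matrix (Fin μ.card → Fin n) (Fin μ.card → Fin n) ℂ :=
  heckeAction n μ.card q (primitiveIdempotent q Λ)

/-! ### The series `S_Λ(z)` -/

/-- The diagonal matrix `D = diag(q^{n-1}, q^{n-3}, …, q^{-n+1})`. -/
def DMat (n : ℕ) (q : ℂˣ) : Matrix (Fin n) (Fin n) ℂ :=
  Matrix.diagonal fun i => (q : ℂ) ^ ((n : ℤ) - 1 - 2 * (i : ℤ))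

/-- For a series `F(u)` with matrix coefficients in a variable `u` (or `u⁻¹`), the series obtained
by placing the matrices in the copy `a` of `End ℂⁿ` and rescaling the variable by `x`. -/
def siteSeries {n m : ℕ} {A : Type*} [Ring A] [Algebra ℂ A] (a : Fin m) (x : ℂ)
    (F : PowerSeries (Matrix (Fin n) (Fin n) A)) :
    PowerSeries (Matrix (Fin m → Fin n) (Fin m → Fin n) A) :=
  PowerSeries.mk fun r => x ^ r • site a (PowerSeries.coeff r F)

/-- The product `L⁺_1(z q^{-2c_1(Λ)}) ⋯ L⁺_m(z q^{-2c_m(Λ)})`, a power series in `z`. -/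
def plusProduct (n : ℕ) (q : ℂˣ) {μ : YoungDiagram} (Λ : StdTableau μ) :
    PowerSeries (Matrix (Fin μ.card → Fin n) (Fin μ.card → Fin n) (UqCri n q)) :=
  (List.ofFn fun a => siteSeries a ((q : ℂ) ^ (-2 * Λ.c a)) (LPlusSeries n q)).prod

/-- The product `L⁻_m(z q^{-n-2c_m(Λ)})⁻¹ ⋯ L⁻_1(z q^{-n-2c_1(Λ)})⁻¹`, a power series in the
variable `z⁻¹`. -/
def minusInvProduct (n : ℕ) (q : ℂˣ) {μ : YoungDiagram} (Λ : StdTableau μ) :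
    PowerSeries (Matrix (Fin μ.card → Fin n) (Fin μ.card → Fin n) (UqCri n q)) :=
  (List.ofFn fun a => siteSeries a ((q : ℂ) ^ ((n : ℤ) + 2 * Λ.c a))
    (LMinusInvSeries n q)).reverse.prod

/-- The operator `D_1 ⋯ D_m E_Λ`. -/
def weightE (n : ℕ) (q : ℂˣ) {μ : YoungDiagram} (Λ : StdTableau μ) :
    Matrix (Fin μ.card → Fin n) (Fin μ.card → Fin n) ℂ :=
  (List.ofFn fun a : Fin μ.card => site a (DMat n q)).prod * EMat n q Λ

/-- The contribution to the coefficient of `z^k` in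
`S_Λ(z) = tr_{1,…,m} L⁺_1(z q^{-2c_1}) ⋯ L⁺_m(z q^{-2c_m})
  L⁻_m(z q^{-n-2c_m})⁻¹ ⋯ L⁻_1(z q^{-n-2c_1})⁻¹ D_1 ⋯ D_m E_Λ`
of the term `z^{-r}` of the product of the inverse series (and so of the term `z^{k+r}` of the
product of the series `L⁺`). -/
def sugawaraTerm (n : ℕ) (q : ℂˣ) {μ : YoungDiagram} (Λ : StdTableau μ) (k : ℤ) (r : ℕ) :
    UqCri n q :=
  if 0 ≤ k + r then
    Matrix.trace (PowerSeries.coeff (k + r).toNat (plusProduct n q Λ) *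
      PowerSeries.coeff r (minusInvProduct n q Λ) *
      (weightE n q Λ).map (algebraMap ℂ (UqCri n q)))
  else 0

/-- The coefficient of `z^k` in the Laurent series `S_Λ(z)`, an element of the completed quantum
affine algebra at the critical level. -/
def sugawaraCoeff (n : ℕ) (q : ℂˣ) {μ : YoungDiagram} (Λ : StdTableau μ) (k : ℤ) :
    UqCriCompletion n q :=
  ∑' r : ℕ, (sugawaraTerm n q Λ k r : UqCriCompletion n q)

end

end QuantumAffine

namespace QuantumAffine

noncomputable section

section

/-! ### Reduced decompositions in the symmetric group -/

section Reduced

variable {m : ℕ}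

theorem HeckeIdx.lo_lt_hi (k : HeckeIdx m) : k.lo < k.hi := by
  simp [HeckeIdx.lo, HeckeIdx.hi, Fin.lt_def]

@[simp] theorem adjSwap_lo (k : HeckeIdx m) : adjSwap k k.lo = k.hi := Equiv.swap_apply_left _ _

@[simp] theorem adjSwap_hi (k : HeckeIdx m) : adjSwap k k.hi = k.lo := Equiv.swap_apply_right _ _

@[simp] theorem adjSwap_mul_self (k : HeckeIdx m) : adjSwap k * adjSwap k = 1 :=
  Equiv.swap_mul_self _ _

@[simp] theorem adjSwap_inv (k : HeckeIdx m) : (adjSwap k)⁻¹ = adjSwap k := Equiv.swap_inv _ _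

@[simp] theorem adjSwap_adjSwap (k : HeckeIdx m) (i : Fin m) : adjSwap k (adjSwap k i) = i := by
  rw [← Equiv.Perm.mul_apply, adjSwap_mul_self, Equiv.Perm.one_apply]

theorem adjSwap_of_ne (k : HeckeIdx m) {i : Fin m} (h1 : i ≠ k.lo) (h2 : i ≠ k.hi) :
    adjSwap k i = i := Equiv.swap_apply_of_ne_of_ne h1 h2

theorem adjSwap_val (k : HeckeIdx m) (i : Fin m) :
    (adjSwap k i : ℕ) = if (i : ℕ) = k.1 then k.1 + 1 else if (i : ℕ) = k.1 + 1 then k.1 else i := by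
  rw [adjSwap, Equiv.swap_apply_def]
  simp only [Fin.ext_iff, HeckeIdx.lo, HeckeIdx.hi]
  split_ifs <;> rfl

/-- The set of inversions of a permutation. -/
def invSet (f : Equiv.Perm (Fin m)) : Finset (Fin m × Fin m) :=
  Finset.univ.filter fun p => p.1 < p.2 ∧ f p.2 < f p.1

theorem mem_invSet {f : Equiv.Perm (Fin m)} {a b : Fin m} :
    (a, b) ∈ invSet f ↔ a < b ∧ f b < f a := by
  rw [invSet, Finset.mem_filter_univ]

/-- The number of inversions of a permutation. -/
def invCount (f : Equiv.Perm (Fin m)) : ℕ := (invSet f).card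

theorem adjSwap_lt_adjSwap (k : HeckeIdx m) {a b : Fin m} (h : a < b)
    (hne : ¬ (a = k.lo ∧ b = k.hi)) : adjSwap k a < adjSwap k b := by
  rw [Fin.lt_def, adjSwap_val, adjSwap_val]
  rw [Fin.lt_def] at h
  simp only [HeckeIdx.lo, HeckeIdx.hi, Fin.ext_iff] at hne
  split_ifs <;> omega

theorem invSet_mul_adjSwap (f : Equiv.Perm (Fin m)) (k : HeckeIdx m) (h : f k.lo < f k.hi) :
    invSet (f * adjSwap k) =
      insert (k.lo, k.hi) ((invSet f).map ((adjSwap k).prodCongr (adjSwap k)).toEmbedding) := by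
  ext ⟨a, b⟩
  simp only [Finset.mem_insert, mem_invSet,
    Finset.mem_map_equiv, Equiv.prodCongr_symm, Equiv.prodCongr_apply, Prod.map_apply,
    Equiv.Perm.mul_apply, Prod.mk.injEq]
  have e : ∀ i, (adjSwap k).symm i = adjSwap k i := fun i => by
    rw [Equiv.symm_apply_eq, adjSwap_adjSwap]
  simp only [e]
  constructor
  · rintro ⟨h1, h2⟩
    by_cases hne : a = k.lo ∧ b = k.hi
    · exact Or.inl hne
    · exact Or.inr ⟨adjSwap_lt_adjSwap k h1 hne, h2⟩
  · rintro (⟨rfl, rfl⟩ | ⟨h1, h2⟩)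
    · simpa using ⟨k.lo_lt_hi, h⟩
    · refine ⟨?_, h2⟩
      have := adjSwap_lt_adjSwap k h1 (fun hne => ?_)
      · simpa using this
      · rw [hne.1, hne.2] at h2
        exact absurd h2 h.not_gt

theorem invCount_mul_adjSwap (f : Equiv.Perm (Fin m)) (k : HeckeIdx m) (h : f k.lo < f k.hi) :
    invCount (f * adjSwap k) = invCount f + 1 := by
  rw [invCount, invSet_mul_adjSwap f k h, Finset.card_insert_of_notMem, Finset.card_map, invCount]
  rw [Finset.mem_map_equiv]
  have e : ∀ i, (adjSwap k).symm i = adjSwap k i := fun i => by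
    rw [Equiv.symm_apply_eq, adjSwap_adjSwap]
  simp [invSet, e, k.lo_lt_hi.le]

theorem invCount_mul_adjSwap' (f : Equiv.Perm (Fin m)) (k : HeckeIdx m) (h : f k.hi < f k.lo) :
    invCount (f * adjSwap k) + 1 = invCount f := by
  have := invCount_mul_adjSwap (f * adjSwap k) k (by simpa using h)
  rw [← this, mul_assoc, adjSwap_mul_self, mul_one]

theorem eq_one_of_ascending (f : Equiv.Perm (Fin m)) (h : ∀ k : HeckeIdx m, f k.lo < f k.hi) :
    f = 1 := by
  match m, f, h with
  | 0, f, h => exact Subsingleton.elim _ _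
  | m + 1, f, h =>
    have hm : StrictMono f := by
      rw [Fin.strictMono_iff_lt_succ]
      intro i
      exact h ⟨i.1, by omega⟩
    have := Subsingleton.elim (hm.orderIsoOfSurjective f f.surjective) (OrderIso.refl _)
    ext i
    have := DFunLike.congr_fun this i
    simpa using congrArg Fin.val this

/-- The product of the adjacent transpositions listed in a word. -/
def wordPerm (w : List (HeckeIdx m)) : Equiv.Perm (Fin m) := (w.map adjSwap).prod

@[simp] theorem wordPerm_nil : wordPerm ([] : List (HeckeIdx m)) = 1 := rfl

@[simp] theorem wordPerm_cons (k : HeckeIdx m) (w : List (HeckeIdx m)) :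
    wordPerm (k :: w) = adjSwap k * wordPerm w := by simp [wordPerm]

@[simp] theorem wordPerm_append (w w' : List (HeckeIdx m)) :
    wordPerm (w ++ w') = wordPerm w * wordPerm w' := by simp [wordPerm]

theorem wordPerm_reverse (w : List (HeckeIdx m)) : wordPerm w.reverse = (wordPerm w)⁻¹ := by
  induction w with
  | nil => simp
  | cons k w ih => simp [ih]

/-- The length of a permutation. -/
def permLength (σ : Equiv.Perm (Fin m)) : ℕ := invCount σ⁻¹

theorem permLength_mul_of_asc {σ : Equiv.Perm (Fin m)} {k : HeckeIdx m}
    (h : σ⁻¹ k.lo < σ⁻¹ k.hi) : permLength (adjSwap k * σ) = permLength σ + 1 := by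
  rw [permLength, mul_inv_rev, adjSwap_inv, invCount_mul_adjSwap _ _ h, permLength]

theorem permLength_mul_of_desc {σ : Equiv.Perm (Fin m)} {k : HeckeIdx m}
    (h : σ⁻¹ k.hi < σ⁻¹ k.lo) : permLength (adjSwap k * σ) + 1 = permLength σ := by
  rw [permLength, mul_inv_rev, adjSwap_inv, invCount_mul_adjSwap' _ _ h, permLength]

theorem asc_or_desc (σ : Equiv.Perm (Fin m)) (k : HeckeIdx m) :
    σ⁻¹ k.lo < σ⁻¹ k.hi ∨ σ⁻¹ k.hi < σ⁻¹ k.lo :=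
  lt_or_gt_of_ne fun h => k.lo_ne_hi (σ⁻¹.injective h)

theorem exists_desc {σ : Equiv.Perm (Fin m)} (h : σ ≠ 1) :
    ∃ k : HeckeIdx m, σ⁻¹ k.hi < σ⁻¹ k.lo := by
  by_contra hc
  push Not at hc
  refine h (inv_eq_one.1 (eq_one_of_ascending σ⁻¹ fun k => (hc k).lt_of_ne fun h => ?_))
  exact k.lo_ne_hi (σ⁻¹.injective h)

@[simp] theorem permLength_one : permLength (1 : Equiv.Perm (Fin m)) = 0 := by
  simp only [permLength, invCount, invSet, inv_one, Equiv.Perm.one_apply, Finset.card_eq_zero,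
    Finset.filter_eq_empty_iff, not_and, not_lt]
  exact fun _ _ h => h.le

theorem permLength_eq_zero {σ : Equiv.Perm (Fin m)} (h : permLength σ = 0) : σ = 1 := by
  by_contra hne
  obtain ⟨k, hk⟩ := exists_desc hne
  have := permLength_mul_of_desc hk
  omega

theorem permLength_wordPerm_le (w : List (HeckeIdx m)) : permLength (wordPerm w) ≤ w.length := by
  induction w with
  | nil => simp
  | cons k w ih =>
    rw [wordPerm_cons, List.length_cons]
    rcases asc_or_desc (wordPerm w) k with h | h
    · have := permLength_mul_of_asc h; omega
    · have := permLength_mul_of_desc h; omega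

theorem exists_reduced (σ : Equiv.Perm (Fin m)) :
    ∃ w : List (HeckeIdx m), wordPerm w = σ ∧ w.length = permLength σ := by
  induction h : permLength σ generalizing σ with
  | zero => exact ⟨[], (permLength_eq_zero h).symm, rfl⟩
  | succ l ih =>
    obtain ⟨k, hk⟩ := exists_desc (σ := σ) (by rintro rfl; simp at h)
    obtain ⟨w, hw, hl⟩ := ih (adjSwap k * σ) (by have := permLength_mul_of_desc hk; omega)
    exact ⟨k :: w, by rw [wordPerm_cons, hw, ← mul_assoc, adjSwap_mul_self, one_mul], by simp [hl]⟩

theorem permLength_inv (σ : Equiv.Perm (Fin m)) : permLength σ⁻¹ = permLength σ := by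
  have key : ∀ σ : Equiv.Perm (Fin m), permLength σ⁻¹ ≤ permLength σ := by
    intro σ
    obtain ⟨w, rfl, hl⟩ := exists_reduced σ
    rw [← wordPerm_reverse, ← hl, ← List.length_reverse]
    exact permLength_wordPerm_le _
  exact le_antisymm (key σ) (by simpa using key σ⁻¹)

theorem wordPerm_reducedWord (σ : Equiv.Perm (Fin m)) : wordPerm (reducedWord σ) = σ :=
  Function.argminOn_mem List.length _ (exists_word σ)

theorem length_reducedWord (σ : Equiv.Perm (Fin m)) : (reducedWord σ).length = permLength σ := by
  apply le_antisymm
  · obtain ⟨w, hw, hl⟩ := exists_reduced σ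
    rw [← hl]
    exact Function.argminOn_le List.length {w : List (HeckeIdx m) | (w.map adjSwap).prod = σ}
      (show w ∈ {w : List (HeckeIdx m) | (w.map adjSwap).prod = σ} from hw)
  · have := permLength_wordPerm_le (reducedWord σ)
    rwa [wordPerm_reducedWord] at this

/-- The braid relations for a family of elements of a monoid. -/
structure IsBraid {M : Type*} [Monoid M] (g : HeckeIdx m → M) : Prop where
  braid : ∀ k l : HeckeIdx m, l.1 = k.1 + 1 → g k * g l * g k = g l * g k * g l
  comm : ∀ k l : HeckeIdx m, k.1 + 1 < l.1 → g k * g l = g l * g k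

theorem adjSwap_isBraid : IsBraid (adjSwap : HeckeIdx m → Equiv.Perm (Fin m)) where
  braid k l h := by
    have e0 : k.hi = l.lo := by simp [HeckeIdx.lo, HeckeIdx.hi, h]
    have e1 : k.lo ≠ l.lo := by simp [HeckeIdx.lo, Fin.ext_iff]; omega
    have e2 : k.lo ≠ l.hi := by simp [HeckeIdx.lo, HeckeIdx.hi, Fin.ext_iff]; omega
    rw [adjSwap, adjSwap, e0, Equiv.swap_mul_swap_mul_swap e1 e2,
      Equiv.swap_comm k.lo l.lo, Equiv.swap_comm l.lo l.hi,
      Equiv.swap_mul_swap_mul_swap l.lo_ne_hi.symm e2.symm, Equiv.swap_comm]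
  comm k l h := by
    have e1 : k.lo ≠ l.lo := by simp [HeckeIdx.lo, Fin.ext_iff]; omega
    have e2 : k.lo ≠ l.hi := by simp [HeckeIdx.lo, HeckeIdx.hi, Fin.ext_iff]; omega
    have e3 : k.hi ≠ l.lo := by simp [HeckeIdx.lo, HeckeIdx.hi, Fin.ext_iff]; omega
    have e4 : k.hi ≠ l.hi := by simp [HeckeIdx.hi, Fin.ext_iff]; omega
    exact (Equiv.Perm.disjoint_swap_swap
      (by simp [e1, e2, e3, e4, k.lo_ne_hi, l.lo_ne_hi])).commute.eq

/-- Matsumoto's theorem for the symmetric group. -/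
theorem IsBraid.prod_eq {M : Type*} [Monoid M] {g : HeckeIdx m → M} (hg : IsBraid g) :
    ∀ (L : ℕ) (w w' : List (HeckeIdx m)), wordPerm w = wordPerm w' →
      w.length = L → permLength (wordPerm w) = L → w'.length = L →
      (w.map g).prod = (w'.map g).prod := by
  intro L
  induction L with
  | zero =>
    intro w w' _ h1 _ h3
    rw [List.length_eq_zero_iff.1 h1, List.length_eq_zero_iff.1 h3]
  | succ L ih =>
    intro w w' hww h1 h2 h3
    -- words of the length `L` of the permutations below `σ`
    have key : ∀ (k : HeckeIdx m) (v : List (HeckeIdx m)), (k :: v).length = L + 1 →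
        wordPerm (k :: v) = wordPerm w → (wordPerm w)⁻¹ k.hi < (wordPerm w)⁻¹ k.lo ∧
          wordPerm v = adjSwap k * wordPerm w ∧ v.length = L ∧ permLength (wordPerm v) = L := by
      intro k v hv hvw
      have hv' : v.length = L := by simpa using hv
      have e : wordPerm v = adjSwap k * wordPerm w := by
        rw [← hvw, wordPerm_cons, ← mul_assoc, adjSwap_mul_self, one_mul]
      have hle := permLength_wordPerm_le v
      rcases asc_or_desc (wordPerm w) k with h | h
      · have := permLength_mul_of_asc h
        rw [← e] at this
        omega
      · have := permLength_mul_of_desc h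
        rw [← e] at this
        exact ⟨h, e, hv', by omega⟩
    match w, w', h1, h3 with
    | k :: v, l :: v', h1, h3 =>
      obtain ⟨hk, ek, hvk, hlk⟩ := key k v h1 rfl
      obtain ⟨hl, el, hvl, hll⟩ := key l v' h3 hww.symm
      set σ := wordPerm (k :: v) with hσ
      rw [List.map_cons, List.prod_cons, List.map_cons, List.prod_cons]
      have general : ∀ (k l : HeckeIdx m) (v v' : List (HeckeIdx m)),
          σ⁻¹ k.hi < σ⁻¹ k.lo → σ⁻¹ l.hi < σ⁻¹ l.lo →
          wordPerm v = adjSwap k * σ → wordPerm v' = adjSwap l * σ →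
          v.length = L → v'.length = L → permLength (wordPerm v) = L →
          permLength (wordPerm v') = L →
          k.1 < l.1 → g k * (v.map g).prod = g l * (v'.map g).prod := by
        clear hk ek hvk hlk hl el hvl hll h1 h3 key
        intro k l v v' hk hl ek el hvk hvl hlk hll hkl
        rcases (Nat.succ_le_of_lt hkl).eq_or_lt with hadj | hfar
        · have hadj : l.1 = k.1 + 1 := hadj.symm
          have e0 : l.lo = k.hi := by simp [HeckeIdx.lo, HeckeIdx.hi, hadj]
          have s1 : adjSwap k l.hi = l.hi := adjSwap_of_ne k
            (by simp [HeckeIdx.lo, HeckeIdx.hi, Fin.ext_iff]; omega)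
            (by simp [HeckeIdx.hi, Fin.ext_iff]; omega)
          have s2 : adjSwap l k.lo = k.lo := adjSwap_of_ne l
            (by simp [HeckeIdx.lo, Fin.ext_iff]; omega)
            (by simp [HeckeIdx.lo, HeckeIdx.hi, Fin.ext_iff]; omega)
          have d1 : (adjSwap k * σ)⁻¹ l.hi < (adjSwap k * σ)⁻¹ l.lo := by
            rw [mul_inv_rev, adjSwap_inv, Equiv.Perm.mul_apply, Equiv.Perm.mul_apply, s1, e0,
              adjSwap_hi]
            rw [e0] at hl
            exact hl.trans hk
          have p1 := permLength_mul_of_desc d1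
          have d2 : (adjSwap l * (adjSwap k * σ))⁻¹ k.hi < (adjSwap l * (adjSwap k * σ))⁻¹ k.lo := by
            rw [mul_inv_rev, mul_inv_rev, adjSwap_inv, adjSwap_inv, Equiv.Perm.mul_apply,
              Equiv.Perm.mul_apply, Equiv.Perm.mul_apply, Equiv.Perm.mul_apply, s2, adjSwap_lo,
              ← e0, adjSwap_lo, s1, e0]
            rw [e0] at hl
            exact hl
          have p2 := permLength_mul_of_desc d2
          obtain ⟨u, hu, hul⟩ := exists_reduced (adjSwap k * (adjSwap l * (adjSwap k * σ)))
          have hb := adjSwap_isBraid.braid k l hadj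
          have E1 : wordPerm (l :: k :: u) = adjSwap k * σ := by
            simp only [wordPerm_cons, hu]
            rw [← mul_assoc (adjSwap k) (adjSwap k), adjSwap_mul_self, one_mul, ← mul_assoc,
              adjSwap_mul_self, one_mul]
          have E2 : wordPerm (k :: l :: u) = adjSwap l * σ := by
            simp only [wordPerm_cons, hu]
            have : adjSwap k * (adjSwap l * (adjSwap k * (adjSwap l * (adjSwap k * σ)))) =
              (adjSwap k * adjSwap l * adjSwap k) * adjSwap l * adjSwap k * σ := by
              simp only [mul_assoc]
            rw [this, hb, mul_assoc _ (adjSwap l) (adjSwap l), adjSwap_mul_self, mul_one,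
              mul_assoc _ (adjSwap k) (adjSwap k), adjSwap_mul_self, mul_one]
          rw [← ek] at p1 p2
          rw [← ek] at hul
          rw [ih v (l :: k :: u) (ek.trans E1.symm) hvk hlk (by simp; omega),
            ih v' (k :: l :: u) (el.trans E2.symm) hvl hll (by simp; omega)]
          simp only [List.map_cons, List.prod_cons]
          rw [← mul_assoc, ← mul_assoc, hg.braid k l hadj]
          simp only [mul_assoc]
        · have s1 : adjSwap k l.hi = l.hi := adjSwap_of_ne k
            (by simp [HeckeIdx.lo, HeckeIdx.hi, Fin.ext_iff]; omega)
            (by simp [HeckeIdx.hi, Fin.ext_iff]; omega)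
          have s2 : adjSwap k l.lo = l.lo := adjSwap_of_ne k
            (by simp [HeckeIdx.lo, Fin.ext_iff]; omega)
            (by simp [HeckeIdx.lo, HeckeIdx.hi, Fin.ext_iff]; omega)
          have d1 : (adjSwap k * σ)⁻¹ l.hi < (adjSwap k * σ)⁻¹ l.lo := by
            rw [mul_inv_rev, adjSwap_inv, Equiv.Perm.mul_apply, Equiv.Perm.mul_apply, s1, s2]
            exact hl
          have p1 := permLength_mul_of_desc d1
          obtain ⟨u, hu, hul⟩ := exists_reduced (adjSwap l * (adjSwap k * σ))
          have E1 : wordPerm (l :: u) = adjSwap k * σ := by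
            rw [wordPerm_cons, hu, ← mul_assoc, adjSwap_mul_self, one_mul]
          have E2 : wordPerm (k :: u) = adjSwap l * σ := by
            rw [wordPerm_cons, hu, ← mul_assoc, adjSwap_isBraid.comm k l hfar, mul_assoc,
              ← mul_assoc (adjSwap k), adjSwap_mul_self, one_mul]
          rw [← ek] at p1 hul
          rw [ih v (l :: u) (ek.trans E1.symm) hvk hlk (by simp; omega),
            ih v' (k :: u) (el.trans E2.symm) hvl hll (by simp; omega)]
          simp only [List.map_cons, List.prod_cons]
          rw [← mul_assoc, ← mul_assoc, hg.comm k l hfar]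
      rcases lt_trichotomy k.1 l.1 with h | h | h
      · exact general k l v v' hk hl ek el hvk hvl hlk hll h
      · obtain rfl : k = l := Subtype.ext h
        rw [ih v v' (ek.trans el.symm) hvk hlk hvl]
      · exact (general l k v' v hl hk el ek hvl hvk hll hlk h).symm

section AlongReduced

variable {M : Type*} [Monoid M] {g : HeckeIdx m → M}

theorem IsBraid.alongReduced_eq (hg : IsBraid g) {w : List (HeckeIdx m)} {σ : Equiv.Perm (Fin m)}
    (hw : wordPerm w = σ) (hl : w.length = permLength σ) : alongReduced g σ = (w.map g).prod := by
  refine hg.prod_eq (permLength σ) _ _ ((wordPerm_reducedWord σ).trans hw.symm)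
    (length_reducedWord σ) ?_ hl
  rw [wordPerm_reducedWord]

theorem IsBraid.alongReduced_one (hg : IsBraid g) : alongReduced g 1 = 1 := by
  rw [hg.alongReduced_eq (w := []) wordPerm_nil (by simp)]; simp

theorem IsBraid.alongReduced_adjSwap_mul (hg : IsBraid g) {σ : Equiv.Perm (Fin m)} {k : HeckeIdx m}
    (h : permLength (adjSwap k * σ) = permLength σ + 1) :
    alongReduced g (adjSwap k * σ) = g k * alongReduced g σ := by
  obtain ⟨w, hw, hl⟩ := exists_reduced σ
  rw [hg.alongReduced_eq hw hl, hg.alongReduced_eq (w := k :: w) (by rw [wordPerm_cons, hw])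
    (by rw [h, ← hl, List.length_cons])]
  simp

theorem IsBraid.alongReduced_mul_adjSwap (hg : IsBraid g) {σ : Equiv.Perm (Fin m)} {k : HeckeIdx m}
    (h : permLength (σ * adjSwap k) = permLength σ + 1) :
    alongReduced g (σ * adjSwap k) = alongReduced g σ * g k := by
  obtain ⟨w, hw, hl⟩ := exists_reduced σ
  rw [hg.alongReduced_eq hw hl, hg.alongReduced_eq (w := w ++ [k]) (by simp [hw])
    (by simp [h, hl])]
  simp

theorem map_alongReduced {N : Type*} [Monoid N] (φ : M →* N) (g : HeckeIdx m → M)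
    (σ : Equiv.Perm (Fin m)) : φ (alongReduced g σ) = alongReduced (fun k => φ (g k)) σ := by
  simp [alongReduced, map_list_prod, Function.comp_def]

end AlongReduced

end Reduced

end

section

/-! ### Standard sequences of boxes -/

section Std

variable {m : ℕ}

/-- A sequence of boxes is standard if the boxes are distinct and every initial segment of it is
(the set of boxes of) a Young diagram. -/
structure IsStd (f : Fin m → ℕ × ℕ) : Prop where
  inj : Function.Injective f
  lower : ∀ k b, b ≤ f k → ∃ l ≤ k, f l = b

theorem IsStd.le_of_le {f : Fin m → ℕ × ℕ} (hf : IsStd f) {i j : Fin m} (h : f i ≤ f j) :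
    i ≤ j := by
  obtain ⟨l, hl, e⟩ := hf.lower j _ h
  rwa [← hf.inj e]

theorem IsStd.lt_of_le {f : Fin m → ℕ × ℕ} (hf : IsStd f) {b : ℕ × ℕ} {j : Fin m} (h : b ≤ f j)
    (hne : b ≠ f j) : ∃ l < j, f l = b := by
  obtain ⟨l, hl, e⟩ := hf.lower j _ h
  refine ⟨l, hl.lt_of_ne ?_, e⟩
  rintro rfl
  exact hne e.symm

theorem IsStd.three_le_of_content_eq {f : Fin m → ℕ × ℕ} (hf : IsStd f) {i j : Fin m} (hij : i < j)
    (h : content (f i) = content (f j)) : (i : ℕ) + 3 ≤ j := by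
  rcases hi : f i with ⟨r, c⟩
  rcases hj : f j with ⟨r', c'⟩
  rw [hi, hj, content, content] at h
  simp only at h
  have hr : r < r' := by
    by_contra hr
    push Not at hr
    have : f j ≤ f i := by rw [hi, hj, Prod.mk_le_mk]; omega
    exact absurd (hf.le_of_le this) hij.not_ge
  obtain ⟨l, hl, el⟩ := hf.lt_of_le (b := (r + 1, c)) (j := j)
    (by rw [hj, Prod.mk_le_mk]; omega) (by rw [hj, Ne, Prod.mk.injEq]; omega)
  obtain ⟨l', hl', el'⟩ := hf.lt_of_le (b := (r, c + 1)) (j := j)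
    (by rw [hj, Prod.mk_le_mk]; omega) (by rw [hj, Ne, Prod.mk.injEq]; omega)
  have h1 : i ≤ l := hf.le_of_le (by rw [hi, el, Prod.mk_le_mk]; omega)
  have h2 : i ≤ l' := hf.le_of_le (by rw [hi, el', Prod.mk_le_mk]; omega)
  have n1 : i ≠ l := by rintro rfl; rw [hi, Prod.mk.injEq] at el; omega
  have n2 : i ≠ l' := by rintro rfl; rw [hi, Prod.mk.injEq] at el'; omega
  have n3 : l ≠ l' := by rintro rfl; rw [el, Prod.mk.injEq] at el'; omega
  rw [Fin.lt_def] at hl hl'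
  rw [Fin.le_def] at h1 h2
  rw [Ne, Fin.ext_iff] at n1 n2 n3
  omega

theorem IsStd.content_ne {f : Fin m → ℕ × ℕ} (hf : IsStd f) {i j : Fin m} (hij : i < j)
    (h : (j : ℕ) < i + 3) : content (f i) ≠ content (f j) := fun e => by
  have := hf.three_le_of_content_eq hij e
  omega

/-- The difference of the contents of the boxes exchanged by an adjacent transposition. -/
def contentDiff (f : Fin m → ℕ × ℕ) (k : HeckeIdx m) : ℤ := content (f k.hi) - content (f k.lo)

theorem IsStd.content_lo_ne_hi {f : Fin m → ℕ × ℕ} (hf : IsStd f) (k : HeckeIdx m) :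
    content (f k.lo) ≠ content (f k.hi) :=
  hf.content_ne k.lo_lt_hi (by simp [HeckeIdx.lo, HeckeIdx.hi])

theorem contentDiff_comp (f : Fin m → ℕ × ℕ) (k : HeckeIdx m) :
    contentDiff (f ∘ adjSwap k) k = -contentDiff f k := by
  simp [contentDiff]

theorem comp_adjSwap_comp {α : Type*} (f : Fin m → α) (k : HeckeIdx m) :
    (f ∘ adjSwap k) ∘ adjSwap k = f := by
  funext i; simp

/-- Two consecutive comparable boxes of a standard sequence are adjacent. -/
theorem IsStd.adjacent {f : Fin m → ℕ × ℕ} (hf : IsStd f) (k : HeckeIdx m)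
    (h : f k.lo ≤ f k.hi) : contentDiff f k = 1 ∨ contentDiff f k = -1 := by
  have key : ∀ b, f k.lo ≤ b → b ≤ f k.hi → b ≠ f k.lo → b = f k.hi := by
    intro b h1 h2 h3
    by_contra h4
    obtain ⟨l, hl, rfl⟩ := hf.lt_of_le h2 h4
    have h5 := hf.le_of_le h1
    have h6 : k.lo ≠ l := by rintro rfl; exact h3 rfl
    simp only [HeckeIdx.lo, HeckeIdx.hi, Fin.lt_def, Fin.le_def, Ne, Fin.ext_iff] at hl h5 h6
    omega
  have hne : f k.lo ≠ f k.hi := fun e => k.lo_ne_hi (hf.inj e)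
  rw [contentDiff]
  rcases hi : f k.lo with ⟨r, c⟩
  rcases hj : f k.hi with ⟨r', c'⟩
  rw [hi, hj] at key h hne
  rw [Prod.mk_le_mk] at h
  rw [Ne, Prod.mk.injEq] at hne
  by_cases hr : r < r'
  · have := key (r + 1, c) (by rw [Prod.mk_le_mk]; omega) (by rw [Prod.mk_le_mk]; omega)
      (by rw [Ne, Prod.mk.injEq]; omega)
    rw [Prod.mk.injEq] at this
    simp only [content]
    omega
  · have := key (r, c + 1) (by rw [Prod.mk_le_mk]; omega) (by rw [Prod.mk_le_mk]; omega)
      (by rw [Ne, Prod.mk.injEq]; omega)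
    rw [Prod.mk.injEq] at this
    simp only [content]
    omega

theorem IsStd.comp_adjSwap_of_not_le {f : Fin m → ℕ × ℕ} (hf : IsStd f) (k : HeckeIdx m)
    (h : ¬ f k.lo ≤ f k.hi) : IsStd (f ∘ adjSwap k) where
  inj := hf.inj.comp (adjSwap k).injective
  lower p b hb := by
    obtain ⟨l, hl, rfl⟩ := hf.lower _ _ hb
    refine ⟨adjSwap k l, ?_, by simp⟩
    have h1 : p = k.lo → l ≠ k.lo := by
      rintro rfl rfl
      simp only [Function.comp_apply, adjSwap_lo] at hb
      exact h hb
    rw [Fin.le_def, adjSwap_val] at hl ⊢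
    simp only [HeckeIdx.lo, Ne, Fin.ext_iff] at h1
    split_ifs at hl ⊢ <;> omega

theorem IsStd.comp_adjSwap {f : Fin m → ℕ × ℕ} (hf : IsStd f) (k : HeckeIdx m)
    (h1 : contentDiff f k ≠ 1) (h2 : contentDiff f k ≠ -1) : IsStd (f ∘ adjSwap k) :=
  hf.comp_adjSwap_of_not_le k fun h => by rcases hf.adjacent k h with h | h <;> contradiction

theorem IsStd.contentDiff_ne {f : Fin m → ℕ × ℕ} (hf : IsStd f) (k : HeckeIdx m)
    (h : IsStd (f ∘ adjSwap k)) : contentDiff f k ≠ 1 ∧ contentDiff f k ≠ -1 := by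
  have h1 : ¬ f k.lo ≤ f k.hi := by
    intro hle
    have : (f ∘ adjSwap k) k.hi ≤ (f ∘ adjSwap k) k.lo := by simpa using hle
    exact absurd (h.le_of_le this) k.lo_lt_hi.not_ge
  have h2 : ¬ f k.hi ≤ f k.lo := fun hle => absurd (hf.le_of_le hle) k.lo_lt_hi.not_ge
  rw [Prod.le_def] at h1 h2
  simp only [contentDiff, content]
  omega

/-- The contents determine a standard sequence. -/
theorem IsStd.eq_of_content {f g : Fin m → ℕ × ℕ} (hf : IsStd f) (hg : IsStd g)
    (h : ∀ k, content (f k) = content (g k)) : f = g := by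
  have key : ∀ {f g : Fin m → ℕ × ℕ}, IsStd f → IsStd g → ∀ k, (∀ l < k, f l = g l) →
      f k ≤ g k → f k = g k := by
    intro f g hf hg k ih hle
    obtain ⟨l, hl, e⟩ := hg.lower k _ hle
    rcases hl.eq_or_lt with rfl | hlt
    · exact e.symm
    · rw [← ih l hlt] at e
      exact absurd (hf.inj e) hlt.ne
  have : ∀ n : ℕ, ∀ k : Fin m, (k : ℕ) = n → f k = g k := by
    intro n
    induction n using Nat.strong_induction_on with
    | _ n ih =>
      rintro k rfl
      have ih' : ∀ l < k, f l = g l := fun l hl => ih l hl l rfl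
      have hc := h k
      rcases le_total (f k).1 (g k).1 with hr | hr
      · refine key hf hg k ih' ?_
        simp only [content] at hc
        rw [Prod.le_def]
        omega
      · refine (key hg hf k (fun l hl => (ih' l hl).symm) ?_).symm
        simp only [content] at hc
        rw [Prod.le_def]
        omega
  exact funext fun k => this k k rfl

theorem IsStd.first {f : Fin m → ℕ × ℕ} (hf : IsStd f) (k : Fin m) (hk : (k : ℕ) = 0) :
    f k = (0, 0) := by
  obtain ⟨l, hl, e⟩ := hf.lower k (0, 0) (by rw [Prod.le_def]; simp)
  have : l = k := by rw [Fin.le_def] at hl; apply Fin.ext; omega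
  rw [← this, e]

theorem IsStd.add_le {f : Fin m → ℕ × ℕ} (hf : IsStd f) :
    ∀ (n : ℕ) (k : Fin m), (f k).1 + (f k).2 = n → n ≤ k := by
  intro n
  induction n with
  | zero => intro k _; omega
  | succ n ih =>
    intro k hk
    obtain ⟨b, hb, hs⟩ : ∃ b, b ≤ f k ∧ b.1 + b.2 = n := by
      rcases Nat.eq_zero_or_pos (f k).1 with h0 | h0
      · exact ⟨((f k).1, (f k).2 - 1), by rw [Prod.le_def]; simp, by simp only; omega⟩
      · exact ⟨((f k).1 - 1, (f k).2), by rw [Prod.le_def]; simp, by simp only; omega⟩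
    obtain ⟨l, hl, e⟩ := hf.lt_of_le hb (by rintro rfl; omega)
    have := ih l (by rw [e]; exact hs)
    rw [Fin.lt_def] at hl
    omega

end Std

/-- The standard sequences of boxes of a given length, that is, the standard tableaux of all
shapes of a given size. -/
abbrev Tab (m : ℕ) : Type := {f : Fin m → ℕ × ℕ // IsStd f}

instance (m : ℕ) : Finite (Tab m) := by
  refine Finite.of_injective (β := Fin m → Fin (m + 1) × Fin (m + 1))
    (fun t k => (⟨(t.1 k).1, ?_⟩, ⟨(t.1 k).2, ?_⟩)) ?_
  · have := t.2.add_le _ k rfl; omega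
  · have := t.2.add_le _ k rfl; omega
  · intro t t' h
    apply Subtype.ext
    funext k
    have := congrFun h k
    simp only [Prod.mk.injEq, Fin.mk.injEq] at this
    exact Prod.ext this.1 this.2

instance (m : ℕ) : Fintype (Tab m) := Fintype.ofFinite _

/-! ### The coefficients of the Young matrices -/

section Coef

variable {q : ℂˣ}

/-- The diagonal coefficient `q^d / [d]_q`. -/
def diagCoef (q : ℂˣ) (d : ℤ) : ℂ := (q : ℂ) ^ d / qNum q d

/-- The off-diagonal coefficient `√(1 - 1/[d]_q²)`. -/
def offCoef (q : ℂˣ) (d : ℤ) : ℂ := (1 - 1 / qNum q d ^ 2) ^ (1 / 2 : ℂ)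

/-- The eigenvalue `q^{2c}`. -/
def qSq (q : ℂˣ) (c : ℤ) : ℂ := (q : ℂ) ^ (2 * c)

/-- The number `q - q⁻¹`. -/
def qDiff (q : ℂˣ) : ℂ := (q : ℂ) - (q : ℂ)⁻¹

theorem zpow_eq_one_iff (hq : ∀ k : ℕ, 0 < k → q ^ k ≠ 1) {d : ℤ} :
    (q : ℂ) ^ d = 1 ↔ d = 0 := by
  constructor
  · intro h
    by_contra hd
    have hn : ∀ n : ℕ, 0 < n → (q : ℂ) ^ n ≠ 1 := fun n hn h' => hq n hn (by ext; simpa using h')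
    rcases lt_or_gt_of_ne hd with hd | hd
    · obtain ⟨n, rfl⟩ : ∃ n : ℕ, d = -n := ⟨d.natAbs, by omega⟩
      rw [zpow_neg, inv_eq_one, zpow_natCast] at h
      exact hn n (by omega) h
    · obtain ⟨n, rfl⟩ : ∃ n : ℕ, d = n := ⟨d.natAbs, by omega⟩
      rw [zpow_natCast] at h
      exact hn n (by omega) h
  · rintro rfl; simp

theorem qSq_ne_zero (c : ℤ) : qSq q c ≠ 0 := zpow_ne_zero _ q.ne_zero

theorem qSq_injective (hq : ∀ k : ℕ, 0 < k → q ^ k ≠ 1) : Function.Injective (qSq q) := by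
  intro c c' h
  have : (q : ℂ) ^ (2 * c - 2 * c') = 1 := by
    rw [zpow_sub₀ q.ne_zero, div_eq_one_iff_eq (zpow_ne_zero _ q.ne_zero)]
    exact h
  rw [zpow_eq_one_iff hq] at this
  omega

theorem qDiff_ne_zero (hq : ∀ k : ℕ, 0 < k → q ^ k ≠ 1) : qDiff q ≠ 0 := by
  intro h
  have : (q : ℂ) ^ (2 : ℤ) = 1 := by
    rw [qDiff, sub_eq_zero] at h
    rw [zpow_ofNat, sq]
    nth_rewrite 2 [h]
    exact mul_inv_cancel₀ q.ne_zero
  rw [zpow_eq_one_iff hq] at this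
  omega

theorem qNum_eq (d : ℤ) : qNum q d = ((q : ℂ) ^ d - ((q : ℂ) ^ d)⁻¹) / qDiff q := by
  rw [qNum, zpow_neg, qDiff]

theorem qNum_neg (d : ℤ) : qNum q (-d) = -qNum q d := by
  rw [qNum, qNum, neg_neg, ← neg_div, neg_sub]

theorem offCoef_neg (d : ℤ) : offCoef q (-d) = offCoef q d := by
  rw [offCoef, offCoef, qNum_neg, neg_sq]

theorem offCoef_sub_comm (c c' : ℤ) : offCoef q (c - c') = offCoef q (c' - c) := by
  rw [← offCoef_neg, neg_sub]

theorem diagCoef_sub (c c' : ℤ) :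
    diagCoef q (c' - c) = qDiff q * qSq q c' / (qSq q c' - qSq q c) := by
  have h0 : (q : ℂ) ^ c ≠ 0 := zpow_ne_zero _ q.ne_zero
  have h1 : (q : ℂ) ^ c' ≠ 0 := zpow_ne_zero _ q.ne_zero
  rw [diagCoef, qNum_eq, zpow_sub₀ q.ne_zero, qSq, qSq, two_mul, two_mul, zpow_add₀ q.ne_zero,
    zpow_add₀ q.ne_zero]
  set x := (q : ℂ) ^ c
  set y := (q : ℂ) ^ c'
  have e : y / x - (y / x)⁻¹ = (y * y - x * x) / (x * y) := by field_simp
  rw [e]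
  by_cases h : y * y - x * x = 0
  · rw [h]; simp
  by_cases h2 : qDiff q = 0
  · rw [h2]; simp
  field_simp

theorem offCoef_sq (d : ℤ) : offCoef q d ^ 2 = 1 - 1 / qNum q d ^ 2 := by
  rw [offCoef, one_div (2 : ℂ), Complex.cpow_ofNat_inv_pow]

theorem offCoef_sub_sq (hq : ∀ k : ℕ, 0 < k → q ^ k ≠ 1) {c c' : ℤ} (h : c ≠ c') :
    offCoef q (c' - c) ^ 2 =
      1 - qDiff q ^ 2 * qSq q c * qSq q c' / (qSq q c' - qSq q c) ^ 2 := by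
  have h0 : (q : ℂ) ^ c ≠ 0 := zpow_ne_zero _ q.ne_zero
  have h1 : (q : ℂ) ^ c' ≠ 0 := zpow_ne_zero _ q.ne_zero
  have h2 := qDiff_ne_zero hq
  have h3 : qSq q c' - qSq q c ≠ 0 := sub_ne_zero.2 fun e => h (qSq_injective hq e).symm
  rw [offCoef_sq, qNum_eq, zpow_sub₀ q.ne_zero]
  rw [qSq, qSq, two_mul, two_mul, zpow_add₀ q.ne_zero, zpow_add₀ q.ne_zero] at h3 ⊢
  set x := (q : ℂ) ^ c
  set y := (q : ℂ) ^ c'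
  have e : y / x - (y / x)⁻¹ = (y * y - x * x) / (x * y) := by field_simp
  rw [e]
  field_simp

theorem qNum_one (hq : ∀ k : ℕ, 0 < k → q ^ k ≠ 1) : qNum q 1 = 1 := by
  rw [qNum_eq, zpow_one, ← qDiff, div_self (qDiff_ne_zero hq)]

theorem offCoef_one (hq : ∀ k : ℕ, 0 < k → q ^ k ≠ 1) : offCoef q 1 = 0 := by
  rw [offCoef, qNum_one hq]; simp

theorem offCoef_neg_one (hq : ∀ k : ℕ, 0 < k → q ^ k ≠ 1) : offCoef q (-1) = 0 := by
  rw [offCoef_neg, offCoef_one hq]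

theorem offCoef_ne_zero (hq : ∀ k : ℕ, 0 < k → q ^ k ≠ 1) {d : ℤ} (h1 : d ≠ 1) (h2 : d ≠ -1)
    (h0 : d ≠ 0) : offCoef q d ≠ 0 := by
  intro h
  have hs := offCoef_sub_sq hq (c := 0) (c' := d) h0.symm
  have hd : qSq q d - qSq q 0 ≠ 0 := sub_ne_zero.2 fun e => h0 (qSq_injective hq e)
  have hz : qSq q 0 = 1 := by simp [qSq]
  rw [sub_zero, h, hz] at hs
  rw [hz] at hd
  have hq0 : (q : ℂ) ≠ 0 := q.ne_zero
  have key : (qSq q d - (q : ℂ) ^ 2) * (qSq q d - ((q : ℂ) ^ 2)⁻¹) = 0 := by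
    rw [qDiff] at hs
    field_simp at hs ⊢
    linear_combination (-1 : ℂ) * hs
  rcases mul_eq_zero.1 key with e | e
  · have : qSq q d = qSq q 1 := by rw [sub_eq_zero.1 e, qSq]; norm_cast
    exact h1 (qSq_injective hq this)
  · have : qSq q d = qSq q (-1) := by
      rw [sub_eq_zero.1 e, qSq, show (2 * -1 : ℤ) = -2 by norm_num, zpow_neg]; norm_cast
    exact h2 (qSq_injective hq this)

theorem diagCoef_one (hq : ∀ k : ℕ, 0 < k → q ^ k ≠ 1) : diagCoef q 1 = q := by
  rw [diagCoef, qNum_one hq, zpow_one, div_one]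

theorem diagCoef_neg_one (hq : ∀ k : ℕ, 0 < k → q ^ k ≠ 1) : diagCoef q (-1) = -(q : ℂ)⁻¹ := by
  rw [diagCoef, qNum_neg, qNum_one hq, zpow_neg_one, div_neg, div_one]

end Coef

end

section

/-! ### Young's orthogonal matrices for the standard tableaux of all shapes -/

section TabMatrix

variable {q : ℂˣ} {m : ℕ}

/-- The matrix of `T_k` in the Young basis of the direct sum of the modules `V_λ`, `λ ⊢ m`. -/
def tabMatrix (q : ℂˣ) {m : ℕ} (k : HeckeIdx m) : Matrix (Tab m) (Tab m) ℂ :=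
  open Classical in
  Matrix.of fun Γ Λ =>
    (if Γ = Λ then diagCoef q (contentDiff Λ.1 k) else 0) +
    (if Γ.1 = Λ.1 ∘ adjSwap k then offCoef q (contentDiff Λ.1 k) else 0)

/-- The basis vector of a standard sequence of boxes, and zero if the sequence is not standard. -/
def tabVec (f : Fin m → ℕ × ℕ) : Tab m → ℂ := open Classical in fun Γ => if Γ.1 = f then 1 else 0

theorem tabVec_val (Λ : Tab m) : tabVec Λ.1 = Pi.single Λ 1 := by
  funext Γ
  simp only [tabVec, Pi.single_apply, Subtype.ext_iff]

theorem tabMatrix_mulVec {f : Fin m → ℕ × ℕ} (hf : IsStd f) (k : HeckeIdx m) :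
    (tabMatrix q k).mulVec (tabVec f) = diagCoef q (contentDiff f k) • tabVec f +
      offCoef q (contentDiff f k) • tabVec (f ∘ adjSwap k) := by
  have h := tabVec_val (⟨f, hf⟩ : Tab m)
  simp only at h
  funext Γ
  rw [h, Matrix.mulVec_single_one, ← h]
  simp only [Matrix.col_apply, tabMatrix, Matrix.of_apply, Pi.add_apply, Pi.smul_apply, tabVec,
    smul_eq_mul, mul_ite, mul_one, mul_zero, Subtype.ext_iff]

theorem tabMatrix_mulVec_smul {f : Fin m → ℕ × ℕ} (k : HeckeIdx m) {x : ℂ} (h : x = 0 ∨ IsStd f) :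
    (tabMatrix q k).mulVec (x • tabVec f) = (x * diagCoef q (contentDiff f k)) • tabVec f +
      (x * offCoef q (contentDiff f k)) • tabVec (f ∘ adjSwap k) := by
  rcases h with rfl | h
  · simp
  · rw [Matrix.mulVec_smul, tabMatrix_mulVec h, smul_add, smul_smul, smul_smul]

theorem mul_offCoef_eq_zero_or (hq : ∀ k : ℕ, 0 < k → q ^ k ≠ 1) {f : Fin m → ℕ × ℕ}
    (k : HeckeIdx m) {x : ℂ} (h : x = 0 ∨ IsStd f) :
    x * offCoef q (contentDiff f k) = 0 ∨ IsStd (f ∘ adjSwap k) := by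
  rcases h with rfl | h
  · simp
  · by_cases h1 : contentDiff f k = 1
    · left; rw [h1, offCoef_one hq, mul_zero]
    · by_cases h2 : contentDiff f k = -1
      · left; rw [h2, offCoef_neg_one hq, mul_zero]
      · exact Or.inr (h.comp_adjSwap k h1 h2)

theorem tabMatrix_ext {M N : Matrix (Tab m) (Tab m) ℂ}
    (h : ∀ f, IsStd f → M.mulVec (tabVec f) = N.mulVec (tabVec f)) : M = N := by
  apply Matrix.ext_of_mulVec_single
  intro Λ
  rw [← tabVec_val]
  exact h Λ.1 Λ.2

theorem tabMatrix_sq (hq : ∀ k : ℕ, 0 < k → q ^ k ≠ 1) (k : HeckeIdx m) :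
    tabMatrix q k * tabMatrix q k = 1 + qDiff q • tabMatrix q k := by
  apply tabMatrix_ext
  intro f hf
  have h1 := mul_offCoef_eq_zero_or hq k (Or.inr hf : (1 : ℂ) = 0 ∨ IsStd f)
  rw [one_mul] at h1
  have hc := hf.content_lo_ne_hi k
  simp only [← Matrix.mulVec_mulVec, Matrix.add_mulVec, Matrix.smul_mulVec, Matrix.one_mulVec,
    tabMatrix_mulVec hf, Matrix.mulVec_add]
  rw [tabMatrix_mulVec_smul k h1, tabMatrix_mulVec_smul k (Or.inr hf), comp_adjSwap_comp,
    contentDiff_comp]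
  have ha := offCoef_sub_sq hq hc
  have hd : qSq q (content (f k.hi)) - qSq q (content (f k.lo)) ≠ 0 :=
    sub_ne_zero.2 fun e => hc (qSq_injective hq e).symm
  have hd' : qSq q (content (f k.lo)) - qSq q (content (f k.hi)) ≠ 0 :=
    sub_ne_zero.2 fun e => hc (qSq_injective hq e)
  rw [offCoef_neg, contentDiff, neg_sub, diagCoef_sub, diagCoef_sub]
  set a := offCoef q (content (f k.hi) - content (f k.lo))
  set u := qSq q (content (f k.hi))
  set v := qSq q (content (f k.lo))
  have e : u - v = -(v - u) := by ring
  rw [smul_add, smul_smul, smul_smul]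
  match_scalars
  · field_simp
    field_simp at ha
    linear_combination ha
  · rw [e]
    field_simp
    ring

theorem tabMatrix_isBraid (hq : ∀ k : ℕ, 0 < k → q ^ k ≠ 1) :
    IsBraid (tabMatrix q : HeckeIdx m → _) where
  comm k l h := by
    apply tabMatrix_ext
    intro f hf
    have h0 : (1 : ℂ) = 0 ∨ IsStd f := Or.inr hf
    have e1 : adjSwap k l.lo = l.lo := adjSwap_of_ne k
      (by simp [HeckeIdx.lo, Fin.ext_iff]; omega)
      (by simp [HeckeIdx.lo, HeckeIdx.hi, Fin.ext_iff]; omega)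
    have e2 : adjSwap k l.hi = l.hi := adjSwap_of_ne k
      (by simp [HeckeIdx.lo, HeckeIdx.hi, Fin.ext_iff]; omega)
      (by simp [HeckeIdx.hi, Fin.ext_iff]; omega)
    have e3 : adjSwap l k.lo = k.lo := adjSwap_of_ne l
      (by simp [HeckeIdx.lo, Fin.ext_iff]; omega)
      (by simp [HeckeIdx.lo, HeckeIdx.hi, Fin.ext_iff]; omega)
    have e4 : adjSwap l k.hi = k.hi := adjSwap_of_ne l
      (by simp [HeckeIdx.lo, HeckeIdx.hi, Fin.ext_iff]; omega)
      (by simp [HeckeIdx.hi, Fin.ext_iff]; omega)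
    have d1 : contentDiff (f ∘ adjSwap k) l = contentDiff f l := by simp [contentDiff, e1, e2]
    have d2 : contentDiff (f ∘ adjSwap l) k = contentDiff f k := by simp [contentDiff, e3, e4]
    have hc : (f ∘ adjSwap k) ∘ adjSwap l = (f ∘ adjSwap l) ∘ adjSwap k := by
      funext i
      exact congrArg f (DFunLike.congr_fun (adjSwap_isBraid.comm k l h) i)
    have hk := mul_offCoef_eq_zero_or hq k h0
    have hl := mul_offCoef_eq_zero_or hq l h0
    rw [← one_smul ℂ (tabVec f)]
    simp only [← Matrix.mulVec_mulVec]
    rw [tabMatrix_mulVec_smul k h0, tabMatrix_mulVec_smul l h0, Matrix.mulVec_add,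
      Matrix.mulVec_add, tabMatrix_mulVec_smul k (Or.inr hf), tabMatrix_mulVec_smul l (Or.inr hf),
      tabMatrix_mulVec_smul k hl, tabMatrix_mulVec_smul l hk, d1, d2, hc]
    module
  braid k l h := by
    apply tabMatrix_ext
    intro f hf
    have e0 : k.hi = l.lo := by simp [HeckeIdx.lo, HeckeIdx.hi, h]
    have n1 : k.lo ≠ l.lo := by simp [HeckeIdx.lo, Fin.ext_iff]; omega
    have n2 : k.lo ≠ l.hi := by simp [HeckeIdx.lo, HeckeIdx.hi, Fin.ext_iff]; omega
    have e1 : adjSwap k l.hi = l.hi := adjSwap_of_ne k n2.symm (e0 ▸ l.lo_ne_hi.symm)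
    have e2 : adjSwap l k.lo = k.lo := adjSwap_of_ne l n1 n2
    have e3 : adjSwap k k.lo = l.lo := e0 ▸ adjSwap_lo k
    have e4 : adjSwap k l.lo = k.lo := e0 ▸ adjSwap_hi k
    have hs : (((f ∘ adjSwap l) ∘ adjSwap k) ∘ adjSwap l) =
        (((f ∘ adjSwap k) ∘ adjSwap l) ∘ adjSwap k) := by
      funext i
      exact congrArg f (DFunLike.congr_fun (adjSwap_isBraid.braid k l h) i).symm
    have S : ∀ (g : Fin m → ℕ × ℕ) (k : HeckeIdx m) (x : ℂ), x = 0 ∨ IsStd g →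
      x * offCoef q (contentDiff g k) = 0 ∨ IsStd (g ∘ adjSwap k) :=
      fun g k x hx => mul_offCoef_eq_zero_or hq k hx
    have Z : ∀ (g : Fin m → ℕ × ℕ) (x y : ℂ), x = 0 ∨ IsStd g → x * y = 0 ∨ IsStd g :=
      fun g x y hx => hx.imp_left fun hx => by rw [hx, zero_mul]
    have h0 : (1 : ℂ) = 0 ∨ IsStd f := Or.inr hf
    rw [← one_smul ℂ (tabVec f)]
    simp only [← Matrix.mulVec_mulVec]
    have hk := S f k _ h0
    have hl := S f l _ h0
    have hk' := S f k _ (Z f _ (diagCoef q (contentDiff f l)) h0)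
    have hl' := S f l _ (Z f _ (diagCoef q (contentDiff f k)) h0)
    have hkl := S _ l _ hk
    have hlk := S _ k _ hl
    rw [tabMatrix_mulVec_smul k h0, tabMatrix_mulVec_smul l h0]
    simp only [Matrix.mulVec_add]
    rw [tabMatrix_mulVec_smul k (Z _ _ _ h0), tabMatrix_mulVec_smul l (Z _ _ _ h0),
      tabMatrix_mulVec_smul k hl, tabMatrix_mulVec_smul l hk]
    simp only [Matrix.mulVec_add]
    rw [tabMatrix_mulVec_smul k (Z _ _ _ (Z _ _ _ h0)), tabMatrix_mulVec_smul k hl',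
      tabMatrix_mulVec_smul k (Z _ _ _ hk), tabMatrix_mulVec_smul k hkl,
      tabMatrix_mulVec_smul l (Z _ _ _ (Z _ _ _ h0)), tabMatrix_mulVec_smul l hk',
      tabMatrix_mulVec_smul l (Z _ _ _ hl), tabMatrix_mulVec_smul l hlk]
    simp only [hs, comp_adjSwap_comp]
    simp only [contentDiff, Function.comp_apply, e0, e1, e2, e3, e4, adjSwap_lo, adjSwap_hi]
    have c12 : content (f k.lo) ≠ content (f l.lo) := by
      have := hf.content_lo_ne_hi k; rwa [e0] at this
    have c23 : content (f l.lo) ≠ content (f l.hi) := hf.content_lo_ne_hi l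
    have c13 : content (f k.lo) ≠ content (f l.hi) := hf.content_ne
      (by rw [Fin.lt_def, HeckeIdx.lo, HeckeIdx.hi]; simp only; omega)
      (by simp only [HeckeIdx.lo, HeckeIdx.hi]; omega)
    set x := content (f k.lo)
    set y := content (f l.lo)
    set z := content (f l.hi)
    rw [offCoef_sub_comm x y, offCoef_sub_comm y z]
    have a12 := offCoef_sub_sq hq c12
    have a23 := offCoef_sub_sq hq c23
    have d12 : qSq q y - qSq q x ≠ 0 := sub_ne_zero.2 fun e => c12 (qSq_injective hq e).symm
    have d13 : qSq q z - qSq q x ≠ 0 := sub_ne_zero.2 fun e => c13 (qSq_injective hq e).symm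
    have d23 : qSq q z - qSq q y ≠ 0 := sub_ne_zero.2 fun e => c23 (qSq_injective hq e).symm
    have r12 : qSq q x - qSq q y = -(qSq q y - qSq q x) := by ring
    have r23 : qSq q y - qSq q z = -(qSq q z - qSq q y) := by ring
    simp only [diagCoef_sub, r12, r23, one_mul]
    set u := qSq q x
    set v := qSq q y
    set w := qSq q z
    set A := offCoef q (y - x)
    set B := offCoef q (z - y)
    set C := offCoef q (z - x)
    match_scalars
    · linear_combination (norm := (field_simp; ring))
        (qDiff q * w / (w - u)) * a12 - (qDiff q * w / (w - u)) * a23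
    all_goals field_simp
    all_goals ring

end TabMatrix

end

section

/-! ### Matrix units of the Hecke algebra -/

/-- The relations of the Hecke algebra for a family of elements of an algebra. -/
structure IsHecke {m : ℕ} (q : ℂˣ) {A : Type*} [Ring A] [Algebra ℂ A] (g : HeckeIdx m → A) :
    Prop extends IsBraid g where
  sq : ∀ k, g k * g k = 1 + qDiff q • g k

section Casimir

variable {q : ℂˣ} {m : ℕ} {A B : Type*} [Ring A] [Algebra ℂ A] [Ring B] [Algebra ℂ B]
  {g : HeckeIdx m → A} {ρ : HeckeIdx m → B}

theorem tabMatrix_isHecke (hq : ∀ k : ℕ, 0 < k → q ^ k ≠ 1) :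
    IsHecke q (tabMatrix q : HeckeIdx m → _) where
  toIsBraid := tabMatrix_isBraid hq
  sq := tabMatrix_sq hq

theorem sq_eq_of_quadratic {x : A}
    (h : (x - algebraMap ℂ A (q : ℂ)) * (x + algebraMap ℂ A (q : ℂ)⁻¹) = 0) :
    x * x = 1 + qDiff q • x := by
  rw [sub_mul, mul_add, mul_add, ← Algebra.commutes, ← map_mul, mul_inv_cancel₀ q.ne_zero,
    map_one] at h
  rw [qDiff, sub_smul, Algebra.smul_def, Algebra.smul_def]
  rw [← sub_eq_zero, ← h]
  abel

theorem Hecke.T_isHecke (m : ℕ) (q : ℂˣ) : IsHecke q (Hecke.T m q) where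
  braid k l h := by
    have := RingQuot.mkAlgHom_rel ℂ (HeckeRel.braid (q := q) k l h)
    simp only [map_mul] at this
    exact this
  comm k l h := by
    have := RingQuot.mkAlgHom_rel ℂ (HeckeRel.comm (q := q) k l h)
    simp only [map_mul] at this
    exact this
  sq k := by
    have := RingQuot.mkAlgHom_rel ℂ (HeckeRel.quadratic (q := q) k)
    simp only [map_mul, map_sub, map_add, AlgHom.commutes, map_zero] at this
    exact sq_eq_of_quadratic this

theorem IsHecke.map (hg : IsHecke q g) (φ : A →ₐ[ℂ] B) : IsHecke q fun k => φ (g k) where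
  braid k l h := by simp only [← map_mul, hg.braid k l h]
  comm k l h := by simp only [← map_mul, hg.comm k l h]
  sq k := by rw [← map_mul, hg.sq, map_add, map_one, map_smul]

theorem permLength_mul_adjSwap_inv (σ : Equiv.Perm (Fin m)) (k : HeckeIdx m) :
    permLength (σ⁻¹ * adjSwap k) = permLength (adjSwap k * σ) := by
  rw [← permLength_inv (adjSwap k * σ), mul_inv_rev, adjSwap_inv]

/-- The element `∑ ρ(T_{σ⁻¹}) ⊗ T_σ` intertwines the right multiplication in the first factor and
the left multiplication in the second one. -/
theorem casimir_left (hg : IsHecke q g) (hρ : IsHecke q ρ) (φ : B →ₗ[ℂ] ℂ) (k : HeckeIdx m) :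
    ∑ σ : Equiv.Perm (Fin m), φ (alongReduced ρ σ⁻¹) • (g k * alongReduced g σ) =
      ∑ σ : Equiv.Perm (Fin m), φ (alongReduced ρ σ⁻¹ * ρ k) • alongReduced g σ := by
  have key : ∀ σ : Equiv.Perm (Fin m), permLength (adjSwap k * σ) = permLength σ + 1 →
      φ (alongReduced ρ σ⁻¹) • (g k * alongReduced g σ) +
        φ (alongReduced ρ (adjSwap k * σ)⁻¹) • (g k * alongReduced g (adjSwap k * σ)) =
      φ (alongReduced ρ σ⁻¹ * ρ k) • alongReduced g σ +
        φ (alongReduced ρ (adjSwap k * σ)⁻¹ * ρ k) • alongReduced g (adjSwap k * σ) := by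
    intro σ h
    have h' : permLength (σ⁻¹ * adjSwap k) = permLength σ⁻¹ + 1 := by
      rw [permLength_mul_adjSwap_inv, h, permLength_inv]
    rw [hg.alongReduced_adjSwap_mul h, mul_inv_rev, adjSwap_inv, hρ.alongReduced_mul_adjSwap h',
      ← mul_assoc (g k), hg.sq, mul_assoc _ (ρ k), hρ.sq, add_mul, mul_add, one_mul, mul_one,
      mul_smul_comm, smul_mul_assoc, map_add, map_smul, smul_eq_mul]
    module
  have key' : ∀ σ : Equiv.Perm (Fin m),
      φ (alongReduced ρ σ⁻¹) • (g k * alongReduced g σ) +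
        φ (alongReduced ρ (adjSwap k * σ)⁻¹) • (g k * alongReduced g (adjSwap k * σ)) =
      φ (alongReduced ρ σ⁻¹ * ρ k) • alongReduced g σ +
        φ (alongReduced ρ (adjSwap k * σ)⁻¹ * ρ k) • alongReduced g (adjSwap k * σ) := by
    intro σ
    rcases asc_or_desc σ k with h | h
    · exact key σ (permLength_mul_of_asc h)
    · have := key (adjSwap k * σ) (by
        rw [← mul_assoc, adjSwap_mul_self, one_mul]
        exact (permLength_mul_of_desc h).symm)
      rw [← mul_assoc, adjSwap_mul_self, one_mul] at this
      rw [add_comm, this, add_comm]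
  have hsum := Finset.sum_congr (rfl : (Finset.univ : Finset (Equiv.Perm (Fin m))) = _)
    fun σ _ => key' σ
  rw [Finset.sum_add_distrib, Finset.sum_add_distrib] at hsum
  have re : ∀ F : Equiv.Perm (Fin m) → A, ∑ σ, F (adjSwap k * σ) = ∑ σ, F σ := fun F =>
    Equiv.sum_comp (Equiv.mulLeft (adjSwap k)) F
  rw [re fun σ => φ (alongReduced ρ σ⁻¹) • (g k * alongReduced g σ),
    re fun σ => φ (alongReduced ρ σ⁻¹ * ρ k) • alongReduced g σ, ← two_smul ℂ, ← two_smul ℂ] at hsum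
  exact smul_right_injective A (two_ne_zero (α := ℂ)) hsum

/-- The mirror image of `casimir_left`. -/
theorem casimir_right (hg : IsHecke q g) (hρ : IsHecke q ρ) (φ : B →ₗ[ℂ] ℂ) (k : HeckeIdx m) :
    ∑ σ : Equiv.Perm (Fin m), φ (alongReduced ρ σ⁻¹) • (alongReduced g σ * g k) =
      ∑ σ : Equiv.Perm (Fin m), φ (ρ k * alongReduced ρ σ⁻¹) • alongReduced g σ := by
  have key : ∀ σ : Equiv.Perm (Fin m), permLength (σ * adjSwap k) = permLength σ + 1 →
      φ (alongReduced ρ σ⁻¹) • (alongReduced g σ * g k) +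
        φ (alongReduced ρ (σ * adjSwap k)⁻¹) • (alongReduced g (σ * adjSwap k) * g k) =
      φ (ρ k * alongReduced ρ σ⁻¹) • alongReduced g σ +
        φ (ρ k * alongReduced ρ (σ * adjSwap k)⁻¹) • alongReduced g (σ * adjSwap k) := by
    intro σ h
    have h' : permLength (adjSwap k * σ⁻¹) = permLength σ⁻¹ + 1 := by
      rw [← permLength_mul_adjSwap_inv, inv_inv, h, permLength_inv]
    rw [hg.alongReduced_mul_adjSwap h, mul_inv_rev, adjSwap_inv, hρ.alongReduced_adjSwap_mul h',
      mul_assoc _ (g k), hg.sq, ← mul_assoc (ρ k), hρ.sq, add_mul, mul_add, one_mul, mul_one,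
      mul_smul_comm, smul_mul_assoc, map_add, map_smul, smul_eq_mul]
    module
  have key' : ∀ σ : Equiv.Perm (Fin m),
      φ (alongReduced ρ σ⁻¹) • (alongReduced g σ * g k) +
        φ (alongReduced ρ (σ * adjSwap k)⁻¹) • (alongReduced g (σ * adjSwap k) * g k) =
      φ (ρ k * alongReduced ρ σ⁻¹) • alongReduced g σ +
        φ (ρ k * alongReduced ρ (σ * adjSwap k)⁻¹) • alongReduced g (σ * adjSwap k) := by
    intro σ
    have e : permLength (σ * adjSwap k) = permLength (adjSwap k * σ⁻¹) := by
      rw [← permLength_mul_adjSwap_inv, inv_inv]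
    rcases asc_or_desc σ⁻¹ k with h | h
    · exact key σ (by rw [e, permLength_mul_of_asc h, permLength_inv])
    · have := key (σ * adjSwap k) (by
        rw [mul_assoc, adjSwap_mul_self, mul_one, e, permLength_mul_of_desc h, permLength_inv])
      rw [mul_assoc, adjSwap_mul_self, mul_one] at this
      rw [add_comm, this, add_comm]
  have hsum := Finset.sum_congr (rfl : (Finset.univ : Finset (Equiv.Perm (Fin m))) = _)
    fun σ _ => key' σ
  rw [Finset.sum_add_distrib, Finset.sum_add_distrib] at hsum
  have re : ∀ F : Equiv.Perm (Fin m) → A, ∑ σ, F (σ * adjSwap k) = ∑ σ, F σ := fun F =>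
    Equiv.sum_comp (Equiv.mulRight (adjSwap k)) F
  rw [re fun σ => φ (alongReduced ρ σ⁻¹) • (alongReduced g σ * g k),
    re fun σ => φ (ρ k * alongReduced ρ σ⁻¹) • alongReduced g σ, ← two_smul ℂ, ← two_smul ℂ] at hsum
  exact smul_right_injective A (two_ne_zero (α := ℂ)) hsum

end Casimir

/-! ### Jucys–Murphy elements -/

section JucysMurphy

variable {q : ℂˣ} {m : ℕ} {A B : Type*} [Ring A] [Algebra ℂ A] [Ring B] [Algebra ℂ B]

/-- The Jucys–Murphy elements `y_1 = 1`, `y_{j+1} = T_j y_j T_j` (numbered from zero). -/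
def jucysMurphy (g : HeckeIdx m → A) : ℕ → A
  | 0 => 1
  | j + 1 => if h : j + 1 < m then g ⟨j, h⟩ * jucysMurphy g j * g ⟨j, h⟩ else 0

theorem jucysMurphy_hi {R : Type*} [Ring R] (g : HeckeIdx m → R) (k : HeckeIdx m) :
    jucysMurphy g k.hi = g k * jucysMurphy g k.lo * g k := by
  change jucysMurphy g (k.1 + 1) = _
  rw [jucysMurphy, dif_pos k.2]
  rfl

theorem jucysMurphy_tabMatrix (hq : ∀ k : ℕ, 0 < k → q ^ k ≠ 1) : ∀ (j : ℕ) (hj : j < m)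
    (f : Fin m → ℕ × ℕ), IsStd f → (jucysMurphy (tabMatrix q) j).mulVec (tabVec f) =
      qSq q (content (f ⟨j, hj⟩)) • tabVec f := by
  intro j
  induction j with
  | zero =>
    intro hj f hf
    rw [hf.first ⟨0, hj⟩ rfl]
    simp [jucysMurphy, content, qSq]
  | succ j ih =>
    intro hj f hf
    let k : HeckeIdx m := ⟨j, hj⟩
    have h1 := mul_offCoef_eq_zero_or hq k (Or.inr hf : (1 : ℂ) = 0 ∨ IsStd f)
    rw [one_mul] at h1
    rw [jucysMurphy, dif_pos hj, ← Matrix.mulVec_mulVec, ← Matrix.mulVec_mulVec,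
      tabMatrix_mulVec hf, Matrix.mulVec_add, Matrix.mulVec_smul, ih (by omega) f hf]
    have h2 : (jucysMurphy (tabMatrix q) j).mulVec
        (offCoef q (contentDiff f k) • tabVec (f ∘ adjSwap k)) =
        (offCoef q (contentDiff f k) * qSq q (content (f k.hi))) • tabVec (f ∘ adjSwap k) := by
      rcases h1 with h1 | h1
      · simp [h1]
      · rw [Matrix.mulVec_smul, ih (by omega) _ h1, smul_smul]
        congr 4
        change f (adjSwap k k.lo) = _
        rw [adjSwap_lo]
    rw [h2, Matrix.mulVec_add, smul_smul, tabMatrix_mulVec_smul _ (Or.inr hf),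
      tabMatrix_mulVec_smul _ (h1.imp_left fun h => by rw [h, zero_mul]), comp_adjSwap_comp,
      contentDiff_comp]
    have hc := hf.content_lo_ne_hi k
    have ha := offCoef_sub_sq hq hc
    have hd : qSq q (content (f k.hi)) - qSq q (content (f k.lo)) ≠ 0 :=
      sub_ne_zero.2 fun e => hc (qSq_injective hq e).symm
    have hd' : qSq q (content (f k.lo)) - qSq q (content (f k.hi)) ≠ 0 :=
      sub_ne_zero.2 fun e => hc (qSq_injective hq e)
    change _ = qSq q (content (f k.hi)) • _
    change (diagCoef q (contentDiff f k) * qSq q (content (f k.lo)) *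
        diagCoef q (contentDiff f k)) • _ +
      (diagCoef q (contentDiff f k) * qSq q (content (f k.lo)) *
        offCoef q (contentDiff f k)) • _ + _ = _
    rw [offCoef_neg, contentDiff, neg_sub, diagCoef_sub, diagCoef_sub]
    set a := offCoef q (content (f k.hi) - content (f k.lo))
    set u := qSq q (content (f k.hi))
    set v := qSq q (content (f k.lo))
    have e : u - v = -(v - u) := by ring
    match_scalars
    · linear_combination (norm := (field_simp; ring)) u * ha
    · rw [e]
      field_simp
      ring

end JucysMurphy

/-! ### The elements `∑ ⟨T_{σ⁻¹} v_Γ, v_Λ⟩ T_σ` -/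

section Units

variable {q : ℂˣ} {m : ℕ} {A : Type*} [Ring A] [Algebra ℂ A] {g : HeckeIdx m → A}

theorem tabMatrix_transpose (k : HeckeIdx m) : (tabMatrix q k).transpose = tabMatrix q k := by
  ext Γ Λ
  simp only [Matrix.transpose_apply, tabMatrix, Matrix.of_apply]
  congr 1
  · by_cases h : Λ = Γ
    · subst h; rfl
    · rw [if_neg h, if_neg (Ne.symm h)]
  · by_cases h : Λ.1 = Γ.1 ∘ adjSwap k
    · have h' : Γ.1 = Λ.1 ∘ adjSwap k := by rw [h, comp_adjSwap_comp]
      rw [if_pos h, if_pos h', h, contentDiff_comp, offCoef_neg]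
    · have h' : ¬ Γ.1 = Λ.1 ∘ adjSwap k := fun h' => h (by rw [h', comp_adjSwap_comp])
      rw [if_neg h, if_neg h']

/-- The linear combination of the elements `∑ ⟨T_{σ⁻¹} v_Γ, v_Λ⟩ T_σ` with the coefficients
`x Λ * y Γ`. -/
def tabUnit (q : ℂˣ) (g : HeckeIdx m → A) (x y : Tab m → ℂ) : A :=
  ∑ σ : Equiv.Perm (Fin m), (x ⬝ᵥ (alongReduced (tabMatrix q) σ⁻¹).mulVec y) • alongReduced g σ

theorem tabUnit_smul_left (c : ℂ) (x y : Tab m → ℂ) :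
    tabUnit q g (c • x) y = c • tabUnit q g x y := by
  simp [tabUnit, Finset.smul_sum, smul_smul]

theorem tabUnit_smul_right (c : ℂ) (x y : Tab m → ℂ) :
    tabUnit q g x (c • y) = c • tabUnit q g x y := by
  simp [tabUnit, Finset.smul_sum, smul_smul, Matrix.mulVec_smul]

theorem tabUnit_add_left (x x' y : Tab m → ℂ) :
    tabUnit q g (x + x') y = tabUnit q g x y + tabUnit q g x' y := by
  simp [tabUnit, add_smul, Finset.sum_add_distrib]

theorem tabUnit_add_right (x y y' : Tab m → ℂ) :
    tabUnit q g x (y + y') = tabUnit q g x y + tabUnit q g x y' := by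
  simp [tabUnit, add_smul, Finset.sum_add_distrib, Matrix.mulVec_add]

theorem mul_tabUnit (hq : ∀ k : ℕ, 0 < k → q ^ k ≠ 1) (hg : IsHecke q g) (k : HeckeIdx m)
    (x y : Tab m → ℂ) : g k * tabUnit q g x y = tabUnit q g x ((tabMatrix q k).mulVec y) := by
  let φ : Matrix (Tab m) (Tab m) ℂ →ₗ[ℂ] ℂ :=
    { toFun := fun M => x ⬝ᵥ M.mulVec y
      map_add' := fun M N => by rw [Matrix.add_mulVec, dotProduct_add]
      map_smul' := fun c M => by rw [Matrix.smul_mulVec, dotProduct_smul, RingHom.id_apply] }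
  have := casimir_left hg (tabMatrix_isHecke hq) φ k
  simp only [tabUnit, Finset.mul_sum, mul_smul_comm, Matrix.mulVec_mulVec]
  exact this

theorem tabUnit_mul (hq : ∀ k : ℕ, 0 < k → q ^ k ≠ 1) (hg : IsHecke q g) (k : HeckeIdx m)
    (x y : Tab m → ℂ) : tabUnit q g x y * g k = tabUnit q g ((tabMatrix q k).mulVec x) y := by
  let φ : Matrix (Tab m) (Tab m) ℂ →ₗ[ℂ] ℂ :=
    { toFun := fun M => x ⬝ᵥ M.mulVec y
      map_add' := fun M N => by rw [Matrix.add_mulVec, dotProduct_add]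
      map_smul' := fun c M => by rw [Matrix.smul_mulVec, dotProduct_smul, RingHom.id_apply] }
  have := casimir_right hg (tabMatrix_isHecke hq) φ k
  simp only [tabUnit, Finset.sum_mul, smul_mul_assoc]
  refine this.trans (Finset.sum_congr rfl fun σ _ => ?_)
  congr 1
  change x ⬝ᵥ (_ * _ : Matrix _ _ ℂ).mulVec y = _
  rw [← Matrix.mulVec_mulVec, Matrix.dotProduct_mulVec, ← Matrix.mulVec_transpose,
    tabMatrix_transpose]

theorem jucysMurphy_mul_tabUnit (hq : ∀ k : ℕ, 0 < k → q ^ k ≠ 1) (hg : IsHecke q g)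
    (x : Tab m → ℂ) (j : ℕ) : ∀ y : Tab m → ℂ, jucysMurphy g j * tabUnit q g x y =
      tabUnit q g x ((jucysMurphy (tabMatrix q) j).mulVec y) := by
  induction j with
  | zero => intro y; simp [jucysMurphy]
  | succ j ih =>
    intro y
    rw [jucysMurphy, jucysMurphy]
    split_ifs with h
    · rw [mul_assoc, mul_tabUnit hq hg, mul_assoc, ih, mul_tabUnit hq hg, Matrix.mulVec_mulVec,
        Matrix.mulVec_mulVec, mul_assoc]
    · rw [zero_mul, Matrix.zero_mulVec]
      simpa using (tabUnit_smul_right (q := q) (g := g) 0 x y).symm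

theorem tabUnit_mul_jucysMurphy (hq : ∀ k : ℕ, 0 < k → q ^ k ≠ 1) (hg : IsHecke q g)
    (y : Tab m → ℂ) (j : ℕ) : ∀ x : Tab m → ℂ, tabUnit q g x y * jucysMurphy g j =
      tabUnit q g ((jucysMurphy (tabMatrix q) j).mulVec x) y := by
  induction j with
  | zero => intro x; simp [jucysMurphy]
  | succ j ih =>
    intro x
    rw [jucysMurphy, jucysMurphy]
    split_ifs with h
    · rw [← mul_assoc, ← mul_assoc, tabUnit_mul hq hg, ih, tabUnit_mul hq hg, Matrix.mulVec_mulVec,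
        Matrix.mulVec_mulVec, mul_assoc]
    · rw [mul_zero, Matrix.zero_mulVec]
      simpa using (tabUnit_smul_left (q := q) (g := g) 0 x y).symm

end Units

end

section

/-! ### Addable and removable boxes -/

section Addable

variable {m : ℕ}

/-- The restriction of a standard sequence to the boxes but the last one. -/
theorem IsStd.init {f : Fin (m + 1) → ℕ × ℕ} (hf : IsStd f) : IsStd (f ∘ Fin.castSucc) where
  inj := hf.inj.comp (Fin.castSucc_injective m)
  lower k b hb := by
    obtain ⟨l, hl, e⟩ := hf.lower _ b hb
    have hl' : (l : ℕ) ≤ k := hl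
    exact ⟨⟨l, by omega⟩, hl', e⟩

theorem isStd_snoc {f : Fin m → ℕ × ℕ} (hf : IsStd f) {β : ℕ × ℕ} (h1 : β ∉ Set.range f)
    (h2 : ∀ b ≤ β, b ≠ β → b ∈ Set.range f) : IsStd (Fin.snoc f β : Fin (m + 1) → ℕ × ℕ) where
  inj := by
    rw [Fin.snoc_injective_iff]
    exact ⟨hf.inj, h1⟩
  lower k b hb := by
    induction k using Fin.lastCases with
    | last =>
      rw [Fin.snoc_last] at hb
      by_cases h : b = β
      · exact ⟨Fin.last m, le_rfl, by rw [Fin.snoc_last, h]⟩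
      · obtain ⟨l, rfl⟩ := h2 b hb h
        exact ⟨l.castSucc, l.castSucc.le_last, by rw [Fin.snoc_castSucc]⟩
    | cast k =>
      rw [Fin.snoc_castSucc] at hb
      obtain ⟨l, hl, rfl⟩ := hf.lower _ _ hb
      exact ⟨l.castSucc, by simpa using hl, by rw [Fin.snoc_castSucc]⟩

theorem snoc_init (f : Fin (m + 1) → ℕ × ℕ) :
    (Fin.snoc (f ∘ Fin.castSucc) (f (Fin.last m)) : Fin (m + 1) → ℕ × ℕ) = f :=
  Fin.snoc_init_self f

theorem snoc_comp_castSucc (f : Fin m → ℕ × ℕ) (β : ℕ × ℕ) :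
    (Fin.snoc f β : Fin (m + 1) → ℕ × ℕ) ∘ Fin.castSucc = f := by
  funext i
  simp

theorem IsStd.snoc_of_range_eq {f g : Fin m → ℕ × ℕ} (hg : IsStd g)
    (h : Set.range f = Set.range g) {β : ℕ × ℕ}
    (hf : IsStd (Fin.snoc f β : Fin (m + 1) → ℕ × ℕ)) :
    IsStd (Fin.snoc g β : Fin (m + 1) → ℕ × ℕ) := by
  refine isStd_snoc hg ?_ ?_
  · rw [← h]
    exact (Fin.snoc_injective_iff.1 hf.inj).2
  · intro b hb hne
    obtain ⟨l, hl, e⟩ := hf.lt_of_le (b := b) (j := Fin.last m) (by rwa [Fin.snoc_last])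
      (by rwa [Fin.snoc_last])
    rw [← h]
    have hl' : (l : ℕ) < m := hl
    refine ⟨⟨l, hl'⟩, ?_⟩
    rw [← e]
    exact (Fin.snoc_castSucc (α := fun _ => ℕ × ℕ) β f ⟨l, hl'⟩).symm

/-- The restriction of a tableau of size `m + 1`. -/
def Tab.init (Λ : Tab (m + 1)) : Tab m := ⟨_, Λ.2.init⟩

/-- The box occupied by the last number. -/
def Tab.last (Λ : Tab (m + 1)) : ℕ × ℕ := Λ.1 (Fin.last m)

theorem Tab.ext_init_last {Λ Γ : Tab (m + 1)} (h1 : Λ.init = Γ.init) (h2 : Λ.last = Γ.last) :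
    Λ = Γ := by
  apply Subtype.ext
  rw [← snoc_init Λ.1, ← snoc_init Γ.1]
  exact congrArg₂ (fun f β => (Fin.snoc f β : Fin (m + 1) → ℕ × ℕ)) (congrArg Subtype.val h1) h2

theorem Tab.val_eq_snoc (Λ : Tab (m + 1)) :
    Λ.1 = (Fin.snoc Λ.init.1 Λ.last : Fin (m + 1) → ℕ × ℕ) := (snoc_init Λ.1).symm

/-- The column of the first free box in a row. -/
def rowEnd (S : Set (ℕ × ℕ)) (i : ℕ) : ℕ := sInf {c | (i, c) ∉ S}

theorem rowEnd_notMem {S : Set (ℕ × ℕ)} (hS : S.Finite) (i : ℕ) : (i, rowEnd S i) ∉ S := by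
  refine Nat.sInf_mem (s := {c | (i, c) ∉ S}) ?_
  by_contra h
  rw [Set.not_nonempty_iff_eq_empty, Set.eq_empty_iff_forall_notMem] at h
  have h' : ∀ c, (i, c) ∈ S := fun c => not_not.1 (h c)
  exact Set.infinite_of_injective_forall_mem (Prod.mk_right_injective i) h' hS

theorem mem_of_lt_rowEnd {S : Set (ℕ × ℕ)} {i c : ℕ} (h : c < rowEnd S i) : (i, c) ∈ S :=
  not_not.1 (Nat.notMem_of_lt_sInf h)

theorem lt_rowEnd {f : Fin m → ℕ × ℕ} (hf : IsStd f) {i c : ℕ} (h : (i, c) ∈ Set.range f) :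
    c < rowEnd (Set.range f) i := by
  by_contra hc
  push Not at hc
  obtain ⟨k, hk⟩ := h
  obtain ⟨l, -, e⟩ := hf.lower k (i, rowEnd (Set.range f) i)
    (by rw [hk, Prod.mk_le_mk]; exact ⟨le_rfl, hc⟩)
  exact rowEnd_notMem (Set.finite_range f) i ⟨l, e⟩

theorem isStd_snoc_rowEnd {f : Fin m → ℕ × ℕ} (hf : IsStd f) (i : ℕ)
    (h : ∀ j < i, (j, rowEnd (Set.range f) i) ∈ Set.range f) :
    IsStd (Fin.snoc f (i, rowEnd (Set.range f) i) : Fin (m + 1) → ℕ × ℕ) := by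
  refine isStd_snoc hf (rowEnd_notMem (Set.finite_range f) i) ?_
  rintro ⟨a, b⟩ hle hne
  rw [Prod.mk_le_mk] at hle
  rw [Ne, Prod.mk.injEq] at hne
  rcases hle.1.eq_or_lt with rfl | ha
  · exact mem_of_lt_rowEnd (lt_of_le_of_ne hle.2 fun e => hne ⟨rfl, e⟩)
  · obtain ⟨k, hk⟩ := h a ha
    obtain ⟨l, -, e⟩ := hf.lower k (a, b) (by rw [hk, Prod.mk_le_mk]; exact ⟨le_rfl, hle.2⟩)
    exact ⟨l, e⟩

open Classical in
/-- The tableaux extending a given one. -/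
def Tab.extensions (N : Tab m) : Finset (Tab (m + 1)) := Finset.univ.filter fun Λ => Λ.init = N

theorem Tab.mem_extensions {N : Tab m} {Λ : Tab (m + 1)} : Λ ∈ N.extensions ↔ Λ.init = N := by
  rw [Tab.extensions, Finset.mem_filter_univ]

open Classical in
/-- The contents of the removable boxes of the shape of a tableau. -/
def Tab.removable (N : Tab (m + 1)) : Finset ℤ :=
  (Finset.univ.filter fun K : Tab (m + 1) => Set.range K.1 = Set.range N.1).image
    fun K => content K.last

open Classical in
/-- There are more addable than removable boxes. -/
theorem Tab.card_removable_lt (N : Tab (m + 1)) : N.removable.card < N.extensions.card := by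
  let S := Set.range N.1
  let I : Finset ℕ := N.extensions.image fun Λ => Λ.last.1
  have hI : ∀ i, (∀ j < i, (j, rowEnd S i) ∈ S) → i ∈ I := by
    intro i hi
    refine Finset.mem_image.2 ⟨⟨_, isStd_snoc_rowEnd N.2 i hi⟩, ?_, ?_⟩
    · rw [Tab.mem_extensions]
      exact Subtype.ext (snoc_comp_castSucc _ _)
    · simp [Tab.last]
  have h0 : 0 ∈ I := hI 0 fun j hj => absurd hj (Nat.not_lt_zero j)
  have hR : N.removable ⊆ (I.erase 0).image fun i => content (i - 1, rowEnd S (i - 1) - 1) := by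
    intro c hc
    obtain ⟨K, hK, rfl⟩ := Finset.mem_image.1 hc
    rw [Finset.mem_filter_univ] at hK
    have hmax : ∀ b ∈ S, K.last ≤ b → b = K.last := by
      intro b hb hle
      obtain ⟨l, rfl⟩ : b ∈ Set.range K.1 := by rw [hK]; exact hb
      have := K.2.le_of_le hle
      rw [Fin.last_le_iff.1 this]
      rfl
    rcases hα : K.last with ⟨r, c⟩
    rw [hα] at hmax
    have hmem : (r, c) ∈ S := by
      change _ ∈ Set.range N.1
      rw [← hK, ← hα]
      exact ⟨_, rfl⟩
    have hc : rowEnd S r = c + 1 := by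
      apply le_antisymm
      · by_contra h
        push Not at h
        have := hmax _ (mem_of_lt_rowEnd h) (by rw [Prod.mk_le_mk]; omega)
        rw [Prod.mk.injEq] at this
        omega
      · exact lt_rowEnd N.2 hmem
    have hr : rowEnd S (r + 1) ≤ c := by
      by_contra h
      push Not at h
      have := hmax _ (mem_of_lt_rowEnd h) (by rw [Prod.mk_le_mk]; omega)
      rw [Prod.mk.injEq] at this
      omega
    refine Finset.mem_image.2 ⟨r + 1, Finset.mem_erase.2 ⟨by omega, hI _ fun j hj => ?_⟩, ?_⟩
    · obtain ⟨k, hk⟩ := hmem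
      obtain ⟨l, -, e⟩ := N.2.lower k (j, rowEnd S (r + 1))
        (by rw [hk, Prod.mk_le_mk]; omega)
      exact ⟨l, e⟩
    · simp [hc]
  calc N.removable.card ≤ _ := Finset.card_le_card hR
    _ ≤ (I.erase 0).card := Finset.card_image_le
    _ < I.card := Finset.card_erase_lt_of_mem h0
    _ ≤ _ := Finset.card_image_le

end Addable

/-! ### Weights -/

section Weights

variable {q : ℂˣ} {m : ℕ}

theorem Tab.last_content_injOn (N : Tab m) (hq : ∀ k : ℕ, 0 < k → q ^ k ≠ 1) :
    Set.InjOn (fun Λ : Tab (m + 1) => qSq q (content Λ.last)) N.extensions := by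
  intro Λ hΛ Γ hΓ h
  rw [Finset.mem_coe, Tab.mem_extensions] at hΛ hΓ
  apply Subtype.ext
  refine Λ.2.eq_of_content Γ.2 fun k => ?_
  induction k using Fin.lastCases with
  | last => exact qSq_injective hq h
  | cast k =>
    have : Λ.init.1 k = Γ.init.1 k := by rw [hΛ, hΓ]
    exact congrArg content this

open Polynomial in
/-- A system of linear equations solved by Lagrange interpolation. -/
theorem exists_weights_of_card_lt {ι : Type*} [DecidableEq ι] (s : Finset ι) (v : ι → ℂ)
    (hv : Set.InjOn v s) (hv0 : ∀ i ∈ s, v i ≠ 0) (R : Finset ℂ) (hR0 : ∀ a ∈ R, a ≠ 0)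
    (hR : ∀ a ∈ R, ∀ i ∈ s, a ≠ v i) (hcard : R.card < s.card) :
    ∃ w : ι → ℂ, ∑ i ∈ s, w i = 1 ∧ ∀ a ∈ R, ∑ i ∈ s, w i * (v i / (v i - a)) = 0 := by
  let p : ℂ[X] := ∏ a ∈ R, (X - C a)
  have hdeg : p.degree < s.card := by
    rw [degree_prod]
    simp only [degree_X_sub_C, Finset.sum_const, nsmul_eq_mul, mul_one]
    exact_mod_cast hcard
  have hp := Lagrange.eq_interpolate_of_eval_eq (fun i => p.eval (v i)) hv hdeg fun _ _ => rfl
  let S : ℂ → ℂ := fun x =>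
    ∑ i ∈ s, Lagrange.nodalWeight s v i * (x - v i)⁻¹ * p.eval (v i)
  have hS : ∀ x, (∀ i ∈ s, x ≠ v i) → p.eval x = (Lagrange.nodal s v).eval x * S x := by
    intro x hx
    conv_lhs => rw [hp]
    rw [Lagrange.eval_interpolate_not_at_node _ hx]
  have hS0 : S 0 ≠ 0 := by
    intro h
    have h1 := hS 0 fun i hi => (hv0 i hi).symm
    rw [h, mul_zero, eval_prod, Finset.prod_eq_zero_iff] at h1
    obtain ⟨a, ha, h1⟩ := h1
    simp only [eval_sub, eval_X, eval_C, zero_sub, neg_eq_zero] at h1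
    exact hR0 a ha h1
  have hSa : ∀ a ∈ R, S a = 0 := by
    intro a ha
    have h1 := hS a fun i hi => hR a ha i hi
    have h2 : p.eval a = 0 := by
      rw [eval_prod]
      exact Finset.prod_eq_zero ha (by simp)
    rw [h2] at h1
    refine (mul_eq_zero.1 h1.symm).resolve_left ?_
    exact Lagrange.eval_nodal_not_at_node fun i hi => hR a ha i hi
  refine ⟨fun i => Lagrange.nodalWeight s v i * (0 - v i)⁻¹ * p.eval (v i) / S 0, ?_, ?_⟩
  · rw [← Finset.sum_div]
    exact div_self hS0
  · intro a ha
    have : ∀ i ∈ s, Lagrange.nodalWeight s v i * (0 - v i)⁻¹ * p.eval (v i) / S 0 *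
        (v i / (v i - a)) = (Lagrange.nodalWeight s v i * (a - v i)⁻¹ * p.eval (v i)) * (S 0)⁻¹ := by
      intro i hi
      have h1 := hv0 i hi
      have h2 : v i - a ≠ 0 := sub_ne_zero.2 (hR a ha i hi).symm
      have h3 : a - v i = -(v i - a) := by ring
      rw [h3, zero_sub]
      field_simp
    rw [Finset.sum_congr rfl this, ← Finset.sum_mul]
    change S a * _ = 0
    rw [hSa a ha, zero_mul]

theorem Tab.nonempty_extensions (N : Tab m) : N.extensions.Nonempty := by
  refine ⟨⟨_, isStd_snoc_rowEnd N.2 0 fun j hj => absurd hj (Nat.not_lt_zero j)⟩, ?_⟩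
  rw [Tab.mem_extensions]
  exact Subtype.ext (snoc_comp_castSucc _ _)

open Classical in
/-- The weights of the transitions from a tableau to its extensions. -/
theorem Tab.exists_transition (hq : ∀ k : ℕ, 0 < k → q ^ k ≠ 1) (N : Tab (m + 1)) :
    ∃ w : Tab (m + 2) → ℂ, ∑ Λ ∈ N.extensions, w Λ = 1 ∧
      ∀ K : Tab (m + 1), Set.range K.1 = Set.range N.1 →
        ∑ Λ ∈ N.extensions, w Λ * diagCoef q (content Λ.last - content K.last) = 0 := by
  obtain ⟨w, hw1, hw2⟩ := exists_weights_of_card_lt N.extensions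
    (fun Λ => qSq q (content Λ.last)) (N.last_content_injOn hq) (fun _ _ => qSq_ne_zero _)
    (N.removable.image (qSq q)) (by
      intro a ha
      obtain ⟨c, -, rfl⟩ := Finset.mem_image.1 ha
      exact qSq_ne_zero _) (by
      intro a ha Λ hΛ
      obtain ⟨c, hc, rfl⟩ := Finset.mem_image.1 ha
      obtain ⟨K, hK, rfl⟩ := Finset.mem_image.1 hc
      rw [Finset.mem_filter_univ] at hK
      rw [Tab.mem_extensions] at hΛ
      have h1 : IsStd (Fin.snoc N.1 Λ.last : Fin (m + 2) → ℕ × ℕ) := by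
        rw [← hΛ, ← Tab.val_eq_snoc]; exact Λ.2
      have h2 := IsStd.snoc_of_range_eq K.2 hK.symm h1
      have h3 := h2.content_ne (i := (Fin.last m).castSucc) (j := Fin.last (m + 1))
        (Fin.castSucc_lt_last _) (by simp)
      rw [Fin.snoc_castSucc, Fin.snoc_last] at h3
      exact fun h => h3 (qSq_injective hq h))
    (Finset.card_image_le.trans_lt N.card_removable_lt)
  refine ⟨w, hw1, fun K hK => ?_⟩
  have := hw2 (qSq q (content K.last)) (Finset.mem_image_of_mem _
    (Finset.mem_image.2 ⟨K, (Finset.mem_filter_univ _).2 hK, rfl⟩))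
  simp only [diagCoef_sub]
  rw [← mul_zero (qDiff q), ← this, Finset.mul_sum]
  refine Finset.sum_congr rfl fun Λ _ => ?_
  ring

end Weights

end

section

/-! ### Decomposition of the unit of the Hecke algebra -/

section Parabolic

variable {m : ℕ}

/-- The index of a generator of `H_m` in `H_{m+1}`. -/
def HeckeIdx.up (k : HeckeIdx m) : HeckeIdx (m + 1) := ⟨k.1, by have := k.2; omega⟩

/-- The permutations fixing the last point have reduced words that do not involve the last
adjacent transposition. -/
theorem exists_reduced_of_last_fixed : ∀ (l : ℕ) (σ : Equiv.Perm (Fin (m + 1))),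
    permLength σ = l → σ (Fin.last m) = Fin.last m →
    ∃ w : List (HeckeIdx m), wordPerm (w.map HeckeIdx.up) = σ ∧ w.length = l := by
  intro l
  induction l with
  | zero => exact fun σ h _ => ⟨[], (permLength_eq_zero h).symm, rfl⟩
  | succ l ih =>
    intro σ h hσ
    obtain ⟨k, hk⟩ := exists_desc (σ := σ) (by rintro rfl; simp at h)
    have hσ' : σ⁻¹ (Fin.last m) = Fin.last m := by rw [Equiv.Perm.inv_eq_iff_eq, hσ]
    have hk' : k.hi ≠ Fin.last m := by
      intro e
      rw [e, hσ'] at hk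
      exact absurd hk (Fin.le_last _).not_gt
    have hlo : k.lo ≠ Fin.last m := by
      intro e
      have := k.lo_lt_hi
      rw [e] at this
      exact absurd this (Fin.le_last _).not_gt
    have hkm : k.1 + 1 < m := by
      have h1 := k.2
      have h2 : k.1 + 1 ≠ m := fun e => hk' (Fin.ext (by simpa [HeckeIdx.hi] using e))
      omega
    obtain ⟨w, hw, hl⟩ := ih (adjSwap k * σ) (by have := permLength_mul_of_desc hk; omega)
      (by rw [Equiv.Perm.mul_apply, hσ, adjSwap_of_ne k hlo.symm hk'.symm])
    refine ⟨⟨k.1, hkm⟩ :: w, ?_, by simp [hl]⟩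
    rw [List.map_cons, wordPerm_cons, hw]
    change adjSwap k * _ = _
    rw [← mul_assoc, adjSwap_mul_self, one_mul]

/-- The other permutations have reduced words involving the last adjacent transposition exactly
once. -/
theorem exists_reduced_of_last_moved : ∀ (d : ℕ) (σ : Equiv.Perm (Fin (m + 2))),
    (σ (Fin.last (m + 1)) : ℕ) + d = m →
    ∃ w w' : List (HeckeIdx (m + 1)),
      wordPerm (w.map HeckeIdx.up ++ (⟨m, by omega⟩ : HeckeIdx (m + 2)) :: w'.map HeckeIdx.up) = σ ∧
      w.length + 1 + w'.length = permLength σ := by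
  intro d
  induction d with
  | zero =>
    intro σ h
    let k : HeckeIdx (m + 2) := ⟨m, by omega⟩
    have hlo : σ (Fin.last (m + 1)) = k.lo := Fin.ext (by simpa [HeckeIdx.lo, k] using h)
    have hhi : k.hi = Fin.last (m + 1) := rfl
    have hk : σ⁻¹ k.hi < σ⁻¹ k.lo := by
      rw [← hlo, show σ⁻¹ (σ (Fin.last (m + 1))) = Fin.last (m + 1) from σ.symm_apply_apply _]
      refine lt_of_le_of_ne (Fin.le_last _) fun e => ?_
      rw [Equiv.Perm.inv_eq_iff_eq, hlo] at e
      exact k.lo_ne_hi e.symm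
    obtain ⟨w', hw', hl⟩ := exists_reduced_of_last_fixed _ (adjSwap k * σ) rfl
      (by rw [Equiv.Perm.mul_apply, hlo, adjSwap_lo, hhi])
    refine ⟨[], w', ?_, ?_⟩
    · rw [List.map_nil, List.nil_append, wordPerm_cons, hw', ← mul_assoc, adjSwap_mul_self, one_mul]
    · rw [hl, List.length_nil, zero_add, add_comm, permLength_mul_of_desc hk]
  | succ d ih =>
    intro σ h
    let j : HeckeIdx (m + 1) := ⟨σ (Fin.last (m + 1)), by omega⟩
    have hlo : σ (Fin.last (m + 1)) = j.up.lo := rfl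
    have hk : σ⁻¹ j.up.hi < σ⁻¹ j.up.lo := by
      rw [← hlo, show σ⁻¹ (σ (Fin.last (m + 1))) = Fin.last (m + 1) from σ.symm_apply_apply _]
      refine lt_of_le_of_ne (Fin.le_last _) fun e => ?_
      rw [Equiv.Perm.inv_eq_iff_eq, hlo] at e
      exact j.up.lo_ne_hi e.symm
    obtain ⟨w, w', hw, hl⟩ := ih (adjSwap j.up * σ) (by
      rw [Equiv.Perm.mul_apply, hlo, adjSwap_lo]
      change (σ (Fin.last (m + 1)) : ℕ) + 1 + d = m
      omega)
    refine ⟨j :: w, w', ?_, ?_⟩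
    · rw [List.map_cons, List.cons_append, wordPerm_cons, hw, ← mul_assoc, adjSwap_mul_self,
        one_mul]
    · have := permLength_mul_of_desc hk
      rw [List.length_cons]
      omega

theorem HeckeIdx.up_lo (k : HeckeIdx m) : k.up.lo = k.lo.castSucc := rfl

theorem HeckeIdx.up_hi (k : HeckeIdx m) : k.up.hi = k.hi.castSucc := rfl

theorem adjSwap_up_castSucc (k : HeckeIdx m) (i : Fin m) :
    adjSwap k.up i.castSucc = (adjSwap k i).castSucc := by
  apply Fin.ext
  rw [adjSwap_val, Fin.val_castSucc, Fin.val_castSucc, adjSwap_val]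
  rfl

theorem adjSwap_up_last (k : HeckeIdx m) : adjSwap k.up (Fin.last m) = Fin.last m := by
  refine adjSwap_of_ne _ ?_ ?_
  · rw [HeckeIdx.up_lo]; exact (Fin.castSucc_lt_last _).ne'
  · rw [HeckeIdx.up_hi]; exact (Fin.castSucc_lt_last _).ne'

theorem wordPerm_up_castSucc (w : List (HeckeIdx m)) (i : Fin m) :
    wordPerm (w.map HeckeIdx.up) i.castSucc = (wordPerm w i).castSucc := by
  induction w generalizing i with
  | nil => simp
  | cons k w ih => simp [ih, adjSwap_up_castSucc]

theorem wordPerm_up_last (w : List (HeckeIdx m)) :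
    wordPerm (w.map HeckeIdx.up) (Fin.last m) = Fin.last m := by
  induction w with
  | nil => simp
  | cons k w ih => simp [ih, adjSwap_up_last]

theorem wordPerm_up_congr {w w' : List (HeckeIdx m)} (h : wordPerm w = wordPerm w') :
    wordPerm (w.map HeckeIdx.up) = wordPerm (w'.map HeckeIdx.up) := by
  ext i
  induction i using Fin.lastCases with
  | last => rw [wordPerm_up_last, wordPerm_up_last]
  | cast i => rw [wordPerm_up_castSucc, wordPerm_up_castSucc, h]

theorem length_eq_permLength_of_up {w : List (HeckeIdx m)}
    (h : w.length = permLength (wordPerm (w.map HeckeIdx.up))) :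
    w.length = permLength (wordPerm w) := by
  refine le_antisymm ?_ (permLength_wordPerm_le w)
  obtain ⟨w', hw', hl⟩ := exists_reduced (wordPerm w)
  rw [h, ← hl, ← wordPerm_up_congr hw', ← List.length_map (as := w') HeckeIdx.up]
  exact permLength_wordPerm_le _

end Parabolic

section Extension

variable {q : ℂˣ} {m : ℕ}

/-- The product of the Young matrices along a word. -/
def tabWord (q : ℂˣ) {m : ℕ} (w : List (HeckeIdx m)) : Matrix (Tab m) (Tab m) ℂ :=
  (w.map (tabMatrix q)).prod

theorem tabWord_range_eq (w : List (HeckeIdx m)) : ∀ {Γ Λ : Tab m}, tabWord q w Γ Λ ≠ 0 →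
    Set.range Γ.1 = Set.range Λ.1 := by
  induction w with
  | nil =>
    intro Γ Λ h
    by_contra hne
    refine h ?_
    rw [tabWord, List.map_nil, List.prod_nil, Matrix.one_apply_ne]
    rintro rfl
    exact hne rfl
  | cons k w ih =>
    intro Γ Λ h
    rw [tabWord, List.map_cons, List.prod_cons, Matrix.mul_apply] at h
    obtain ⟨Δ, -, hΔ⟩ := Finset.exists_ne_zero_of_sum_ne_zero h
    rw [← ih (right_ne_zero_of_mul hΔ)]
    have h1 := left_ne_zero_of_mul hΔ
    by_contra hne
    refine h1 ?_
    simp only [tabMatrix, Matrix.of_apply]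
    rw [if_neg, if_neg, add_zero]
    · intro e
      rw [e, Set.range_comp, (adjSwap k).surjective.range_eq, Set.image_univ] at hne
      exact hne rfl
    · rintro rfl
      exact hne rfl

/-- The vector of the tableaux with the last number in a given box determined by a vector of
their restrictions. -/
def extVec (β : ℕ × ℕ) (v : Tab m → ℂ) : Tab (m + 1) → ℂ :=
  fun Λ => if Λ.last = β then v Λ.init else 0

theorem extVec_tabVec (β : ℕ × ℕ) (f : Fin m → ℕ × ℕ) :
    extVec β (tabVec f) = tabVec (Fin.snoc f β : Fin (m + 1) → ℕ × ℕ) := by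
  funext Λ
  have : Λ.1 = (Fin.snoc f β : Fin (m + 1) → ℕ × ℕ) ↔ Λ.last = β ∧ Λ.init.1 = f := by
    constructor
    · intro h
      refine ⟨?_, ?_⟩
      · rw [Tab.last, h, Fin.snoc_last]
      · change Λ.1 ∘ Fin.castSucc = f
        rw [h, snoc_comp_castSucc]
    · rintro ⟨rfl, rfl⟩
      exact Λ.val_eq_snoc
  simp only [extVec, tabVec, this, ite_and]

theorem extVec_add (β : ℕ × ℕ) (v v' : Tab m → ℂ) :
    extVec β (v + v') = extVec β v + extVec β v' := by
  funext Λ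
  simp only [extVec, Pi.add_apply]
  split_ifs <;> simp

theorem extVec_smul (β : ℕ × ℕ) (c : ℂ) (v : Tab m → ℂ) :
    extVec β (c • v) = c • extVec β v := by
  funext Λ
  simp only [extVec, Pi.smul_apply]
  split_ifs <;> simp

theorem snoc_comp_up (f : Fin m → ℕ × ℕ) (β : ℕ × ℕ) (k : HeckeIdx m) :
    (Fin.snoc f β : Fin (m + 1) → ℕ × ℕ) ∘ adjSwap k.up =
      (Fin.snoc (f ∘ adjSwap k) β : Fin (m + 1) → ℕ × ℕ) := by
  funext i
  induction i using Fin.lastCases with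
  | last => simp [adjSwap_up_last]
  | cast i => simp [adjSwap_up_castSucc]

theorem contentDiff_snoc_up (f : Fin m → ℕ × ℕ) (β : ℕ × ℕ) (k : HeckeIdx m) :
    contentDiff (Fin.snoc f β : Fin (m + 1) → ℕ × ℕ) k.up = contentDiff f k := by
  simp [contentDiff, HeckeIdx.up_lo, HeckeIdx.up_hi]

theorem tabVec_eq_zero {f : Fin m → ℕ × ℕ} (h : ¬ IsStd f) : tabVec f = 0 := by
  funext Λ
  simp only [tabVec, Pi.zero_apply, ite_eq_right_iff, one_ne_zero, imp_false]
  rintro rfl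
  exact h Λ.2

theorem tabMatrix_up_mulVec_extVec (hq : ∀ k : ℕ, 0 < k → q ^ k ≠ 1) (k : HeckeIdx m) (β : ℕ × ℕ)
    (v : Tab m → ℂ) :
    (tabMatrix q k.up).mulVec (extVec β v) = extVec β ((tabMatrix q k).mulVec v) := by
  have hlin : ∀ v : Tab m → ℂ, v = ∑ Λ, v Λ • tabVec Λ.1 := by
    intro v
    funext Γ
    simp [Finset.sum_apply, tabVec_val, Pi.single_apply]
  let E : (Tab m → ℂ) →ₗ[ℂ] (Tab (m + 1) → ℂ) :=
    { toFun := extVec β, map_add' := extVec_add β, map_smul' := extVec_smul β }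
  have : (tabMatrix q k.up).mulVecLin ∘ₗ E = E ∘ₗ (tabMatrix q k).mulVecLin := by
    refine LinearMap.pi_ext' fun Λ => LinearMap.ext_ring ?_
    change (tabMatrix q k.up).mulVec (extVec β (Pi.single Λ 1)) =
      extVec β ((tabMatrix q k).mulVec (Pi.single Λ 1))
    rw [← tabVec_val, extVec_tabVec, tabMatrix_mulVec Λ.2, extVec_add, extVec_smul, extVec_smul,
      extVec_tabVec, extVec_tabVec]
    by_cases h : IsStd (Fin.snoc Λ.1 β : Fin (m + 1) → ℕ × ℕ)
    · rw [tabMatrix_mulVec h, contentDiff_snoc_up, snoc_comp_up]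
    · rw [tabVec_eq_zero h, Matrix.mulVec_zero, smul_zero, zero_add]
      rcases mul_offCoef_eq_zero_or hq k (Or.inr Λ.2 : (1 : ℂ) = 0 ∨ IsStd Λ.1) with h1 | h1
      · rw [one_mul] at h1
        rw [h1, zero_smul]
      · rw [tabVec_eq_zero, smul_zero]
        intro h2
        refine h (IsStd.snoc_of_range_eq Λ.2 ?_ h2)
        rw [Set.range_comp, (adjSwap k).surjective.range_eq, Set.image_univ]
  exact LinearMap.congr_fun this v

theorem tabWord_up_apply (hq : ∀ k : ℕ, 0 < k → q ^ k ≠ 1) (w : List (HeckeIdx m))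
    (Γ Λ : Tab (m + 1)) : tabWord q (w.map HeckeIdx.up) Γ Λ =
      if Γ.last = Λ.last then tabWord q w Γ.init Λ.init else 0 := by
  have key : ∀ (β : ℕ × ℕ) (v : Tab m → ℂ),
      (tabWord q (w.map HeckeIdx.up)).mulVec (extVec β v) = extVec β ((tabWord q w).mulVec v) := by
    intro β
    induction w with
    | nil => intro v; simp [tabWord]
    | cons k w ih =>
      intro v
      simp only [tabWord, List.map_cons, List.prod_cons, ← Matrix.mulVec_mulVec] at ih ⊢
      rw [ih, tabMatrix_up_mulVec_extVec hq]
  have h := congrFun (key Λ.last (tabVec Λ.init.1)) Γ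
  rw [extVec_tabVec, ← Tab.val_eq_snoc, tabVec_val, tabVec_val, Matrix.mulVec_single_one,
    Matrix.mulVec_single_one] at h
  exact h

theorem tabMatrix_last_apply {k : HeckeIdx (m + 2)} (hk : k.1 = m) {Γ Λ : Tab (m + 2)}
    (h : Γ.last = Λ.last) : tabMatrix q k Γ Λ =
      if Γ = Λ then diagCoef q (content Λ.last - content Λ.init.last) else 0 := by
  obtain ⟨k, hk'⟩ := k
  obtain rfl : k = m := hk
  simp only [tabMatrix, Matrix.of_apply]
  rw [if_neg (c := Γ.1 = _), add_zero]
  · rfl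
  · intro e
    have h1 : Γ.last = Λ.1 (HeckeIdx.lo ⟨k, hk'⟩) := by
      rw [Tab.last, e, Function.comp_apply]
      exact congrArg Λ.1 (adjSwap_hi ⟨k, hk'⟩)
    rw [h1] at h
    exact HeckeIdx.lo_ne_hi ⟨k, hk'⟩ (Λ.2.inj h)

open Classical in
theorem sum_init (β : ℕ × ℕ) (F : Tab m → ℂ)
    (hF : ∀ K, F K ≠ 0 → IsStd (Fin.snoc K.1 β : Fin (m + 1) → ℕ × ℕ)) :
    ∑ Γ : Tab (m + 1), (if Γ.last = β then F Γ.init else 0) = ∑ K, F K := by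
  have hinj : Set.InjOn (Tab.init : Tab (m + 1) → Tab m)
      (Finset.univ.filter fun Γ : Tab (m + 1) => Γ.last = β) := by
    intro Γ hΓ Δ hΔ h
    rw [Finset.mem_coe, Finset.mem_filter_univ] at hΓ hΔ
    exact Tab.ext_init_last h (hΓ.trans hΔ.symm)
  rw [← Finset.sum_filter, ← Finset.sum_image (f := F) hinj]
  refine Finset.sum_subset (Finset.subset_univ _) fun K _ hK => ?_
  by_contra h
  refine hK (Finset.mem_image.2 ⟨⟨_, hF K h⟩, ?_, ?_⟩)
  · rw [Finset.mem_filter_univ]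
    exact Fin.snoc_last (α := fun _ => ℕ × ℕ) _ _
  · exact Subtype.ext (snoc_comp_castSucc _ _)

open Classical in
theorem sum_extensions (F : Tab (m + 1) → ℂ) :
    ∑ N : Tab m, ∑ Λ ∈ N.extensions, F Λ = ∑ Λ, F Λ :=
  Finset.sum_fiberwise Finset.univ Tab.init F

theorem Tab.nonempty : ∀ m : ℕ, Nonempty (Tab m)
  | 0 => ⟨⟨Fin.elim0, fun i => i.elim0, fun i => i.elim0⟩⟩
  | m + 1 => by
    obtain ⟨N⟩ := Tab.nonempty m
    obtain ⟨Λ, -⟩ := N.nonempty_extensions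
    exact ⟨Λ⟩

theorem exists_trace_weights_of_subsingleton [Subsingleton (Equiv.Perm (Fin m))] (q : ℂˣ) :
    ∃ a : Tab m → ℂ, ∀ σ : Equiv.Perm (Fin m),
      ∑ Λ, a Λ * alongReduced (tabMatrix q) σ Λ Λ = if σ = 1 then 1 else 0 := by
  refine ⟨fun _ => (Fintype.card (Tab m) : ℂ)⁻¹, fun σ => ?_⟩
  have : Nonempty (Tab m) := Tab.nonempty m
  have h : alongReduced (tabMatrix q) σ = 1 := by
    have hl := length_reducedWord σ
    rw [Subsingleton.elim σ 1, permLength_one, List.length_eq_zero_iff] at hl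
    rw [Subsingleton.elim σ 1, alongReduced, hl, List.map_nil, List.prod_nil]
  rw [h, if_pos (Subsingleton.elim _ _)]
  simp

/-- The symmetrizing trace of the Hecke algebra is a linear combination of the diagonal
coefficients of the Young matrices. -/
theorem exists_trace_weights (hq : ∀ k : ℕ, 0 < k → q ^ k ≠ 1) : ∀ m : ℕ,
    ∃ a : Tab m → ℂ, ∀ σ : Equiv.Perm (Fin m),
      ∑ Λ, a Λ * alongReduced (tabMatrix q) σ Λ Λ = if σ = 1 then 1 else 0
  | 0 => exists_trace_weights_of_subsingleton q
  | 1 => exists_trace_weights_of_subsingleton q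
  | m + 2 => by
    obtain ⟨a, ha⟩ := exists_trace_weights hq (m + 1)
    choose w hw1 hw2 using fun N : Tab (m + 1) => N.exists_transition hq
    refine ⟨fun Λ => a Λ.init * w Λ.init Λ, fun σ => ?_⟩
    have hb := tabMatrix_isBraid (m := m + 2) hq
    have hb' := tabMatrix_isBraid (m := m + 1) hq
    by_cases hσ : σ (Fin.last (m + 1)) = Fin.last (m + 1)
    · obtain ⟨v, hv, hl⟩ := exists_reduced_of_last_fixed _ σ rfl hσ
      have hl' : v.length = permLength (wordPerm v) := length_eq_permLength_of_up (by rw [hl, hv])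
      have e1 : alongReduced (tabMatrix q) σ = tabWord q (v.map HeckeIdx.up) :=
        hb.alongReduced_eq hv (by rw [List.length_map, hl])
      have e2 : alongReduced (tabMatrix q) (wordPerm v) = tabWord q v :=
        hb'.alongReduced_eq rfl hl'
      have h1 : σ = 1 ↔ wordPerm v = 1 := by
        rw [← hv]
        constructor
        · intro h
          ext i
          have := wordPerm_up_castSucc v i
          rw [h, Equiv.Perm.one_apply] at this
          rw [← Fin.castSucc_injective _ this, Equiv.Perm.one_apply]
        · intro h
          exact wordPerm_up_congr (w' := []) h
      simp only [h1]
      rw [← ha (wordPerm v), ← sum_extensions]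
      refine Finset.sum_congr rfl fun N _ => ?_
      calc ∑ Λ ∈ N.extensions, a Λ.init * w Λ.init Λ * alongReduced (tabMatrix q) σ Λ Λ
          = ∑ Λ ∈ N.extensions,
              w N Λ * (a N * alongReduced (tabMatrix q) (wordPerm v) N N) := by
            refine Finset.sum_congr rfl fun Λ hΛ => ?_
            rw [Tab.mem_extensions] at hΛ
            rw [e1, e2, tabWord_up_apply hq, if_pos rfl, hΛ]
            ring
        _ = _ := by rw [← Finset.sum_mul, hw1, one_mul]
    · have hlt : (σ (Fin.last (m + 1)) : ℕ) ≤ m := by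
        have h1 := (σ (Fin.last (m + 1))).2
        have h2 : (σ (Fin.last (m + 1)) : ℕ) ≠ m + 1 := fun e => hσ (Fin.ext e)
        omega
      obtain ⟨v, v', hv, hl⟩ := exists_reduced_of_last_moved (m - σ (Fin.last (m + 1))) σ
        (by omega)
      let k : HeckeIdx (m + 2) := ⟨m, by omega⟩
      have e1 : alongReduced (tabMatrix q) σ = tabWord q (v.map HeckeIdx.up) *
          (tabMatrix q k * tabWord q (v'.map HeckeIdx.up)) := by
        rw [hb.alongReduced_eq hv (by simp [← hl]; ring)]
        simp [tabWord, k]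
      rw [if_neg (by rintro rfl; exact hσ rfl), ← sum_extensions]
      refine Finset.sum_eq_zero fun N _ => ?_
      have entry : ∀ Λ ∈ N.extensions, alongReduced (tabMatrix q) σ Λ Λ =
          ∑ K, tabWord q v N K * tabWord q v' K N *
            diagCoef q (content Λ.last - content K.last) := by
        intro Λ hΛ
        rw [Tab.mem_extensions] at hΛ
        rw [← sum_init Λ.last, e1, Matrix.mul_apply]
        · refine Finset.sum_congr rfl fun Γ _ => ?_
          rw [tabWord_up_apply hq, hΛ]
          by_cases hΓ : Γ.last = Λ.last
          · rw [if_pos hΓ.symm, if_pos hΓ, Matrix.mul_apply, Finset.sum_eq_single Γ]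
            · rw [tabMatrix_last_apply rfl rfl, if_pos rfl, tabWord_up_apply hq, if_pos hΓ, hΛ, hΓ]
              ring
            · intro Δ _ hΔ
              rw [tabWord_up_apply hq]
              split_ifs with hc
              · rw [tabMatrix_last_apply rfl (hΓ.trans hc.symm), if_neg hΔ.symm, zero_mul]
              · rw [mul_zero]
            · exact fun h => absurd (Finset.mem_univ _) h
          · rw [if_neg (Ne.symm hΓ), if_neg hΓ, zero_mul]
        · intro K hK
          have hr := tabWord_range_eq v (left_ne_zero_of_mul (left_ne_zero_of_mul hK))
          refine IsStd.snoc_of_range_eq K.2 hr ?_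
          rw [← hΛ, ← Tab.val_eq_snoc]
          exact Λ.2
      calc ∑ Λ ∈ N.extensions, a Λ.init * w Λ.init Λ * alongReduced (tabMatrix q) σ Λ Λ
          = ∑ Λ ∈ N.extensions, ∑ K, a N * tabWord q v N K * tabWord q v' K N *
              (w N Λ * diagCoef q (content Λ.last - content K.last)) := by
            refine Finset.sum_congr rfl fun Λ hΛ => ?_
            rw [entry Λ hΛ, Finset.mul_sum]
            rw [Tab.mem_extensions] at hΛ
            rw [hΛ]
            refine Finset.sum_congr rfl fun K _ => ?_
            ring
        _ = ∑ K, a N * tabWord q v N K * tabWord q v' K N *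
              ∑ Λ ∈ N.extensions, w N Λ * diagCoef q (content Λ.last - content K.last) := by
            rw [Finset.sum_comm]
            simp only [Finset.mul_sum]
        _ = 0 := by
            refine Finset.sum_eq_zero fun K _ => ?_
            by_cases h : tabWord q v N K = 0
            · rw [h]; ring
            · rw [hw2 N K (tabWord_range_eq v h).symm, mul_zero]

end Extension

end

section

/-! ### Fusion -/

section Fusion

variable {q : ℂˣ} {m : ℕ} {A : Type*} [Ring A] [Algebra ℂ A] {g : HeckeIdx m → A}

/-- The elements `(y - x) T_k + (q - q⁻¹) x` with `x = q^{2c_k}` and `y = q^{2c_{k+1}}`. -/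
def baxter (q : ℂˣ) (g : HeckeIdx m → A) (k : HeckeIdx m) (c : Fin m → ℤ) : A :=
  (qSq q (c k.hi) - qSq q (c k.lo)) • g k + (qDiff q * qSq q (c k.lo)) • (1 : A)

/-- The contents of a sequence of boxes. -/
def contents (f : Fin m → ℕ × ℕ) : Fin m → ℤ := fun k => content (f k)

/-- The coefficients of the decomposition of the symmetrizing trace. -/
def IsTraceWeight (q : ℂˣ) (a : Tab m → ℂ) : Prop :=
  ∀ σ : Equiv.Perm (Fin m), ∑ Λ, a Λ * alongReduced (tabMatrix q) σ Λ Λ = if σ = 1 then 1 else 0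

theorem dotProduct_mulVec_tabVec (M : Matrix (Tab m) (Tab m) ℂ) (Γ Λ : Tab m) :
    tabVec Γ.1 ⬝ᵥ M.mulVec (tabVec Λ.1) = M Γ Λ := by
  rw [tabVec_val, tabVec_val, Matrix.mulVec_single_one, single_one_dotProduct]
  rfl

theorem one_eq_sum_tabUnit {a : Tab m → ℂ} (ha : IsTraceWeight q a) (hg : IsHecke q g) :
    (1 : A) = ∑ Λ : Tab m, a Λ • tabUnit q g (tabVec Λ.1) (tabVec Λ.1) := by
  simp only [tabUnit, dotProduct_mulVec_tabVec, Finset.smul_sum, smul_smul]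
  rw [Finset.sum_comm]
  rw [Finset.sum_congr rfl fun σ _ => by rw [← Finset.sum_smul, ha σ⁻¹]]
  simp only [inv_eq_one, ite_smul, one_smul, zero_smul]
  rw [Finset.sum_ite_eq' Finset.univ 1, if_pos (Finset.mem_univ _), hg.alongReduced_one]

theorem mul_tabUnit_tabVec (hq : ∀ k : ℕ, 0 < k → q ^ k ≠ 1) (hg : IsHecke q g) (k : HeckeIdx m)
    (x : Tab m → ℂ) {f : Fin m → ℕ × ℕ} (hf : IsStd f) :
    g k * tabUnit q g x (tabVec f) = diagCoef q (contentDiff f k) • tabUnit q g x (tabVec f) +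
      offCoef q (contentDiff f k) • tabUnit q g x (tabVec (f ∘ adjSwap k)) := by
  rw [mul_tabUnit hq hg, tabMatrix_mulVec hf, tabUnit_add_right, tabUnit_smul_right,
    tabUnit_smul_right]

theorem tabUnit_tabVec_mul (hq : ∀ k : ℕ, 0 < k → q ^ k ≠ 1) (hg : IsHecke q g) (k : HeckeIdx m)
    (y : Tab m → ℂ) {f : Fin m → ℕ × ℕ} (hf : IsStd f) :
    tabUnit q g (tabVec f) y * g k = diagCoef q (contentDiff f k) • tabUnit q g (tabVec f) y +
      offCoef q (contentDiff f k) • tabUnit q g (tabVec (f ∘ adjSwap k)) y := by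
  rw [tabUnit_mul hq hg, tabMatrix_mulVec hf, tabUnit_add_left, tabUnit_smul_left,
    tabUnit_smul_left]

/-- The coefficient relating the tableaux `f` and `f ∘ adjSwap k`. -/
def swapCoef (q : ℂˣ) (f : Fin m → ℕ × ℕ) (k : HeckeIdx m) : ℂ :=
  (qSq q (content (f k.hi)) - qSq q (content (f k.lo))) * offCoef q (contentDiff f k)

theorem IsStd.qSq_sub_ne_zero (hq : ∀ k : ℕ, 0 < k → q ^ k ≠ 1) {f : Fin m → ℕ × ℕ}
    (hf : IsStd f) (k : HeckeIdx m) :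
    qSq q (content (f k.hi)) - qSq q (content (f k.lo)) ≠ 0 :=
  sub_ne_zero.2 fun e => hf.content_lo_ne_hi k (qSq_injective hq e).symm

theorem swapCoef_ne_zero (hq : ∀ k : ℕ, 0 < k → q ^ k ≠ 1) {f : Fin m → ℕ × ℕ} (hf : IsStd f)
    {k : HeckeIdx m} (hfk : IsStd (f ∘ adjSwap k)) : swapCoef q f k ≠ 0 := by
  obtain ⟨h1, h2⟩ := hf.contentDiff_ne k hfk
  exact mul_ne_zero (hf.qSq_sub_ne_zero hq k) (offCoef_ne_zero hq h1 h2
    (sub_ne_zero.2 (hf.content_lo_ne_hi k).symm))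

theorem diagCoef_neg_contentDiff (hq : ∀ k : ℕ, 0 < k → q ^ k ≠ 1) {f : Fin m → ℕ × ℕ}
    (hf : IsStd f) (k : HeckeIdx m) :
    (qSq q (content (f k.hi)) - qSq q (content (f k.lo))) * diagCoef q (-contentDiff f k) +
      qDiff q * qSq q (content (f k.lo)) = 0 := by
  have h := hf.qSq_sub_ne_zero hq k
  rw [contentDiff, neg_sub, diagCoef_sub, ← neg_sub (qSq q (content (f k.hi)))]
  field_simp
  ring

theorem baxter_mul_tabUnit (hq : ∀ k : ℕ, 0 < k → q ^ k ≠ 1) (hg : IsHecke q g) (k : HeckeIdx m)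
    (x : Tab m → ℂ) {f : Fin m → ℕ × ℕ} (hf : IsStd f) (hfk : IsStd (f ∘ adjSwap k)) :
    baxter q g k (contents f) * tabUnit q g x (tabVec (f ∘ adjSwap k)) =
      swapCoef q f k • tabUnit q g x (tabVec f) := by
  have h := diagCoef_neg_contentDiff hq hf k
  rw [baxter, add_mul, smul_mul_assoc, smul_mul_assoc, one_mul, mul_tabUnit_tabVec hq hg k x hfk,
    comp_adjSwap_comp, contentDiff_comp, offCoef_neg, swapCoef]
  simp only [contents]
  linear_combination (norm := module) h • tabUnit q g x (tabVec (f ∘ adjSwap k))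

theorem tabUnit_mul_baxter (hq : ∀ k : ℕ, 0 < k → q ^ k ≠ 1) (hg : IsHecke q g) (k : HeckeIdx m)
    (y : Tab m → ℂ) {f : Fin m → ℕ × ℕ} (hf : IsStd f) (hfk : IsStd (f ∘ adjSwap k)) :
    tabUnit q g (tabVec (f ∘ adjSwap k)) y * baxter q g k (contents f) =
      swapCoef q f k • tabUnit q g (tabVec f) y := by
  have h := diagCoef_neg_contentDiff hq hf k
  rw [baxter, mul_add, mul_smul_comm, mul_smul_comm, mul_one, tabUnit_tabVec_mul hq hg k y hfk,
    comp_adjSwap_comp, contentDiff_comp, offCoef_neg, swapCoef]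
  simp only [contents]
  linear_combination (norm := module) h • tabUnit q g (tabVec (f ∘ adjSwap k)) y

theorem tabUnit_mul_eq_zero (hq : ∀ k : ℕ, 0 < k → q ^ k ≠ 1) (hg : IsHecke q g) {Γ Λ : Tab m}
    (h : Γ ≠ Λ) (y : Tab m → ℂ) {z : A}
    (hz : ∀ j : Fin m, jucysMurphy g j * z = qSq q (content (Λ.1 j)) • z) :
    tabUnit q g (tabVec Γ.1) y * z = 0 := by
  obtain ⟨j, hj⟩ : ∃ j, content (Γ.1 j) ≠ content (Λ.1 j) := by
    by_contra hc
    push Not at hc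
    exact h (Subtype.ext (Γ.2.eq_of_content Λ.2 hc))
  have h1 := tabUnit_mul_jucysMurphy hq hg y j (tabVec Γ.1)
  rw [jucysMurphy_tabMatrix hq j j.2 _ Γ.2, tabUnit_smul_left] at h1
  have h2 : tabUnit q g (tabVec Γ.1) y * (jucysMurphy g j * z) =
      tabUnit q g (tabVec Γ.1) y * jucysMurphy g j * z := (mul_assoc _ _ _).symm
  rw [h1, hz, mul_smul_comm, smul_mul_assoc, ← sub_eq_zero, ← sub_smul] at h2
  exact (smul_eq_zero.1 h2).resolve_left (sub_ne_zero.2 fun e => hj (qSq_injective hq e).symm)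

/-- The weight vectors of the Jucys–Murphy elements are fixed by the idempotents. -/
theorem weight_eq_mul (hq : ∀ k : ℕ, 0 < k → q ^ k ≠ 1) (hg : IsHecke q g) {a : Tab m → ℂ}
    (ha : IsTraceWeight q a) (Λ : Tab m) {z : A}
    (hz : ∀ j : Fin m, jucysMurphy g j * z = qSq q (content (Λ.1 j)) • z) :
    z = a Λ • (tabUnit q g (tabVec Λ.1) (tabVec Λ.1) * z) := by
  conv_lhs => rw [← one_mul z, one_eq_sum_tabUnit ha hg, Finset.sum_mul]
  rw [Finset.sum_eq_single Λ]
  · rw [smul_mul_assoc]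
  · intro Γ _ h
    rw [smul_mul_assoc, tabUnit_mul_eq_zero hq hg h _ hz, smul_zero]
  · exact fun h => absurd (Finset.mem_univ _) h

theorem adjacent_coef (hq : ∀ k : ℕ, 0 < k → q ^ k ≠ 1) {c c' : ℤ} (h : c' - c = 1 ∨ c' - c = -1) :
    diagCoef q (c' - c) ^ 2 = 1 + qDiff q * diagCoef q (c' - c) ∧
    qSq q c' = diagCoef q (c' - c) ^ 2 * qSq q c ∧ diagCoef q (c' - c) ^ 2 + 1 ≠ 0 ∧
    offCoef q (c' - c) = 0 := by
  have hq0 : (q : ℂ) ≠ 0 := q.ne_zero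
  have hq4 : ((q : ℂ) ^ 2) ^ 2 ≠ 1 := by
    rw [← pow_mul]
    intro h
    have := (zpow_eq_one_iff hq (d := 4)).1 (by exact_mod_cast h)
    omega
  have hq2 : (q : ℂ) ^ 2 + 1 ≠ 0 := by
    intro h
    apply hq4
    rw [eq_neg_of_add_eq_zero_left h]
    norm_num
  rcases h with h | h
  · obtain rfl : c' = c + 1 := by omega
    rw [h, diagCoef_one hq, offCoef_one hq]
    refine ⟨?_, ?_, hq2, rfl⟩
    · rw [qDiff]; field_simp; ring
    · rw [qSq, qSq, mul_add, zpow_add₀ hq0, mul_comm]; norm_cast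
  · obtain rfl : c' = c - 1 := by omega
    rw [h, diagCoef_neg_one hq, offCoef_neg_one hq]
    refine ⟨?_, ?_, ?_, rfl⟩
    · rw [qDiff]; field_simp; ring
    · rw [qSq, qSq, mul_sub, zpow_sub₀ hq0, neg_sq, inv_pow, div_eq_inv_mul]; norm_cast
    · intro h
      apply hq2
      field_simp at h
      simpa [add_comm] using h

theorem jucysMurphy_mul_of_intertwines (hq : ∀ k : ℕ, 0 < k → q ^ k ≠ 1) (hg : IsHecke q g)
    {X : (Fin m → ℤ) → A}
    (hX : ∀ k c, X c * baxter q g k c = baxter q g k c * X (c ∘ adjSwap k)) (x : Tab m → ℂ) :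
    ∀ (j : ℕ) (hj : j < m) (f : Fin m → ℕ × ℕ), IsStd f →
      jucysMurphy g j * (X (contents f) * tabUnit q g x (tabVec f)) =
        qSq q (content (f ⟨j, hj⟩)) • (X (contents f) * tabUnit q g x (tabVec f)) := by
  intro j
  induction j with
  | zero =>
    intro hj f hf
    rw [hf.first ⟨0, hj⟩ rfl]
    simp [jucysMurphy, content, qSq]
  | succ j ih =>
    intro hj f hf
    let k : HeckeIdx m := ⟨j, hj⟩
    have hlo : ∀ f, IsStd f → jucysMurphy g k.lo * (X (contents f) * tabUnit q g x (tabVec f)) =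
        qSq q (content (f k.lo)) • (X (contents f) * tabUnit q g x (tabVec f)) :=
      fun f hf => ih (by omega) f hf
    change jucysMurphy g k.hi * _ = qSq q (content (f k.hi)) • _
    rw [jucysMurphy_hi]
    have hsq := hg.sq k
    have hne := hf.qSq_sub_ne_zero hq k
    have hXk := hX k (contents f)
    by_cases hadj : contentDiff f k = 1 ∨ contentDiff f k = -1
    · obtain ⟨h1, h2, h3, h4⟩ := adjacent_coef (q := q) hq hadj
      have hU := mul_tabUnit_tabVec hq hg k x hf
      rw [show contentDiff f k = content (f k.hi) - content (f k.lo) from rfl, h4, zero_smul,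
        add_zero] at hU
      set t := diagCoef q (content (f k.hi) - content (f k.lo))
      set a := qSq q (content (f k.lo)) with ha
      set U := tabUnit q g x (tabVec f)
      have hP : baxter q g k (contents f) = (a * qDiff q) • (t • g k + 1) := by
        rw [baxter, contents, contents, h2, ← ha, smul_add, smul_smul, mul_comm a (qDiff q)]
        congr 2
        linear_combination a * h1
      have hc : a * qDiff q * (t ^ 2 + 1) ≠ 0 :=
        mul_ne_zero (mul_ne_zero (qSq_ne_zero _) (qDiff_ne_zero hq)) h3
      have hPU : baxter q g k (contents f) * U = (a * qDiff q * (t ^ 2 + 1)) • U := by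
        rw [hP, smul_mul_assoc, add_mul, smul_mul_assoc, hU, one_mul, smul_smul, ← sq,
          mul_smul (a * qDiff q), add_smul, one_smul]
      have hgP : g k * baxter q g k (contents f) = t • baxter q g k (contents f) := by
        rw [hP, mul_smul_comm, mul_add, mul_smul_comm, hsq, mul_one, smul_comm t (a * qDiff q)]
        congr 1
        linear_combination (norm := module) (-h1) • g k
      have hgX : g k * (X (contents f) * U) = t • (X (contents f) * U) := by
        have e : (a * qDiff q * (t ^ 2 + 1)) • (X (contents f) * U) =
            baxter q g k (contents f) * (X (contents f ∘ adjSwap k) * U) := by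
          rw [← mul_smul_comm, ← hPU, ← mul_assoc, hXk, mul_assoc]
        apply smul_right_injective A hc
        simp only
        rw [← mul_smul_comm, e, ← mul_assoc, hgP, smul_mul_assoc, ← e, smul_comm]
      rw [mul_assoc, hgX, mul_assoc, mul_smul_comm, mul_smul_comm, hlo f hf, mul_smul_comm, hgX,
        smul_smul, smul_smul, h2]
      congr 1
      ring
    · push Not at hadj
      have hfk := hf.comp_adjSwap k hadj.1 hadj.2
      have hU := baxter_mul_tabUnit hq hg k x hf hfk
      have hs := swapCoef_ne_zero hq hf hfk
      set V := X (contents (f ∘ adjSwap k)) * tabUnit q g x (tabVec (f ∘ adjSwap k)) with hV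
      have e : swapCoef q f k • (X (contents f) * tabUnit q g x (tabVec f)) =
          baxter q g k (contents f) * V := by
        rw [← mul_smul_comm, ← hU, ← mul_assoc, hXk, mul_assoc]
        rfl
      have y1 := hlo _ hfk
      rw [← hV, Function.comp_apply, adjSwap_lo] at y1
      have y2 := congrArg (swapCoef q f k • ·) (hlo f hf)
      beta_reduce at y2
      rw [← mul_smul_comm, smul_comm, e] at y2
      apply smul_right_injective A hs
      simp only
      rw [← mul_smul_comm, smul_comm, e]
      simp only [baxter, contents] at y2 ⊢
      set a := qSq q (content (f k.lo))
      set b := qSq q (content (f k.hi))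
      set y := jucysMurphy g k.lo
      simp only [add_mul, mul_add, smul_mul_assoc, mul_smul_comm, one_mul, smul_add, mul_assoc,
        smul_smul] at y1 y2 ⊢
      have hsq' : ∀ z, g k * (g k * z) = z + qDiff q • (g k * z) := fun z => by
        rw [← mul_assoc, hsq, add_mul, one_mul, smul_mul_assoc]
      have y3 : y * (g k * V) = a • (g k * V) - (qDiff q * a) • V := by
        apply smul_right_injective A hne
        simp only
        rw [y1] at y2
        rw [eq_sub_of_add_eq y2]
        module
      rw [hsq']
      simp only [mul_add, mul_smul_comm, y1, y3, mul_sub, hsq']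
      module

/-- A family of elements with the exchange relations of a product of the L-operators preserves the
image of the idempotent of a tableau when its parameters are the contents of this tableau. -/
theorem fusion (hq : ∀ k : ℕ, 0 < k → q ^ k ≠ 1) (hg : IsHecke q g) {a : Tab m → ℂ}
    (ha : IsTraceWeight q a) {X : (Fin m → ℤ) → A}
    (hX : ∀ k c, X c * baxter q g k c = baxter q g k c * X (c ∘ adjSwap k)) (Λ : Tab m) :
    X (contents Λ.1) * tabUnit q g (tabVec Λ.1) (tabVec Λ.1) =
      a Λ • (tabUnit q g (tabVec Λ.1) (tabVec Λ.1) *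
        (X (contents Λ.1) * tabUnit q g (tabVec Λ.1) (tabVec Λ.1))) :=
  weight_eq_mul hq hg ha Λ fun j => jucysMurphy_mul_of_intertwines hq hg hX _ j j.2 Λ.1 Λ.2

theorem tabUnit_idempotent (hq : ∀ k : ℕ, 0 < k → q ^ k ≠ 1) (hg : IsHecke q g) {a : Tab m → ℂ}
    (ha : IsTraceWeight q a) (Λ : Tab m) :
    tabUnit q g (tabVec Λ.1) (tabVec Λ.1) =
      a Λ • (tabUnit q g (tabVec Λ.1) (tabVec Λ.1) * tabUnit q g (tabVec Λ.1) (tabVec Λ.1)) := by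
  have := fusion hq hg ha (X := fun _ => 1) (fun _ _ => by rw [one_mul, mul_one]) Λ
  simpa using this

theorem baxter_tabUnit_baxter (hq : ∀ k : ℕ, 0 < k → q ^ k ≠ 1) (hg : IsHecke q g)
    (k : HeckeIdx m) {f : Fin m → ℕ × ℕ} (hf : IsStd f) (hfk : IsStd (f ∘ adjSwap k)) :
    baxter q g k (contents f) * tabUnit q g (tabVec (f ∘ adjSwap k)) (tabVec (f ∘ adjSwap k)) *
      baxter q g k (contents f) = swapCoef q f k ^ 2 • tabUnit q g (tabVec f) (tabVec f) := by
  rw [baxter_mul_tabUnit hq hg k _ hf hfk, smul_mul_assoc, tabUnit_mul_baxter hq hg k _ hf hfk,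
    smul_smul, sq]

theorem tabUnit_baxter_tabUnit (hq : ∀ k : ℕ, 0 < k → q ^ k ≠ 1) (hg : IsHecke q g)
    (k : HeckeIdx m) {f : Fin m → ℕ × ℕ} (hf : IsStd f) (hfk : IsStd (f ∘ adjSwap k)) :
    tabUnit q g (tabVec (f ∘ adjSwap k)) (tabVec (f ∘ adjSwap k)) *
      (baxter q g k (contents f) * baxter q g k (contents f)) *
      tabUnit q g (tabVec (f ∘ adjSwap k)) (tabVec (f ∘ adjSwap k)) =
      swapCoef q f k ^ 2 • (tabUnit q g (tabVec (f ∘ adjSwap k)) (tabVec (f ∘ adjSwap k)) *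
        tabUnit q g (tabVec (f ∘ adjSwap k)) (tabVec (f ∘ adjSwap k))) := by
  set e := tabUnit q g (tabVec (f ∘ adjSwap k)) (tabVec (f ∘ adjSwap k)) with he
  have hne : (⟨f, hf⟩ : Tab m) ≠ ⟨f ∘ adjSwap k, hfk⟩ := by
    intro h
    have := congrFun (congrArg Subtype.val h) k.lo
    simp only [Function.comp_apply, adjSwap_lo] at this
    exact k.lo_ne_hi (hf.inj this)
  have h0 : tabUnit q g (tabVec f) (tabVec (f ∘ adjSwap k)) * e = 0 :=
    tabUnit_mul_eq_zero hq hg hne _ fun j => by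
      rw [he, jucysMurphy_mul_tabUnit hq hg, jucysMurphy_tabMatrix hq j j.2 _ hfk,
        tabUnit_smul_right]
  rw [← mul_assoc e, he, tabUnit_mul_baxter hq hg k _ hf hfk, ← he, smul_mul_assoc,
    smul_mul_assoc, baxter, mul_add, mul_smul_comm, mul_smul_comm, mul_one,
    tabUnit_tabVec_mul hq hg k _ hf, ← he, add_mul, smul_mul_assoc, add_mul, smul_mul_assoc,
    smul_mul_assoc, smul_mul_assoc, h0, smul_zero, zero_add, smul_zero, add_zero, smul_smul,
    smul_smul, sq, swapCoef, contents]
  congr 1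
  simp only [contents]
  ring

end Fusion

end

section

/-! ### Standard tableaux of a fixed shape -/

section Shape

variable {q : ℂˣ} {μ : YoungDiagram}

theorem StdTableau.le_of_le (Λ : StdTableau μ) {k l : Fin μ.card}
    (h : (Λ.box k).1 ≤ (Λ.box l).1) : k ≤ l := by
  have hrow : ∀ {k l : Fin μ.card}, (Λ.box k).1.1 = (Λ.box l).1.1 →
      (Λ.box k).1.2 ≤ (Λ.box l).1.2 → k ≤ l := by
    intro k l h1 h2
    rcases h2.lt_or_eq with h2 | h2
    · exact (Λ.row_lt k l h1 h2).le
    · exact (Λ.box.injective (Subtype.ext (Prod.ext h1 h2))).le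
  have hcol : ∀ {k l : Fin μ.card}, (Λ.box k).1.2 = (Λ.box l).1.2 →
      (Λ.box k).1.1 ≤ (Λ.box l).1.1 → k ≤ l := by
    intro k l h1 h2
    rcases h2.lt_or_eq with h2 | h2
    · exact (Λ.col_lt k l h1 h2).le
    · exact (Λ.box.injective (Subtype.ext (Prod.ext h2 h1))).le
  have hmem : ((Λ.box k).1.1, (Λ.box l).1.2) ∈ μ.cells :=
    μ.isLowerSet (Prod.mk_le_mk.2 ⟨h.1, le_rfl⟩) (Λ.box l).2
  obtain ⟨p, hp⟩ := Λ.box.surjective ⟨_, hmem⟩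
  have hp' := congrArg Subtype.val hp
  have h1 : k ≤ p := hrow (by rw [hp']) (by rw [hp']; exact h.2)
  have h2 : p ≤ l := hcol (by rw [hp']) (by rw [hp']; exact h.1)
  exact h1.trans h2

/-- The sequence of boxes occupied by the numbers. -/
def StdTableau.toTab (Λ : StdTableau μ) : Tab μ.card :=
  ⟨fun k => (Λ.box k).1, {
    inj := fun _ _ h => Λ.box.injective (Subtype.ext h)
    lower := fun k b hb => by
      obtain ⟨p, hp⟩ := Λ.box.surjective ⟨b, μ.isLowerSet hb (Λ.box k).2⟩
      have hp' := congrArg Subtype.val hp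
      exact ⟨p, Λ.le_of_le (by rw [hp']; exact hb), hp'⟩ }⟩

theorem StdTableau.toTab_apply (Λ : StdTableau μ) (k : Fin μ.card) :
    Λ.toTab.1 k = (Λ.box k).1 := rfl

theorem StdTableau.toTab_injective : Function.Injective (StdTableau.toTab (μ := μ)) := by
  intro Λ Λ' h
  apply StdTableau.ext
  ext1 k
  exact Subtype.ext (congrFun (congrArg Subtype.val h) k)

theorem StdTableau.range_toTab (Λ : StdTableau μ) : Set.range Λ.toTab.1 = μ.cells := by
  ext b
  constructor
  · rintro ⟨k, rfl⟩
    exact (Λ.box k).2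
  · intro hb
    obtain ⟨p, hp⟩ := Λ.box.surjective ⟨b, hb⟩
    exact ⟨p, congrArg Subtype.val hp⟩

theorem exists_toTab_eq (K : Tab μ.card) (h : Set.range K.1 = μ.cells) :
    ∃ Λ : StdTableau μ, Λ.toTab = K := by
  have hmem : ∀ k, K.1 k ∈ μ.cells := fun k => by
    have : K.1 k ∈ (μ.cells : Set (ℕ × ℕ)) := h ▸ ⟨k, rfl⟩
    exact this
  let e : Fin μ.card ≃ μ.cells := Equiv.ofBijective (fun k => ⟨K.1 k, hmem k⟩)
    ⟨fun _ _ h => K.2.inj (congrArg Subtype.val h), fun b => by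
      obtain ⟨k, hk⟩ : b.1 ∈ Set.range K.1 := h ▸ b.2
      exact ⟨k, Subtype.ext hk⟩⟩
  refine ⟨⟨e, fun k l h1 h2 => ?_, fun k l h1 h2 => ?_⟩, rfl⟩
  · refine (K.2.le_of_le (Prod.le_def.2 ⟨h1.le, h2.le⟩)).lt_of_ne ?_
    rintro rfl
    exact lt_irrefl _ h2
  · refine (K.2.le_of_le (Prod.le_def.2 ⟨h2.le, h1.le⟩)).lt_of_ne ?_
    rintro rfl
    exact lt_irrefl _ h2

theorem youngMatrix_apply (k : HeckeIdx μ.card) (Γ Λ : StdTableau μ) :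
    youngMatrix q μ k Γ Λ = tabMatrix q k Γ.toTab Λ.toTab := by
  have h1 : Γ = Λ ↔ Γ.toTab = Λ.toTab := StdTableau.toTab_injective.eq_iff.symm
  have h2 : (∀ l, Γ.box l = Λ.box (adjSwap k l)) ↔ Γ.toTab.1 = Λ.toTab.1 ∘ adjSwap k := by
    rw [funext_iff]
    exact forall_congr' fun l => Subtype.ext_iff
  simp only [youngMatrix, tabMatrix, Matrix.of_apply, h1, h2]
  rfl

theorem prod_youngMatrix_apply (w : List (HeckeIdx μ.card)) : ∀ Γ Λ : StdTableau μ,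
    (w.map (youngMatrix q μ)).prod Γ Λ = tabWord q w Γ.toTab Λ.toTab := by
  induction w with
  | nil =>
    intro Γ Λ
    simp [tabWord, Matrix.one_apply, StdTableau.toTab_injective.eq_iff]
  | cons k w ih =>
    intro Γ Λ
    rw [tabWord, List.map_cons, List.prod_cons, List.map_cons, List.prod_cons, Matrix.mul_apply,
      Matrix.mul_apply]
    refine Finset.sum_of_injOn StdTableau.toTab StdTableau.toTab_injective.injOn
      (fun _ _ => Finset.mem_coe.2 (Finset.mem_univ _)) ?_ fun K _ => by
        rw [youngMatrix_apply, ih]; rfl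
    intro K _ hK
    by_contra hne
    have h := tabWord_range_eq (q := q) w (right_ne_zero_of_mul hne)
    obtain ⟨Δ, rfl⟩ := exists_toTab_eq K (h.trans Λ.range_toTab)
    exact hK ⟨Δ, Finset.mem_coe.2 (Finset.mem_univ _), rfl⟩

/-- Any two standard tableaux of the same shape are connected by adjacent transpositions. -/
theorem StdTableau.eq_of_swap {α : Type*} (F : StdTableau μ → α)
    (h : ∀ (Λ Γ : StdTableau μ) (k : HeckeIdx μ.card), Γ.toTab.1 = Λ.toTab.1 ∘ adjSwap k →
      F Λ = F Γ) (Λ Λ' : StdTableau μ) : F Λ = F Λ' := by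
  induction hN : invCount (Λ.box.trans Λ'.box.symm) using Nat.strong_induction_on generalizing Λ with
  | _ N ih =>
  by_cases h1 : (Λ.box.trans Λ'.box.symm : Equiv.Perm (Fin μ.card)) = 1
  · have : Λ = Λ' := by
      apply StdTableau.ext
      ext1 k
      have := DFunLike.congr_fun h1 k
      exact (Equiv.symm_apply_eq _).1 this
    rw [this]
  · set σ : Equiv.Perm (Fin μ.card) := Λ.box.trans Λ'.box.symm with hσ
    obtain ⟨k, hk⟩ := exists_desc (σ := σ⁻¹) (by simpa using h1)
    rw [inv_inv] at hk
    have hle : ¬ Λ.toTab.1 k.lo ≤ Λ.toTab.1 k.hi := by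
      intro hle
      have : σ k.lo ≤ σ k.hi := by
        apply Λ'.le_of_le
        simpa [hσ, ← StdTableau.toTab_apply] using hle
      exact absurd hk this.not_gt
    have hstd := Λ.toTab.2.comp_adjSwap_of_not_le k hle
    obtain ⟨Γ, hΓ⟩ := exists_toTab_eq (μ := μ) ⟨_, hstd⟩ (by
      rw [← Λ.range_toTab]
      exact (adjSwap k).surjective.range_comp Λ.toTab.1)
    have hΓ' : Γ.toTab.1 = Λ.toTab.1 ∘ adjSwap k := congrArg Subtype.val hΓ
    rw [h Λ Γ k hΓ']
    have e : (Γ.box.trans Λ'.box.symm : Equiv.Perm (Fin μ.card)) = σ * adjSwap k := by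
      ext1 i
      have : Γ.box i = Λ.box (adjSwap k i) := Subtype.ext (congrFun hΓ' i)
      simp [hσ, this]
    have hlt := invCount_mul_adjSwap' σ k hk
    exact ih _ (by rw [e]; omega) Γ rfl

theorem heckeAction_T (n m : ℕ) (q : ℂˣ) (k : HeckeIdx m) :
    heckeAction n m q (Hecke.T m q k) = RCheck n q k := by
  exact (RingQuot.liftAlgHom_mkAlgHom_apply ℂ (FreeAlgebra.lift ℂ (RCheck n q)) _ _).trans
    (FreeAlgebra.lift_ι_apply _ _)

theorem RCheck_isHecke (n m : ℕ) (q : ℂˣ) :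
    IsHecke q (RCheck n q : HeckeIdx m → Matrix (Fin m → Fin n) (Fin m → Fin n) ℂ) := by
  have := (Hecke.T_isHecke m q).map (heckeAction n m q)
  simpa only [heckeAction_T] using this

theorem EMat_eq (n : ℕ) (Λ : StdTableau μ) :
    EMat n q Λ = (schurElement q μ)⁻¹ •
      tabUnit q (RCheck n q) (tabVec Λ.toTab.1) (tabVec Λ.toTab.1) := by
  rw [EMat, primitiveIdempotent, map_smul, map_sum, tabUnit]
  congr 1
  refine Finset.sum_congr rfl fun σ _ => ?_
  rw [map_smul, dotProduct_mulVec_tabVec, Hecke.TPerm, alongReduced, prod_youngMatrix_apply]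
  have := map_alongReduced (heckeAction n μ.card q).toRingHom.toMonoidHom (Hecke.T μ.card q) σ
  congr 1
  refine this.trans ?_
  congr 1
  funext k
  exact heckeAction_T n μ.card q k

end Shape

end

section

/-! ### Operators on one and two tensor factors -/

section Sites

variable {n m : ℕ} {S : Type*} [Ring S]

theorem kronecker_one_mul_one_kronecker (M N : Matrix (Fin n) (Fin n) S) (s t : Fin n × Fin n) :
    ((M ⊗ₖ (1 : Matrix (Fin n) (Fin n) S)) * ((1 : Matrix (Fin n) (Fin n) S) ⊗ₖ N)) s t =
      M s.1 t.1 * N s.2 t.2 := by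
  simp [Matrix.mul_apply, Matrix.kroneckerMap_apply, Fintype.sum_prod_type, Matrix.one_apply]

theorem one_kronecker_mul_kronecker_one (M N : Matrix (Fin n) (Fin n) S) (s t : Fin n × Fin n) :
    (((1 : Matrix (Fin n) (Fin n) S) ⊗ₖ N) * (M ⊗ₖ (1 : Matrix (Fin n) (Fin n) S))) s t =
      N s.2 t.2 * M s.1 t.1 := by
  simp [Matrix.mul_apply, Matrix.kroneckerMap_apply, Fintype.sum_prod_type, Matrix.one_apply]

theorem agree_iff (a : Fin m) (w w' : Fin m → Fin n) :
    (∀ b, b ≠ a → w b = w' b) ↔ Function.update w a (w' a) = w' := by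
  rw [Function.update_eq_iff]
  simp

theorem sum_eq_sum_update (a : Fin m) (w : Fin m → Fin n) (F : (Fin m → Fin n) → S)
    (hF : ∀ u, ¬ (∀ b, b ≠ a → w b = u b) → F u = 0) :
    ∑ u, F u = ∑ i, F (Function.update w a i) := by
  symm
  refine Finset.sum_of_injOn (fun i => Function.update w a i)
    (Function.update_injective w a).injOn (fun _ _ => Finset.mem_coe.2 (Finset.mem_univ _)) ?_
    fun _ _ => rfl
  intro u _ hu
  refine hF u fun h => hu ⟨u a, Finset.mem_coe.2 (Finset.mem_univ _), (agree_iff a w u).1 h⟩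

theorem sum_eq_sum_update_update {a b : Fin m} (hab : a ≠ b) (w : Fin m → Fin n)
    (F : (Fin m → Fin n) → S) (hF : ∀ u, ¬ (∀ c, c ≠ a → c ≠ b → w c = u c) → F u = 0) :
    ∑ u, F u = ∑ s : Fin n × Fin n, F (Function.update (Function.update w a s.1) b s.2) := by
  symm
  refine Finset.sum_of_injOn (fun s : Fin n × Fin n =>
    Function.update (Function.update w a s.1) b s.2) ?_
    (fun _ _ => Finset.mem_coe.2 (Finset.mem_univ _)) ?_ fun _ _ => rfl
  · intro s _ t _ h
    have h1 := congrFun h a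
    have h2 := congrFun h b
    simp only [Function.update_self, Function.update_of_ne hab] at h1 h2
    exact Prod.ext h1 h2
  · intro u _ hu
    refine hF u fun h => hu ⟨(u a, u b), Finset.mem_coe.2 (Finset.mem_univ _), ?_⟩
    funext c
    by_cases hcb : c = b
    · subst hcb; simp
    · by_cases hca : c = a
      · subst hca; simp [hcb]
      · simp [hcb, hca, h c hca hcb]

theorem site_mul (a : Fin m) (X Y : Matrix (Fin n) (Fin n) S) :
    site a (X * Y) = site a X * site a Y := by
  ext w w'
  rw [Matrix.mul_apply, sum_eq_sum_update a w]
  · simp only [site, Matrix.of_apply, Function.update_self, Matrix.mul_apply]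
    have h1 : ∀ i, ∀ b, b ≠ a → w b = Function.update w a i b := fun i b hb => by
      rw [Function.update_of_ne hb]
    have h2 : ∀ i, (∀ b, b ≠ a → Function.update w a i b = w' b) ↔ ∀ b, b ≠ a → w b = w' b :=
      fun i => forall₂_congr fun b hb => by rw [Function.update_of_ne hb]
    simp only [h2, if_pos (h1 _)]
    split_ifs <;> simp
  · intro u hu
    rw [site, Matrix.of_apply, if_neg hu, zero_mul]

theorem site_one (a : Fin m) : site a (1 : Matrix (Fin n) (Fin n) S) = 1 := by
  ext w w'
  simp only [site, Matrix.of_apply, Matrix.one_apply]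
  by_cases h : w = w'
  · simp [h]
  · rw [if_neg h]
    split_ifs with h1 h2
    · refine absurd (funext fun b => ?_) h
      by_cases hb : b = a
      · rw [hb, h2]
      · exact h1 b hb
    · rfl
    · rfl

theorem site_scalar (a : Fin m) (x : S) :
    site a (Matrix.scalar (Fin n) x) = Matrix.scalar (Fin m → Fin n) x := by
  have h := site_one (S := S) (n := n) a
  ext w w'
  have h' := congrFun (congrFun h w) w'
  simp only [site, Matrix.of_apply, Matrix.one_apply, Matrix.scalar_apply,
    Matrix.diagonal_apply] at h' ⊢
  by_cases hw : w = w'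
  · simp [hw]
  · rw [if_neg hw] at h' ⊢
    split_ifs with h1 h2
    · have : w = w' := funext fun b => by
        by_cases hb : b = a
        · rw [hb, h2]
        · exact h1 b hb
      exact absurd this hw
    · rfl
    · rfl

theorem site_map {S' : Type*} [Ring S'] (φ : S →+* S') (a : Fin m)
    (X : Matrix (Fin n) (Fin n) S) : (site a X).map φ = site a (X.map φ) := by
  ext w w'
  simp only [site, Matrix.map_apply, Matrix.of_apply]
  split_ifs <;> simp

theorem twoSite_map {S' : Type*} [Ring S'] (φ : S →+* S') (a b : Fin m)
    (X : Matrix (Fin n × Fin n) (Fin n × Fin n) S) :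
    (twoSite a b X).map φ = twoSite a b (X.map φ) := by
  ext w w'
  simp only [twoSite, Matrix.map_apply, Matrix.of_apply]
  split_ifs <;> simp

theorem twoSite_mul {a b : Fin m} (hab : a ≠ b) (X Y : Matrix (Fin n × Fin n) (Fin n × Fin n) S) :
    twoSite a b (X * Y) = twoSite a b X * twoSite a b Y := by
  ext w w'
  rw [Matrix.mul_apply, sum_eq_sum_update_update hab w]
  · simp only [twoSite, Matrix.of_apply, Function.update_self, Matrix.mul_apply,
      Function.update_of_ne hab]
    have h1 : ∀ s : Fin n × Fin n, ∀ c, c ≠ a → c ≠ b →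
        w c = Function.update (Function.update w a s.1) b s.2 c := fun s c ha hb => by
      rw [Function.update_of_ne hb, Function.update_of_ne ha]
    have h2 : ∀ s : Fin n × Fin n, (∀ c, c ≠ a → c ≠ b →
        Function.update (Function.update w a s.1) b s.2 c = w' c) ↔
          ∀ c, c ≠ a → c ≠ b → w c = w' c :=
      fun s => forall₃_congr fun c ha hb => by
        rw [Function.update_of_ne hb, Function.update_of_ne ha]
    simp only [h2, if_pos (h1 _)]
    split_ifs <;> simp
  · intro u hu
    rw [twoSite, Matrix.of_apply, if_neg hu, zero_mul]

theorem twoSite_add (a b : Fin m) (X Y : Matrix (Fin n × Fin n) (Fin n × Fin n) S) :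
    twoSite a b (X + Y) = twoSite a b X + twoSite a b Y := by
  ext w w'
  simp only [twoSite, Matrix.of_apply, Matrix.add_apply]
  split_ifs <;> simp

theorem twoSite_smul {R : Type*} [Monoid R] [DistribMulAction R S] (a b : Fin m) (c : R)
    (X : Matrix (Fin n × Fin n) (Fin n × Fin n) S) :
    twoSite a b (c • X) = c • twoSite a b X := by
  ext w w'
  simp only [twoSite, Matrix.of_apply, Matrix.smul_apply]
  split_ifs <;> simp

theorem twoSite_kronecker_one {a b : Fin m} (hab : a ≠ b) (X : Matrix (Fin n) (Fin n) S) :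
    twoSite a b (X ⊗ₖ (1 : Matrix (Fin n) (Fin n) S)) = site a X := by
  ext w w'
  simp only [twoSite, site, Matrix.of_apply, Matrix.kroneckerMap_apply, Matrix.one_apply]
  by_cases hb : w b = w' b
  · have : (∀ c, c ≠ a → c ≠ b → w c = w' c) ↔ ∀ c, c ≠ a → w c = w' c :=
      ⟨fun h c hc => by
        by_cases hcb : c = b
        · rw [hcb, hb]
        · exact h c hc hcb, fun h c hc _ => h c hc⟩
    simp [this, hb]
  · have : ¬ ∀ c, c ≠ a → w c = w' c := fun h => hb (h b hab.symm)
    simp [this, hb]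

theorem twoSite_one_kronecker {a b : Fin m} (hab : a ≠ b) (X : Matrix (Fin n) (Fin n) S) :
    twoSite a b ((1 : Matrix (Fin n) (Fin n) S) ⊗ₖ X) = site b X := by
  ext w w'
  simp only [twoSite, site, Matrix.of_apply, Matrix.kroneckerMap_apply, Matrix.one_apply]
  by_cases ha : w a = w' a
  · have : (∀ c, c ≠ a → c ≠ b → w c = w' c) ↔ ∀ c, c ≠ b → w c = w' c :=
      ⟨fun h c hc => by
        by_cases hca : c = a
        · rw [hca, ha]
        · exact h c hca hc, fun h c _ hc => h c hc⟩
    simp [this, ha]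
  · have : ¬ ∀ c, c ≠ b → w c = w' c := fun h => ha (h a hab)
    simp [this, ha]

theorem twoSite_one {a b : Fin m} (hab : a ≠ b) :
    twoSite a b (1 : Matrix (Fin n × Fin n) (Fin n × Fin n) S) = 1 := by
  rw [← Matrix.one_kronecker_one, twoSite_kronecker_one hab, site_one]

theorem site_commute {a b : Fin m} (hab : a ≠ b) {M N : Matrix (Fin n) (Fin n) S}
    (h : ∀ i j k l, Commute (M i j) (N k l)) : Commute (site a M) (site b N) := by
  rw [← twoSite_kronecker_one hab, ← twoSite_one_kronecker hab, Commute, SemiconjBy,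
    ← twoSite_mul hab, ← twoSite_mul hab]
  congr 1
  ext s t
  rw [kronecker_one_mul_one_kronecker, one_kronecker_mul_kronecker_one, (h _ _ _ _).eq]

/-- Operators on disjoint pairs of factors commute if one of them is scalar. -/
theorem site_mul_twoSite_comm {a b c : Fin m} (hac : c ≠ a) (hbc : c ≠ b) (hab : a ≠ b)
    {M : Matrix (Fin n) (Fin n) S} {C : Matrix (Fin n × Fin n) (Fin n × Fin n) S}
    (h : ∀ i j s t, Commute (M i j) (C s t)) : Commute (site c M) (twoSite a b C) := by
  ext w w'
  rw [Matrix.mul_apply, Matrix.mul_apply, sum_eq_sum_update c w, sum_eq_sum_update_update hab w]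
  · have e1 : ∀ i, site c M w (Function.update w c i) = M (w c) i := fun i => by
      rw [site, Matrix.of_apply, if_pos fun b hb => (Function.update_of_ne hb _ _).symm,
        Function.update_self]
    have e2 : ∀ s : Fin n × Fin n, twoSite a b C w
        (Function.update (Function.update w a s.1) b s.2) = C (w a, w b) s := fun s => by
      rw [twoSite, Matrix.of_apply, if_pos, Function.update_self, Function.update_of_ne hab,
        Function.update_self]
      intro d hd hd'
      rw [Function.update_of_ne hd', Function.update_of_ne hd]
    simp only [e1, e2]
    simp only [site, twoSite, Matrix.of_apply]
    by_cases hw : ∀ d, d ≠ a → d ≠ b → d ≠ c → w d = w' d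
    · rw [Finset.sum_eq_single (w' c), Finset.sum_eq_single (w' a, w' b)]
      · rw [if_pos, if_pos]
        · simp only [Function.update_of_ne hac.symm, Function.update_of_ne hbc.symm,
            Function.update_of_ne hac, Function.update_of_ne hbc]
          exact (h _ _ _ _).eq
        · intro d hd
          by_cases h1 : d = b
          · subst h1; simp
          · by_cases h2 : d = a
            · subst h2; simp [h1]
            · simp [h1, h2, hw d h2 h1 hd]
        · intro d h2 h1
          by_cases hd : d = c
          · subst hd; simp
          · simp [hd, hw d h2 h1 hd]
      · rintro ⟨i, j⟩ _ hs
        rw [if_neg, mul_zero]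
        intro hd
        apply hs
        have h1 := hd a hac.symm
        have h2 := hd b hbc.symm
        simp only [Function.update_self, Function.update_of_ne hab] at h1 h2
        rw [h1, h2]
      · exact fun h => absurd (Finset.mem_univ _) h
      · intro i _ hi
        rw [if_neg, mul_zero]
        intro hd
        have h1 := hd c hac hbc
        rw [Function.update_self] at h1
        exact hi h1
      · exact fun h => absurd (Finset.mem_univ _) h
    · rw [Finset.sum_eq_zero, Finset.sum_eq_zero]
      · intro s _
        rw [if_neg, mul_zero]
        intro hd
        apply hw
        intro d h1 h2 h3
        have := hd d h3
        rwa [Function.update_of_ne h2, Function.update_of_ne h1] at this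
      · intro i _
        rw [if_neg, mul_zero]
        intro hd
        apply hw
        intro d h1 h2 h3
        have := hd d h1 h2
        rwa [Function.update_of_ne h3] at this
  · intro u hu
    rw [twoSite, Matrix.of_apply, if_neg hu, zero_mul]
  · intro u hu
    rw [site, Matrix.of_apply, if_neg hu, zero_mul]

/-- The entries of a product of operators acting in different factors. -/
theorem prod_site_apply (X : Fin m → Matrix (Fin n) (Fin n) S) :
    ∀ (l : List (Fin m)), l.Nodup → ∀ w w' : Fin m → Fin n,
      (l.map fun a => site a (X a)).prod w w' =
        if ∀ b, b ∉ l → w b = w' b then (l.map fun a => X a (w a) (w' a)).prod else 0 := by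
  intro l
  induction l with
  | nil =>
    intro _ w w'
    simp [Matrix.one_apply, funext_iff]
  | cons a l ih =>
    intro hl w w'
    obtain ⟨ha, hl⟩ := List.nodup_cons.1 hl
    rw [List.map_cons, List.prod_cons, Matrix.mul_apply, sum_eq_sum_update a w]
    · have e1 : ∀ i, site a (X a) w (Function.update w a i) = X a (w a) i := fun i => by
        rw [site, Matrix.of_apply, if_pos fun b hb => (Function.update_of_ne hb _ _).symm,
          Function.update_self]
      simp only [e1, ih hl]
      rw [Finset.sum_eq_single (w' a)]
      · have h1 : (∀ b, b ∉ l → Function.update w a (w' a) b = w' b) ↔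
            ∀ b, b ∉ a :: l → w b = w' b := by
          refine ⟨fun h b hb => ?_, fun h b hb => ?_⟩
          · rw [List.mem_cons, not_or] at hb
            have := h b hb.2
            rwa [Function.update_of_ne hb.1] at this
          · by_cases hba : b = a
            · subst hba; simp
            · rw [Function.update_of_ne hba]
              exact h b (by simp [hb, hba])
        simp only [h1, List.map_cons, List.prod_cons]
        split_ifs
        · congr 2
          refine List.map_congr_left fun b hb => ?_
          rw [Function.update_of_ne]
          rintro rfl
          exact ha hb
        · simp
      · intro i _ hi
        rw [if_neg, mul_zero]
        intro h
        have := h a ha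
        rw [Function.update_self] at this
        exact hi this
      · exact fun h => absurd (Finset.mem_univ _) h
    · intro u hu
      rw [site, Matrix.of_apply, if_neg hu, zero_mul]

end Sites

end

section

/-! ### The Yang–Baxter equation -/

section Flip

variable {n m : ℕ} {S : Type*} [Ring S] [Algebra ℂ S]

/-- The operator exchanging two tensor factors, with coefficients in an algebra. -/
def flip (n : ℕ) (S : Type*) [Ring S] [Algebra ℂ S] :
    Matrix (Fin n × Fin n) (Fin n × Fin n) S := (PMat n).map (algebraMap ℂ S)

theorem flip_apply (s t : Fin n × Fin n) : flip n S s t = if t = s.swap then 1 else 0 := by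
  have : (s.1 = t.2 ∧ s.2 = t.1) ↔ t = s.swap := by
    rw [Prod.ext_iff]
    simp only [Prod.fst_swap, Prod.snd_swap]
    tauto
  simp only [flip, Matrix.map_apply, PMat, Matrix.of_apply, this]
  split_ifs <;> simp

theorem flip_mul (M : Matrix (Fin n × Fin n) (Fin n × Fin n) S) :
    flip n S * M = M.submatrix Prod.swap id := by
  ext s t
  simp [Matrix.mul_apply, flip_apply]

theorem mul_flip (M : Matrix (Fin n × Fin n) (Fin n × Fin n) S) :
    M * flip n S = M.submatrix id Prod.swap := by
  ext s t
  have : ∀ u : Fin n × Fin n, t = u.swap ↔ u = t.swap := fun u => by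
    constructor <;> (rintro rfl; simp)
  simp [Matrix.mul_apply, flip_apply, this]

theorem flip_mul_flip : flip n S * flip n S = 1 := by
  rw [flip_mul]
  ext s t
  have : t = s ↔ s = t := eq_comm
  simp [flip_apply, Matrix.one_apply, this]

theorem flip_mul_one_kronecker_mul (M N : Matrix (Fin n) (Fin n) S) :
    flip n S * (((1 : Matrix (Fin n) (Fin n) S) ⊗ₖ N) * (M ⊗ₖ (1 : Matrix (Fin n) (Fin n) S))) =
      (N ⊗ₖ (1 : Matrix (Fin n) (Fin n) S)) * ((1 : Matrix (Fin n) (Fin n) S) ⊗ₖ M) * flip n S := by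
  rw [flip_mul, mul_flip]
  ext s t
  simp only [Matrix.submatrix_apply, id, one_kronecker_mul_kronecker_one,
    kronecker_one_mul_one_kronecker, Prod.fst_swap, Prod.snd_swap]

theorem twoSite_flip_apply (a b : Fin m) (w w' : Fin m → Fin n) :
    twoSite a b (flip n S) w w' = if w' = w ∘ Equiv.swap a b then 1 else 0 := by
  have h := congrFun (twoSite_PMat_mulVec a b w') w
  rw [Matrix.mulVec_single_one, Matrix.col_apply, Pi.single_apply] at h
  have h2 : w = w' ∘ Equiv.swap a b ↔ w' = w ∘ Equiv.swap a b := by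
    constructor <;> (rintro rfl; funext c; simp)
  rw [flip, ← twoSite_map, Matrix.map_apply, h, if_congr h2 rfl rfl]
  split_ifs <;> simp

theorem twoSite_flip_mul_mul (a b : Fin m) (M : Matrix (Fin m → Fin n) (Fin m → Fin n) S) :
    twoSite a b (flip n S) * M * twoSite a b (flip n S) =
      M.submatrix (· ∘ Equiv.swap a b) (· ∘ Equiv.swap a b) := by
  ext w w'
  have : ∀ u : Fin m → Fin n, w' = u ∘ Equiv.swap a b ↔ u = w' ∘ Equiv.swap a b := fun u => by
    constructor <;> (rintro rfl; funext c; simp)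
  simp [Matrix.mul_apply, twoSite_flip_apply, this]

theorem twoSite_conj (a b c d : Fin m) (C : Matrix (Fin n × Fin n) (Fin n × Fin n) S) :
    twoSite a b (flip n S) * twoSite c d C * twoSite a b (flip n S) =
      twoSite (Equiv.swap a b c) (Equiv.swap a b d) C := by
  rw [twoSite_flip_mul_mul]
  ext w w'
  simp only [twoSite, Matrix.submatrix_apply, Matrix.of_apply, Function.comp_apply]
  congr 1
  rw [eq_iff_iff, (Equiv.swap a b).forall_congr_left]
  refine forall_congr' fun e => ?_
  simp only [ne_eq, Equiv.symm_swap, Equiv.swap_apply_self, Equiv.swap_apply_eq_iff]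

end Flip

theorem yang_baxter_of_hecke {K A : Type*} [CommRing K] [Ring A] [Algebra K A] {S T : A} {h : K}
    (hS : S * S = 1 + h • S) (hT : T * T = 1 + h • T) (hb : S * T * S = T * S * T)
    (u v u' v' : K) :
    ((v' - u') • S + (h * u') • (1 : A)) * ((v * v' - u * u') • T + (h * (u * u')) • (1 : A)) *
        ((v - u) • S + (h * u) • (1 : A)) =
      ((v - u) • T + (h * u) • (1 : A)) * ((v * v' - u * u') • S + (h * (u * u')) • (1 : A)) *
        ((v' - u') • T + (h * u') • (1 : A)) := by
  simp only [add_mul, mul_add, smul_mul_assoc, mul_smul_comm, smul_smul, mul_one, one_mul, hS, hT,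
    hb, smul_add]
  match_scalars <;> ring

section YangBaxter

variable {n m : ℕ} {K : Type*} [CommRing K] [Algebra ℂ K] {q : ℂˣ}

/-- The polynomial `R`-matrix `(v - u) R + u (q - q⁻¹) P`. -/
def rPoly (n : ℕ) (q : ℂˣ) (u v : K) : Matrix (Fin n × Fin n) (Fin n × Fin n) K :=
  (v - u) • (RFin n q).map (algebraMap ℂ K) + (algebraMap ℂ K (qDiff q) * u) • flip n K

theorem rPoly_mul (c u v : K) : rPoly n q (c * u) (c * v) = c • rPoly n q u v := by
  rw [rPoly, rPoly, smul_add, smul_smul, smul_smul]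
  congr 2
  · ring
  · ring

/-- The braid form of the polynomial `R`-matrix. -/
def rCheck (n : ℕ) (q : ℂˣ) (k : HeckeIdx m) (u v : K) :
    Matrix (Fin m → Fin n) (Fin m → Fin n) K :=
  (v - u) • (RCheck n q k).map (algebraMap ℂ K) + (algebraMap ℂ K (qDiff q) * u) • 1

theorem map_RCheck {S : Type*} [Ring S] [Algebra ℂ S] (k : HeckeIdx m) :
    (RCheck n q k).map (algebraMap ℂ S) =
      twoSite k.lo k.hi (flip n S * (RFin n q).map (algebraMap ℂ S)) := by
  rw [RCheck, Matrix.map_mul, twoSite_map, twoSite_map, ← twoSite_mul k.lo_ne_hi, flip]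

theorem rCheck_eq (k : HeckeIdx m) (u v : K) :
    rCheck n q k u v = twoSite k.lo k.hi (flip n K * rPoly n q u v) := by
  rw [rPoly, mul_add, mul_smul_comm, mul_smul_comm, flip_mul_flip, twoSite_add, twoSite_smul,
    twoSite_smul, twoSite_one k.lo_ne_hi, ← map_RCheck, rCheck]

theorem map_RCheck_isHecke (n m : ℕ) (q : ℂˣ) (S : Type*) [Ring S] [Algebra ℂ S] :
    IsHecke q fun k : HeckeIdx m => (RCheck n q k).map (algebraMap ℂ S) :=
  (RCheck_isHecke n m q).map (Algebra.ofId ℂ S).mapMatrix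

theorem rCheck_yang_baxter (k l : HeckeIdx m) (hkl : l.1 = k.1 + 1) (u v u' v' : K) :
    rCheck n q k u' v' * rCheck n q l (u * u') (v * v') * rCheck n q k u v =
      rCheck n q l u v * rCheck n q k (u * u') (v * v') * rCheck n q l u' v' := by
  have hH := map_RCheck_isHecke n m q K
  have hs : ∀ j : HeckeIdx m, (RCheck n q j).map (algebraMap ℂ K) *
      (RCheck n q j).map (algebraMap ℂ K) =
        1 + algebraMap ℂ K (qDiff q) • (RCheck n q j).map (algebraMap ℂ K) := fun j => by
    rw [hH.sq j, algebraMap_smul]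
  exact yang_baxter_of_hecke (hs k) (hs l) (hH.braid k l hkl) u v u' v'

/-- The Yang–Baxter equation. -/
theorem rPoly_yang_baxter (u v u' v' : K) :
    twoSite (m := 3) 0 1 (rPoly n q u v) * twoSite 0 2 (rPoly n q (u * u') (v * v')) *
        twoSite 1 2 (rPoly n q u' v') =
      twoSite 1 2 (rPoly n q u' v') * twoSite 0 2 (rPoly n q (u * u') (v * v')) *
        twoSite 0 1 (rPoly n q u v) := by
  let k : HeckeIdx 3 := ⟨0, by omega⟩
  let l : HeckeIdx 3 := ⟨1, by omega⟩
  have hb := rCheck_yang_baxter (n := n) (q := q) k l rfl u v u' v'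
  have hk : ∀ u v : K, rCheck n q k u v =
      twoSite 0 1 (flip n K) * twoSite 0 1 (rPoly n q u v) := fun u v => by
    rw [rCheck_eq, twoSite_mul k.lo_ne_hi]; rfl
  have hl : ∀ u v : K, rCheck n q l u v =
      twoSite 1 2 (flip n K) * twoSite 1 2 (rPoly n q u v) := fun u v => by
    rw [rCheck_eq, twoSite_mul l.lo_ne_hi]; rfl
  have c1 := fun C => twoSite_conj (n := n) (S := K) (0 : Fin 3) 1 0 2 C
  have c2 := fun C => twoSite_conj (n := n) (S := K) (1 : Fin 3) 2 0 2 C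
  have c3 := fun C => twoSite_conj (n := n) (S := K) (0 : Fin 3) 1 1 2 C
  have c4 := fun C => twoSite_conj (n := n) (S := K) (1 : Fin 3) 2 0 1 C
  have s1 : Equiv.swap (0 : Fin 3) 1 0 = 1 := by decide
  have s2 : Equiv.swap (0 : Fin 3) 1 2 = 2 := by decide
  have s3 : Equiv.swap (1 : Fin 3) 2 0 = 0 := by decide
  have s4 : Equiv.swap (1 : Fin 3) 2 2 = 1 := by decide
  have s5 : Equiv.swap (0 : Fin 3) 1 1 = 0 := by decide
  have s6 : Equiv.swap (1 : Fin 3) 2 1 = 2 := by decide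
  simp only [s1, s2, s3, s4, s5, s6] at c1 c2 c3 c4
  have hPQP := (c3 (flip n K)).trans (c4 (flip n K)).symm
  set P := twoSite (0 : Fin 3) 1 (flip n K)
  set Q := twoSite (1 : Fin 3) 2 (flip n K)
  have hP : P * P = 1 := by
    rw [← twoSite_mul (by decide), flip_mul_flip, twoSite_one (by decide)]
  have hQ : Q * Q = 1 := by
    rw [← twoSite_mul (by decide), flip_mul_flip, twoSite_one (by decide)]
  rw [hk, hk, hk, hl, hl, hl] at hb
  set a := rPoly n q u v
  set b := rPoly n q (u * u') (v * v')
  set c := rPoly n q u' v'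
  have m1 : twoSite 0 1 c * Q = Q * twoSite 0 2 c := by
    rw [← c4 c, mul_assoc Q, ← mul_assoc Q Q, hQ, one_mul]
  have m2 : twoSite 1 2 b * P = P * twoSite 0 2 b := by
    rw [← c3 b, mul_assoc P, ← mul_assoc P P, hP, one_mul]
  have m3 : twoSite 0 2 c * P = P * twoSite 1 2 c := by
    rw [← c1 c, mul_assoc P, ← mul_assoc P P, hP, one_mul]
  have m4 : twoSite 1 2 a * P = P * twoSite 0 2 a := by
    rw [← c3 a, mul_assoc P, ← mul_assoc P P, hP, one_mul]
  have m5 : twoSite 0 1 b * Q = Q * twoSite 0 2 b := by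
    rw [← c4 b, mul_assoc Q, ← mul_assoc Q Q, hQ, one_mul]
  have m6 : twoSite 0 2 a * Q = Q * twoSite 0 1 a := by
    rw [← c2 a, mul_assoc Q, ← mul_assoc Q Q, hQ, one_mul]
  have hl' : P * twoSite 0 1 c * (Q * twoSite 1 2 b) * (P * twoSite 0 1 a) =
      P * Q * P * (twoSite 1 2 c * twoSite 0 2 b * twoSite 0 1 a) := by
    calc _ = P * (twoSite 0 1 c * Q) * (twoSite 1 2 b * P) * twoSite 0 1 a := by
          simp only [mul_assoc]
      _ = P * Q * (twoSite 0 2 c * P) * twoSite 0 2 b * twoSite 0 1 a := by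
          rw [m1, m2]; simp only [mul_assoc]
      _ = _ := by rw [m3]; simp only [mul_assoc]
  have hr' : Q * twoSite 1 2 a * (P * twoSite 0 1 b) * (Q * twoSite 1 2 c) =
      P * Q * P * (twoSite 0 1 a * twoSite 0 2 b * twoSite 1 2 c) := by
    calc _ = Q * (twoSite 1 2 a * P) * (twoSite 0 1 b * Q) * twoSite 1 2 c := by
          simp only [mul_assoc]
      _ = Q * P * (twoSite 0 2 a * Q) * twoSite 0 2 b * twoSite 1 2 c := by
          rw [m4, m5]; simp only [mul_assoc]
      _ = _ := by rw [m6, hPQP]; simp only [mul_assoc]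
  rw [hl', hr'] at hb
  have hu : P * Q * P * (P * Q * P) = 1 := by
    rw [mul_assoc, ← mul_assoc P (P * Q) P, ← mul_assoc P P Q, hP, one_mul, mul_assoc P Q,
      ← mul_assoc Q Q, hQ, one_mul, hP]
  have := congrArg (P * Q * P * ·) hb
  simp only [← mul_assoc (P * Q * P) (P * Q * P), hu, one_mul] at this
  exact this.symm

end YangBaxter

end

section

/-! ### Inversion and crossing symmetry of the R-matrix -/

section Crossing

variable {n : ℕ} {K : Type*} [CommRing K] [Algebra ℂ K] {q : ℂˣ}

/-- The diagonal entries of the polynomial `R`-matrix. -/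
def rDiag (q : ℂˣ) (u v : K) (i j : Fin n) : K :=
  if i = j then algebraMap ℂ K q * v - algebraMap ℂ K (q : ℂ)⁻¹ * u else v - u

/-- The off-diagonal entries of the polynomial `R`-matrix. -/
def rOff (q : ℂˣ) (u v : K) (i j : Fin n) : K :=
  if i < j then algebraMap ℂ K (qDiff q) * v
  else if j < i then algebraMap ℂ K (qDiff q) * u else 0

theorem rOff_self (u v : K) (i : Fin n) : rOff q u v i i = 0 := by simp [rOff]

theorem rPoly_apply (u v : K) (s t : Fin n × Fin n) :
    rPoly n q u v s t = (if t = s then rDiag q u v s.1 s.2 else 0) +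
      (if t = s.swap then rOff q u v s.1 s.2 else 0) := by
  have hd : algebraMap ℂ K (qDiff q) = algebraMap ℂ K q - algebraMap ℂ K (q : ℂ)⁻¹ := map_sub _ _ _
  obtain ⟨i, j⟩ := s
  rw [rPoly, Matrix.add_apply, Matrix.smul_apply, Matrix.smul_apply, flip_apply, Matrix.map_apply]
  simp only [RFin, Matrix.of_apply, rDiag, rOff, smul_eq_mul, Prod.swap_prod_mk]
  have hsw : (i = t.2 ∧ j = t.1 ∧ i < j) ↔ (t = (j, i) ∧ i < j) := by
    rw [Prod.ext_iff]; simp only; tauto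
  rw [if_congr hsw rfl rfl, if_congr (eq_comm (a := (i, j)) (b := t)) rfl rfl]
  rcases lt_trichotomy i j with h | h | h
  · by_cases h1 : t = (i, j)
    · subst h1
      simp [h.ne, h.ne']
    · by_cases h2 : t = (j, i)
      · subst h2
        simp only [h, h1, if_true, if_false, and_self, qDiff]
        push_cast [map_sub]
        ring
      · simp [h1, h2]
  · subst h
    by_cases h1 : t = (i, i)
    · subst h1
      simp only [if_true, lt_irrefl, if_false, hd]
      ring
    · simp [h1]
  · by_cases h1 : t = (i, j)
    · subst h1
      simp [h.ne, h.ne']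
    · by_cases h2 : t = (j, i)
      · subst h2
        simp [h, h1, h.not_gt]
      · simp [h1, h2]

theorem rPoly_mul_apply (u v : K) (M : Matrix (Fin n × Fin n) (Fin n × Fin n) K)
    (s t : Fin n × Fin n) : (rPoly n q u v * M) s t =
      rDiag q u v s.1 s.2 * M s t + rOff q u v s.1 s.2 * M s.swap t := by
  simp [Matrix.mul_apply, rPoly_apply, add_mul, Finset.sum_add_distrib]

theorem qDiff_inv : qDiff q⁻¹ = -qDiff q := by
  simp [qDiff]

theorem rPoly_mul_rPoly_inv (u v : K) : rPoly n q u v * rPoly n q⁻¹ u v =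
    ((algebraMap ℂ K q * v - algebraMap ℂ K (q : ℂ)⁻¹ * u) *
      (algebraMap ℂ K (q : ℂ)⁻¹ * v - algebraMap ℂ K q * u)) • 1 := by
  have hq : algebraMap ℂ K q * algebraMap ℂ K (q : ℂ)⁻¹ = 1 := by
    rw [← map_mul, mul_inv_cancel₀ q.ne_zero, map_one]
  ext s t
  obtain ⟨i, j⟩ := s
  rw [rPoly_mul_apply, rPoly_apply, rPoly_apply, Matrix.smul_apply, Matrix.one_apply,
    smul_eq_mul, Prod.swap_swap, if_congr (eq_comm (a := (i, j)) (b := t)) rfl rfl]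
  simp only [rDiag, rOff, qDiff_inv, Units.val_inv_eq_inv_val, inv_inv, Prod.swap_prod_mk, map_neg]
  set h := algebraMap ℂ K (qDiff q) with hh
  have hd : h = algebraMap ℂ K q - algebraMap ℂ K (q : ℂ)⁻¹ := map_sub _ _ _
  generalize algebraMap ℂ K q = a at *
  generalize algebraMap ℂ K (q : ℂ)⁻¹ = b at *
  rcases lt_trichotomy i j with hij | hij | hij
  · by_cases h1 : t = (i, j)
    · subst h1
      simp only [hij, hij.ne, hij.ne', hij.not_gt, Prod.mk.injEq, if_true, if_false, and_self]
      grind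
    · by_cases h2 : t = (j, i)
      · subst h2
        simp only [hij, hij.ne, hij.ne', hij.not_gt, Prod.mk.injEq, if_true, if_false, and_self]
        ring
      · simp [h1, h2]
  · subst hij
    by_cases h1 : t = (i, i)
    · subst h1
      simp
    · simp [h1]
  · by_cases h1 : t = (i, j)
    · subst h1
      simp only [hij, hij.ne, hij.ne', hij.not_gt, Prod.mk.injEq, if_true, if_false, and_self]
      grind
    · by_cases h2 : t = (j, i)
      · subst h2
        simp only [hij, hij.ne, hij.ne', hij.not_gt, Prod.mk.injEq, if_true, if_false, and_self]
        ring
      · simp [h1, h2]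

/-- The diagonal entries of `D`. -/
def dEntry (n : ℕ) (q : ℂˣ) (i : Fin n) : ℂ := (q : ℂ) ^ ((n : ℤ) - 1 - 2 * (i : ℤ))

theorem sum_dEntry_lt (n : ℕ) (q : ℂˣ) {j : ℕ} (hj : j ≤ n) :
    ∑ u : Fin n, (if (u : ℕ) < j then qDiff q * dEntry n q u else 0) =
      (q : ℂ) ^ (n : ℤ) - (q : ℂ) ^ ((n : ℤ) - 2 * j) := by
  have h1 := Fin.sum_univ_eq_sum_range
    (fun u => if u < j then qDiff q * (q : ℂ) ^ ((n : ℤ) - 1 - 2 * (u : ℤ)) else 0) n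
  have h2 : ∑ u ∈ Finset.range n,
      (if u < j then qDiff q * (q : ℂ) ^ ((n : ℤ) - 1 - 2 * (u : ℤ)) else 0) =
      ∑ u ∈ Finset.range j, ((q : ℂ) ^ ((n : ℤ) - 2 * (u : ℕ)) -
        (q : ℂ) ^ ((n : ℤ) - 2 * ((u + 1 : ℕ) : ℤ))) := by
    rw [← Finset.sum_filter]
    have : (Finset.range n).filter (· < j) = Finset.range j := by
      ext u; simp only [Finset.mem_filter, Finset.mem_range]; omega
    rw [this]
    refine Finset.sum_congr rfl fun u _ => ?_
    rw [qDiff, sub_mul]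
    congr 1
    · rw [← zpow_one_add₀ q.ne_zero]; congr 1; ring
    · rw [← zpow_neg_one, ← zpow_add₀ q.ne_zero]; congr 1; push_cast; ring
  refine h1.trans (h2.trans ?_)
  rw [Finset.sum_range_sub' (fun u : ℕ => (q : ℂ) ^ ((n : ℤ) - 2 * (u : ℤ)))]
  simp

/-- The scalar identity behind the crossing symmetry. -/
theorem crossing_scalar (x : K) (k l : Fin n) :
    rDiag q⁻¹ x 1 k k * rOff q (algebraMap ℂ K (q ^ (2 * n) : ℂ) * x) 1 k l *
        algebraMap ℂ K (dEntry n q k) +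
      rOff q⁻¹ x 1 k l * rDiag q (algebraMap ℂ K (q ^ (2 * n) : ℂ) * x) 1 l l *
        algebraMap ℂ K (dEntry n q l) +
      ∑ u, rOff q⁻¹ x 1 k u * rOff q (algebraMap ℂ K (q ^ (2 * n) : ℂ) * x) 1 u l *
        algebraMap ℂ K (dEntry n q u) =
    if k = l then ((1 - x) * (1 - algebraMap ℂ K (q ^ (2 * n) : ℂ) * x) -
      rDiag q⁻¹ x 1 k k * rDiag q (algebraMap ℂ K (q ^ (2 * n) : ℂ) * x) 1 k k) *
        algebraMap ℂ K (dEntry n q k) else 0 := by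
  set L : ℕ → K := fun j => ∑ u : Fin n,
    (if (u : ℕ) < j then algebraMap ℂ K (qDiff q) * algebraMap ℂ K (dEntry n q u) else 0) with hL
  have hLv : ∀ j, j ≤ n → L j = algebraMap ℂ K ((q : ℂ) ^ (n : ℤ)) -
      algebraMap ℂ K ((q : ℂ) ^ ((n : ℤ) - 2 * j)) := by
    intro j hj
    rw [← map_sub, ← sum_dEntry_lt n q hj, map_sum]
    refine Finset.sum_congr rfl fun u _ => ?_
    split_ifs <;> simp
  set h := algebraMap ℂ K (qDiff q) with hh
  have hd : h = algebraMap ℂ K q - algebraMap ℂ K (q : ℂ)⁻¹ := map_sub _ _ _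
  have hq : algebraMap ℂ K q * algebraMap ℂ K (q : ℂ)⁻¹ = 1 := by
    rw [← map_mul, mul_inv_cancel₀ q.ne_zero, map_one]
  have hX : algebraMap ℂ K ((q : ℂ) ^ (n : ℤ)) * algebraMap ℂ K ((q : ℂ) ^ (-(n : ℤ))) = 1 := by
    rw [← map_mul, ← zpow_add₀ q.ne_zero]; simp
  have hQ : algebraMap ℂ K ((q : ℂ) ^ (2 * n)) = algebraMap ℂ K ((q : ℂ) ^ (n : ℤ)) ^ 2 := by
    rw [← map_pow, zpow_natCast, ← pow_mul, mul_comm]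
  have hD : ∀ i : Fin n, algebraMap ℂ K (dEntry n q i) =
      algebraMap ℂ K (q : ℂ)⁻¹ * algebraMap ℂ K ((q : ℂ) ^ ((n : ℤ) - 2 * (i : ℕ))) := by
    intro i
    rw [← map_mul, dEntry, ← zpow_neg_one, ← zpow_add₀ q.ne_zero]
    congr 2; ring
  have hLn := hLv n le_rfl
  rw [show (n : ℤ) - 2 * n = -n by ring] at hLn
  have hL1 : ∀ i : Fin n, L i = algebraMap ℂ K ((q : ℂ) ^ (n : ℤ)) -
      algebraMap ℂ K ((q : ℂ) ^ ((n : ℤ) - 2 * (i : ℕ))) := fun i => hLv i i.2.le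
  have hL2 : ∀ i : Fin n, L (i + 1) = algebraMap ℂ K ((q : ℂ) ^ (n : ℤ)) -
      algebraMap ℂ K (q : ℂ)⁻¹ ^ 2 * algebraMap ℂ K ((q : ℂ) ^ ((n : ℤ) - 2 * (i : ℕ))) := by
    intro i
    rw [hLv _ i.2, ← map_pow, ← map_mul]
    congr 2
    rw [← zpow_natCast, ← zpow_neg_one, ← zpow_mul, ← zpow_add₀ q.ne_zero]
    congr 1; push_cast; ring
  have hsum : ∀ (c₁ c₂ c₃ c₄ c₅ : K) (i₁ i₂ i₃ i₄ : ℕ),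
      (∀ u : Fin n, rOff q⁻¹ x 1 k u * rOff q (algebraMap ℂ K (q ^ (2 * n) : ℂ) * x) 1 u l =
        -h * (h * (c₁ * (if (u : ℕ) < i₁ then 1 else 0) + c₂ * (if (u : ℕ) < i₂ then 1 else 0) +
          c₃ * (if (u : ℕ) < i₃ then 1 else 0) + c₄ * (if (u : ℕ) < i₄ then 1 else 0) +
          c₅ * (if (u : ℕ) < n then 1 else 0)))) →
      ∑ u, rOff q⁻¹ x 1 k u * rOff q (algebraMap ℂ K (q ^ (2 * n) : ℂ) * x) 1 u l *
        algebraMap ℂ K (dEntry n q u) =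
        -h * (c₁ * L i₁ + c₂ * L i₂ + c₃ * L i₃ + c₄ * L i₄ + c₅ * L n) := by
    intro c₁ c₂ c₃ c₄ c₅ i₁ i₂ i₃ i₄ hu
    simp only [hL, Finset.mul_sum, ← Finset.sum_add_distrib]
    refine Finset.sum_congr rfl fun u _ => ?_
    rw [hu]
    split_ifs <;> ring
  set Q := algebraMap ℂ K ((q : ℂ) ^ (2 * n))
  have hoff : ∀ u v : Fin n, rOff q⁻¹ x 1 u v = if u < v then -h else if v < u then -(h * x) else 0 := by
    intro u v
    simp [rOff, qDiff_inv, ← hh]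
  have hoff' : ∀ u v : Fin n, rOff q (Q * x) 1 u v =
      if u < v then h else if v < u then h * (Q * x) else 0 := by
    intro u v
    simp [rOff, ← hh]
  rcases lt_trichotomy k l with hkl | hkl | hkl
  · rw [hsum x (-1) 1 (-(x * Q)) (x * Q) k (k + 1) l (l + 1) (by
      intro u
      rw [hoff, hoff']
      simp only [Fin.lt_def] at hkl ⊢
      have := u.2
      split_ifs <;> first | omega | ring)]
    rw [hL1, hL1, hL2, hL2, hLn, hoff, hoff', if_pos hkl, if_pos hkl, if_neg hkl.ne, hD, hD]
    simp only [rDiag, if_true, Units.val_inv_eq_inv_val, inv_inv]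
    rw [hQ]
    generalize algebraMap ℂ K ((q : ℂ) ^ ((n : ℤ) - 2 * (k : ℕ))) = tk
    generalize algebraMap ℂ K ((q : ℂ) ^ ((n : ℤ) - 2 * (l : ℕ))) = tl
    linear_combination (-h * x * tk - h * tl) * hq + h * x * algebraMap ℂ K ((q : ℂ) ^ (n : ℤ)) * hX
  · subst hkl
    rw [hsum x (-(x * Q)) 0 0 (x * Q) k (k + 1) 0 0 (by
      intro u
      rw [hoff, hoff']
      simp only [Fin.lt_def]
      have := u.2
      split_ifs <;> first | omega | ring)]
    rw [hL1, hL2, hLn, rOff_self, rOff_self, if_pos rfl, hD]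
    simp only [rDiag, if_true, Units.val_inv_eq_inv_val, inv_inv]
    rw [hQ]
    generalize algebraMap ℂ K ((q : ℂ) ^ ((n : ℤ) - 2 * (k : ℕ))) = t
    generalize algebraMap ℂ K ((q : ℂ) ^ (n : ℤ)) = X at *
    rw [hd]
    generalize algebraMap ℂ K q = a at *
    generalize algebraMap ℂ K (q : ℂ)⁻¹ = b at *
    linear_combination (-t * (x * a + X ^ 2 * x * b - b - b * X ^ 2 * x ^ 2)) * hq +
      (a - b) * x * X * hX
  · rw [hsum x (x ^ 2 * Q) (-(x ^ 2 * Q)) (-(x * Q)) (x * Q) l k (l + 1) (k + 1) (by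
      intro u
      rw [hoff, hoff']
      simp only [Fin.lt_def] at hkl ⊢
      have := u.2
      split_ifs <;> first | omega | ring)]
    rw [hL1, hL1, hL2, hL2, hLn, hoff, hoff', if_neg hkl.not_gt, if_neg hkl.not_gt, if_pos hkl,
      if_pos hkl, if_neg hkl.ne', hD, hD]
    simp only [rDiag, if_true, Units.val_inv_eq_inv_val, inv_inv]
    rw [hQ]
    generalize algebraMap ℂ K ((q : ℂ) ^ ((n : ℤ) - 2 * (k : ℕ))) = tk
    generalize algebraMap ℂ K ((q : ℂ) ^ ((n : ℤ) - 2 * (l : ℕ))) = tl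
    generalize algebraMap ℂ K ((q : ℂ) ^ (n : ℤ)) = X at *
    linear_combination (-h * X ^ 2 * x ^ 2 * tk - h * x * tl) * hq + h * x * X * hX

end Crossing

/-! ### Auxiliary tensor factors -/

section Aux

variable {n : ℕ} {S : Type*} [Ring S]

/-- An operator on two factors, regarded as an operator on the second factor with values in the
endomorphisms of the first one. -/
def auxFirst : Matrix (Fin n × Fin n) (Fin n × Fin n) S →+*
    Matrix (Fin n) (Fin n) (Matrix (Fin n) (Fin n) S) where
  toFun M := Matrix.of fun i j => Matrix.of fun k l => M (k, i) (l, j)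
  map_one' := by
    ext i j k l
    by_cases h1 : i = j
    · subst h1; simp [Matrix.one_apply]
    · simp [Matrix.one_apply, h1]
  map_mul' M N := by
    ext i j k l
    simp only [Matrix.of_apply, Matrix.mul_apply, Fintype.sum_prod_type, Matrix.sum_apply]
    exact Finset.sum_comm
  map_zero' := rfl
  map_add' M N := rfl

/-- An operator on two factors, regarded as an operator on the first factor with values in the
endomorphisms of the second one. -/
def auxLast : Matrix (Fin n × Fin n) (Fin n × Fin n) S →+*
    Matrix (Fin n) (Fin n) (Matrix (Fin n) (Fin n) S) where
  toFun M := Matrix.of fun i j => Matrix.of fun k l => M (i, k) (j, l)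
  map_one' := by
    ext i j k l
    by_cases h1 : i = j
    · subst h1; simp [Matrix.one_apply]
    · simp [Matrix.one_apply, h1]
  map_mul' M N := by
    ext i j k l
    simp only [Matrix.of_apply, Matrix.mul_apply, Fintype.sum_prod_type, Matrix.sum_apply]
  map_zero' := rfl
  map_add' M N := rfl

theorem auxFirst_apply (M : Matrix (Fin n × Fin n) (Fin n × Fin n) S) (i j k l : Fin n) :
    auxFirst M i j k l = M (k, i) (l, j) := rfl

theorem auxLast_apply (M : Matrix (Fin n × Fin n) (Fin n × Fin n) S) (i j k l : Fin n) :
    auxLast M i j k l = M (i, k) (j, l) := rfl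

theorem auxFirst_kronecker_one (M : Matrix (Fin n) (Fin n) S) :
    auxFirst (M ⊗ₖ (1 : Matrix (Fin n) (Fin n) S)) = Matrix.scalar (Fin n) M := by
  ext i j k l
  by_cases h : i = j
  · subst h; simp [auxFirst_apply]
  · simp [auxFirst_apply, h]

theorem auxFirst_one_kronecker (M : Matrix (Fin n) (Fin n) S) :
    auxFirst ((1 : Matrix (Fin n) (Fin n) S) ⊗ₖ M) = M.map (Matrix.scalar (Fin n)) := by
  ext i j k l
  by_cases h : k = l
  · subst h; simp [auxFirst_apply]
  · simp [auxFirst_apply, h]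

theorem auxLast_one_kronecker (M : Matrix (Fin n) (Fin n) S) :
    auxLast ((1 : Matrix (Fin n) (Fin n) S) ⊗ₖ M) = Matrix.scalar (Fin n) M := by
  ext i j k l
  by_cases h : i = j
  · subst h; simp [auxLast_apply]
  · simp [auxLast_apply, h]

theorem auxLast_kronecker_one (M : Matrix (Fin n) (Fin n) S) :
    auxLast (M ⊗ₖ (1 : Matrix (Fin n) (Fin n) S)) = M.map (Matrix.scalar (Fin n)) := by
  ext i j k l
  by_cases h : k = l
  · subst h; simp [auxLast_apply]
  · simp [auxLast_apply, h]

end Aux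

section CrossingMatrix

variable {n : ℕ} {K : Type*} [CommRing K] [Algebra ℂ K] {q : ℂˣ}

theorem rDiag_mul_rDiag_inv (x y : K) {k w : Fin n} (h : k ≠ w) :
    rDiag q⁻¹ x 1 k w * rDiag q y 1 k w = (1 - x) * (1 - y) := by
  simp [rDiag, h]

theorem crossing_auxFirst (x : K) (w w' : Fin n) :
    ∑ u, algebraMap ℂ K (dEntry n q u) • (auxFirst (rPoly n q⁻¹ x 1) u w *
      auxFirst (rPoly n q (algebraMap ℂ K (q ^ (2 * n) : ℂ) * x) 1) w' u) =
    if w = w' then ((1 - x) * (1 - algebraMap ℂ K (q ^ (2 * n) : ℂ) * x) *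
      algebraMap ℂ K (dEntry n q w)) • 1 else 0 := by
  ext k l
  have h := crossing_scalar (n := n) (q := q) x k l
  have hdd : k ≠ w → _ := rDiag_mul_rDiag_inv (q := q) x (algebraMap ℂ K (q ^ (2 * n) : ℂ) * x)
  have e : ∀ u, (algebraMap ℂ K (dEntry n q u) • (auxFirst (rPoly n q⁻¹ x 1) u w *
      auxFirst (rPoly n q (algebraMap ℂ K (q ^ (2 * n) : ℂ) * x) 1) w' u)) k l =
      algebraMap ℂ K (dEntry n q u) * (
        (if u = w then rDiag q⁻¹ x 1 k w * rPoly n q (algebraMap ℂ K (q ^ (2 * n) : ℂ) * x) 1 (k, w') (l, w)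
          else 0) + (if k = w then rOff q⁻¹ x 1 k u *
            rPoly n q (algebraMap ℂ K (q ^ (2 * n) : ℂ) * x) 1 (u, w') (l, u) else 0)) := by
    intro u
    rw [Matrix.smul_apply, Matrix.mul_apply, smul_eq_mul]
    congr 1
    simp only [auxFirst_apply, rPoly_apply (q := q⁻¹), Prod.swap_prod_mk, Prod.mk.injEq, add_mul,
      ite_mul, zero_mul, Finset.sum_add_distrib]
    congr 1
    · by_cases hu : u = w
      · subst hu
        simp
      · simp [hu, Ne.symm hu]
    · by_cases hk : k = w
      · subst hk; simp
      · simp [hk, Ne.symm hk]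
  rw [Matrix.sum_apply, Finset.sum_congr rfl fun u _ => e u]
  simp only [mul_add, Finset.sum_add_distrib, mul_ite, mul_zero]
  rw [Finset.sum_ite_eq' Finset.univ w, if_pos (Finset.mem_univ _)]
  set Q := algebraMap ℂ K (q ^ (2 * n) : ℂ)
  by_cases hk : k = w
  · subst hk
    by_cases hl : l = w'
    · subst hl
      have e2 : ∀ u, rPoly n q (Q * x) 1 (u, l) (l, u) =
          (if u = l then rDiag q (Q * x) 1 l l else 0) + rOff q (Q * x) 1 u l := by
        intro u
        rw [rPoly_apply]
        by_cases hu : u = l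
        · subst hu; simp
        · simp [hu, Ne.symm hu]
      simp only [e2, mul_add, mul_ite, mul_zero, Finset.sum_add_distrib, if_true]
      rw [Finset.sum_ite_eq' Finset.univ l, if_pos (Finset.mem_univ _)]
      have e3 : ∑ u, algebraMap ℂ K (dEntry n q u) * (rOff q⁻¹ x 1 k u * rOff q (Q * x) 1 u l) =
          ∑ u, rOff q⁻¹ x 1 k u * rOff q (Q * x) 1 u l * algebraMap ℂ K (dEntry n q u) :=
        Finset.sum_congr rfl fun u _ => mul_comm _ _
      rw [e3]
      by_cases hkl : k = l
      · subst hkl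
        rw [if_pos rfl] at h ⊢
        rw [if_pos rfl, Matrix.smul_apply, Matrix.one_apply_eq, smul_eq_mul, mul_one, rOff_self,
          rOff_self]
        rw [rOff_self, rOff_self] at h
        linear_combination h
      · rw [if_neg hkl] at h ⊢
        rw [if_neg hkl, Matrix.zero_apply]
        linear_combination h
    · have e1 : rPoly n q (Q * x) 1 (k, w') (l, k) = 0 := by
        rw [rPoly_apply, if_neg, if_neg, add_zero]
        · simp [hl]
        · rintro h'
          obtain ⟨rfl, rfl⟩ := Prod.mk.inj h'
          exact hl rfl
      have e2 : ∀ u, rPoly n q (Q * x) 1 (u, w') (l, u) = 0 := by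
        intro u
        rw [rPoly_apply, if_neg, if_neg, add_zero]
        · simp [hl]
        · rintro h'
          obtain ⟨rfl, rfl⟩ := Prod.mk.inj h'
          exact hl rfl
      simp only [e1, e2, mul_zero, Finset.sum_const_zero, add_zero, if_true]
      split_ifs with h1
      · subst h1
        rw [Matrix.smul_apply, Matrix.one_apply_ne (Ne.symm hl), smul_zero]
      · rfl
  · simp only [if_neg hk, Finset.sum_const_zero, add_zero]
    rw [rPoly_apply]
    have h1 : ¬ (l, w) = (k, w').swap := fun h' => hk (Prod.mk.inj h').2.symm
    rw [if_neg h1, add_zero]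
    by_cases hw : w = w'
    · subst hw
      rw [if_pos rfl, Matrix.smul_apply, Matrix.one_apply]
      by_cases hl : l = k
      · subst hl
        rw [if_pos rfl, if_pos rfl, hdd hk, smul_eq_mul]
        ring
      · rw [if_neg (by simp [hl]), if_neg (Ne.symm hl)]
        simp
    · rw [if_neg hw, if_neg (by simp [hw])]
      simp

theorem crossing_auxLast (x : K) (w w' : Fin n) :
    ∑ u, algebraMap ℂ K (dEntry n q u) •
      (auxLast (rPoly n q (algebraMap ℂ K (q ^ (2 * n) : ℂ) * x) 1) u w *
        auxLast (rPoly n q⁻¹ x 1) w' u) =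
    if w = w' then ((1 - x) * (1 - algebraMap ℂ K (q ^ (2 * n) : ℂ) * x) *
      algebraMap ℂ K (dEntry n q w)) • 1 else 0 := by
  ext k l
  have h := crossing_scalar (n := n) (q := q) x l k
  have hdd : w ≠ k → _ := rDiag_mul_rDiag_inv (q := q) x (algebraMap ℂ K (q ^ (2 * n) : ℂ) * x)
  set Q := algebraMap ℂ K (q ^ (2 * n) : ℂ)
  have e : ∀ u, (algebraMap ℂ K (dEntry n q u) • (auxLast (rPoly n q (Q * x) 1) u w *
      auxLast (rPoly n q⁻¹ x 1) w' u)) k l =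
      algebraMap ℂ K (dEntry n q u) * (
        (if u = w then rDiag q (Q * x) 1 w k * rPoly n q⁻¹ x 1 (w', k) (w, l) else 0) +
        (if k = w then rOff q (Q * x) 1 u k * rPoly n q⁻¹ x 1 (w', u) (u, l) else 0)) := by
    intro u
    rw [Matrix.smul_apply, Matrix.mul_apply, smul_eq_mul]
    congr 1
    simp only [auxLast_apply, rPoly_apply (q := q), Prod.swap_prod_mk, Prod.mk.injEq, add_mul,
      ite_mul, zero_mul, Finset.sum_add_distrib]
    congr 1
    · by_cases hu : u = w
      · subst hu
        simp
      · simp [hu, Ne.symm hu]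
    · by_cases hk : k = w
      · subst hk; simp
      · simp [hk, Ne.symm hk]
  rw [Matrix.sum_apply, Finset.sum_congr rfl fun u _ => e u]
  simp only [mul_add, Finset.sum_add_distrib, mul_ite, mul_zero]
  rw [Finset.sum_ite_eq' Finset.univ w, if_pos (Finset.mem_univ _)]
  by_cases hk : k = w
  · subst hk
    by_cases hl : l = w'
    · subst hl
      have e2 : ∀ u, rPoly n q⁻¹ x 1 (l, u) (u, l) =
          (if u = l then rDiag q⁻¹ x 1 l l else 0) + rOff q⁻¹ x 1 l u := by
        intro u
        rw [rPoly_apply]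
        by_cases hu : u = l
        · subst hu; simp
        · simp [hu, Ne.symm hu]
      simp only [e2, mul_add, mul_ite, mul_zero, Finset.sum_add_distrib, if_true]
      rw [Finset.sum_ite_eq' Finset.univ l, if_pos (Finset.mem_univ _)]
      have e3 : ∑ u, algebraMap ℂ K (dEntry n q u) * (rOff q (Q * x) 1 u k * rOff q⁻¹ x 1 l u) =
          ∑ u, rOff q⁻¹ x 1 l u * rOff q (Q * x) 1 u k * algebraMap ℂ K (dEntry n q u) :=
        Finset.sum_congr rfl fun u _ => by ring
      rw [e3]
      by_cases hkl : k = l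
      · subst hkl
        rw [if_pos rfl] at h ⊢
        rw [if_pos rfl, Matrix.smul_apply, Matrix.one_apply_eq, smul_eq_mul, mul_one, rOff_self,
          rOff_self]
        rw [rOff_self, rOff_self] at h
        linear_combination h
      · rw [if_neg (Ne.symm hkl)] at h
        rw [if_neg hkl, if_neg hkl, Matrix.zero_apply]
        linear_combination h
    · have e1 : rPoly n q⁻¹ x 1 (w', k) (k, l) = 0 := by
        rw [rPoly_apply, if_neg, if_neg, add_zero]
        · simp [hl]
        · rintro h'
          obtain ⟨rfl, rfl⟩ := Prod.mk.inj h'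
          exact hl rfl
      have e2 : ∀ u, rPoly n q⁻¹ x 1 (w', u) (u, l) = 0 := by
        intro u
        rw [rPoly_apply, if_neg, if_neg, add_zero]
        · simp [hl]
        · rintro h'
          obtain ⟨rfl, rfl⟩ := Prod.mk.inj h'
          exact hl rfl
      simp only [e1, e2, mul_zero, Finset.sum_const_zero, add_zero, if_true]
      split_ifs with h1
      · subst h1
        rw [Matrix.smul_apply, Matrix.one_apply_ne (Ne.symm hl), smul_zero]
      · rfl
  · simp only [if_neg hk, Finset.sum_const_zero, add_zero]
    rw [rPoly_apply]
    have h1 : ¬ (w, l) = (w', k).swap := fun h' => hk (Prod.mk.inj h').1.symm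
    rw [if_neg h1, add_zero]
    by_cases hw : w = w'
    · subst hw
      rw [if_pos rfl, Matrix.smul_apply, Matrix.one_apply]
      by_cases hl : l = k
      · subst hl
        rw [if_pos rfl, if_pos rfl, mul_comm (rDiag q _ 1 w l), hdd (Ne.symm hk), smul_eq_mul]
        ring
      · rw [if_neg (by simp [hl]), if_neg (Ne.symm hl)]
        simp
    · rw [if_neg hw, if_neg (by simp [hw])]
      simp

end CrossingMatrix

end

section

/-! ### The R-matrix as a formal power series -/

section RSeries

variable {n : ℕ} {q : ℂˣ}

theorem rPoly_map {K K' : Type*} [CommRing K] [Algebra ℂ K] [CommRing K'] [Algebra ℂ K']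
    (φ : K →+* K') (hφ : ∀ c : ℂ, φ (algebraMap ℂ K c) = algebraMap ℂ K' c) (u v : K) :
    (rPoly n q u v).map φ = rPoly n q (φ u) (φ v) := by
  ext s t
  simp only [Matrix.map_apply, rPoly_apply, rDiag, rOff]
  split_ifs <;> simp [hφ]

theorem rescale_algebraMap (x c : ℂ) :
    PowerSeries.rescale x (algebraMap ℂ (PowerSeries ℂ) c) = algebraMap ℂ (PowerSeries ℂ) c := by
  ext k
  rw [PowerSeries.coeff_rescale, PowerSeries.algebraMap_apply, PowerSeries.coeff_C]
  split_ifs with h <;> simp [h]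

theorem rescale_X (x : ℂ) :
    PowerSeries.rescale x (PowerSeries.X : PowerSeries ℂ) =
      algebraMap ℂ (PowerSeries ℂ) x * PowerSeries.X := by
  rw [PowerSeries.rescale_X]
  rfl

theorem rPoly_rescale (x : ℂ) (q : ℂˣ) :
    (rPoly n q (PowerSeries.X : PowerSeries ℂ) 1).map (PowerSeries.rescale x) =
      rPoly n q (algebraMap ℂ (PowerSeries ℂ) x * PowerSeries.X) 1 := by
  rw [rPoly_map _ (rescale_algebraMap x), rescale_X, map_one]

/-- The denominator `q - q⁻¹ x`. -/
def rDen (q : ℂˣ) : PowerSeries ℂ :=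
  algebraMap ℂ (PowerSeries ℂ) q - algebraMap ℂ (PowerSeries ℂ) (q : ℂ)⁻¹ * PowerSeries.X

theorem constantCoeff_rDen : PowerSeries.constantCoeff (rDen q) = q := by
  simp [rDen]

theorem rDen_ne_zero : PowerSeries.constantCoeff (rDen q) ≠ 0 := by
  rw [constantCoeff_rDen]
  exact q.ne_zero

/-- The R-matrix `R(x) = f(x) R̄(x)`. -/
def rSeries (n : ℕ) (q : ℂˣ) : Matrix (Fin n × Fin n) (Fin n × Fin n) (PowerSeries ℂ) :=
  normSeries n q • RBar n q

theorem coeff_rSeries (k : ℕ) (s t : Fin n × Fin n) :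
    PowerSeries.coeff k (rSeries n q s t) = RCoeff n q k s t := rfl

/-- The scalar factor relating `R(x)` to the polynomial R-matrix. -/
def rScal (n : ℕ) (q : ℂˣ) : PowerSeries ℂ := normSeries n q * (rDen q)⁻¹

theorem rScal_mul_rDen : rScal n q * rDen q = normSeries n q := by
  rw [rScal, mul_assoc, PowerSeries.inv_mul_cancel _ rDen_ne_zero, mul_one]

theorem RBar_eq : RBar n q = (rDen q)⁻¹ • rPoly n q (PowerSeries.X : PowerSeries ℂ) 1 := by
  have hd : PowerSeries.C (q : ℂ) - PowerSeries.C (q : ℂ)⁻¹ * PowerSeries.X = rDen q := rfl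
  have hsw : ∀ s t : Fin n × Fin n, (s.1 = t.2 ∧ s.2 = t.1) ↔ t = s.swap := fun s t => by
    rw [Prod.ext_iff]; simp only [Prod.fst_swap, Prod.snd_swap]; tauto
  ext1 s t
  rw [Matrix.smul_apply, rPoly_apply, smul_eq_mul]
  simp only [RBar, Matrix.of_apply, hd, hsw, rDiag, rOff]
  obtain ⟨i, j⟩ := s
  by_cases h1 : t = (i, j)
  · subst h1
    rw [if_pos rfl, if_pos rfl]
    by_cases hij : i = j
    · subst hij
      simp only [if_true, Prod.swap_prod_mk, lt_irrefl, if_false, add_zero, mul_one]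
      exact (PowerSeries.inv_mul_cancel _ rDen_ne_zero).symm
    · rw [if_neg hij, if_neg hij, if_neg, add_zero, mul_comm]
      simp [hij]
  · rw [if_neg (Ne.symm h1), if_neg h1, zero_add]
    by_cases h2 : t = (j, i)
    · subst h2
      have hij : i ≠ j := fun h => h1 (by rw [h])
      simp only [Prod.swap_prod_mk, if_true]
      rcases lt_or_gt_of_ne hij with h | h
      · rw [if_neg h.not_gt, if_pos h, mul_one, mul_comm]; rfl
      · rw [if_pos h, if_neg h.not_gt, if_pos h, mul_comm]; rfl
    · have h2 : ¬ t = (i, j).swap := h2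
      rw [if_neg h2, if_neg h2, mul_zero]

theorem rSeries_eq : rSeries n q = rScal n q • rPoly n q (PowerSeries.X : PowerSeries ℂ) 1 := by
  rw [rSeries, RBar_eq, smul_smul, rScal]

/-- The scalar factor of the inverse R-matrix. -/
def rInvScal (n : ℕ) (q : ℂˣ) : PowerSeries ℂ := (normSeries n q * rDen q⁻¹)⁻¹

theorem rInvScal_mul : rInvScal n q * (normSeries n q * rDen q⁻¹) = 1 := by
  refine PowerSeries.inv_mul_cancel _ ?_
  rw [map_mul]
  refine mul_ne_zero ?_ rDen_ne_zero
  rw [← PowerSeries.coeff_zero_eq_constantCoeff_apply]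
  simp [normSeries, normCoeff]

/-- The inverse of `R(x)`. -/
def rSeriesInv (n : ℕ) (q : ℂˣ) : Matrix (Fin n × Fin n) (Fin n × Fin n) (PowerSeries ℂ) :=
  rInvScal n q • rPoly n q⁻¹ (PowerSeries.X : PowerSeries ℂ) 1

theorem rSeries_mul_rSeriesInv : rSeries n q * rSeriesInv n q = 1 := by
  rw [rSeries_eq, rSeriesInv, smul_mul_smul_comm, rPoly_mul_rPoly_inv, smul_smul, mul_one, mul_one]
  have h1 : algebraMap ℂ (PowerSeries ℂ) q -
      algebraMap ℂ (PowerSeries ℂ) (q : ℂ)⁻¹ * PowerSeries.X = rDen q := rfl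
  have h2 : algebraMap ℂ (PowerSeries ℂ) (q : ℂ)⁻¹ -
      algebraMap ℂ (PowerSeries ℂ) (q : ℂ) * PowerSeries.X = rDen q⁻¹ := by
    rw [rDen, Units.val_inv_eq_inv_val, inv_inv]
  rw [h1, h2]
  have : rScal n q * rInvScal n q * (rDen q * rDen q⁻¹) = 1 := by
    linear_combination rInvScal_mul (n := n) (q := q) +
      rInvScal n q * rDen q⁻¹ * rScal_mul_rDen (n := n) (q := q)
  rw [this, one_smul]

theorem rSeriesInv_mul_rSeries : rSeriesInv n q * rSeries n q = 1 :=
  mul_eq_one_comm.1 rSeries_mul_rSeriesInv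

theorem crossing_factor (hn : 1 ≤ n) (hq : ∀ k : ℕ, 0 < k → q ^ k ≠ 1) :
    rInvScal n q * PowerSeries.rescale ((q : ℂ) ^ (2 * n)) (rScal n q) *
      ((1 - PowerSeries.X) *
        (1 - algebraMap ℂ (PowerSeries ℂ) ((q : ℂ) ^ (2 * n)) * PowerSeries.X)) = 1 := by
  have h1 := normSeries_functional_equation n hn q hq
  have h2 := congrArg (PowerSeries.rescale ((q : ℂ) ^ (2 * n))) (rScal_mul_rDen (n := n) (q := q))
  rw [map_mul] at h2
  have h3 : PowerSeries.rescale ((q : ℂ) ^ (2 * n)) (rDen q) ≠ 0 := by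
    intro h
    have := congrArg PowerSeries.constantCoeff h
    rw [← PowerSeries.coeff_zero_eq_constantCoeff_apply, PowerSeries.coeff_rescale,
      PowerSeries.coeff_zero_eq_constantCoeff_apply, constantCoeff_rDen] at this
    simp at this
  apply mul_right_cancel₀ h3
  have h4 : rDen q⁻¹ * PowerSeries.rescale ((q : ℂ) ^ (2 * n)) (rDen q) =
      (1 - PowerSeries.C ((q : ℂ) ^ 2) * PowerSeries.X) *
        (1 - PowerSeries.C ((q : ℂ) ^ (2 * (n : ℤ) - 2)) * PowerSeries.X) := by
    have e1 : (q : ℂ) ^ (2 * (n : ℤ) - 2) = (q : ℂ)⁻¹ ^ 2 * (q : ℂ) ^ (2 * n) := by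
      rw [zpow_sub₀ q.ne_zero, div_eq_mul_inv, mul_comm, inv_pow]; norm_cast
    have e2 : algebraMap ℂ (PowerSeries ℂ) q * algebraMap ℂ (PowerSeries ℂ) (q : ℂ)⁻¹ = 1 := by
      rw [← map_mul, mul_inv_cancel₀ q.ne_zero, map_one]
    rw [rDen, rDen, map_sub, map_mul, rescale_algebraMap, rescale_algebraMap, rescale_X, e1,
      Units.val_inv_eq_inv_val, inv_inv]
    change _ = (1 - algebraMap ℂ (PowerSeries ℂ) _ * _) * (1 - algebraMap ℂ (PowerSeries ℂ) _ * _)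
    simp only [map_mul, map_pow]
    generalize algebraMap ℂ (PowerSeries ℂ) (q : ℂ) = a at *
    generalize algebraMap ℂ (PowerSeries ℂ) (q : ℂ)⁻¹ = b at *
    generalize (PowerSeries.X : PowerSeries ℂ) = x
    linear_combination (1 - x ^ 2 * a ^ (2 * n) * (a * b)) * e2
  have h5 := rInvScal_mul (n := n) (q := q)
  have h6 : PowerSeries.C ((q : ℂ) ^ (2 * n)) =
    algebraMap ℂ (PowerSeries ℂ) ((q : ℂ) ^ (2 * n)) := rfl
  rw [h6] at h1
  rw [← h4] at h1
  linear_combination rInvScal n q * h1 +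
    rInvScal n q * ((1 - PowerSeries.X) *
        (1 - algebraMap ℂ (PowerSeries ℂ) ((q : ℂ) ^ (2 * n)) * PowerSeries.X)) * h2 +
    PowerSeries.rescale ((q : ℂ) ^ (2 * n)) (rDen q) * h5

theorem auxFirst_smul {K : Type*} [CommRing K] (c : K)
    (M : Matrix (Fin n × Fin n) (Fin n × Fin n) K) : auxFirst (c • M) = c • auxFirst M := rfl

theorem auxLast_smul {K : Type*} [CommRing K] (c : K)
    (M : Matrix (Fin n × Fin n) (Fin n × Fin n) K) : auxLast (c • M) = c • auxLast M := rfl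

theorem rSeries_rescale (x : ℂ) : (rSeries n q).map (PowerSeries.rescale x) =
    PowerSeries.rescale x (rScal n q) •
      rPoly n q (algebraMap ℂ (PowerSeries ℂ) x * PowerSeries.X) 1 := by
  rw [← rPoly_rescale, rSeries_eq]
  ext1 s t
  simp

theorem crossing_series_first (hn : 1 ≤ n) (hq : ∀ k : ℕ, 0 < k → q ^ k ≠ 1) (w w' : Fin n) :
    ∑ u, algebraMap ℂ (PowerSeries ℂ) (dEntry n q u) • (auxFirst (rSeriesInv n q) u w *
      auxFirst ((rSeries n q).map (PowerSeries.rescale ((q : ℂ) ^ (2 * n)))) w' u) =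
    if w = w' then algebraMap ℂ (PowerSeries ℂ) (dEntry n q w) • 1 else 0 := by
  have h := congrArg ((rInvScal n q * PowerSeries.rescale ((q : ℂ) ^ (2 * n)) (rScal n q)) • ·)
    (crossing_auxFirst (n := n) (q := q) (PowerSeries.X : PowerSeries ℂ) w w')
  simp only [Finset.smul_sum] at h
  rw [rSeries_rescale, rSeriesInv, auxFirst_smul, auxFirst_smul]
  have e : ∀ u, algebraMap ℂ (PowerSeries ℂ) (dEntry n q u) •
      ((rInvScal n q • auxFirst (rPoly n q⁻¹ (PowerSeries.X : PowerSeries ℂ) 1)) u w *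
        (PowerSeries.rescale ((q : ℂ) ^ (2 * n)) (rScal n q) • auxFirst (rPoly n q
          (algebraMap ℂ (PowerSeries ℂ) ((q : ℂ) ^ (2 * n)) * PowerSeries.X) 1)) w' u) =
      (rInvScal n q * PowerSeries.rescale ((q : ℂ) ^ (2 * n)) (rScal n q)) •
        algebraMap ℂ (PowerSeries ℂ) (dEntry n q u) •
        (auxFirst (rPoly n q⁻¹ (PowerSeries.X : PowerSeries ℂ) 1) u w * auxFirst (rPoly n q
          (algebraMap ℂ (PowerSeries ℂ) ((q : ℂ) ^ (2 * n)) * PowerSeries.X) 1) w' u) := by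
    intro u
    rw [Matrix.smul_apply, Matrix.smul_apply, smul_mul_smul_comm, smul_comm]
  rw [Finset.sum_congr rfl fun u _ => e u, h]
  split_ifs
  · rw [smul_smul, ← mul_assoc, crossing_factor hn hq, one_mul]
  · rw [smul_zero]

theorem crossing_series_last (hn : 1 ≤ n) (hq : ∀ k : ℕ, 0 < k → q ^ k ≠ 1) (w w' : Fin n) :
    ∑ u, algebraMap ℂ (PowerSeries ℂ) (dEntry n q u) •
      (auxLast ((rSeries n q).map (PowerSeries.rescale ((q : ℂ) ^ (2 * n)))) u w *
        auxLast (rSeriesInv n q) w' u) =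
    if w = w' then algebraMap ℂ (PowerSeries ℂ) (dEntry n q w) • 1 else 0 := by
  have h := congrArg ((rInvScal n q * PowerSeries.rescale ((q : ℂ) ^ (2 * n)) (rScal n q)) • ·)
    (crossing_auxLast (n := n) (q := q) (PowerSeries.X : PowerSeries ℂ) w w')
  simp only [Finset.smul_sum] at h
  rw [rSeries_rescale, rSeriesInv, auxLast_smul, auxLast_smul]
  have e : ∀ u, algebraMap ℂ (PowerSeries ℂ) (dEntry n q u) •
      ((PowerSeries.rescale ((q : ℂ) ^ (2 * n)) (rScal n q) • auxLast (rPoly n q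
          (algebraMap ℂ (PowerSeries ℂ) ((q : ℂ) ^ (2 * n)) * PowerSeries.X) 1)) u w *
        (rInvScal n q • auxLast (rPoly n q⁻¹ (PowerSeries.X : PowerSeries ℂ) 1)) w' u) =
      (rInvScal n q * PowerSeries.rescale ((q : ℂ) ^ (2 * n)) (rScal n q)) •
        algebraMap ℂ (PowerSeries ℂ) (dEntry n q u) •
        (auxLast (rPoly n q
          (algebraMap ℂ (PowerSeries ℂ) ((q : ℂ) ^ (2 * n)) * PowerSeries.X) 1) u w *
        auxLast (rPoly n q⁻¹ (PowerSeries.X : PowerSeries ℂ) 1) w' u) := by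
    intro u
    rw [Matrix.smul_apply, Matrix.smul_apply, smul_mul_smul_comm, smul_comm,
      mul_comm (rInvScal n q)]
  rw [Finset.sum_congr rfl fun u _ => e u, h]
  split_ifs
  · rw [smul_smul, ← mul_assoc, crossing_factor hn hq, one_mul]
  · rw [smul_zero]

end RSeries

/-! ### Exchange relations -/

section Kronecker

variable {n : ℕ}

theorem kronecker_one_mul_self {S : Type*} [Ring S] (X Y : Matrix (Fin n) (Fin n) S) (h : X * Y = 1) :
    (X ⊗ₖ (1 : Matrix (Fin n) (Fin n) S)) * (Y ⊗ₖ (1 : Matrix (Fin n) (Fin n) S)) = 1 := by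
  ext s t
  have h' := congrFun (congrFun h s.1) t.1
  rw [Matrix.mul_apply] at h'
  simp only [Matrix.mul_apply, Matrix.kroneckerMap_apply, Fintype.sum_prod_type, Matrix.one_apply,
    Prod.ext_iff] at h' ⊢
  by_cases hst : s.2 = t.2
  · simp [hst, h']
  · simp [hst]

theorem one_kronecker_mul_self {S : Type*} [Ring S] (X Y : Matrix (Fin n) (Fin n) S) (h : X * Y = 1) :
    ((1 : Matrix (Fin n) (Fin n) S) ⊗ₖ X) * ((1 : Matrix (Fin n) (Fin n) S) ⊗ₖ Y) = 1 := by
  ext s t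
  have h' := congrFun (congrFun h s.2) t.2
  rw [Matrix.mul_apply] at h'
  simp only [Matrix.mul_apply, Matrix.kroneckerMap_apply, Fintype.sum_prod_type, Matrix.one_apply,
    Prod.ext_iff] at h' ⊢
  by_cases hst : s.1 = t.1
  · simp [hst, h']
  · simp [hst]

end Kronecker

section Exchange

variable {n m : ℕ} {S : Type*} [Ring S] [Algebra ℂ S] {q : ℂˣ}

/-- The polynomial R-matrix with scalar parameters. -/
def rScalar (n : ℕ) (q : ℂˣ) (S : Type*) [Ring S] [Algebra ℂ S] (x y : ℂ) :
    Matrix (Fin n × Fin n) (Fin n × Fin n) S := (rPoly n q x y).map (algebraMap ℂ S)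

/-- The relation `R(x/y) F₁(x) F₂(y) = F₂(y) F₁(x) R(x/y)`. -/
def IsExchange (q : ℂˣ) (F : ℂ → Matrix (Fin n) (Fin n) S) : Prop :=
  ∀ x y : ℂ, x ≠ 0 → y ≠ 0 →
    rScalar n q S x y * ((F x ⊗ₖ (1 : Matrix (Fin n) (Fin n) S)) *
      ((1 : Matrix (Fin n) (Fin n) S) ⊗ₖ F y)) =
    ((1 : Matrix (Fin n) (Fin n) S) ⊗ₖ F y) * (F x ⊗ₖ (1 : Matrix (Fin n) (Fin n) S)) *
      rScalar n q S x y

/-- The relation `R(x/y) F₂(x) F₁(y) = F₁(y) F₂(x) R(x/y)`. -/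
def IsCoexchange (q : ℂˣ) (F : ℂ → Matrix (Fin n) (Fin n) S) : Prop :=
  ∀ x y : ℂ, x ≠ 0 → y ≠ 0 →
    rScalar n q S x y * (((1 : Matrix (Fin n) (Fin n) S) ⊗ₖ F x) *
      (F y ⊗ₖ (1 : Matrix (Fin n) (Fin n) S))) =
    (F y ⊗ₖ (1 : Matrix (Fin n) (Fin n) S)) * ((1 : Matrix (Fin n) (Fin n) S) ⊗ₖ F x) *
      rScalar n q S x y

theorem rScalar_mul (c x y : ℂ) : rScalar n q S (c * x) (c * y) = c • rScalar n q S x y := by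
  rw [rScalar, rScalar, rPoly_mul]
  ext s t
  rw [Matrix.map_apply, Matrix.smul_apply, Matrix.smul_apply, Matrix.map_apply, smul_eq_mul,
    map_mul, Algebra.smul_def]

theorem IsExchange.inv {F G : ℂ → Matrix (Fin n) (Fin n) S} (hF : IsExchange q F)
    (h1 : ∀ x, x ≠ 0 → F x * G x = 1) (h2 : ∀ x, x ≠ 0 → G x * F x = 1) :
    IsCoexchange q fun x => G x⁻¹ := by
  intro x y hx hy
  have h := hF y⁻¹ x⁻¹ (inv_ne_zero hy) (inv_ne_zero hx)
  have hr : rScalar n q S x y = (x * y) • rScalar n q S y⁻¹ x⁻¹ := by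
    rw [← rScalar_mul]
    congr 1 <;> field_simp
  rw [hr, smul_mul_assoc, mul_smul_comm]
  congr 1
  set r := rScalar n q S y⁻¹ x⁻¹
  have a1 := kronecker_one_mul_self _ _ (h1 y⁻¹ (inv_ne_zero hy))
  have a2 := kronecker_one_mul_self _ _ (h2 y⁻¹ (inv_ne_zero hy))
  have b1 := one_kronecker_mul_self _ _ (h1 x⁻¹ (inv_ne_zero hx))
  have b2 := one_kronecker_mul_self _ _ (h2 x⁻¹ (inv_ne_zero hx))
  set F1 := F y⁻¹ ⊗ₖ (1 : Matrix (Fin n) (Fin n) S)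
  set G1 := G y⁻¹ ⊗ₖ (1 : Matrix (Fin n) (Fin n) S)
  set F2 := (1 : Matrix (Fin n) (Fin n) S) ⊗ₖ F x⁻¹
  set G2 := (1 : Matrix (Fin n) (Fin n) S) ⊗ₖ G x⁻¹
  calc r * (G2 * G1) = (G1 * (G2 * F2) * F1) * r * (G2 * G1) := by
        rw [b2, mul_one, a2, one_mul]
    _ = G1 * G2 * (F2 * F1 * r) * (G2 * G1) := by simp only [mul_assoc]
    _ = G1 * G2 * r * (F1 * (F2 * G2) * G1) := by rw [← h]; simp only [mul_assoc]
    _ = G1 * G2 * r := by rw [b1, mul_one, a1, mul_one]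

end Exchange

end

section

/-! ### The R-matrix satisfies the exchange relations -/

section Transport

variable {n : ℕ} {K : Type*} [CommRing K]

/-- Three tensor factors, with the last one in the coefficients. -/
def threeLast (n : ℕ) : (Fin n × Fin n) × Fin n ≃ (Fin 3 → Fin n) where
  toFun p := ![p.1.1, p.1.2, p.2]
  invFun w := ((w 0, w 1), w 2)
  left_inv _ := rfl
  right_inv w := by ext i; fin_cases i <;> rfl

/-- Three tensor factors, with the first one in the coefficients. -/
def threeFirst (n : ℕ) : (Fin n × Fin n) × Fin n ≃ (Fin 3 → Fin n) where
  toFun p := ![p.2, p.1.1, p.1.2]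
  invFun w := ((w 1, w 2), w 0)
  left_inv _ := rfl
  right_inv w := by ext i; fin_cases i <;> rfl

@[simp] theorem threeLast_zero (p : (Fin n × Fin n) × Fin n) : threeLast n p 0 = p.1.1 := rfl

@[simp] theorem threeLast_one (p : (Fin n × Fin n) × Fin n) : threeLast n p 1 = p.1.2 := rfl

@[simp] theorem threeLast_two (p : (Fin n × Fin n) × Fin n) : threeLast n p 2 = p.2 := rfl

@[simp] theorem threeFirst_zero (p : (Fin n × Fin n) × Fin n) : threeFirst n p 0 = p.2 := rfl

@[simp] theorem threeFirst_one (p : (Fin n × Fin n) × Fin n) : threeFirst n p 1 = p.1.1 := rfl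

@[simp] theorem threeFirst_two (p : (Fin n × Fin n) × Fin n) : threeFirst n p 2 = p.1.2 := rfl

/-- Operators on three factors as operators on two factors with matrix coefficients. -/
def splitAux (e : (Fin n × Fin n) × Fin n ≃ (Fin 3 → Fin n)) :
    Matrix (Fin 3 → Fin n) (Fin 3 → Fin n) K →
      Matrix (Fin n × Fin n) (Fin n × Fin n) (Matrix (Fin n) (Fin n) K) :=
  fun M => Matrix.of fun s t => Matrix.of fun k l => M (e (s, k)) (e (t, l))

theorem splitAux_mul (e : (Fin n × Fin n) × Fin n ≃ (Fin 3 → Fin n))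
    (M N : Matrix (Fin 3 → Fin n) (Fin 3 → Fin n) K) :
    splitAux e (M * N) = splitAux e M * splitAux e N := by
  ext s t k l
  simp only [splitAux, Matrix.of_apply, Matrix.mul_apply, Matrix.sum_apply]
  rw [← Equiv.sum_comp e, Fintype.sum_prod_type]

theorem forall_ne_ne_fin_three {p : Fin 3 → Prop} :
    ((∀ c, c ≠ 0 → c ≠ 1 → p c) ↔ p 2) ∧ ((∀ c, c ≠ 0 → c ≠ 2 → p c) ↔ p 1) ∧
      ((∀ c, c ≠ 1 → c ≠ 2 → p c) ↔ p 0) := by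
  refine ⟨⟨fun h => h 2 (by decide) (by decide), fun h c h1 h2 => ?_⟩,
    ⟨fun h => h 1 (by decide) (by decide), fun h c h1 h2 => ?_⟩,
    ⟨fun h => h 0 (by decide) (by decide), fun h c h1 h2 => ?_⟩⟩ <;>
  fin_cases c <;> first | exact h | simp at h1 h2

theorem splitAux_last_zero_one (C : Matrix (Fin n × Fin n) (Fin n × Fin n) K) :
    splitAux (threeLast n) (twoSite 0 1 C) = C.map (Matrix.scalar (Fin n)) := by
  ext s t k l
  simp [splitAux, twoSite, forall_ne_ne_fin_three.1, Matrix.diagonal_apply]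

theorem splitAux_last_zero_two (C : Matrix (Fin n × Fin n) (Fin n × Fin n) K) :
    splitAux (threeLast n) (twoSite 0 2 C) =
      auxLast C ⊗ₖ (1 : Matrix (Fin n) (Fin n) (Matrix (Fin n) (Fin n) K)) := by
  ext s t k l
  simp only [splitAux, twoSite, forall_ne_ne_fin_three.2.1, Matrix.of_apply,
    Matrix.kroneckerMap_apply, Matrix.one_apply]
  by_cases h : s.2 = t.2
  · simp [h, auxLast_apply]
  · simp [h]

theorem splitAux_last_one_two (C : Matrix (Fin n × Fin n) (Fin n × Fin n) K) :
    splitAux (threeLast n) (twoSite 1 2 C) =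
      (1 : Matrix (Fin n) (Fin n) (Matrix (Fin n) (Fin n) K)) ⊗ₖ auxLast C := by
  ext s t k l
  simp only [splitAux, twoSite, forall_ne_ne_fin_three.2.2, Matrix.of_apply,
    Matrix.kroneckerMap_apply, Matrix.one_apply]
  by_cases h : s.1 = t.1
  · simp [h, auxLast_apply]
  · simp [h]

theorem splitAux_first_one_two (C : Matrix (Fin n × Fin n) (Fin n × Fin n) K) :
    splitAux (threeFirst n) (twoSite 1 2 C) = C.map (Matrix.scalar (Fin n)) := by
  ext s t k l
  simp [splitAux, twoSite, forall_ne_ne_fin_three.2.2, Matrix.diagonal_apply]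

theorem splitAux_first_zero_one (C : Matrix (Fin n × Fin n) (Fin n × Fin n) K) :
    splitAux (threeFirst n) (twoSite 0 1 C) =
      auxFirst C ⊗ₖ (1 : Matrix (Fin n) (Fin n) (Matrix (Fin n) (Fin n) K)) := by
  ext s t k l
  simp only [splitAux, twoSite, forall_ne_ne_fin_three.1, Matrix.of_apply,
    Matrix.kroneckerMap_apply, Matrix.one_apply]
  by_cases h : s.2 = t.2
  · simp [h, auxFirst_apply]
  · simp [h]

theorem splitAux_first_zero_two (C : Matrix (Fin n × Fin n) (Fin n × Fin n) K) :
    splitAux (threeFirst n) (twoSite 0 2 C) =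
      (1 : Matrix (Fin n) (Fin n) (Matrix (Fin n) (Fin n) K)) ⊗ₖ auxFirst C := by
  ext s t k l
  simp only [splitAux, twoSite, forall_ne_ne_fin_three.2.1, Matrix.of_apply,
    Matrix.kroneckerMap_apply, Matrix.one_apply]
  by_cases h : s.1 = t.1
  · simp [h, auxFirst_apply]
  · simp [h]

end Transport

section RExchange

variable {n : ℕ} {q : ℂˣ}

/-- The R-matrix `R(x ζ)` as a formal power series in `ζ`. -/
def rShift (n : ℕ) (q : ℂˣ) (x : ℂ) : Matrix (Fin n × Fin n) (Fin n × Fin n) (PowerSeries ℂ) :=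
  (rSeries n q).map (PowerSeries.rescale x)

theorem rScalar_eq_map (x y : ℂ) : rScalar n q (Matrix (Fin n) (Fin n) (PowerSeries ℂ)) x y =
    (rPoly n q (algebraMap ℂ (PowerSeries ℂ) x) (algebraMap ℂ (PowerSeries ℂ) y)).map
      (Matrix.scalar (Fin n)) := by
  rw [← rPoly_map (algebraMap ℂ (PowerSeries ℂ)) (fun _ => rfl), rScalar]
  ext1 s t
  rw [Matrix.map_apply, Matrix.map_apply, Matrix.map_apply, Matrix.algebraMap_eq_diagonal]
  rfl

theorem rShift_yang_baxter_last {x y : ℂ} (hy : y ≠ 0) :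
    twoSite (m := 3) 0 1 (rPoly n q (algebraMap ℂ (PowerSeries ℂ) x)
        (algebraMap ℂ (PowerSeries ℂ) y)) * twoSite 0 2 (rShift n q x) *
        twoSite 1 2 (rShift n q y) =
      twoSite 1 2 (rShift n q y) * twoSite 0 2 (rShift n q x) *
        twoSite 0 1 (rPoly n q (algebraMap ℂ (PowerSeries ℂ) x)
          (algebraMap ℂ (PowerSeries ℂ) y)) := by
  have h := rPoly_yang_baxter (n := n) (q := q) (algebraMap ℂ (PowerSeries ℂ) x)
    (algebraMap ℂ (PowerSeries ℂ) y) (algebraMap ℂ (PowerSeries ℂ) y * PowerSeries.X) 1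
  rw [show algebraMap ℂ (PowerSeries ℂ) x * (algebraMap ℂ (PowerSeries ℂ) y * PowerSeries.X) =
    algebraMap ℂ (PowerSeries ℂ) y * (algebraMap ℂ (PowerSeries ℂ) x * PowerSeries.X) by ring,
    rPoly_mul, twoSite_smul] at h
  simp only [mul_smul_comm, smul_mul_assoc] at h
  have h' := congrArg (algebraMap ℂ (PowerSeries ℂ) y⁻¹ • ·) h
  simp only [smul_smul, ← map_mul, inv_mul_cancel₀ hy, map_one, one_smul] at h'
  rw [rShift, rShift, rSeries_rescale, rSeries_rescale, twoSite_smul, twoSite_smul]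
  simp only [mul_smul_comm, smul_mul_assoc, h']
  rw [smul_comm]

theorem rShift_yang_baxter_first {x y : ℂ} (hy : y ≠ 0) :
    twoSite (m := 3) 0 1 (rShift n q y) * twoSite 0 2 (rShift n q x) *
        twoSite 1 2 (rPoly n q (algebraMap ℂ (PowerSeries ℂ) x)
          (algebraMap ℂ (PowerSeries ℂ) y)) =
      twoSite 1 2 (rPoly n q (algebraMap ℂ (PowerSeries ℂ) x)
          (algebraMap ℂ (PowerSeries ℂ) y)) * twoSite 0 2 (rShift n q x) *
        twoSite 0 1 (rShift n q y) := by
  have h := rPoly_yang_baxter (n := n) (q := q) (algebraMap ℂ (PowerSeries ℂ) y * PowerSeries.X) 1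
    (algebraMap ℂ (PowerSeries ℂ) x) (algebraMap ℂ (PowerSeries ℂ) y)
  rw [show algebraMap ℂ (PowerSeries ℂ) y * PowerSeries.X * algebraMap ℂ (PowerSeries ℂ) x =
    algebraMap ℂ (PowerSeries ℂ) y * (algebraMap ℂ (PowerSeries ℂ) x * PowerSeries.X) by ring,
    mul_comm (1 : PowerSeries ℂ), rPoly_mul, twoSite_smul] at h
  simp only [mul_smul_comm, smul_mul_assoc] at h
  have h' := congrArg (algebraMap ℂ (PowerSeries ℂ) y⁻¹ • ·) h
  simp only [smul_smul, ← map_mul, inv_mul_cancel₀ hy, map_one, one_smul] at h'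
  rw [rShift, rShift, rSeries_rescale, rSeries_rescale, twoSite_smul, twoSite_smul]
  simp only [mul_smul_comm, smul_mul_assoc, h']
  rw [smul_comm]

theorem rShift_last_isExchange : IsExchange q fun x => auxLast (rShift n q x) := by
  intro x y _ hy
  have h := congrArg (splitAux (threeLast n)) (rShift_yang_baxter_last (n := n) (q := q) (x := x) hy)
  simp only [splitAux_mul, splitAux_last_zero_one, splitAux_last_zero_two,
    splitAux_last_one_two] at h
  rw [rScalar_eq_map, ← mul_assoc]
  exact h

theorem rShift_first_isCoexchange : IsCoexchange q fun x => auxFirst (rShift n q x) := by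
  intro x y _ hy
  have h := congrArg (splitAux (threeFirst n))
    (rShift_yang_baxter_first (n := n) (q := q) (x := x) hy)
  simp only [splitAux_mul, splitAux_first_zero_one, splitAux_first_zero_two,
    splitAux_first_one_two] at h
  rw [rScalar_eq_map, ← mul_assoc]
  exact h.symm

/-- The inverse of `R(x ζ)`. -/
def rShiftInv (n : ℕ) (q : ℂˣ) (x : ℂ) :
    Matrix (Fin n × Fin n) (Fin n × Fin n) (PowerSeries ℂ) :=
  (rSeriesInv n q).map (PowerSeries.rescale x)

theorem rShift_mul_rShiftInv (x : ℂ) : rShift n q x * rShiftInv n q x = 1 := by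
  rw [rShift, rShiftInv, ← Matrix.map_mul, rSeries_mul_rSeriesInv, Matrix.map_one _ (map_zero _) (map_one _)]

theorem rShiftInv_mul_rShift (x : ℂ) : rShiftInv n q x * rShift n q x = 1 := by
  rw [rShift, rShiftInv, ← Matrix.map_mul, rSeriesInv_mul_rSeries, Matrix.map_one _ (map_zero _) (map_one _)]

theorem rShiftInv_last_isCoexchange : IsCoexchange q fun x => auxLast (rShiftInv n q x⁻¹) :=
  rShift_last_isExchange.inv (G := fun x => auxLast (rShiftInv n q x))
    (fun x _ => by rw [← map_mul, rShift_mul_rShiftInv, map_one])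
    (fun x _ => by rw [← map_mul, rShiftInv_mul_rShift, map_one])

end RExchange

/-! ### Products of exchange families -/

section Products

variable {n m : ℕ} {S : Type*} [Ring S] [Algebra ℂ S] {q : ℂˣ}

/-- The scalar form of the operators `T_k`. -/
def tensorT (n : ℕ) (q : ℂˣ) (S : Type*) [Ring S] [Algebra ℂ S] (k : HeckeIdx m) :
    Matrix (Fin m → Fin n) (Fin m → Fin n) S := (RCheck n q k).map (algebraMap ℂ S)

/-- The braid form of the polynomial R-matrix. -/
def braidScalar (n : ℕ) (q : ℂˣ) (S : Type*) [Ring S] [Algebra ℂ S] (k : HeckeIdx m) (x y : ℂ) :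
    Matrix (Fin m → Fin n) (Fin m → Fin n) S :=
  twoSite k.lo k.hi (flip n S * rScalar n q S x y)

theorem braidScalar_eq (k : HeckeIdx m) (x y : ℂ) :
    braidScalar n q S k x y = (y - x) • tensorT n q S k + (qDiff q * x) • 1 := by
  have h : rScalar n q S x y = (y - x) • (RFin n q).map (algebraMap ℂ S) +
      (qDiff q * x) • flip n S := by
    ext s t
    rw [rScalar, rPoly, Matrix.map_apply, Matrix.add_apply, Matrix.add_apply, Matrix.smul_apply,
      Matrix.smul_apply, Matrix.smul_apply, Matrix.smul_apply, map_add, smul_eq_mul, smul_eq_mul,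
      map_mul, map_mul, ← Algebra.smul_def, ← Algebra.smul_def]
    rfl
  rw [braidScalar, h, mul_add, mul_smul_comm, mul_smul_comm, flip_mul_flip, twoSite_add,
    twoSite_smul, twoSite_smul, twoSite_one k.lo_ne_hi, ← map_RCheck, tensorT]

theorem baxter_tensorT (k : HeckeIdx m) (c : Fin m → ℤ) :
    baxter q (tensorT n q S) k c = braidScalar n q S k (qSq q (c k.lo)) (qSq q (c k.hi)) :=
  (braidScalar_eq k _ _).symm

theorem braidScalar_mul (k : HeckeIdx m) (a x y : ℂ) :
    braidScalar n q S k (a * x) (a * y) = a • braidScalar n q S k x y := by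
  rw [braidScalar, rScalar_mul, mul_smul_comm, twoSite_smul, braidScalar]

theorem IsExchange.braid {F : ℂ → Matrix (Fin n) (Fin n) S} (hF : IsExchange q F) (k : HeckeIdx m)
    {x y : ℂ} (hx : x ≠ 0) (hy : y ≠ 0) :
    braidScalar n q S k x y * (site k.lo (F x) * site k.hi (F y)) =
      site k.lo (F y) * site k.hi (F x) * braidScalar n q S k x y := by
  rw [← twoSite_kronecker_one k.lo_ne_hi, ← twoSite_one_kronecker k.lo_ne_hi,
    ← twoSite_kronecker_one k.lo_ne_hi, ← twoSite_one_kronecker k.lo_ne_hi, braidScalar,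
    ← twoSite_mul k.lo_ne_hi, ← twoSite_mul k.lo_ne_hi, ← twoSite_mul k.lo_ne_hi,
    ← twoSite_mul k.lo_ne_hi, mul_assoc (flip n S), hF x y hx hy, ← mul_assoc (flip n S),
    flip_mul_one_kronecker_mul, mul_assoc _ (flip n S)]

theorem flip_mul_kronecker_one_mul (M N : Matrix (Fin n) (Fin n) S) :
    flip n S * ((M ⊗ₖ (1 : Matrix (Fin n) (Fin n) S)) * ((1 : Matrix (Fin n) (Fin n) S) ⊗ₖ N)) =
      ((1 : Matrix (Fin n) (Fin n) S) ⊗ₖ M) * (N ⊗ₖ (1 : Matrix (Fin n) (Fin n) S)) * flip n S := by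
  rw [flip_mul, mul_flip]
  ext s t
  simp only [Matrix.submatrix_apply, id, one_kronecker_mul_kronecker_one,
    kronecker_one_mul_one_kronecker, Prod.fst_swap, Prod.snd_swap]

theorem IsCoexchange.braid {F : ℂ → Matrix (Fin n) (Fin n) S} (hF : IsCoexchange q F)
    (k : HeckeIdx m) {x y : ℂ} (hx : x ≠ 0) (hy : y ≠ 0) :
    braidScalar n q S k x y * (site k.hi (F x) * site k.lo (F y)) =
      site k.hi (F y) * site k.lo (F x) * braidScalar n q S k x y := by
  rw [← twoSite_kronecker_one k.lo_ne_hi, ← twoSite_one_kronecker k.lo_ne_hi,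
    ← twoSite_kronecker_one k.lo_ne_hi, ← twoSite_one_kronecker k.lo_ne_hi, braidScalar,
    ← twoSite_mul k.lo_ne_hi, ← twoSite_mul k.lo_ne_hi, ← twoSite_mul k.lo_ne_hi,
    ← twoSite_mul k.lo_ne_hi, mul_assoc (flip n S), hF x y hx hy, ← mul_assoc (flip n S),
    flip_mul_kronecker_one_mul, mul_assoc _ (flip n S)]

theorem exists_finRange_split (k : HeckeIdx m) : ∃ l₁ l₂ : List (Fin m),
    List.finRange m = l₁ ++ k.lo :: k.hi :: l₂ ∧ (∀ a ∈ l₁, a ≠ k.lo ∧ a ≠ k.hi) ∧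
      ∀ a ∈ l₂, a ≠ k.lo ∧ a ≠ k.hi := by
  have hk := k.2
  have e : List.finRange m = (List.finRange m).take k.1 ++ k.lo :: k.hi ::
      (List.finRange m).drop (k.1 + 1 + 1) := by
    conv_lhs => rw [← List.take_append_drop k.1 (List.finRange m)]
    rw [List.drop_eq_getElem_cons (by rw [List.length_finRange]; omega),
      List.drop_eq_getElem_cons (by rw [List.length_finRange]; omega)]
    congr 2
    · simp [HeckeIdx.lo]
    · congr 1
      simp [HeckeIdx.hi]
  have hn := List.nodup_finRange m
  rw [e] at hn
  refine ⟨_, _, e, fun a ha => ?_, fun a ha => ?_⟩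
  · rw [List.nodup_append] at hn
    exact ⟨hn.2.2 a ha _ (by simp), hn.2.2 a ha _ (by simp)⟩
  · have h2 := (List.nodup_append.1 hn).2.1
    rw [List.nodup_cons, List.nodup_cons] at h2
    constructor
    · rintro rfl
      exact h2.1 (List.mem_cons_of_mem _ ha)
    · rintro rfl
      exact h2.2.1 ha

theorem braidScalar_commute_site (k : HeckeIdx m) (x y : ℂ) {a : Fin m} (h : a ≠ k.lo ∧ a ≠ k.hi)
    (M : Matrix (Fin n) (Fin n) S) : Commute (braidScalar n q S k x y) (site a M) := by
  have hmap : flip n S * rScalar n q S x y =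
      (flip n ℂ * rPoly n q x y).map (algebraMap ℂ S) := by
    rw [Matrix.map_mul, rScalar, flip, flip]
    rfl
  refine (site_mul_twoSite_comm h.1 h.2 k.lo_ne_hi fun i j s t => ?_).symm
  rw [hmap, Matrix.map_apply]
  exact (Algebra.commutes _ _).symm

theorem commute_prod_map {R ι : Type*} [Monoid R] {b : R} (f : ι → R) (l : List ι)
    (h : ∀ a ∈ l, Commute b (f a)) : Commute b (l.map f).prod := by
  refine Commute.list_prod_right _ _ fun x hx => ?_
  obtain ⟨a, ha, rfl⟩ := List.mem_map.1 hx
  exact h a ha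

/-- The product `F₁(x₁) ⋯ F_m(x_m)`. -/
def sitesProd (F : ℂ → Matrix (Fin n) (Fin n) S) (x : Fin m → ℂ) :
    Matrix (Fin m → Fin n) (Fin m → Fin n) S :=
  ((List.finRange m).map fun a => site a (F (x a))).prod

/-- The product `F_m(x_m) ⋯ F₁(x₁)`. -/
def sitesProdRev (F : ℂ → Matrix (Fin n) (Fin n) S) (x : Fin m → ℂ) :
    Matrix (Fin m → Fin n) (Fin m → Fin n) S :=
  ((List.finRange m).reverse.map fun a => site a (F (x a))).prod

theorem map_comp_adjSwap {R : Type*} (k : HeckeIdx m) (l : List (Fin m))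
    (hl : ∀ a ∈ l, a ≠ k.lo ∧ a ≠ k.hi) (G : Fin m → ℂ → R) (x : Fin m → ℂ) :
    (l.map fun a => G a (x (adjSwap k a))) = l.map fun a => G a (x a) :=
  List.map_congr_left fun a ha => by
    rw [adjSwap_of_ne k (hl a ha).1 (hl a ha).2]

theorem IsExchange.sitesProd {F : ℂ → Matrix (Fin n) (Fin n) S} (hF : IsExchange q F)
    (k : HeckeIdx m) {x : Fin m → ℂ} (hx : ∀ a, x a ≠ 0) :
    sitesProd F x * braidScalar n q S k (x k.hi) (x k.lo) =
      braidScalar n q S k (x k.hi) (x k.lo) * QuantumAffine.sitesProd F (x ∘ adjSwap k) := by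
  obtain ⟨l₁, l₂, e, h1, h2⟩ := exists_finRange_split k
  have hb := hF.braid (m := m) k (hx k.hi) (hx k.lo)
  have c1 := commute_prod_map (b := braidScalar n q S k (x k.hi) (x k.lo))
    (fun a => site a (F (x a))) l₁ fun a ha => braidScalar_commute_site k _ _ (h1 a ha) _
  have c2 := commute_prod_map (b := braidScalar n q S k (x k.hi) (x k.lo))
    (fun a => site a (F (x a))) l₂ fun a ha => braidScalar_commute_site k _ _ (h2 a ha) _
  simp only [QuantumAffine.sitesProd, e, List.map_append, List.map_cons, List.prod_append,
    List.prod_cons, Function.comp_apply, map_comp_adjSwap k l₁ h1 (fun a z => site a (F z)),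
    map_comp_adjSwap k l₂ h2 (fun a z => site a (F z)), adjSwap_lo, adjSwap_hi]
  set B := braidScalar n q S k (x k.hi) (x k.lo)
  set L₁ := (l₁.map fun a => site a (F (x a))).prod
  set L₂ := (l₂.map fun a => site a (F (x a))).prod
  calc L₁ * (site k.lo (F (x k.lo)) * (site k.hi (F (x k.hi)) * L₂)) * B
      = L₁ * (site k.lo (F (x k.lo)) * site k.hi (F (x k.hi))) * (L₂ * B) := by
        simp only [mul_assoc]
    _ = L₁ * (site k.lo (F (x k.lo)) * site k.hi (F (x k.hi)) * B) * L₂ := by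
        rw [← c2.eq]; simp only [mul_assoc]
    _ = L₁ * B * (site k.lo (F (x k.hi)) * site k.hi (F (x k.lo))) * L₂ := by
        rw [← hb]; simp only [mul_assoc]
    _ = _ := by rw [← c1.eq]; simp only [mul_assoc]

theorem IsCoexchange.sitesProdRev {F : ℂ → Matrix (Fin n) (Fin n) S} (hF : IsCoexchange q F)
    (k : HeckeIdx m) {x : Fin m → ℂ} (hx : ∀ a, x a ≠ 0) :
    sitesProdRev F x * braidScalar n q S k (x k.lo) (x k.hi) =
      braidScalar n q S k (x k.lo) (x k.hi) * QuantumAffine.sitesProdRev F (x ∘ adjSwap k) := by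
  obtain ⟨l₁, l₂, e, h1, h2⟩ := exists_finRange_split k
  have hb := hF.braid (m := m) k (hx k.lo) (hx k.hi)
  have h1' : ∀ a ∈ l₁.reverse, a ≠ k.lo ∧ a ≠ k.hi := fun a ha => h1 a (List.mem_reverse.1 ha)
  have h2' : ∀ a ∈ l₂.reverse, a ≠ k.lo ∧ a ≠ k.hi := fun a ha => h2 a (List.mem_reverse.1 ha)
  have c1 := commute_prod_map (b := braidScalar n q S k (x k.lo) (x k.hi))
    (fun a => site a (F (x a))) l₁.reverse fun a ha => braidScalar_commute_site k _ _ (h1' a ha) _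
  have c2 := commute_prod_map (b := braidScalar n q S k (x k.lo) (x k.hi))
    (fun a => site a (F (x a))) l₂.reverse fun a ha => braidScalar_commute_site k _ _ (h2' a ha) _
  simp only [QuantumAffine.sitesProdRev, e, List.reverse_append, List.reverse_cons,
    List.map_append, List.map_cons, List.map_nil, List.prod_append, List.prod_singleton, Function.comp_apply,
    map_comp_adjSwap k _ h1' (fun a z => site a (F z)),
    map_comp_adjSwap k _ h2' (fun a z => site a (F z)), adjSwap_lo, adjSwap_hi]
  set B := braidScalar n q S k (x k.lo) (x k.hi)
  set L₁ := (l₁.reverse.map fun a => site a (F (x a))).prod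
  set L₂ := (l₂.reverse.map fun a => site a (F (x a))).prod
  calc L₂ * site k.hi (F (x k.hi)) * site k.lo (F (x k.lo)) * L₁ * B
      = L₂ * (site k.hi (F (x k.hi)) * site k.lo (F (x k.lo))) * (L₁ * B) := by
        simp only [mul_assoc]
    _ = L₂ * (site k.hi (F (x k.hi)) * site k.lo (F (x k.lo)) * B) * L₁ := by
        rw [← c1.eq]; simp only [mul_assoc]
    _ = L₂ * B * (site k.hi (F (x k.lo)) * site k.lo (F (x k.hi))) * L₁ := by
        rw [← hb]; simp only [mul_assoc]
    _ = _ := by rw [← c2.eq]; simp only [mul_assoc]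

theorem IsExchange.sitesProd_baxter {F : ℂ → Matrix (Fin n) (Fin n) S} (hF : IsExchange q F)
    (k : HeckeIdx m) (c : Fin m → ℤ) :
    QuantumAffine.sitesProd F (fun a => qSq q (-c a)) * baxter q (tensorT n q S) k c =
      baxter q (tensorT n q S) k c *
        QuantumAffine.sitesProd F (fun a => qSq q (-(c ∘ adjSwap k) a)) := by
  have h := hF.sitesProd (m := m) k (x := fun a => qSq q (-c a)) fun a => qSq_ne_zero _
  have e : ∀ i j : ℤ, qSq q i = qSq q i * qSq q j * qSq q (-j) := fun i j => by
    rw [mul_assoc, qSq, qSq, qSq, ← zpow_add₀ q.ne_zero (2 * j)]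
    simp
  have hB : baxter q (tensorT n q S) k c = (qSq q (c k.lo) * qSq q (c k.hi)) •
      braidScalar n q S k (qSq q (-c k.hi)) (qSq q (-c k.lo)) := by
    rw [baxter_tensorT, ← braidScalar_mul, ← e, mul_comm (qSq q (c k.lo)), ← e]
  rw [hB, mul_smul_comm, smul_mul_assoc]
  exact congrArg _ h

theorem IsCoexchange.sitesProdRev_baxter {F : ℂ → Matrix (Fin n) (Fin n) S}
    (hF : IsCoexchange q F) (k : HeckeIdx m) (c : Fin m → ℤ) :
    QuantumAffine.sitesProdRev F (fun a => qSq q (c a)) * baxter q (tensorT n q S) k c =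
      baxter q (tensorT n q S) k c *
        QuantumAffine.sitesProdRev F (fun a => qSq q ((c ∘ adjSwap k) a)) := by
  rw [baxter_tensorT]
  exact hF.sitesProdRev (m := m) k (x := fun a => qSq q (c a)) fun a => qSq_ne_zero _

theorem tensorT_isHecke (n m : ℕ) (q : ℂˣ) (S : Type*) [Ring S] [Algebra ℂ S] :
    IsHecke q (tensorT n q S : HeckeIdx m → _) := map_RCheck_isHecke n m q S

end Products

end

section

/-! ### The exchange relations for `L⁺(u)` and `L⁻(u)` -/

section Evaluation

variable {B : Type*} [Ring B] [Algebra ℂ B]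

theorem sum_antidiagonal_cancel {r d : PowerSeries ℂ} (hr : r * d = 1) {W W' : ℕ → B}
    (h : ∀ a, ∑ p ∈ Finset.HasAntidiagonal.antidiagonal a, PowerSeries.coeff p.1 r • W p.2 =
      ∑ p ∈ Finset.HasAntidiagonal.antidiagonal a, PowerSeries.coeff p.1 r • W' p.2) : W = W' := by
  have key : ∀ V : ℕ → B, PowerSeries.map (algebraMap ℂ B) d *
      (PowerSeries.map (algebraMap ℂ B) r * PowerSeries.mk V) = PowerSeries.mk V := by
    intro V
    rw [← mul_assoc, ← map_mul, mul_comm d, hr, map_one, one_mul]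
  have e : PowerSeries.map (algebraMap ℂ B) r * PowerSeries.mk W =
      PowerSeries.map (algebraMap ℂ B) r * PowerSeries.mk W' := by
    ext a
    rw [PowerSeries.coeff_mul, PowerSeries.coeff_mul]
    simpa only [PowerSeries.coeff_map, PowerSeries.coeff_mk, ← Algebra.smul_def] using h a
  have h2 : PowerSeries.mk W = PowerSeries.mk W' := by rw [← key W, e, key W']
  funext a
  simpa using congrArg (PowerSeries.coeff a) h2

theorem eval_linear_relation {R0 R1 : B} {W W' : ℕ → B} {N : ℕ} (hW : ∀ a, N < a → W a = 0)
    (hW' : ∀ a, N < a → W' a = 0) (h0 : R0 * W 0 = W' 0 * R0)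
    (hs : ∀ a, R0 * W (a + 1) + R1 * W a = W' (a + 1) * R0 + W' a * R1) (x y : ℂ) :
    (y • R0 + x • R1) * ∑ p ∈ Finset.HasAntidiagonal.antidiagonal N, (x ^ p.1 * y ^ p.2) • W p.1 =
      (∑ p ∈ Finset.HasAntidiagonal.antidiagonal N, (x ^ p.1 * y ^ p.2) • W' p.1) * (y • R0 + x • R1) := by
  have key : ∀ V : ℕ → B, V (N + 1) = 0 →
      y • ∑ p ∈ Finset.HasAntidiagonal.antidiagonal N, (x ^ p.1 * y ^ p.2) • V p.1 =
        ∑ p ∈ Finset.HasAntidiagonal.antidiagonal (N + 1), (x ^ p.1 * y ^ p.2) • V p.1 := by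
    intro V hV
    rw [Finset.Nat.antidiagonal_succ', Finset.sum_cons, hV, smul_zero, zero_add, Finset.sum_map,
      Finset.smul_sum]
    refine Finset.sum_congr rfl fun p _ => ?_
    simp only [smul_smul, Function.Embedding.prodMap, Function.Embedding.coeFn_mk, Prod.map,
      Function.Embedding.refl_apply]
    congr 1
    rw [Nat.succ_eq_add_one]
    ring
  have key' : ∀ V : ℕ → B, x • ∑ p ∈ Finset.HasAntidiagonal.antidiagonal N, (x ^ p.1 * y ^ p.2) • V p.1 =
      ∑ p ∈ Finset.HasAntidiagonal.antidiagonal N, (x ^ (p.1 + 1) * y ^ p.2) • V p.1 := by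
    intro V
    rw [Finset.smul_sum]
    refine Finset.sum_congr rfl fun p _ => ?_
    rw [smul_smul]
    congr 1
    ring
  rw [add_mul, mul_add, smul_mul_assoc, smul_mul_assoc, mul_smul_comm, mul_smul_comm,
    ← mul_smul_comm, ← mul_smul_comm, ← smul_mul_assoc, ← smul_mul_assoc,
    key W (hW _ (Nat.lt_succ_self N)), key W' (hW' _ (Nat.lt_succ_self N)), key', key',
    Finset.Nat.antidiagonal_succ, Finset.sum_cons, Finset.sum_cons, Finset.sum_map, Finset.sum_map,
    mul_add, add_mul, add_assoc, add_assoc]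
  congr 1
  · rw [mul_smul_comm, smul_mul_assoc, h0]
  · rw [Finset.mul_sum, Finset.mul_sum, Finset.sum_mul, Finset.sum_mul, ← Finset.sum_add_distrib,
      ← Finset.sum_add_distrib]
    refine Finset.sum_congr rfl fun p _ => ?_
    simp only [Function.Embedding.prodMap, Function.Embedding.coeFn_mk, Prod.map,
      Function.Embedding.refl_apply, Nat.succ_eq_add_one]
    rw [mul_smul_comm, mul_smul_comm, smul_mul_assoc, smul_mul_assoc, ← smul_add, ← smul_add, hs]

theorem mk_smul_pow_mul {L G : ℕ → B} (h : PowerSeries.mk L * PowerSeries.mk G = 1) (x : ℂ) :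
    (PowerSeries.mk fun r => x ^ r • L r) * (PowerSeries.mk fun r => x ^ r • G r) = 1 := by
  ext k
  have h' := congrArg (PowerSeries.coeff k) h
  rw [PowerSeries.coeff_mul] at h' ⊢
  have e : ∀ p ∈ Finset.HasAntidiagonal.antidiagonal k,
      PowerSeries.coeff p.1 (PowerSeries.mk fun r => x ^ r • L r) *
        PowerSeries.coeff p.2 (PowerSeries.mk fun r => x ^ r • G r) =
      x ^ k • (PowerSeries.coeff p.1 (PowerSeries.mk L) *
        PowerSeries.coeff p.2 (PowerSeries.mk G)) := by
    intro p hp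
    rw [← Finset.HasAntidiagonal.mem_antidiagonal.1 hp]
    simp only [PowerSeries.coeff_mk]
    rw [smul_mul_smul_comm, pow_add]
  rw [Finset.sum_congr rfl e, ← Finset.smul_sum, h', PowerSeries.coeff_one]
  by_cases hk : k = 0 <;> simp [hk]

end Evaluation

section Exchange

variable {n : ℕ} {q : ℂˣ} {A : Type*} [Ring A] [Algebra ℂ A]

/-- The product of the series `rPoly(ζ, 1)` and a series with coefficients `W a`. -/
theorem linear_relation_of_series
    {W W' : ℕ → Matrix (Fin n × Fin n) (Fin n × Fin n) A}
    (h : ∀ a, ∑ k ∈ Finset.range (a + 1), (RCoeff n q k).map (algebraMap ℂ A) * W (a - k) =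
      ∑ k ∈ Finset.range (a + 1), W' (a - k) * (RCoeff n q k).map (algebraMap ℂ A)) :
    rScalar n q A 0 1 * W 0 = W' 0 * rScalar n q A 0 1 ∧
    ∀ a, rScalar n q A 0 1 * W (a + 1) + rScalar n q A 1 0 * W a =
      W' (a + 1) * rScalar n q A 0 1 + W' a * rScalar n q A 1 0 := by
  have hd : PowerSeries.constantCoeff (rScal n q) ≠ 0 := by
    rw [rScal, map_mul, ← PowerSeries.coeff_zero_eq_constantCoeff_apply, PowerSeries.constantCoeff_inv,
      constantCoeff_rDen]
    simp [normSeries, normCoeff]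
  have hR : ∀ k, (RCoeff n q k).map (algebraMap ℂ A) =
      PowerSeries.coeff k (rScal n q) • rScalar n q A 0 1 +
        (if k = 0 then 0 else PowerSeries.coeff (k - 1) (rScal n q)) • rScalar n q A 1 0 := by
    intro k
    ext s t
    have e : RCoeff n q k s t = PowerSeries.coeff k (rScal n q) * rPoly n q (0 : ℂ) 1 s t +
        (if k = 0 then 0 else PowerSeries.coeff (k - 1) (rScal n q)) * rPoly n q (1 : ℂ) 0 s t := by
      have hX : rPoly n q (PowerSeries.X : PowerSeries ℂ) 1 s t =
          PowerSeries.C (rPoly n q (0 : ℂ) 1 s t) +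
            PowerSeries.X * PowerSeries.C (rPoly n q (1 : ℂ) 0 s t) := by
        simp only [rPoly, Matrix.add_apply, Matrix.smul_apply, Matrix.map_apply, smul_eq_mul,
          flip, PowerSeries.algebraMap_apply, Algebra.algebraMap_self, RingHom.id_apply]
        simp only [map_add, map_mul, map_sub, map_one, map_zero]
        ring
      rw [← coeff_rSeries, rSeries_eq, Matrix.smul_apply, hX, smul_eq_mul, mul_add, ← mul_assoc,
        map_add, PowerSeries.coeff_mul_C, PowerSeries.coeff_mul_C]
      cases k with
      | zero => simp
      | succ k => simp [PowerSeries.coeff_succ_mul_X]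
    rw [Matrix.map_apply, e, map_add, map_mul, map_mul, Matrix.add_apply, Matrix.smul_apply,
      Matrix.smul_apply, Algebra.smul_def, Algebra.smul_def]
    rfl
  let V : ℕ → Matrix (Fin n × Fin n) (Fin n × Fin n) A := fun a =>
    rScalar n q A 0 1 * W a + if a = 0 then 0 else rScalar n q A 1 0 * W (a - 1)
  let V' : ℕ → Matrix (Fin n × Fin n) (Fin n × Fin n) A := fun a =>
    W' a * rScalar n q A 0 1 + if a = 0 then 0 else W' (a - 1) * rScalar n q A 1 0
  have hV : V = V' := by
    refine sum_antidiagonal_cancel (PowerSeries.mul_inv_cancel _ hd) fun a => ?_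
    have h' := h a
    simp only [hR, add_mul, mul_add, smul_mul_assoc, mul_smul_comm, Finset.sum_add_distrib] at h'
    simp only [V, V', smul_add, Finset.sum_add_distrib,
      Finset.Nat.sum_antidiagonal_eq_sum_range_succ (fun i j => PowerSeries.coeff i (rScal n q) •
        (rScalar n q A 0 1 * W j)),
      Finset.Nat.sum_antidiagonal_eq_sum_range_succ (fun i j => PowerSeries.coeff i (rScal n q) •
        (W' j * rScalar n q A 0 1)),
      Finset.Nat.sum_antidiagonal_eq_sum_range_succ (fun i j => PowerSeries.coeff i (rScal n q) •
        (if j = 0 then 0 else rScalar n q A 1 0 * W (j - 1))),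
      Finset.Nat.sum_antidiagonal_eq_sum_range_succ (fun i j => PowerSeries.coeff i (rScal n q) •
        (if j = 0 then 0 else W' (j - 1) * rScalar n q A 1 0))]
    have shift : ∀ U : ℕ → Matrix (Fin n × Fin n) (Fin n × Fin n) A,
        ∑ k ∈ Finset.range (a + 1), PowerSeries.coeff k (rScal n q) •
          (if a - k = 0 then 0 else U (a - k - 1)) =
        ∑ k ∈ Finset.range (a + 1),
          (if k = 0 then 0 else PowerSeries.coeff (k - 1) (rScal n q)) • U (a - k) := by
      intro U
      rw [Finset.sum_range_succ, Finset.sum_range_succ']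
      simp only [Nat.sub_self, if_true, smul_zero, add_zero, zero_smul, Nat.succ_ne_zero, if_false]
      refine Finset.sum_congr rfl fun k hk => ?_
      have := Finset.mem_range.1 hk
      rw [if_neg (by omega), Nat.sub_sub, Nat.add_sub_cancel]
    rw [shift (fun j => rScalar n q A 1 0 * W j), shift (fun j => W' j * rScalar n q A 1 0)]
    exact h'
  refine ⟨by simpa [V, V'] using congrFun hV 0, fun a => by simpa [V, V'] using congrFun hV (a + 1)⟩

theorem rScalar_eq_linear (x y : ℂ) :
    rScalar n q A x y = y • rScalar n q A 0 1 + x • rScalar n q A 1 0 := by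
  ext s t
  have e : rPoly n q x y s t = y * rPoly n q (0 : ℂ) 1 s t + x * rPoly n q (1 : ℂ) 0 s t := by
    simp only [rPoly, Matrix.add_apply, Matrix.smul_apply, smul_eq_mul]
    ring
  rw [rScalar, Matrix.map_apply, e, map_add, map_mul, map_mul, Matrix.add_apply, Matrix.smul_apply,
    Matrix.smul_apply, Algebra.smul_def, Algebra.smul_def]
  rfl

/-- The matrix `∑ x^r L[r] T^r` of formal power series in `T`. -/
def scaled (L : ℕ → Matrix (Fin n) (Fin n) A) (x : ℂ) :
    Matrix (Fin n) (Fin n) (PowerSeries A) :=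
  Matrix.of fun i j => PowerSeries.mk fun r => x ^ r • L r i j

/-- The exchange relation, coefficient by coefficient. -/
theorem scaled_relation_of_coeff {L : ℕ → Matrix (Fin n) (Fin n) A} {u v x y : ℂ}
    (h : ∀ N : ℕ, rScalar n q A u v *
        ∑ p ∈ Finset.HasAntidiagonal.antidiagonal N, (x ^ p.1 * y ^ p.2) •
          ((L p.1 ⊗ₖ (1 : Matrix (Fin n) (Fin n) A)) * ((1 : Matrix (Fin n) (Fin n) A) ⊗ₖ L p.2)) =
      (∑ p ∈ Finset.HasAntidiagonal.antidiagonal N, (x ^ p.1 * y ^ p.2) •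
          (((1 : Matrix (Fin n) (Fin n) A) ⊗ₖ L p.2) * (L p.1 ⊗ₖ (1 : Matrix (Fin n) (Fin n) A)))) *
        rScalar n q A u v) :
    rScalar n q (PowerSeries A) u v *
      ((scaled L x ⊗ₖ (1 : Matrix (Fin n) (Fin n) (PowerSeries A))) *
      ((1 : Matrix (Fin n) (Fin n) (PowerSeries A)) ⊗ₖ scaled L y)) =
    ((1 : Matrix (Fin n) (Fin n) (PowerSeries A)) ⊗ₖ scaled L y) *
      (scaled L x ⊗ₖ (1 : Matrix (Fin n) (Fin n) (PowerSeries A))) *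
      rScalar n q (PowerSeries A) u v := by
  ext s t N
  have h' := congrFun (congrFun (h N) s) t
  have e : ∀ s t, rScalar n q (PowerSeries A) u v s t = PowerSeries.C (rScalar n q A u v s t) :=
    fun s t => by simp only [rScalar, Matrix.map_apply, PowerSeries.algebraMap_apply]
  rw [Matrix.mul_apply, Matrix.mul_apply] at h' ⊢
  simp only [Matrix.sum_apply, Matrix.smul_apply,
    kronecker_one_mul_one_kronecker, one_kronecker_mul_kronecker_one] at h'
  simp only [kronecker_one_mul_one_kronecker, one_kronecker_mul_kronecker_one, e, map_sum,
    PowerSeries.coeff_C_mul, PowerSeries.coeff_mul_C]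
  have c1 : ∀ i j k l, PowerSeries.coeff N (scaled L x i j * scaled L y k l) =
      ∑ p ∈ Finset.HasAntidiagonal.antidiagonal N, (x ^ p.1 * y ^ p.2) • (L p.1 i j * L p.2 k l) := by
    intro i j k l
    rw [PowerSeries.coeff_mul]
    refine Finset.sum_congr rfl fun p _ => ?_
    simp only [scaled, Matrix.of_apply, PowerSeries.coeff_mk]
    rw [smul_mul_smul_comm]
  have c2 : ∀ i j k l, PowerSeries.coeff N (scaled L y i j * scaled L x k l) =
      ∑ p ∈ Finset.HasAntidiagonal.antidiagonal N, (x ^ p.1 * y ^ p.2) • (L p.2 i j * L p.1 k l) := by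
    intro i j k l
    rw [PowerSeries.coeff_mul, ← Finset.Nat.sum_antidiagonal_swap]
    refine Finset.sum_congr rfl fun p _ => ?_
    simp only [scaled, Matrix.of_apply, PowerSeries.coeff_mk, Prod.fst_swap, Prod.snd_swap]
    rw [smul_mul_smul_comm, mul_comm (y ^ _)]
  simp only [c1, c2]
  exact h'

theorem isExchange_up {L : ℕ → Matrix (Fin n) (Fin n) A}
    (h : ∀ a b s t, rllLeft q 1 (upCoeff L) (upCoeff L) a b s t =
      rllRight q 1 (upCoeff L) (upCoeff L) a b s t) : IsExchange q (scaled L) := by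
  intro x y _ _
  refine scaled_relation_of_coeff fun N => ?_
  let W : ℕ → Matrix (Fin n × Fin n) (Fin n × Fin n) A := fun a =>
    (upCoeff L a ⊗ₖ 1) * (1 ⊗ₖ upCoeff L ((N : ℤ) - a))
  let W' : ℕ → Matrix (Fin n × Fin n) (Fin n × Fin n) A := fun a =>
    (1 ⊗ₖ upCoeff L ((N : ℤ) - a)) * (upCoeff L a ⊗ₖ 1)
  have hz : ∀ a : ℤ, a < 0 → upCoeff L a = 0 := fun a ha => if_neg ha.not_ge
  have hn' : ∀ a : ℕ, upCoeff L a = L a := fun a => by simp [upCoeff]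
  have hrel := linear_relation_of_series (q := q) (W := W) (W' := W') fun a => by
    have h1 : rllLeft q 1 (upCoeff L) (upCoeff L) a ((N : ℤ) - a) =
        rllRight q 1 (upCoeff L) (upCoeff L) a ((N : ℤ) - a) := by
      ext s t; exact h _ _ s t
    have hsub : Finset.range (a + 1) ⊆
        Finset.range ((a : ℤ).natAbs + ((N : ℤ) - a).natAbs + 1) :=
      Finset.range_subset_range.2 (by omega)
    rw [rllLeft, rllRight, ← Finset.sum_subset hsub, ← Finset.sum_subset hsub] at h1
    · convert h1 using 1
      · refine Finset.sum_congr rfl fun k hk => ?_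
        have := Finset.mem_range.1 hk
        rw [one_pow, one_smul, mul_assoc]
        simp only [W]
        rw [show ((a - k : ℕ) : ℤ) = (a : ℤ) - k by omega,
          show (N : ℤ) - ((a : ℤ) - k) = (N : ℤ) - a + k by ring]
      · refine Finset.sum_congr rfl fun k hk => ?_
        have := Finset.mem_range.1 hk
        rw [one_pow, one_smul]
        simp only [W']
        rw [show ((a - k : ℕ) : ℤ) = (a : ℤ) - k by omega,
          show (N : ℤ) - ((a : ℤ) - k) = (N : ℤ) - a + k by ring]
    · intro k _ hk
      rw [hz (a - k) (by have := mt Finset.mem_range.2 hk; omega)]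
      simp
    · intro k _ hk
      rw [hz (a - k) (by have := mt Finset.mem_range.2 hk; omega)]
      simp
  have := eval_linear_relation (N := N) (W := W) (W' := W')
    (fun a ha => by simp only [W]; rw [hz (N - a) (by omega)]; simp)
    (fun a ha => by simp only [W']; rw [hz (N - a) (by omega)]; simp) hrel.1 hrel.2 x y
  rw [← rScalar_eq_linear] at this
  have e : ∀ p ∈ Finset.HasAntidiagonal.antidiagonal N, upCoeff L ((N : ℤ) - (p.1 : ℕ)) = L p.2 := fun p hp => by
    have := Finset.HasAntidiagonal.mem_antidiagonal.1 hp
    rw [show (N : ℤ) - (p.1 : ℕ) = (p.2 : ℕ) by omega, hn']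
  convert this using 1
  · congr 1
    refine Finset.sum_congr rfl fun p hp => ?_
    simp only [W]; rw [e p hp, hn']
  · congr 1
    refine Finset.sum_congr rfl fun p hp => ?_
    simp only [W']; rw [e p hp, hn']

theorem isExchange_down {L : ℕ → Matrix (Fin n) (Fin n) A}
    (h : ∀ a b s t, rllLeft q 1 (downCoeff L) (downCoeff L) a b s t =
      rllRight q 1 (downCoeff L) (downCoeff L) a b s t) :
    IsExchange q fun x => scaled L x⁻¹ := by
  intro x y hx hy
  have hr : rScalar n q (PowerSeries A) x y = (x * y) • rScalar n q (PowerSeries A) y⁻¹ x⁻¹ := by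
    rw [← rScalar_mul]
    congr 1
    · field_simp
    · field_simp
  rw [hr, smul_mul_assoc, mul_smul_comm]
  congr 1
  refine scaled_relation_of_coeff fun N => ?_
  let W : ℕ → Matrix (Fin n × Fin n) (Fin n × Fin n) A := fun a =>
    (downCoeff L ((a : ℤ) - N) ⊗ₖ 1) * (1 ⊗ₖ downCoeff L (-a))
  let W' : ℕ → Matrix (Fin n × Fin n) (Fin n × Fin n) A := fun a =>
    (1 ⊗ₖ downCoeff L (-a)) * (downCoeff L ((a : ℤ) - N) ⊗ₖ 1)
  have hz : ∀ a : ℤ, 0 < a → downCoeff L a = 0 := fun a ha => if_neg ha.not_ge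
  have hn' : ∀ a : ℕ, downCoeff L (-a) = L a := fun a => by simp [downCoeff]
  have hrel := linear_relation_of_series (q := q) (W := W) (W' := W') fun a => by
    have h1 : rllLeft q 1 (downCoeff L) (downCoeff L) ((a : ℤ) - N) (-a) =
        rllRight q 1 (downCoeff L) (downCoeff L) ((a : ℤ) - N) (-a) := by
      ext s t; exact h _ _ s t
    have hsub : Finset.range (a + 1) ⊆
        Finset.range (((a : ℤ) - N).natAbs + (-(a : ℤ)).natAbs + 1) :=
      Finset.range_subset_range.2 (by omega)
    rw [rllLeft, rllRight, ← Finset.sum_subset hsub, ← Finset.sum_subset hsub] at h1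
    · convert h1 using 1
      · refine Finset.sum_congr rfl fun k hk => ?_
        have := Finset.mem_range.1 hk
        rw [one_pow, one_smul, mul_assoc]
        simp only [W]
        rw [show ((a - k : ℕ) : ℤ) = (a : ℤ) - k by omega,
          show (a : ℤ) - k - N = (a : ℤ) - N - k by ring, show -((a : ℤ) - k) = -a + k by ring]
      · refine Finset.sum_congr rfl fun k hk => ?_
        have := Finset.mem_range.1 hk
        rw [one_pow, one_smul]
        simp only [W']
        rw [show ((a - k : ℕ) : ℤ) = (a : ℤ) - k by omega,
          show (a : ℤ) - k - N = (a : ℤ) - N - k by ring, show -((a : ℤ) - k) = -a + k by ring]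
    · intro k _ hk
      rw [hz (-a + k) (by have := mt Finset.mem_range.2 hk; omega)]
      simp
    · intro k _ hk
      rw [hz (-a + k) (by have := mt Finset.mem_range.2 hk; omega)]
      simp
  have := eval_linear_relation (N := N) (W := W) (W' := W')
    (fun a ha => by simp only [W]; rw [hz (a - N) (by omega)]; simp)
    (fun a ha => by simp only [W']; rw [hz (a - N) (by omega)]; simp) hrel.1 hrel.2 y⁻¹ x⁻¹
  rw [← rScalar_eq_linear, ← Finset.Nat.sum_antidiagonal_swap,
    ← Finset.Nat.sum_antidiagonal_swap (f := fun p => (y⁻¹ ^ p.1 * x⁻¹ ^ p.2) • W' p.1)] at this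
  have e : ∀ p ∈ Finset.HasAntidiagonal.antidiagonal N,
      downCoeff L (((p.2 : ℕ) : ℤ) - N) = L p.1 := fun p hp => by
    have := Finset.HasAntidiagonal.mem_antidiagonal.1 hp
    rw [show ((p.2 : ℕ) : ℤ) - N = -(p.1 : ℕ) by omega, hn']
  convert this using 1
  · congr 1
    refine Finset.sum_congr rfl fun p hp => ?_
    simp only [W, Prod.fst_swap, Prod.snd_swap]; rw [e p hp, hn', mul_comm (x⁻¹ ^ _)]
  · congr 1
    refine Finset.sum_congr rfl fun p hp => ?_
    simp only [W', Prod.fst_swap, Prod.snd_swap]; rw [e p hp, hn', mul_comm (x⁻¹ ^ _)]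

theorem IsCoexchange.comp_mul {S : Type*} [Ring S] [Algebra ℂ S]
    {F : ℂ → Matrix (Fin n) (Fin n) S} (hF : IsCoexchange q F) {c : ℂ} (hc : c ≠ 0) :
    IsCoexchange q fun x => F (c * x) := by
  intro x y hx hy
  have h := hF (c * x) (c * y) (mul_ne_zero hc hx) (mul_ne_zero hc hy)
  rw [rScalar_mul, smul_mul_assoc, mul_smul_comm] at h
  exact (smul_right_injective _ hc) h

/-- Power series of matrices as matrices of power series. -/
def seriesEntries {ι : Type*} [Fintype ι] [DecidableEq ι] :
    PowerSeries (Matrix ι ι A) →* Matrix ι ι (PowerSeries A) where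
  toFun f := Matrix.of fun i j => PowerSeries.mk fun k => PowerSeries.coeff k f i j
  map_one' := by
    ext i j k
    rw [Matrix.of_apply, PowerSeries.coeff_mk, PowerSeries.coeff_one, Matrix.one_apply]
    by_cases hk : k = 0 <;> by_cases hij : i = j <;> simp [hk, hij, PowerSeries.coeff_one, Matrix.one_apply]
  map_mul' f g := by
    ext i j k
    simp only [Matrix.of_apply, PowerSeries.coeff_mk, PowerSeries.coeff_mul, Matrix.sum_apply,
      Matrix.mul_apply, map_sum]
    rw [Finset.sum_comm]

theorem coeff_seriesEntries {ι : Type*} [Fintype ι] [DecidableEq ι]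
    (f : PowerSeries (Matrix ι ι A)) (k : ℕ) :
    (seriesEntries f).map (PowerSeries.coeff k) = PowerSeries.coeff k f := by
  ext i j
  simp [seriesEntries]

theorem seriesEntries_siteSeries {m : ℕ} (a : Fin m) (x : ℂ) (L : ℕ → Matrix (Fin n) (Fin n) A) :
    seriesEntries (siteSeries a x (PowerSeries.mk L)) = site a (scaled L x) := by
  ext w w' k
  simp only [seriesEntries, MonoidHom.coe_mk, OneHom.coe_mk, Matrix.of_apply, PowerSeries.coeff_mk,
    siteSeries, site, scaled, Matrix.smul_apply]
  split_ifs <;> simp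

theorem scaled_eq (L : ℕ → Matrix (Fin n) (Fin n) A) (x : ℂ) :
    scaled L x = seriesEntries (PowerSeries.mk fun r => x ^ r • L r) := by
  ext i j k
  simp [seriesEntries, scaled]

theorem scaled_mul_scaled {L G : ℕ → Matrix (Fin n) (Fin n) A}
    (h : PowerSeries.mk L * PowerSeries.mk G = 1) (x : ℂ) : scaled L x * scaled G x = 1 := by
  rw [scaled_eq, scaled_eq, ← map_mul, mk_smul_pow_mul h, map_one]

end Exchange

section Generators

variable {n : ℕ} {q : ℂˣ}

theorem LPlus_isExchange (n : ℕ) (q : ℂˣ) : IsExchange q (scaled (LPlus n q)) := by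
  refine isExchange_up fun a b s t => ?_
  have h := freeToCri_rel (Rel.rll_plus (n := n) (q := q) a b s t)
  rw [map_rllLeft, map_rllRight, map_one] at h
  simpa only [freeToCri_freePlus] using h

theorem LMinus_isExchange (n : ℕ) (q : ℂˣ) : IsExchange q fun x => scaled (LMinus n q) x⁻¹ := by
  refine isExchange_down fun a b s t => ?_
  have h := freeToCri_rel (Rel.rll_minus (n := n) (q := q) a b s t)
  rw [map_rllLeft, map_rllRight, map_one] at h
  simpa only [freeToCri_freeMinus] using h

/-- The coefficients of `L⁻(u)⁻¹`. -/
def LMinusInv (n : ℕ) (q : ℂˣ) (r : ℕ) : Matrix (Fin n) (Fin n) (UqCri n q) :=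
  PowerSeries.coeff r (LMinusInvSeries n q)

theorem mk_LMinusInv (n : ℕ) (q : ℂˣ) : PowerSeries.mk (LMinusInv n q) = LMinusInvSeries n q := by
  ext1 r
  rw [PowerSeries.coeff_mk, LMinusInv]

theorem LMinus_mul_LMinusInv (x : ℂ) : scaled (LMinus n q) x * scaled (LMinusInv n q) x = 1 := by
  refine scaled_mul_scaled ?_ x
  rw [mk_LMinusInv]
  exact (LMinusSeries_mul_inv n q).1

theorem LMinusInv_mul_LMinus (x : ℂ) : scaled (LMinusInv n q) x * scaled (LMinus n q) x = 1 := by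
  refine scaled_mul_scaled ?_ x
  rw [mk_LMinusInv]
  exact (LMinusSeries_mul_inv n q).2

theorem LMinusInv_isCoexchange (n : ℕ) (q : ℂˣ) : IsCoexchange q (scaled (LMinusInv n q)) := by
  have h := (LMinus_isExchange n q).inv (G := fun x => scaled (LMinusInv n q) x⁻¹)
    (fun x _ => LMinus_mul_LMinusInv _) (fun x _ => LMinusInv_mul_LMinus _)
  simpa only [inv_inv] using h

/-- The family `x ↦ L⁻(z q^{-n} / x)⁻¹`. -/
def inverseFamily (n : ℕ) (q : ℂˣ) (x : ℂ) : Matrix (Fin n) (Fin n) (PowerSeries (UqCri n q)) :=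
  scaled (LMinusInv n q) ((q : ℂ) ^ (n : ℤ) * x)

theorem inverseFamily_isCoexchange (n : ℕ) (q : ℂˣ) : IsCoexchange q (inverseFamily n q) :=
  (LMinusInv_isCoexchange n q).comp_mul (zpow_ne_zero _ q.ne_zero)

theorem coeff_plusProduct {μ : YoungDiagram} (Λ : StdTableau μ) (k : ℕ) :
    PowerSeries.coeff k (plusProduct n q Λ) =
      (sitesProd (scaled (LPlus n q)) fun a => qSq q (-Λ.c a)).map (PowerSeries.coeff k) := by
  rw [← coeff_seriesEntries, plusProduct, map_list_prod, List.map_ofFn, sitesProd,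
    ← List.ofFn_eq_map]
  congr 3
  funext a
  rw [Function.comp_apply, LPlusSeries, seriesEntries_siteSeries, qSq, mul_neg, neg_mul]

theorem coeff_minusInvProduct {μ : YoungDiagram} (Λ : StdTableau μ) (k : ℕ) :
    PowerSeries.coeff k (minusInvProduct n q Λ) =
      (sitesProdRev (inverseFamily n q) fun a => qSq q (Λ.c a)).map (PowerSeries.coeff k) := by
  rw [← coeff_seriesEntries, minusInvProduct, map_list_prod, List.map_reverse, List.map_ofFn,
    sitesProdRev, List.map_reverse, ← List.ofFn_eq_map]
  congr 4
  funext a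
  rw [Function.comp_apply, ← mk_LMinusInv, seriesEntries_siteSeries, inverseFamily, qSq,
    ← zpow_add₀ q.ne_zero]

end Generators

end

section

/-! ### Independence of the standard tableau -/

section Scalars

variable {n m : ℕ} {q : ℂˣ} {A : Type*} [Ring A] [Algebra ℂ A]

/-- A matrix with scalar entries. -/
def scalarMat {ι : Type*} (A : Type*) [Ring A] [Algebra ℂ A] (M : Matrix ι ι ℂ) : Matrix ι ι A :=
  M.map (algebraMap ℂ A)

theorem scalarMat_mul {ι : Type*} [Fintype ι] (M N : Matrix ι ι ℂ) :
    scalarMat A (M * N) = scalarMat A M * scalarMat A N := Matrix.map_mul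

theorem scalarMat_smul {ι : Type*} (c : ℂ) (M : Matrix ι ι ℂ) :
    scalarMat A (c • M) = c • scalarMat A M := by
  ext i j
  simp [scalarMat, Algebra.smul_def]

theorem trace_mul_scalarMat {ι : Type*} [Fintype ι] (Y : Matrix ι ι A) (M : Matrix ι ι ℂ) :
    Matrix.trace (Y * scalarMat A M) = Matrix.trace (scalarMat A M * Y) := by
  simp only [Matrix.trace, Matrix.diag, Matrix.mul_apply, scalarMat, Matrix.map_apply]
  rw [Finset.sum_comm]
  simp only [Algebra.commutes]

theorem tabUnit_tensorT (x y : Tab m → ℂ) :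
    tabUnit q (tensorT n q A) x y = scalarMat A (tabUnit q (RCheck n q) x y) := by
  have h := fun σ => map_alongReduced ((Algebra.ofId ℂ A).mapMatrix.toRingHom.toMonoidHom)
    (RCheck n q (m := m)) σ
  have h' : scalarMat A (tabUnit q (RCheck n q) x y) =
    (Algebra.ofId ℂ A).mapMatrix (tabUnit q (RCheck n q) x y) := rfl
  rw [h', tabUnit, tabUnit, map_sum]
  refine Finset.sum_congr rfl fun σ _ => ?_
  rw [map_smul]
  exact congrArg _ (h σ).symm

theorem baxter_tensorT_eq_scalarMat (k : HeckeIdx m) (c : Fin m → ℤ) :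
    baxter q (tensorT n q A) k c = scalarMat A (baxter q (RCheck n q) k c) := by
  have h' : scalarMat A (baxter q (RCheck n q) k c) =
    (Algebra.ofId ℂ A).mapMatrix (baxter q (RCheck n q) k c) := rfl
  rw [h', baxter, baxter, map_add, map_smul, map_smul, map_one]
  rfl

/-- The diagonal operator `D₁ ⋯ D_m`. -/
def weightD (n m : ℕ) (q : ℂˣ) : Matrix (Fin m → Fin n) (Fin m → Fin n) ℂ :=
  Matrix.diagonal fun w => ∏ a, dEntry n q (w a)

theorem prod_site_DMat : (List.ofFn fun a : Fin m => site a (DMat n q)).prod = weightD n m q := by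
  rw [List.ofFn_eq_map]
  ext w w'
  rw [prod_site_apply (fun _ => DMat n q) _ (List.nodup_finRange m), if_pos (by simp),
    ← List.ofFn_eq_map, List.prod_ofFn, weightD, Matrix.diagonal_apply]
  split_ifs with h
  · subst h
    simp [DMat, dEntry]
  · obtain ⟨a, ha⟩ := Function.ne_iff.1 h
    exact Finset.prod_eq_zero (Finset.mem_univ a) (Matrix.diagonal_apply_ne _ ha)

theorem weightD_mul_RCheck (k : HeckeIdx m) :
    weightD n m q * RCheck n q k = RCheck n q k * weightD n m q := by
  have hD : ∀ w : Fin m → Fin n, (weightD n m q).mulVec (Pi.single w 1) =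
      (∏ a, dEntry n q (w a)) • Pi.single w 1 := by
    intro w
    rw [weightD, Matrix.diagonal_mulVec_single, mul_one, ← Pi.single_smul, smul_eq_mul, mul_one]
  have hs : ∀ w : Fin m → Fin n, ∏ a, dEntry n q ((w ∘ adjSwap k) a) = ∏ a, dEntry n q (w a) :=
    fun w => Equiv.prod_comp (adjSwap k) fun a => dEntry n q (w a)
  apply Matrix.ext_of_mulVec_single
  intro w
  rw [← Matrix.mulVec_mulVec, ← Matrix.mulVec_mulVec, hD, Matrix.mulVec_smul, RCheck_mulVec,
    Matrix.mulVec_add, Matrix.mulVec_smul, Matrix.mulVec_smul, hD, hD, hs, smul_add,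
    smul_comm (∏ a, dEntry n q (w a)), smul_comm (∏ a, dEntry n q (w a))]

theorem weightD_commute_tabUnit (x y : Tab m → ℂ) :
    weightD n m q * tabUnit q (RCheck n q) x y = tabUnit q (RCheck n q) x y * weightD n m q := by
  rw [tabUnit, Finset.mul_sum, Finset.sum_mul]
  refine Finset.sum_congr rfl fun σ _ => ?_
  rw [mul_smul_comm, smul_mul_assoc]
  congr 1
  exact commute_prod_map _ _ fun k _ => weightD_mul_RCheck k

theorem weightD_commute_baxter (k : HeckeIdx m) (c : Fin m → ℤ) :
    weightD n m q * baxter q (RCheck n q) k c = baxter q (RCheck n q) k c * weightD n m q := by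
  rw [baxter, mul_add, add_mul, mul_smul_comm, mul_smul_comm, smul_mul_assoc, smul_mul_assoc,
    weightD_mul_RCheck, mul_one, one_mul]

theorem weightE_eq {μ : YoungDiagram} (Λ : StdTableau μ) : weightE n q Λ =
    (schurElement q μ)⁻¹ • (weightD n μ.card q *
      tabUnit q (RCheck n q) (tabVec Λ.toTab.1) (tabVec Λ.toTab.1)) := by
  rw [weightE, prod_site_DMat, EMat_eq, mul_smul_comm]

/-- The intertwining relation with the operators of the Hecke algebra. -/
def Intertwines (q : ℂˣ) (X : (Fin m → ℤ) → Matrix (Fin m → Fin n) (Fin m → Fin n) A) : Prop :=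
  ∀ k c, X c * baxter q (tensorT n q A) k c = baxter q (tensorT n q A) k c * X (c ∘ adjSwap k)

theorem Intertwines.mul {X Y : (Fin m → ℤ) → Matrix (Fin m → Fin n) (Fin m → Fin n) A}
    (hX : Intertwines q X) (hY : Intertwines q Y) : Intertwines q fun c => X c * Y c := by
  intro k c
  rw [mul_assoc, hY k c, ← mul_assoc, hX k c, mul_assoc]

/-- Additive maps that respect multiplication by scalars preserve the intertwining relation. -/
theorem Intertwines.map {A' : Type*} [Ring A'] [Algebra ℂ A']
    {X : (Fin m → ℤ) → Matrix (Fin m → Fin n) (Fin m → Fin n) A} (hX : Intertwines q X)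
    (φ : A →+ A') (h : ∀ (c : ℂ) a, φ (algebraMap ℂ A c * a) = algebraMap ℂ A' c * φ a) :
    Intertwines q fun c => (X c).map φ := by
  have h1 : ∀ (M : Matrix (Fin m → Fin n) (Fin m → Fin n) ℂ)
      (Y : Matrix (Fin m → Fin n) (Fin m → Fin n) A),
      (scalarMat A M * Y).map φ = scalarMat A' M * Y.map φ := by
    intro M Y
    ext w w'
    simp only [Matrix.map_apply, Matrix.mul_apply, scalarMat, map_sum, h]
  have h2 : ∀ (M : Matrix (Fin m → Fin n) (Fin m → Fin n) ℂ)
      (Y : Matrix (Fin m → Fin n) (Fin m → Fin n) A),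
      (Y * scalarMat A M).map φ = Y.map φ * scalarMat A' M := by
    intro M Y
    ext w w'
    simp only [Matrix.map_apply, Matrix.mul_apply, scalarMat, map_sum, ← Algebra.commutes, h]
  intro k c
  have := congrArg (fun Z : Matrix (Fin m → Fin n) (Fin m → Fin n) A => Z.map φ) (hX k c)
  simp only [baxter_tensorT_eq_scalarMat, h1, h2] at this ⊢
  exact this

theorem Intertwines.coeff
    {X : (Fin m → ℤ) → Matrix (Fin m → Fin n) (Fin m → Fin n) (PowerSeries A)}
    (hX : Intertwines q X) (N : ℕ) : Intertwines q fun c => (X c).map (PowerSeries.coeff N) :=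
  hX.map (PowerSeries.coeff N).toAddMonoidHom fun c a => by
    rw [PowerSeries.algebraMap_apply]
    exact PowerSeries.coeff_C_mul N a _

theorem trace_eq_of_swap (hq : ∀ k : ℕ, 0 < k → q ^ k ≠ 1)
    {Y : (Fin m → ℤ) → Matrix (Fin m → Fin n) (Fin m → Fin n) A} (hY : Intertwines q Y)
    (Λ Γ : Tab m) (k : HeckeIdx m) (h : Γ.1 = Λ.1 ∘ adjSwap k) :
    Matrix.trace (Y (contents Λ.1) * scalarMat A (weightD n m q *
      tabUnit q (RCheck n q) (tabVec Λ.1) (tabVec Λ.1))) =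
    Matrix.trace (Y (contents Γ.1) * scalarMat A (weightD n m q *
      tabUnit q (RCheck n q) (tabVec Γ.1) (tabVec Γ.1))) := by
  obtain ⟨a, ha⟩ := exists_trace_weights hq m
  have hg := RCheck_isHecke n m q
  have hgA := tensorT_isHecke n m q A
  have hΓ : IsStd (Λ.1 ∘ adjSwap k) := h ▸ Γ.2
  have h1 := baxter_tabUnit_baxter hq hg k Λ.2 hΓ
  have h2 := tabUnit_baxter_tabUnit hq hg k Λ.2 hΓ
  have h3 := tabUnit_idempotent hq hg ha Γ
  have h4 := fusion hq hgA ha hY Γ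
  have h5 := hY k (contents Λ.1)
  have h6 : contents Λ.1 ∘ adjSwap k = contents Γ.1 := by rw [h]; rfl
  rw [h6, baxter_tensorT_eq_scalarMat] at h5
  rw [tabUnit_tensorT] at h4
  rw [← h] at h1 h2
  have h7 := weightD_commute_baxter (n := n) (q := q) k (contents Λ.1)
  have h8 := weightD_commute_tabUnit (n := n) (q := q) (tabVec Γ.1) (tabVec Γ.1)
  have hβ : swapCoef q Λ.1 k ^ 2 ≠ 0 := pow_ne_zero 2 (swapCoef_ne_zero hq Λ.2 hΓ)
  set P := baxter q (RCheck n q) k (contents Λ.1)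
  set e := tabUnit q (RCheck n q) (tabVec Γ.1) (tabVec Γ.1)
  set f := tabUnit q (RCheck n q) (tabVec Λ.1) (tabVec Λ.1)
  set D := weightD n m q
  set β := swapCoef q Λ.1 k ^ 2
  set Z := Y (contents Λ.1)
  set Z' := Y (contents Γ.1)
  apply smul_right_injective A hβ
  simp only
  rw [← Matrix.trace_smul, ← Matrix.trace_smul, ← mul_smul_comm, ← mul_smul_comm, ← scalarMat_smul,
    ← scalarMat_smul, ← mul_smul_comm, ← h1]
  calc Matrix.trace (Z * scalarMat A (D * (P * e * P)))
      = Matrix.trace (Z * scalarMat A P * scalarMat A (D * e) * scalarMat A P) := by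
        rw [show D * (P * e * P) = P * (D * e * P) by simp only [← mul_assoc, h7], scalarMat_mul,
          scalarMat_mul (D * e)]
        simp only [mul_assoc]
    _ = Matrix.trace (scalarMat A P * (Z' * scalarMat A (D * e)) * scalarMat A P) := by
        rw [h5, mul_assoc (scalarMat A P)]
    _ = Matrix.trace (Z' * scalarMat A e * scalarMat A (D * (P * P))) := by
        rw [mul_assoc, ← trace_mul_scalarMat, mul_assoc, mul_assoc, mul_assoc, ← scalarMat_mul,
          ← scalarMat_mul, ← scalarMat_mul, h8, mul_assoc e D]
    _ = a Γ • Matrix.trace (scalarMat A e * (Z' * scalarMat A (e * (D * (P * P))))) := by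
        conv_lhs => rw [h4]
        rw [smul_mul_assoc, Matrix.trace_smul, mul_assoc, mul_assoc, ← scalarMat_mul]
    _ = a Γ • Matrix.trace (Z' * scalarMat A (D * (e * (P * P) * e))) := by
        rw [← trace_mul_scalarMat, mul_assoc, ← scalarMat_mul, ← mul_assoc e D, ← h8]
        simp only [mul_assoc]
    _ = Matrix.trace (Z' * scalarMat A (β • (D * e))) := by
        rw [h2, mul_smul_comm, ← Matrix.trace_smul, ← mul_smul_comm, ← scalarMat_smul, smul_comm,
          ← mul_smul_comm, ← h3]

theorem plus_intertwines (n m : ℕ) (q : ℂˣ) (N : ℕ) :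
    Intertwines q fun c : Fin m → ℤ =>
      (sitesProd (scaled (LPlus n q)) fun a => qSq q (-c a)).map (PowerSeries.coeff N) :=
  Intertwines.coeff (X := fun c : Fin m → ℤ => sitesProd (scaled (LPlus n q)) fun a => qSq q (-c a))
    (fun k c => (LPlus_isExchange n q).sitesProd_baxter k c) N

theorem minus_intertwines (n m : ℕ) (q : ℂˣ) (N : ℕ) :
    Intertwines q fun c : Fin m → ℤ =>
      (sitesProdRev (inverseFamily n q) fun a => qSq q (c a)).map (PowerSeries.coeff N) :=
  Intertwines.coeff (X := fun c : Fin m → ℤ => sitesProdRev (inverseFamily n q) fun a => qSq q (c a))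
    (fun k c => (inverseFamily_isCoexchange n q).sitesProdRev_baxter k c) N

theorem contents_toTab {μ : YoungDiagram} (Λ : StdTableau μ) (a : Fin μ.card) :
    contents Λ.toTab.1 a = Λ.c a := rfl

theorem sugawaraTerm_eq_of_shape (hq : ∀ k : ℕ, 0 < k → q ^ k ≠ 1) {μ : YoungDiagram}
    (Λ Λ' : StdTableau μ) : sugawaraTerm n q Λ = sugawaraTerm n q Λ' := by
  refine StdTableau.eq_of_swap (sugawaraTerm n q) (fun Λ Γ k h => ?_) Λ Λ'
  funext N r
  rw [sugawaraTerm, sugawaraTerm]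
  split_ifs with hN
  · have := trace_eq_of_swap hq ((plus_intertwines n μ.card q (N + r).toNat).mul
      (minus_intertwines n μ.card q r)) Λ.toTab Γ.toTab k h
    simp only [contents_toTab, ← coeff_plusProduct, ← coeff_minusInvProduct] at this
    have e : ∀ M : Matrix (Fin μ.card → Fin n) (Fin μ.card → Fin n) ℂ,
        M.map (algebraMap ℂ (UqCri n q)) = scalarMat _ M := fun _ => rfl
    rw [weightE_eq, weightE_eq, e, e, scalarMat_smul, scalarMat_smul, mul_smul_comm, mul_smul_comm,
      Matrix.trace_smul, Matrix.trace_smul, this]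
  · rfl

end Scalars

end

section

/-! ### The relations with an auxiliary space -/

section Master

variable {A : Type*} [Ring A]

/-- Power series in `ζ` whose coefficients are Laurent series in `T`. -/
abbrev Master (A : Type*) [Ring A] : Type _ := PowerSeries (HahnSeries ℤ A)

/-- Scalar power series in `ζ`. -/
def liftScalar (A : Type*) [Ring A] [Algebra ℂ A] : PowerSeries ℂ →+* Master A :=
  PowerSeries.map (HahnSeries.C.comp (algebraMap ℂ A))

/-- Power series in `T`. -/
def liftSeries (A : Type*) [Ring A] : PowerSeries A →+* Master A :=
  PowerSeries.C.comp (HahnSeries.ofPowerSeries ℤ A)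

/-- The series `∑ l_r ζ^r T^{ε r}`. -/
def diagSeries (ε : ℤ) (l : ℕ → A) : Master A := PowerSeries.mk fun r => HahnSeries.single (ε * r) (l r)

/-- The coefficient of `ζ^s T^k`. -/
def coeffMaster (s : ℕ) (k : ℤ) : Master A →+ A where
  toFun f := (PowerSeries.coeff s f).coeff k
  map_zero' := by simp
  map_add' f g := by simp

theorem Master.ext {f g : Master A} (h : ∀ s k, coeffMaster s k f = coeffMaster s k g) : f = g := by
  ext s k
  exact h s k

theorem liftScalar_comm [Algebra ℂ A] (p : PowerSeries ℂ) (f : Master A) :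
    f * liftScalar A p = liftScalar A p * f := by
  ext1 s
  rw [PowerSeries.coeff_mul, PowerSeries.coeff_mul, ← Finset.Nat.sum_antidiagonal_swap]
  refine Finset.sum_congr rfl fun x _ => ?_
  ext k
  simp only [liftScalar, Prod.fst_swap, Prod.snd_swap, PowerSeries.coeff_map, RingHom.comp_apply,
    HahnSeries.C_apply, HahnSeries.coeff_mul_single_zero, HahnSeries.coeff_single_zero_mul]
  exact (Algebra.commutes _ _).symm

theorem coeffMaster_liftScalar_mul [Algebra ℂ A] (p : PowerSeries ℂ) (f : Master A) (s : ℕ) (k : ℤ) :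
    coeffMaster s k (liftScalar A p * f) = ∑ j ∈ Finset.range (s + 1),
      algebraMap ℂ A (PowerSeries.coeff j p) * coeffMaster (s - j) k f := by
  simp only [coeffMaster, AddMonoidHom.coe_mk, ZeroHom.coe_mk]
  rw [PowerSeries.coeff_mul, HahnSeries.coeff_sum, Finset.Nat.sum_antidiagonal_eq_sum_range_succ
    (fun i j => (PowerSeries.coeff i (liftScalar A p) * PowerSeries.coeff j f).coeff k)]
  refine Finset.sum_congr rfl fun j _ => ?_
  rw [liftScalar, PowerSeries.coeff_map, RingHom.comp_apply, HahnSeries.C_apply,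
    HahnSeries.coeff_single_zero_mul]

theorem coeffMaster_diagSeries_mul (ε : ℤ) (l : ℕ → A) (f : PowerSeries A) (s : ℕ) (k : ℤ) :
    coeffMaster s k (diagSeries ε l * liftSeries A f) =
      l s * (HahnSeries.ofPowerSeries ℤ A f).coeff (k - ε * s) := by
  simp only [coeffMaster, AddMonoidHom.coe_mk, ZeroHom.coe_mk, liftSeries, RingHom.comp_apply]
  rw [PowerSeries.coeff_mul_C, diagSeries, PowerSeries.coeff_mk, HahnSeries.coeff_single_mul]

theorem coeffMaster_mul_diagSeries (ε : ℤ) (l : ℕ → A) (f : PowerSeries A) (s : ℕ) (k : ℤ) :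
    coeffMaster s k (liftSeries A f * diagSeries ε l) =
      (HahnSeries.ofPowerSeries ℤ A f).coeff (k - ε * s) * l s := by
  simp only [coeffMaster, AddMonoidHom.coe_mk, ZeroHom.coe_mk, liftSeries, RingHom.comp_apply]
  rw [PowerSeries.coeff_C_mul, diagSeries, PowerSeries.coeff_mk, HahnSeries.coeff_mul_single]

end Master

section Relations

variable {n : ℕ} {q : ℂˣ} {A : Type*} [Ring A] [Algebra ℂ A]

theorem rllLeft_apply {g : ℂ} {X Y : ℤ → Matrix (Fin n) (Fin n) A} {a b : ℤ} {N : ℕ}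
    (hN : N ≤ a.natAbs + b.natAbs) (hz : ∀ j : ℕ, N < j → X (a - j) = 0 ∨ Y (b + j) = 0)
    (s t : Fin n × Fin n) : rllLeft q (algebraMap ℂ A g) X Y a b s t =
      ∑ j ∈ Finset.range (N + 1), ∑ u, algebraMap ℂ A (g ^ j * RCoeff n q j s u) *
        (X (a - j) u.1 t.1 * Y (b + j) u.2 t.2) := by
  rw [rllLeft, Matrix.sum_apply, ← Finset.sum_subset
    (Finset.range_subset_range.2 (Nat.succ_le_succ hN))]
  · refine Finset.sum_congr rfl fun j _ => ?_
    rw [Matrix.smul_apply, mul_assoc, Matrix.mul_apply, smul_eq_mul, Finset.mul_sum]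
    refine Finset.sum_congr rfl fun u _ => ?_
    rw [kronecker_one_mul_one_kronecker, Matrix.map_apply, map_mul, map_pow, mul_assoc]
  · intro j _ hj
    rcases hz j (by have := mt Finset.mem_range.2 hj; omega) with h | h <;> simp [h]

theorem rllRight_apply {g : ℂ} {X Y : ℤ → Matrix (Fin n) (Fin n) A} {a b : ℤ} {N : ℕ}
    (hN : N ≤ a.natAbs + b.natAbs) (hz : ∀ j : ℕ, N < j → X (a - j) = 0 ∨ Y (b + j) = 0)
    (s t : Fin n × Fin n) : rllRight q (algebraMap ℂ A g) X Y a b s t =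
      ∑ j ∈ Finset.range (N + 1), ∑ u, algebraMap ℂ A (g ^ j * RCoeff n q j u t) *
        (Y (b + j) s.2 u.2 * X (a - j) s.1 u.1) := by
  rw [rllRight, Matrix.sum_apply, ← Finset.sum_subset
    (Finset.range_subset_range.2 (Nat.succ_le_succ hN))]
  · refine Finset.sum_congr rfl fun j _ => ?_
    rw [Matrix.smul_apply, Matrix.mul_apply, smul_eq_mul, Finset.mul_sum]
    refine Finset.sum_congr rfl fun u _ => ?_
    rw [one_kronecker_mul_kronecker_one, Matrix.map_apply, map_mul, map_pow,
      ← Algebra.commutes (RCoeff n q j u t), mul_assoc]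
  · intro j _ hj
    rcases hz j (by have := mt Finset.mem_range.2 hj; omega) with h | h <;> simp [h]

theorem algebraMap_mul_smul (x y : ℂ) (a : A) : algebraMap ℂ A x * (y • a) = (y * x) • a := by
  rw [← Algebra.smul_def, smul_smul, mul_comm]

theorem smul_algebraMap_mul (x y : ℂ) (a : A) : y • (algebraMap ℂ A x * a) = (y * x) • a := by
  rw [← Algebra.smul_def, smul_smul]

/-- The matrix `∑ L[r] ζ^r T^{ε r}`. -/
def auxMat (ε : ℤ) (L : ℕ → Matrix (Fin n) (Fin n) A) : Matrix (Fin n) (Fin n) (Master A) :=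
  Matrix.of fun i j => diagSeries ε fun r => L r i j

/-- The matrix `R(x ζ)` over the master ring. -/
def masterR (n : ℕ) (q : ℂˣ) (A : Type*) [Ring A] [Algebra ℂ A] (x : ℂ) :
    Matrix (Fin n × Fin n) (Fin n × Fin n) (Master A) := (rShift n q x).map (liftScalar A)

theorem coeff_rShift (x : ℂ) (j : ℕ) (s t : Fin n × Fin n) :
    PowerSeries.coeff j (rShift n q x s t) = x ^ j * RCoeff n q j s t := by
  rw [rShift, Matrix.map_apply, PowerSeries.coeff_rescale, coeff_rSeries]

theorem aux_first_relation {Y : ℤ → Matrix (Fin n) (Fin n) A} {L : ℕ → Matrix (Fin n) (Fin n) A}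
    {g g' c : ℂ} {ε : ℤ} (h : ∀ a b s t, rllLeft q (algebraMap ℂ A g) (upCoeff L) Y a b s t =
      rllRight q (algebraMap ℂ A g') (upCoeff L) Y a b s t) (hc : c ≠ 0) (hε : ε * ε = 1)
    {F : Matrix (Fin n) (Fin n) (PowerSeries A)}
    (hF : ∀ (k : ℤ) i j, (HahnSeries.ofPowerSeries ℤ A (F i j)).coeff k =
      c ^ (ε * k) • Y (ε * k) i j) :
    masterR n q A (g * c⁻¹) * ((auxMat ε L ⊗ₖ (1 : Matrix (Fin n) (Fin n) (Master A))) *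
      ((1 : Matrix (Fin n) (Fin n) (Master A)) ⊗ₖ F.map (liftSeries A))) =
    ((1 : Matrix (Fin n) (Fin n) (Master A)) ⊗ₖ F.map (liftSeries A)) *
      (auxMat ε L ⊗ₖ (1 : Matrix (Fin n) (Fin n) (Master A))) * masterR n q A (g' * c⁻¹) := by
  ext1 s t
  refine Master.ext fun N k => ?_
  have hz : ∀ j : ℕ, N < j → upCoeff L ((N : ℤ) - j) = 0 ∨ Y (ε * k - N + j) = 0 := fun j hj =>
    Or.inl (if_neg (by omega))
  have hN : N ≤ (N : ℤ).natAbs + (ε * k - N).natAbs := by omega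
  have h' := h N (ε * k - N) s t
  rw [rllLeft_apply hN hz, rllRight_apply hN hz] at h'
  rw [Matrix.mul_apply, Matrix.mul_apply, map_sum, map_sum]
  simp only [kronecker_one_mul_one_kronecker, one_kronecker_mul_kronecker_one, masterR,
    Matrix.map_apply, liftScalar_comm, coeffMaster_liftScalar_mul, auxMat, Matrix.of_apply,
    coeffMaster_diagSeries_mul, coeffMaster_mul_diagSeries, hF, coeff_rShift]
  rw [Finset.sum_comm, Finset.sum_comm (s := Finset.univ) (t := Finset.range (N + 1))]
  have e1 : ∀ j ∈ Finset.range (N + 1), ε * (k - ε * ((N - j : ℕ) : ℤ)) = ε * k - N + j ∧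
      upCoeff L ((N : ℤ) - j) = L (N - j) ∧
      ∀ g : ℂ, (g * c⁻¹) ^ j * c ^ (ε * k - N + j) = c ^ (ε * k - N) * g ^ j := by
    intro j hj
    have hj := Finset.mem_range.1 hj
    refine ⟨?_, ?_, fun g => ?_⟩
    · rw [mul_sub, ← mul_assoc, hε]
      push_cast [Nat.lt_succ_iff.1 hj]
      ring
    · rw [upCoeff, if_pos (by omega)]
      congr 1
      omega
    · rw [zpow_add₀ hc, zpow_natCast, mul_pow, inv_pow]
      field_simp
  have h2 := congrArg (c ^ (ε * k - N) • ·) h'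
  simp only [Finset.smul_sum] at h2
  convert h2 using 1
  · refine Finset.sum_congr rfl fun j hj => Finset.sum_congr rfl fun u _ => ?_
    obtain ⟨h3, h4, h5⟩ := e1 j hj
    rw [h3, h4, mul_smul_comm, algebraMap_mul_smul, smul_algebraMap_mul]
    congr 1
    linear_combination RCoeff n q j s u * h5 g
  · refine Finset.sum_congr rfl fun j hj => Finset.sum_congr rfl fun u _ => ?_
    obtain ⟨h3, h4, h5⟩ := e1 j hj
    rw [h3, h4, smul_mul_assoc, algebraMap_mul_smul, smul_algebraMap_mul]
    congr 1
    linear_combination RCoeff n q j u t * h5 g'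

theorem aux_last_relation {X : ℤ → Matrix (Fin n) (Fin n) A} {L : ℕ → Matrix (Fin n) (Fin n) A}
    {g g' c : ℂ} {δ : ℤ} (h : ∀ a b s t, rllLeft q (algebraMap ℂ A g) X (downCoeff L) a b s t =
      rllRight q (algebraMap ℂ A g') X (downCoeff L) a b s t) (hc : c ≠ 0) (hδ : δ * δ = 1)
    {F : Matrix (Fin n) (Fin n) (PowerSeries A)}
    (hF : ∀ (k : ℤ) i j, (HahnSeries.ofPowerSeries ℤ A (F i j)).coeff k =
      c ^ (δ * k) • X (δ * k) i j) :
    masterR n q A (g * c) * ((F.map (liftSeries A) ⊗ₖ (1 : Matrix (Fin n) (Fin n) (Master A))) *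
      ((1 : Matrix (Fin n) (Fin n) (Master A)) ⊗ₖ auxMat (-δ) L)) =
    ((1 : Matrix (Fin n) (Fin n) (Master A)) ⊗ₖ auxMat (-δ) L) *
      (F.map (liftSeries A) ⊗ₖ (1 : Matrix (Fin n) (Fin n) (Master A))) * masterR n q A (g' * c) := by
  ext1 s t
  refine Master.ext fun N k => ?_
  have hz : ∀ j : ℕ, N < j → X (δ * k + N - j) = 0 ∨ downCoeff L (-(N : ℤ) + j) = 0 :=
    fun j hj => Or.inr (if_neg (by omega))
  have hN : N ≤ (δ * k + N).natAbs + (-(N : ℤ)).natAbs := by omega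
  have h' := h (δ * k + N) (-(N : ℤ)) s t
  rw [rllLeft_apply hN hz, rllRight_apply hN hz] at h'
  rw [Matrix.mul_apply, Matrix.mul_apply, map_sum, map_sum]
  simp only [kronecker_one_mul_one_kronecker, one_kronecker_mul_kronecker_one, masterR,
    Matrix.map_apply, liftScalar_comm, coeffMaster_liftScalar_mul, auxMat, Matrix.of_apply,
    coeffMaster_diagSeries_mul, coeffMaster_mul_diagSeries, hF, coeff_rShift]
  rw [Finset.sum_comm, Finset.sum_comm (s := Finset.univ) (t := Finset.range (N + 1))]
  have e1 : ∀ j ∈ Finset.range (N + 1), δ * (k - -δ * ((N - j : ℕ) : ℤ)) = δ * k + N - j ∧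
      downCoeff L (-(N : ℤ) + j) = L (N - j) ∧
      ∀ g : ℂ, (g * c) ^ j * c ^ (δ * k + N - j) = c ^ (δ * k + N) * g ^ j := by
    intro j hj
    have hj := Finset.mem_range.1 hj
    refine ⟨?_, ?_, fun g => ?_⟩
    · rw [neg_mul, sub_neg_eq_add, mul_add, ← mul_assoc, hδ]
      push_cast [Nat.lt_succ_iff.1 hj]
      ring
    · rw [downCoeff, if_pos (by omega)]
      congr 1
      omega
    · rw [zpow_sub₀ hc, zpow_natCast, mul_pow]
      field_simp
  have h2 := congrArg (c ^ (δ * k + N) • ·) h'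
  simp only [Finset.smul_sum] at h2
  convert h2 using 1
  · refine Finset.sum_congr rfl fun j hj => Finset.sum_congr rfl fun u _ => ?_
    obtain ⟨h3, h4, h5⟩ := e1 j hj
    rw [h3, h4, smul_mul_assoc, algebraMap_mul_smul, smul_algebraMap_mul]
    congr 1
    linear_combination RCoeff n q j s u * h5 g
  · refine Finset.sum_congr rfl fun j hj => Finset.sum_congr rfl fun u _ => ?_
    obtain ⟨h3, h4, h5⟩ := e1 j hj
    rw [h3, h4, mul_smul_comm, algebraMap_mul_smul, smul_algebraMap_mul]
    congr 1
    linear_combination RCoeff n q j u t * h5 g'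

theorem coeff_ofPowerSeries (f : PowerSeries A) (k : ℤ) :
    (HahnSeries.ofPowerSeries ℤ A f).coeff k =
      if 0 ≤ k then PowerSeries.coeff k.toNat f else 0 := by
  split_ifs with hk
  · conv_lhs => rw [← Int.toNat_of_nonneg hk]
    exact HahnSeries.ofPowerSeries_apply_coeff f k.toNat
  · rw [HahnSeries.ofPowerSeries_apply, HahnSeries.embDomain_of_notMem_range]
    rintro ⟨j, hj⟩
    have : ((j : ℕ) : ℤ) = k := hj
    omega

theorem coeff_scaled_up (L : ℕ → Matrix (Fin n) (Fin n) A) (x : ℂ) (k : ℤ) (i j : Fin n) :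
    (HahnSeries.ofPowerSeries ℤ A (scaled L x i j)).coeff k =
      x ^ (1 * k) • upCoeff L (1 * k) i j := by
  rw [coeff_ofPowerSeries, one_mul, upCoeff]
  split_ifs with hk
  · rw [scaled, Matrix.of_apply, PowerSeries.coeff_mk]
    conv_rhs => rw [← Int.toNat_of_nonneg hk, zpow_natCast]
    rfl
  · simp

theorem coeff_scaled_down (L : ℕ → Matrix (Fin n) (Fin n) A) (x : ℂ) (k : ℤ) (i j : Fin n) :
    (HahnSeries.ofPowerSeries ℤ A (scaled L x i j)).coeff k =
      x⁻¹ ^ (-1 * k) • downCoeff L (-1 * k) i j := by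
  rw [coeff_ofPowerSeries, neg_one_mul, downCoeff, zpow_neg, inv_zpow, inv_inv, neg_neg]
  by_cases hk : 0 ≤ k
  · rw [if_pos hk, if_pos (by omega), scaled, Matrix.of_apply, PowerSeries.coeff_mk]
    conv_rhs => rw [← Int.toNat_of_nonneg hk, zpow_natCast]
    rfl
  · rw [if_neg hk, if_neg (by omega)]
    simp

/-- A matrix of power series in `T` in a copy of `End ℂⁿ`. -/
def siteMat (F : Matrix (Fin n) (Fin n) (PowerSeries A)) :
    Matrix (Fin n) (Fin n) (Matrix (Fin n) (Fin n) (Master A)) :=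
  (F.map (liftSeries A)).map (Matrix.scalar (Fin n))

/-- The matrix `R(x ζ)` with the first factor as the auxiliary space. -/
def firstR (n : ℕ) (q : ℂˣ) (A : Type*) [Ring A] [Algebra ℂ A] (x : ℂ) :
    Matrix (Fin n) (Fin n) (Matrix (Fin n) (Fin n) (Master A)) := auxFirst (masterR n q A x)

/-- The matrix `R(x ζ)⁻¹` with the last factor as the auxiliary space. -/
def lastRInv (n : ℕ) (q : ℂˣ) (A : Type*) [Ring A] [Algebra ℂ A] (x : ℂ) :
    Matrix (Fin n) (Fin n) (Matrix (Fin n) (Fin n) (Master A)) :=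
  auxLast ((rShiftInv n q x).map (liftScalar A))

theorem siteMat_mul_siteMat {F G : Matrix (Fin n) (Fin n) (PowerSeries A)} (h : F * G = 1) :
    siteMat F * siteMat G = 1 := by
  rw [siteMat, siteMat, ← Matrix.map_mul, ← Matrix.map_mul, h,
    Matrix.map_one _ (map_zero _) (map_one _), Matrix.map_one _ (map_zero _) (map_one _)]

theorem aux_first_relation_auxFirst {L : ℕ → Matrix (Fin n) (Fin n) A} {x x' : ℂ} {ε : ℤ}
    {F : Matrix (Fin n) (Fin n) (PowerSeries A)}
    (h : masterR n q A x * ((auxMat ε L ⊗ₖ (1 : Matrix (Fin n) (Fin n) (Master A))) *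
      ((1 : Matrix (Fin n) (Fin n) (Master A)) ⊗ₖ F.map (liftSeries A))) =
    ((1 : Matrix (Fin n) (Fin n) (Master A)) ⊗ₖ F.map (liftSeries A)) *
      (auxMat ε L ⊗ₖ (1 : Matrix (Fin n) (Fin n) (Master A))) * masterR n q A x') :
    firstR n q A x * (Matrix.scalar (Fin n) (auxMat ε L) * siteMat F) =
      siteMat F * Matrix.scalar (Fin n) (auxMat ε L) * firstR n q A x' := by
  have := congrArg auxFirst h
  rwa [map_mul, map_mul, map_mul, map_mul, auxFirst_kronecker_one, auxFirst_one_kronecker] at this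

theorem aux_last_relation_auxLast {L : ℕ → Matrix (Fin n) (Fin n) A} {x x' : ℂ} {ε : ℤ}
    {F : Matrix (Fin n) (Fin n) (PowerSeries A)}
    (h : masterR n q A x * ((F.map (liftSeries A) ⊗ₖ (1 : Matrix (Fin n) (Fin n) (Master A))) *
      ((1 : Matrix (Fin n) (Fin n) (Master A)) ⊗ₖ auxMat ε L)) =
    ((1 : Matrix (Fin n) (Fin n) (Master A)) ⊗ₖ auxMat ε L) *
      (F.map (liftSeries A) ⊗ₖ (1 : Matrix (Fin n) (Fin n) (Master A))) * masterR n q A x') :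
    siteMat F * Matrix.scalar (Fin n) (auxMat ε L) * lastRInv n q A x' =
      lastRInv n q A x * (Matrix.scalar (Fin n) (auxMat ε L) * siteMat F) := by
  have h' := congrArg auxLast h
  rw [map_mul, map_mul, map_mul, map_mul, auxLast_kronecker_one, auxLast_one_kronecker] at h'
  change auxLast (masterR n q A x) * (siteMat F * Matrix.scalar (Fin n) (auxMat ε L)) =
    Matrix.scalar (Fin n) (auxMat ε L) * siteMat F * auxLast (masterR n q A x') at h'
  have h1 : ∀ x, auxLast (masterR n q A x) * lastRInv n q A x = 1 := fun x => by
    rw [lastRInv, ← map_mul, masterR, ← Matrix.map_mul, rShift_mul_rShiftInv,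
      Matrix.map_one _ (map_zero _) (map_one _), map_one]
  have h2 : ∀ x, lastRInv n q A x * auxLast (masterR n q A x) = 1 := fun x => by
    rw [lastRInv, ← map_mul, masterR, ← Matrix.map_mul, rShiftInv_mul_rShift,
      Matrix.map_one _ (map_zero _) (map_one _), map_one]
  calc siteMat F * Matrix.scalar (Fin n) (auxMat ε L) * lastRInv n q A x'
      = lastRInv n q A x * (auxLast (masterR n q A x) *
          (siteMat F * Matrix.scalar (Fin n) (auxMat ε L))) * lastRInv n q A x' := by
        rw [← mul_assoc, h2, one_mul]
    _ = lastRInv n q A x * (Matrix.scalar (Fin n) (auxMat ε L) * siteMat F) *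
          (auxLast (masterR n q A x') * lastRInv n q A x') := by
        rw [h']; simp only [mul_assoc]
    _ = _ := by rw [h1, mul_one]

end Relations

section SingleSite

variable {n : ℕ} {q : ℂˣ}

theorem cri_rll_plus (a b : ℤ) (s t : Fin n × Fin n) :
    rllLeft q (algebraMap ℂ (UqCri n q) 1) (upCoeff (LPlus n q)) (upCoeff (LPlus n q)) a b s t =
      rllRight q (algebraMap ℂ (UqCri n q) 1) (upCoeff (LPlus n q)) (upCoeff (LPlus n q)) a b s t := by
  have h := freeToCri_rel (Rel.rll_plus (n := n) (q := q) a b s t)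
  rw [map_rllLeft, map_rllRight, map_one] at h
  simpa only [freeToCri_freePlus, map_one] using h

theorem cri_rll_minus (a b : ℤ) (s t : Fin n × Fin n) :
    rllLeft q (algebraMap ℂ (UqCri n q) 1) (downCoeff (LMinus n q)) (downCoeff (LMinus n q)) a b s t =
      rllRight q (algebraMap ℂ (UqCri n q) 1) (downCoeff (LMinus n q)) (downCoeff (LMinus n q))
        a b s t := by
  have h := freeToCri_rel (Rel.rll_minus (n := n) (q := q) a b s t)
  rw [map_rllLeft, map_rllRight, map_one] at h
  simpa only [freeToCri_freeMinus, map_one] using h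

/-- The matrix `L⁺(w)` in the auxiliary space. -/
def auxPlus (n : ℕ) (q : ℂˣ) (ε : ℤ) : Matrix (Fin n) (Fin n) (Matrix (Fin n) (Fin n) (Master (UqCri n q))) :=
  Matrix.scalar (Fin n) (auxMat ε (LPlus n q))

/-- The matrix `L⁻(w)` in the auxiliary space. -/
def auxMinus (n : ℕ) (q : ℂˣ) (ε : ℤ) : Matrix (Fin n) (Fin n) (Matrix (Fin n) (Fin n) (Master (UqCri n q))) :=
  Matrix.scalar (Fin n) (auxMat ε (LMinus n q))

theorem plus_plus {x : ℂ} (hx : x ≠ 0) :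
    firstR n q (UqCri n q) x⁻¹ * (auxPlus n q 1 * siteMat (scaled (LPlus n q) x)) =
      siteMat (scaled (LPlus n q) x) * auxPlus n q 1 * firstR n q (UqCri n q) x⁻¹ := by
  have h := aux_first_relation_auxFirst (aux_first_relation (cri_rll_plus (n := n) (q := q)) hx
    (one_mul 1) (F := scaled (LPlus n q) x) (coeff_scaled_up _ _))
  rwa [one_mul] at h

theorem plus_minus {y : ℂ} (hy : y ≠ 0) :
    auxPlus n q (-1) * firstR n q (UqCri n q) ((q : ℂ) ^ (-(n : ℤ)) * y) *
        siteMat (scaled (LMinusInv n q) y) =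
      siteMat (scaled (LMinusInv n q) y) * firstR n q (UqCri n q) ((q : ℂ) ^ (n : ℤ) * y) *
        auxPlus n q (-1) := by
  have h := aux_first_relation_auxFirst (aux_first_relation (cri_rll_mixed n q)
    (inv_ne_zero hy) (ε := -1) (by norm_num) (F := scaled (LMinus n q) y) (coeff_scaled_down _ _))
  rw [inv_inv] at h
  have h1 := siteMat_mul_siteMat (LMinus_mul_LMinusInv (n := n) (q := q) y)
  have h2 := siteMat_mul_siteMat (LMinusInv_mul_LMinus (n := n) (q := q) y)
  change firstR n q (UqCri n q) _ * (auxPlus n q (-1) * _) = _ * auxPlus n q (-1) * _ at h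
  calc auxPlus n q (-1) * firstR n q (UqCri n q) ((q : ℂ) ^ (-(n : ℤ)) * y) *
        siteMat (scaled (LMinusInv n q) y)
      = siteMat (scaled (LMinusInv n q) y) * (siteMat (scaled (LMinus n q) y) * auxPlus n q (-1) *
          firstR n q (UqCri n q) ((q : ℂ) ^ (-(n : ℤ)) * y)) *
          siteMat (scaled (LMinusInv n q) y) := by
        simp only [← mul_assoc]
        rw [h2, one_mul]
    _ = siteMat (scaled (LMinusInv n q) y) * firstR n q (UqCri n q) ((q : ℂ) ^ (n : ℤ) * y) *
          auxPlus n q (-1) * (siteMat (scaled (LMinus n q) y) *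
          siteMat (scaled (LMinusInv n q) y)) := by
        rw [← h]
        simp only [mul_assoc]
    _ = _ := by rw [h1, mul_one]

theorem minus_plus {x : ℂ} (hx : x ≠ 0) :
    lastRInv n q (UqCri n q) ((q : ℂ) ^ (n : ℤ) * x) *
        (auxMinus n q (-1) * siteMat (scaled (LPlus n q) x)) =
      siteMat (scaled (LPlus n q) x) * auxMinus n q (-1) *
        lastRInv n q (UqCri n q) ((q : ℂ) ^ (-(n : ℤ)) * x) :=
  (aux_last_relation_auxLast (aux_last_relation (cri_rll_mixed n q) hx
    (δ := 1) (one_mul 1) (F := scaled (LPlus n q) x) (coeff_scaled_up _ _))).symm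

theorem minus_minus {y : ℂ} (hy : y ≠ 0) :
    auxMinus n q 1 * lastRInv n q (UqCri n q) y⁻¹ * siteMat (scaled (LMinusInv n q) y) =
      siteMat (scaled (LMinusInv n q) y) * lastRInv n q (UqCri n q) y⁻¹ * auxMinus n q 1 := by
  have h := aux_last_relation_auxLast (aux_last_relation (cri_rll_minus (n := n) (q := q))
    (inv_ne_zero hy) (δ := -1) (by norm_num) (F := scaled (LMinus n q) y) (coeff_scaled_down _ _))
  rw [one_mul, neg_neg] at h
  have h1 := siteMat_mul_siteMat (LMinus_mul_LMinusInv (n := n) (q := q) y)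
  have h2 := siteMat_mul_siteMat (LMinusInv_mul_LMinus (n := n) (q := q) y)
  change _ * auxMinus n q 1 * _ = _ * (auxMinus n q 1 * _) at h
  calc auxMinus n q 1 * lastRInv n q (UqCri n q) y⁻¹ * siteMat (scaled (LMinusInv n q) y)
      = siteMat (scaled (LMinusInv n q) y) * (siteMat (scaled (LMinus n q) y) * auxMinus n q 1 *
          lastRInv n q (UqCri n q) y⁻¹) * siteMat (scaled (LMinusInv n q) y) := by
        simp only [← mul_assoc]
        rw [h2, one_mul]
    _ = siteMat (scaled (LMinusInv n q) y) * lastRInv n q (UqCri n q) y⁻¹ *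
          auxMinus n q 1 * (siteMat (scaled (LMinus n q) y) *
          siteMat (scaled (LMinusInv n q) y)) := by
        rw [h]
        simp only [mul_assoc]
    _ = _ := by rw [h1, mul_one]

end SingleSite

end

section

/-! ### Products over the tensor factors -/

section Monoid

variable {W ι : Type*} [Monoid W] {A A' X : ι → W} {L : W}

theorem list_prod_relation {l : List ι} (hl : l.Nodup)
    (hA : ∀ a b, a ≠ b → Commute (A a) (X b)) (hA' : ∀ a b, a ≠ b → Commute (A' a) (X b))
    (h : ∀ a, A a * (L * X a) = X a * L * A' a) :
    (l.reverse.map A).prod * (L * (l.map X).prod) = (l.map X).prod * L * (l.reverse.map A').prod := by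
  induction l with
  | nil => simp
  | cons a l ih =>
    obtain ⟨ha, hl⟩ := List.nodup_cons.1 hl
    have h1 : Commute (A' a) (l.map X).prod := commute_prod_map X l fun b hb =>
      hA' a b fun e => ha (e ▸ hb)
    have h2 : Commute (l.reverse.map A).prod (X a) := (commute_prod_map A l.reverse fun b hb =>
      (hA b a fun e => ha (e ▸ List.mem_reverse.1 hb)).symm).symm
    have ih := ih hl
    simp only [List.reverse_cons, List.map_append, List.map_cons, List.map_nil, List.prod_append,
      List.prod_cons, List.prod_nil, mul_one]
    calc (l.reverse.map A).prod * A a * (L * (X a * (l.map X).prod))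
        = (l.reverse.map A).prod * (A a * (L * X a)) * (l.map X).prod := by simp only [mul_assoc]
      _ = (l.reverse.map A).prod * X a * L * (A' a * (l.map X).prod) := by
          rw [h]; simp only [mul_assoc]
      _ = X a * ((l.reverse.map A).prod * (L * (l.map X).prod)) * A' a := by
          rw [h1.eq, h2.eq]; simp only [mul_assoc]
      _ = _ := by rw [ih]; simp only [mul_assoc]

theorem list_prod_relation_inv {l : List ι} (hl : l.Nodup)
    (hA : ∀ a b, a ≠ b → Commute (A a) (X b)) (hA' : ∀ a b, a ≠ b → Commute (A' a) (X b))
    (h : ∀ a, L * A a * X a = X a * A' a * L) :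
    L * ((l.reverse.map A).prod * (l.reverse.map X).prod) =
      (l.reverse.map X).prod * (l.reverse.map A').prod * L := by
  induction l with
  | nil => simp
  | cons a l ih =>
    obtain ⟨ha, hl⟩ := List.nodup_cons.1 hl
    have h1 : Commute (A a) (l.reverse.map X).prod := commute_prod_map X l.reverse fun b hb =>
      hA a b fun e => ha (e ▸ List.mem_reverse.1 hb)
    have h2 : Commute (l.reverse.map A').prod (X a) := (commute_prod_map A' l.reverse fun b hb =>
      (hA' b a fun e => ha (e ▸ List.mem_reverse.1 hb)).symm).symm
    have ih := ih hl
    simp only [List.reverse_cons, List.map_append, List.map_cons, List.map_nil, List.prod_append,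
      List.prod_cons, List.prod_nil, mul_one]
    calc L * ((l.reverse.map A).prod * A a * ((l.reverse.map X).prod * X a))
        = L * ((l.reverse.map A).prod * (A a * (l.reverse.map X).prod) * X a) := by
          simp only [mul_assoc]
      _ = L * ((l.reverse.map A).prod * (l.reverse.map X).prod) * A a * X a := by
          rw [h1.eq]; simp only [mul_assoc]
      _ = (l.reverse.map X).prod * (l.reverse.map A').prod * (L * A a * X a) := by
          rw [ih]; simp only [mul_assoc]
      _ = (l.reverse.map X).prod * ((l.reverse.map A').prod * X a) * A' a * L := by
          rw [h]; simp only [mul_assoc]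
      _ = _ := by rw [h2.eq]; simp only [mul_assoc]

end Monoid

/-! ### Coefficients -/

section Coefficients

variable {n m : ℕ} {A : Type*} [Ring A] [Algebra ℂ A]

local notation "𝕀" => Fin m → Fin n

theorem coeffMaster_lift_mul (p : PowerSeries ℂ) (f : Master A) (s : ℕ) (k : ℤ) :
    coeffMaster s k (liftScalar A p * f) = ∑ x ∈ Finset.HasAntidiagonal.antidiagonal s,
      algebraMap ℂ A (PowerSeries.coeff x.1 p) * coeffMaster x.2 k f := by
  rw [coeffMaster_liftScalar_mul, Finset.Nat.sum_antidiagonal_eq_sum_range_succ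
    (fun i j => algebraMap ℂ A (PowerSeries.coeff i p) * coeffMaster j k f)]

theorem coeffMaster_mul_lift (p : PowerSeries ℂ) (f : Master A) (s : ℕ) (k : ℤ) :
    coeffMaster s k (f * liftScalar A p) = ∑ x ∈ Finset.HasAntidiagonal.antidiagonal s,
      coeffMaster x.2 k f * algebraMap ℂ A (PowerSeries.coeff x.1 p) := by
  simp only [liftScalar_comm, coeffMaster_lift_mul, Algebra.commutes]

theorem coeffMaster_diag_mul (ε : ℤ) (l : ℕ → A) (f : Master A) (s : ℕ) (k : ℤ) :
    coeffMaster s k (diagSeries ε l * f) = ∑ x ∈ Finset.HasAntidiagonal.antidiagonal s,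
      l x.1 * coeffMaster x.2 (k - ε * x.1) f := by
  simp only [coeffMaster, AddMonoidHom.coe_mk, ZeroHom.coe_mk]
  rw [PowerSeries.coeff_mul, HahnSeries.coeff_sum]
  refine Finset.sum_congr rfl fun x _ => ?_
  rw [diagSeries, PowerSeries.coeff_mk, HahnSeries.coeff_single_mul]

theorem coeffMaster_mul_diag (ε : ℤ) (l : ℕ → A) (f : Master A) (s : ℕ) (k : ℤ) :
    coeffMaster s k (f * diagSeries ε l) = ∑ x ∈ Finset.HasAntidiagonal.antidiagonal s,
      coeffMaster x.2 (k - ε * x.1) f * l x.1 := by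
  simp only [coeffMaster, AddMonoidHom.coe_mk, ZeroHom.coe_mk]
  rw [PowerSeries.coeff_mul, HahnSeries.coeff_sum, ← Finset.Nat.sum_antidiagonal_swap]
  refine Finset.sum_congr rfl fun x _ => ?_
  rw [diagSeries, PowerSeries.coeff_mk, HahnSeries.coeff_mul_single, Prod.fst_swap, Prod.snd_swap]

theorem coeffMaster_liftSeries (f : PowerSeries A) (s : ℕ) (k : ℤ) :
    coeffMaster s k (liftSeries A f) =
      if s = 0 then (HahnSeries.ofPowerSeries ℤ A f).coeff k else 0 := by
  simp only [coeffMaster, AddMonoidHom.coe_mk, ZeroHom.coe_mk, liftSeries, RingHom.comp_apply,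
    PowerSeries.coeff_C]
  split_ifs <;> rfl

/-- Operators on the tensor factors with values in the endomorphisms of the auxiliary space. -/
abbrev AuxOp (n m : ℕ) (S : Type*) : Type _ :=
  Matrix (Fin m → Fin n) (Fin m → Fin n) (Matrix (Fin n) (Fin n) S)

/-- Apply a map to the entries. -/
def AuxOp.mapEntries {S S' : Type*} (φ : S → S') (Z : AuxOp n m S) : AuxOp n m S' :=
  Z.map fun M => M.map φ

theorem AuxOp.mapEntries_apply {S S' : Type*} (φ : S → S') (Z : AuxOp n m S) (w w' : 𝕀)
    (i j : Fin n) : Z.mapEntries φ w w' i j = φ (Z w w' i j) := rfl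

theorem AuxOp.mul_apply {S : Type*} [Semiring S] (Y Z : AuxOp n m S) (w w' : 𝕀) (i j : Fin n) :
    (Y * Z) w w' i j = ∑ v, ∑ k, Y w v i k * Z v w' k j := by
  rw [Matrix.mul_apply, Matrix.sum_apply]
  rfl

/-- The operators that act as scalars in the auxiliary space. -/
def AuxOp.ofMatrix {S : Type*} [Semiring S] (M : Matrix 𝕀 𝕀 S) : AuxOp n m S :=
  M.map (Matrix.scalar (Fin n))

theorem AuxOp.ofMatrix_mul {S : Type*} [Ring S] (M N : Matrix 𝕀 𝕀 S) :
    AuxOp.ofMatrix (M * N) = AuxOp.ofMatrix M * AuxOp.ofMatrix N := Matrix.map_mul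

/-- The coefficient of `ζ^s T^k`. -/
def opCoeff (s : ℕ) (k : ℤ) (Z : AuxOp n m (Master A)) : AuxOp n m A :=
  Z.mapEntries (coeffMaster s k)

/-- The coefficient of `ζ^s` of a scalar operator. -/
def scalarCoeff (A : Type*) [Ring A] [Algebra ℂ A] (s : ℕ) (P : AuxOp n m (PowerSeries ℂ)) :
    AuxOp n m A :=
  P.mapEntries fun p => algebraMap ℂ A (PowerSeries.coeff s p)

/-- The coefficient of `T^k` of a matrix of power series in `T`. -/
def intCoeff (k : ℤ) (f : Matrix 𝕀 𝕀 (PowerSeries A)) : Matrix 𝕀 𝕀 A :=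
  f.map fun g => (HahnSeries.ofPowerSeries ℤ A g).coeff k

theorem opCoeff_lift_mul (P : AuxOp n m (PowerSeries ℂ)) (Z : AuxOp n m (Master A)) (s : ℕ) (k : ℤ) :
    opCoeff s k (P.mapEntries (liftScalar A) * Z) =
      ∑ x ∈ Finset.HasAntidiagonal.antidiagonal s, scalarCoeff A x.1 P * opCoeff x.2 k Z := by
  ext w w' i j
  simp only [opCoeff, AuxOp.mapEntries_apply, AuxOp.mul_apply, map_sum, coeffMaster_lift_mul,
    Matrix.sum_apply, scalarCoeff]
  rw [Finset.sum_comm' (t' := Finset.univ) (s' := fun _ => Finset.HasAntidiagonal.antidiagonal s)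
    (by simp)]
  exact Finset.sum_congr rfl fun v _ => Finset.sum_comm

theorem opCoeff_mul_lift (P : AuxOp n m (PowerSeries ℂ)) (Z : AuxOp n m (Master A)) (s : ℕ) (k : ℤ) :
    opCoeff s k (Z * P.mapEntries (liftScalar A)) =
      ∑ x ∈ Finset.HasAntidiagonal.antidiagonal s, opCoeff x.2 k Z * scalarCoeff A x.1 P := by
  ext w w' i j
  simp only [opCoeff, AuxOp.mapEntries_apply, AuxOp.mul_apply, map_sum, coeffMaster_mul_lift,
    Matrix.sum_apply, scalarCoeff]
  rw [Finset.sum_comm' (t' := Finset.univ) (s' := fun _ => Finset.HasAntidiagonal.antidiagonal s)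
    (by simp)]
  exact Finset.sum_congr rfl fun v _ => Finset.sum_comm

theorem AuxOp.scalar_mul_apply {S : Type*} [Ring S] (M : Matrix (Fin n) (Fin n) S)
    (Z : AuxOp n m S) (w w' : 𝕀) (i j : Fin n) :
    (Matrix.scalar 𝕀 M * Z) w w' i j = ∑ k, M i k * Z w w' k j := by
  rw [Matrix.scalar_apply, Matrix.diagonal_mul, Matrix.mul_apply]

theorem AuxOp.mul_scalar_apply {S : Type*} [Ring S] (M : Matrix (Fin n) (Fin n) S)
    (Z : AuxOp n m S) (w w' : 𝕀) (i j : Fin n) :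
    (Z * Matrix.scalar 𝕀 M) w w' i j = ∑ k, Z w w' i k * M k j := by
  rw [Matrix.scalar_apply, Matrix.mul_diagonal, Matrix.mul_apply]

theorem opCoeff_aux_mul (ε : ℤ) (L : ℕ → Matrix (Fin n) (Fin n) A) (Z : AuxOp n m (Master A))
    (s : ℕ) (k : ℤ) : opCoeff s k (Matrix.scalar 𝕀 (auxMat ε L) * Z) =
      ∑ x ∈ Finset.HasAntidiagonal.antidiagonal s,
        Matrix.scalar 𝕀 (L x.1) * opCoeff x.2 (k - ε * x.1) Z := by
  ext w w' i j
  simp only [opCoeff, AuxOp.mapEntries_apply, AuxOp.scalar_mul_apply, map_sum, auxMat,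
    Matrix.of_apply, coeffMaster_diag_mul, Matrix.sum_apply]
  exact Finset.sum_comm

theorem opCoeff_mul_aux (ε : ℤ) (L : ℕ → Matrix (Fin n) (Fin n) A) (Z : AuxOp n m (Master A))
    (s : ℕ) (k : ℤ) : opCoeff s k (Z * Matrix.scalar 𝕀 (auxMat ε L)) =
      ∑ x ∈ Finset.HasAntidiagonal.antidiagonal s,
        opCoeff x.2 (k - ε * x.1) Z * Matrix.scalar 𝕀 (L x.1) := by
  ext w w' i j
  simp only [opCoeff, AuxOp.mapEntries_apply, AuxOp.mul_scalar_apply, map_sum, auxMat,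
    Matrix.of_apply, coeffMaster_mul_diag, Matrix.sum_apply]
  exact Finset.sum_comm

theorem opCoeff_liftSeries (f : Matrix 𝕀 𝕀 (PowerSeries A)) (s : ℕ) (k : ℤ) :
    opCoeff s k (AuxOp.ofMatrix (f.map (liftSeries A))) =
      if s = 0 then AuxOp.ofMatrix (intCoeff k f) else 0 := by
  ext w w' i j
  simp only [opCoeff, AuxOp.mapEntries_apply, AuxOp.ofMatrix, Matrix.map_apply, Matrix.scalar_apply,
    Matrix.diagonal_apply, apply_ite (coeffMaster s k), map_zero, coeffMaster_liftSeries]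
  by_cases hs : s = 0 <;> by_cases hij : i = j <;> simp [hs, hij, intCoeff]

theorem sum_antidiagonal_ite {M : Type*} [AddCommMonoid M] (s : ℕ) (F : ℕ → ℕ → M) (G : ℕ → M)
    (h0 : F s 0 = G s) (h : ∀ i j, j ≠ 0 → F i j = 0) :
    ∑ x ∈ Finset.HasAntidiagonal.antidiagonal s, F x.1 x.2 = G s := by
  rw [← h0]
  refine Finset.sum_eq_single (s, 0) (fun x hx hne => h _ _ fun h2 => hne ?_)
    fun hx => absurd (Finset.HasAntidiagonal.mem_antidiagonal.2 (add_zero s)) hx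
  have := Finset.HasAntidiagonal.mem_antidiagonal.1 hx
  ext
  · simpa [h2] using this
  · exact h2

/-- The coefficients of `A(ζ) L(ζ T^ε) X(T) = X(T) L(ζ T^ε) A''(ζ)`. -/
theorem coeff_relation_left {P P' : AuxOp n m (PowerSeries ℂ)} {ε : ℤ}
    {L : ℕ → Matrix (Fin n) (Fin n) A} {f : Matrix 𝕀 𝕀 (PowerSeries A)}
    (h : P.mapEntries (liftScalar A) * (Matrix.scalar 𝕀 (auxMat ε L) *
        AuxOp.ofMatrix (f.map (liftSeries A))) =
      AuxOp.ofMatrix (f.map (liftSeries A)) * Matrix.scalar 𝕀 (auxMat ε L) *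
        P'.mapEntries (liftScalar A)) (s : ℕ) (k : ℤ) :
    ∑ x ∈ Finset.HasAntidiagonal.antidiagonal s, scalarCoeff A x.1 P *
      (Matrix.scalar 𝕀 (L x.2) * AuxOp.ofMatrix (intCoeff (k - ε * x.2) f)) =
    ∑ x ∈ Finset.HasAntidiagonal.antidiagonal s,
      AuxOp.ofMatrix (intCoeff (k - ε * x.2) f) * Matrix.scalar 𝕀 (L x.2) * scalarCoeff A x.1 P' := by
  have h' := congrArg (opCoeff s k) h
  rw [opCoeff_lift_mul, opCoeff_mul_lift] at h'
  convert h' using 1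
  · refine Finset.sum_congr rfl fun x _ => ?_
    rw [opCoeff_aux_mul, sum_antidiagonal_ite x.2 (fun i j => Matrix.scalar 𝕀 (L i) *
      opCoeff j (k - ε * i) (AuxOp.ofMatrix (f.map (liftSeries A))))
      (fun i => Matrix.scalar 𝕀 (L i) * AuxOp.ofMatrix (intCoeff (k - ε * i) f))]
    · rw [opCoeff_liftSeries, if_pos rfl]
    · intro i j hj
      rw [opCoeff_liftSeries, if_neg hj, mul_zero]
  · refine Finset.sum_congr rfl fun x _ => ?_
    rw [opCoeff_mul_aux, sum_antidiagonal_ite x.2 (fun i j =>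
      opCoeff j (k - ε * i) (AuxOp.ofMatrix (f.map (liftSeries A))) * Matrix.scalar 𝕀 (L i))
      (fun i => AuxOp.ofMatrix (intCoeff (k - ε * i) f) * Matrix.scalar 𝕀 (L i))]
    · rw [opCoeff_liftSeries, if_pos rfl]
    · intro i j hj
      rw [opCoeff_liftSeries, if_neg hj, zero_mul]

/-- The coefficients of `L(ζ T^ε) A''(ζ) M(T) = M(T) A'(ζ) L(ζ T^ε)`. -/
theorem coeff_relation_right {P P' : AuxOp n m (PowerSeries ℂ)} {ε : ℤ}
    {L : ℕ → Matrix (Fin n) (Fin n) A} {f : Matrix 𝕀 𝕀 (PowerSeries A)}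
    (h : Matrix.scalar 𝕀 (auxMat ε L) * (P.mapEntries (liftScalar A) *
        AuxOp.ofMatrix (f.map (liftSeries A))) =
      AuxOp.ofMatrix (f.map (liftSeries A)) * P'.mapEntries (liftScalar A) *
        Matrix.scalar 𝕀 (auxMat ε L)) (s : ℕ) (k : ℤ) :
    ∑ x ∈ Finset.HasAntidiagonal.antidiagonal s, Matrix.scalar 𝕀 (L x.2) *
      (scalarCoeff A x.1 P * AuxOp.ofMatrix (intCoeff (k - ε * x.2) f)) =
    ∑ x ∈ Finset.HasAntidiagonal.antidiagonal s,
      AuxOp.ofMatrix (intCoeff (k - ε * x.2) f) * scalarCoeff A x.1 P' * Matrix.scalar 𝕀 (L x.2) := by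
  have h' := congrArg (opCoeff s k) h
  rw [opCoeff_aux_mul, opCoeff_mul_aux, ← Finset.Nat.sum_antidiagonal_swap,
    ← Finset.Nat.sum_antidiagonal_swap (f := fun x => opCoeff x.2 (k - ε * x.1)
      (AuxOp.ofMatrix (f.map (liftSeries A)) * P'.mapEntries (liftScalar A)) *
        Matrix.scalar 𝕀 (L x.1))] at h'
  convert h' using 1
  · refine Finset.sum_congr rfl fun x _ => ?_
    rw [opCoeff_lift_mul, Prod.fst_swap, Prod.snd_swap, sum_antidiagonal_ite x.1 (fun i j =>
      scalarCoeff A i P * opCoeff j (k - ε * x.2) (AuxOp.ofMatrix (f.map (liftSeries A))))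
      (fun i => scalarCoeff A i P * AuxOp.ofMatrix (intCoeff (k - ε * x.2) f))]
    · rw [opCoeff_liftSeries, if_pos rfl]
    · intro i j hj
      rw [opCoeff_liftSeries, if_neg hj, mul_zero]
  · refine Finset.sum_congr rfl fun x _ => ?_
    rw [opCoeff_mul_lift, Prod.fst_swap, Prod.snd_swap, sum_antidiagonal_ite x.1 (fun i j =>
      opCoeff j (k - ε * x.2) (AuxOp.ofMatrix (f.map (liftSeries A))) * scalarCoeff A i P')
      (fun i => AuxOp.ofMatrix (intCoeff (k - ε * x.2) f) * scalarCoeff A i P')]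
    · rw [opCoeff_liftSeries, if_pos rfl]
    · intro i j hj
      rw [opCoeff_liftSeries, if_neg hj, zero_mul]

end Coefficients

end

section

/-! ### Dressing -/

section Dressing

variable {n m : ℕ} {q : ℂˣ} {A : Type*} [Ring A] [Algebra ℂ A]

local notation "𝕀" => Fin m → Fin n

/-- Scalar operators over the master ring. -/
def liftSite (A : Type*) [Ring A] [Algebra ℂ A]
    (P : Matrix (Fin n) (Fin n) (Matrix (Fin n) (Fin n) (PowerSeries ℂ))) :
    Matrix (Fin n) (Fin n) (Matrix (Fin n) (Fin n) (Master A)) :=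
  P.map (liftScalar A).mapMatrix

theorem liftSite_commute_siteMat {a b : Fin m} (hab : a ≠ b)
    (P : Matrix (Fin n) (Fin n) (Matrix (Fin n) (Fin n) (PowerSeries ℂ)))
    (F : Matrix (Fin n) (Fin n) (PowerSeries A)) :
    Commute (site a (liftSite A P)) (site b (siteMat F)) := by
  refine site_commute hab fun i j k l => ?_
  simp only [liftSite, siteMat, Matrix.map_apply]
  ext1 s t
  rw [Matrix.scalar_apply, Matrix.mul_diagonal, Matrix.diagonal_mul]
  exact (liftScalar_comm _ _).symm

theorem mapEntries_list_prod (l : List (Fin m))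
    (P : Fin m → Matrix (Fin n) (Fin n) (Matrix (Fin n) (Fin n) (PowerSeries ℂ))) :
    AuxOp.mapEntries (liftScalar A) ((l.map fun a => site a (P a)).prod) =
      (l.map fun a => site a (liftSite A (P a))).prod := by
  have h := map_list_prod ((liftScalar A).mapMatrix (m := Fin n)).mapMatrix
    (l.map fun a => site a (P a))
  rw [List.map_map] at h
  refine h.trans ?_
  congr 2
  funext a
  exact site_map _ a (P a)

theorem ofMatrix_list_prod (l : List (Fin m)) (F : Fin m → Matrix (Fin n) (Fin n) (PowerSeries A)) :
    AuxOp.ofMatrix (((l.map fun a => site a (F a)).prod).map (liftSeries A)) =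
      (l.map fun a => site a (siteMat (F a))).prod := by
  have h := map_list_prod ((Matrix.scalar (Fin n)).comp (liftSeries A)).mapMatrix
    (l.map fun a => site a (F a))
  rw [List.map_map] at h
  refine Eq.trans ?_ (h.trans ?_)
  · rw [AuxOp.ofMatrix, Matrix.map_map]
    rfl
  · congr 2
    funext a
    exact (site_map _ a (F a)).trans (congrArg _ (by rw [siteMat, Matrix.map_map]; rfl))

theorem sites_relation_left {P P' : Fin m → Matrix (Fin n) (Fin n) (Matrix (Fin n) (Fin n) (PowerSeries ℂ))}
    {F : Fin m → Matrix (Fin n) (Fin n) (PowerSeries A)} {Z : Matrix (Fin n) (Fin n) (Master A)}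
    (h : ∀ a, liftSite A (P a) * (Matrix.scalar (Fin n) Z * siteMat (F a)) =
      siteMat (F a) * Matrix.scalar (Fin n) Z * liftSite A (P' a)) :
    AuxOp.mapEntries (liftScalar A) (((List.finRange m).reverse.map fun a => site a (P a)).prod) *
      (Matrix.scalar 𝕀 Z * AuxOp.ofMatrix
        ((((List.finRange m).map fun a => site a (F a)).prod).map (liftSeries A))) =
    AuxOp.ofMatrix ((((List.finRange m).map fun a => site a (F a)).prod).map (liftSeries A)) *
      Matrix.scalar 𝕀 Z *
      AuxOp.mapEntries (liftScalar A) (((List.finRange m).reverse.map fun a => site a (P' a)).prod) := by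
  rw [mapEntries_list_prod, mapEntries_list_prod, ofMatrix_list_prod]
  refine list_prod_relation (List.nodup_finRange m) (fun a b hab => liftSite_commute_siteMat hab _ _)
    (fun a b hab => liftSite_commute_siteMat hab _ _) fun a => ?_
  rw [← site_scalar a, ← site_mul, ← site_mul, ← site_mul, ← site_mul, h]

theorem sites_relation_right {P P' : Fin m → Matrix (Fin n) (Fin n) (Matrix (Fin n) (Fin n) (PowerSeries ℂ))}
    {F : Fin m → Matrix (Fin n) (Fin n) (PowerSeries A)} {Z : Matrix (Fin n) (Fin n) (Master A)}
    (h : ∀ a, Matrix.scalar (Fin n) Z * liftSite A (P a) * siteMat (F a) =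
      siteMat (F a) * liftSite A (P' a) * Matrix.scalar (Fin n) Z) :
    Matrix.scalar 𝕀 Z * (AuxOp.mapEntries (liftScalar A)
        (((List.finRange m).reverse.map fun a => site a (P a)).prod) * AuxOp.ofMatrix
        ((((List.finRange m).reverse.map fun a => site a (F a)).prod).map (liftSeries A))) =
    AuxOp.ofMatrix ((((List.finRange m).reverse.map fun a => site a (F a)).prod).map (liftSeries A)) *
      AuxOp.mapEntries (liftScalar A) (((List.finRange m).reverse.map fun a => site a (P' a)).prod) *
      Matrix.scalar 𝕀 Z := by
  rw [mapEntries_list_prod, mapEntries_list_prod, ofMatrix_list_prod]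
  refine list_prod_relation_inv (List.nodup_finRange m) (fun a b hab => liftSite_commute_siteMat hab _ _)
    (fun a b hab => liftSite_commute_siteMat hab _ _) fun a => ?_
  rw [← site_scalar a, ← site_mul, ← site_mul, ← site_mul, ← site_mul, h]

/-- The scalar operators that arise when a generating matrix `L` of the algebra is moved through
the factors of the products `L⁺₁ ⋯ L⁺_m` and `(L⁻_m)⁻¹ ⋯ (L⁻₁)⁻¹`. -/
structure Dressing (n : ℕ) (q : ℂˣ) (L : ℕ → Matrix (Fin n) (Fin n) (UqCri n q)) (ε : ℤ) where
  /-- The operator to the left of `L⁺`. -/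
  outer : ℂ → Matrix (Fin n) (Fin n) (Matrix (Fin n) (Fin n) (PowerSeries ℂ))
  /-- The inverse of `outer`. -/
  outerInv : ℂ → Matrix (Fin n) (Fin n) (Matrix (Fin n) (Fin n) (PowerSeries ℂ))
  /-- The operator between `L⁺` and `(L⁻)⁻¹`. -/
  middle : ℂ → Matrix (Fin n) (Fin n) (Matrix (Fin n) (Fin n) (PowerSeries ℂ))
  /-- The operator to the right of `(L⁻)⁻¹`. -/
  inner : ℂ → Matrix (Fin n) (Fin n) (Matrix (Fin n) (Fin n) (PowerSeries ℂ))
  outer_mul_outerInv : ∀ x, outer x * outerInv x = 1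
  outerInv_mul_outer : ∀ x, outerInv x * outer x = 1
  outer_isCoexchange : IsCoexchange q outer
  inner_isCoexchange : IsCoexchange q inner
  crossing : ∀ x (w w' : Fin n), ∑ u, dEntry n q u • (outerInv x u w * inner x w' u) =
    if w = w' then dEntry n q w • 1 else 0
  left : ∀ x, x ≠ 0 → liftSite (UqCri n q) (outer x) * (Matrix.scalar (Fin n) (auxMat ε L) *
      siteMat (scaled (LPlus n q) x⁻¹)) =
    siteMat (scaled (LPlus n q) x⁻¹) * Matrix.scalar (Fin n) (auxMat ε L) * liftSite (UqCri n q) (middle x)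
  right : ∀ x, x ≠ 0 → Matrix.scalar (Fin n) (auxMat (-ε) L) * liftSite (UqCri n q) (middle x) *
      siteMat (inverseFamily n q x) =
    siteMat (inverseFamily n q x) * liftSite (UqCri n q) (inner x) * Matrix.scalar (Fin n) (auxMat (-ε) L)

theorem rescale_map_map (x y : ℂ) (M : Matrix (Fin n × Fin n) (Fin n × Fin n) (PowerSeries ℂ)) :
    (M.map (PowerSeries.rescale x)).map (PowerSeries.rescale y) = M.map (PowerSeries.rescale (x * y)) := by
  ext s t k
  simp only [Matrix.map_apply, PowerSeries.coeff_rescale]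
  ring

theorem rescale_mapMatrix_smul (x d : ℂ) (M : Matrix (Fin n) (Fin n) (PowerSeries ℂ)) :
    (PowerSeries.rescale x).mapMatrix (algebraMap ℂ (PowerSeries ℂ) d • M) =
      d • (PowerSeries.rescale x).mapMatrix M := by
  ext i j k
  simp only [algebraMap_smul, RingHom.mapMatrix_apply, Matrix.map_apply, Matrix.smul_apply,
    PowerSeries.coeff_rescale, PowerSeries.coeff_smul, smul_eq_mul]
  ring

theorem rescale_crossing {E F : Matrix (Fin n) (Fin n) (Matrix (Fin n) (Fin n) (PowerSeries ℂ))}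
    {w w' : Fin n} (h : ∑ u, algebraMap ℂ (PowerSeries ℂ) (dEntry n q u) • (E u w * F w' u) =
      if w = w' then algebraMap ℂ (PowerSeries ℂ) (dEntry n q w) • 1 else 0) (x : ℂ) :
    ∑ u, dEntry n q u • ((PowerSeries.rescale x).mapMatrix (E u w) *
      (PowerSeries.rescale x).mapMatrix (F w' u)) = if w = w' then dEntry n q w • 1 else 0 := by
  have h' := congrArg (PowerSeries.rescale x).mapMatrix h
  rw [map_sum, apply_ite (PowerSeries.rescale x).mapMatrix, rescale_mapMatrix_smul, map_one, map_zero] at h'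
  simpa only [rescale_mapMatrix_smul, map_mul] using h'

theorem rShift_crossing_first (hn : 1 ≤ n) (hq : ∀ k : ℕ, 0 < k → q ^ k ≠ 1) (x : ℂ) (w w' : Fin n) :
    ∑ u, dEntry n q u • (auxFirst (rShiftInv n q x) u w *
      auxFirst (rShift n q ((q : ℂ) ^ (2 * n) * x)) w' u) =
    if w = w' then dEntry n q w • 1 else 0 := by
  have h := rescale_crossing (crossing_series_first hn hq w w') x
  rw [rShift, ← rescale_map_map]
  exact h

theorem rShift_crossing_last (hn : 1 ≤ n) (hq : ∀ k : ℕ, 0 < k → q ^ k ≠ 1) (x : ℂ) (w w' : Fin n) :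
    ∑ u, dEntry n q u • (auxLast (rShift n q ((q : ℂ) ^ (2 * n) * x)) u w *
      auxLast (rShiftInv n q x) w' u) =
    if w = w' then dEntry n q w • 1 else 0 := by
  have h := rescale_crossing (crossing_series_last hn hq w w') x
  rw [rShift, ← rescale_map_map]
  exact h

/-- The dressing for the series `L⁺(u)`. -/
def dressingPlus (hn : 1 ≤ n) (hq : ∀ k : ℕ, 0 < k → q ^ k ≠ 1) : Dressing n q (LPlus n q) 1 where
  outer x := auxFirst (rShift n q x)
  outerInv x := auxFirst (rShiftInv n q x)
  middle x := auxFirst (rShift n q x)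
  inner x := auxFirst (rShift n q ((q : ℂ) ^ (2 * n) * x))
  outer_mul_outerInv x := by rw [← map_mul, rShift_mul_rShiftInv, map_one]
  outerInv_mul_outer x := by rw [← map_mul, rShiftInv_mul_rShift, map_one]
  outer_isCoexchange := rShift_first_isCoexchange
  inner_isCoexchange := rShift_first_isCoexchange.comp_mul (pow_ne_zero _ q.ne_zero)
  crossing x := rShift_crossing_first hn hq x
  left x hx := by
    have h := plus_plus (n := n) (q := q) (inv_ne_zero hx)
    rwa [inv_inv] at h
  right x hx := by
    have h := plus_minus (n := n) (q := q) (mul_ne_zero (zpow_ne_zero (n : ℤ) q.ne_zero) hx)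
    rwa [← mul_assoc, ← mul_assoc, ← zpow_add₀ q.ne_zero, ← zpow_add₀ q.ne_zero, neg_add_cancel,
      zpow_zero, one_mul, ← two_mul, show (2 * (n : ℤ)) = ((2 * n : ℕ) : ℤ) by push_cast; rfl,
      zpow_natCast] at h

/-- The dressing for the series `L⁻(u)`. -/
def dressingMinus (hn : 1 ≤ n) (hq : ∀ k : ℕ, 0 < k → q ^ k ≠ 1) : Dressing n q (LMinus n q) (-1) where
  outer x := auxLast (rShiftInv n q ((q : ℂ) ^ (n : ℤ) * x⁻¹))
  outerInv x := auxLast (rShift n q ((q : ℂ) ^ (n : ℤ) * x⁻¹))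
  middle x := auxLast (rShiftInv n q ((q : ℂ) ^ (-(n : ℤ)) * x⁻¹))
  inner x := auxLast (rShiftInv n q ((q : ℂ) ^ (-(n : ℤ)) * x⁻¹))
  outer_mul_outerInv x := by rw [← map_mul, rShiftInv_mul_rShift, map_one]
  outerInv_mul_outer x := by rw [← map_mul, rShift_mul_rShiftInv, map_one]
  outer_isCoexchange := by
    have h := (rShiftInv_last_isCoexchange (n := n) (q := q)).comp_mul
      (zpow_ne_zero (-(n : ℤ)) q.ne_zero)
    simpa only [mul_inv, ← zpow_neg, neg_neg] using h
  inner_isCoexchange := by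
    have h := (rShiftInv_last_isCoexchange (n := n) (q := q)).comp_mul
      (zpow_ne_zero (n : ℤ) q.ne_zero)
    simpa only [mul_inv, ← zpow_neg] using h
  crossing x w w' := by
    have h := rShift_crossing_last hn hq ((q : ℂ) ^ (-(n : ℤ)) * x⁻¹) w w'
    rwa [← mul_assoc, ← zpow_natCast, ← zpow_add₀ q.ne_zero,
      show ((2 * n : ℕ) : ℤ) + -n = n by push_cast; ring] at h
  left x hx := minus_plus (n := n) (q := q) (inv_ne_zero hx)
  right x hx := by
    have h := minus_minus (n := n) (q := q) (mul_ne_zero (zpow_ne_zero (n : ℤ) q.ne_zero) hx)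
    rwa [mul_inv, ← zpow_neg] at h

end Dressing

end

section

/-! ### Removing the scalar operators under the trace -/

section Crossing

variable {n m : ℕ} {q : ℂˣ} {S : Type*} [Ring S] [Algebra ℂ S]

local notation "𝕀" => Fin m → Fin n

/-- The weight of a basis vector of `(ℂⁿ)^{⊗ m}`. -/
def tensorWeight (n : ℕ) (q : ℂˣ) (w : Fin m → Fin n) : ℂ := ∏ a, dEntry n q (w a)

theorem prod_crossing {E F : Fin m → Matrix (Fin n) (Fin n) S}
    (h : ∀ a (w w' : Fin n), ∑ u, dEntry n q u • (E a u w * F a w' u) =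
      if w = w' then dEntry n q w • 1 else 0) (w w' : Fin m → Fin n) :
    ∑ u, tensorWeight n q u • (((List.finRange m).map fun a => E a (u a) (w a)).prod *
      ((List.finRange m).reverse.map fun a => F a (w' a) (u a)).prod) =
    if w = w' then tensorWeight n q w • (1 : S) else 0 := by
  induction m with
  | zero => simp [tensorWeight, Subsingleton.elim w w']
  | succ m ih =>
    have ih := ih (E := fun a => E a.succ) (F := fun a => F a.succ) (fun a => h a.succ)
      (fun a => w a.succ) (fun a => w' a.succ)
    rw [← (Fin.consEquiv fun _ => Fin n).sum_comp, Fintype.sum_prod_type]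
    have e : ∀ (i : Fin n) (u : Fin m → Fin n),
        tensorWeight n q (Fin.consEquiv (fun _ => Fin n) (i, u)) •
          (((List.finRange (m + 1)).map fun a =>
              E a (Fin.consEquiv (fun _ => Fin n) (i, u) a) (w a)).prod *
            ((List.finRange (m + 1)).reverse.map fun a =>
              F a (w' a) (Fin.consEquiv (fun _ => Fin n) (i, u) a)).prod) =
        dEntry n q i • (E 0 i (w 0) * (tensorWeight n q u •
          (((List.finRange m).map fun a => E a.succ (u a) (w a.succ)).prod *
            ((List.finRange m).reverse.map fun a => F a.succ (w' a.succ) (u a)).prod)) *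
          F 0 (w' 0) i) := by
      intro i u
      simp only [List.finRange_succ, List.map_cons, List.prod_cons, List.reverse_cons,
        List.map_append, List.map_reverse, List.map_map, List.map_nil, List.prod_append,
        List.prod_nil, mul_one, tensorWeight, Fin.prod_univ_succ, Fin.consEquiv_apply,
        Fin.cons_zero, Fin.cons_succ, Function.comp_def, mul_smul, mul_smul_comm, smul_mul_assoc, mul_assoc]
    simp only [e, ← Finset.smul_sum, ← Finset.mul_sum, ← Finset.sum_mul]
    have hw : w = w' ↔ w 0 = w' 0 ∧ (fun a : Fin m => w a.succ) = fun a => w' a.succ := by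
      rw [funext_iff, Fin.forall_fin_succ, funext_iff]
    simp only [ih]
    by_cases h1 : (fun a : Fin m => w a.succ) = fun a => w' a.succ
    · simp only [if_pos h1, mul_smul_comm, smul_mul_assoc, mul_one]
      simp only [smul_comm _ (tensorWeight n q fun a : Fin m => w a.succ), ← Finset.smul_sum, h]
      by_cases h0 : w 0 = w' 0
      · rw [if_pos h0, if_pos (hw.2 ⟨h0, h1⟩), smul_smul]
        congr 1
        simp only [tensorWeight, Fin.prod_univ_succ]
        ring
      · rw [if_neg h0, if_neg fun hh => h0 (hw.1 hh).1, smul_zero]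
    · simp only [if_neg h1, mul_zero, zero_mul, smul_zero, Finset.sum_const_zero,
        if_neg fun hh => h1 (hw.1 hh).2]

theorem trace_mul_weightD (Z : Matrix 𝕀 𝕀 S) :
    Matrix.trace (Z * scalarMat S (weightD n m q)) = ∑ w, tensorWeight n q w • Z w w := by
  rw [Matrix.trace]
  refine Finset.sum_congr rfl fun w _ => ?_
  rw [Matrix.diag_apply, Matrix.mul_apply, Finset.sum_eq_single w]
  · rw [scalarMat, Matrix.map_apply, weightD, Matrix.diagonal_apply_eq, ← Algebra.commutes,
      ← Algebra.smul_def]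
    rfl
  · intro v _ hv
    rw [scalarMat, Matrix.map_apply, weightD, Matrix.diagonal_apply_ne _ hv, map_zero, mul_zero]
  · simp

theorem trace_crossing {Q Z P : Matrix 𝕀 𝕀 S} (hZ : ∀ w w' v v', Commute (Z w w') (P v v'))
    (h : ∀ w w', ∑ u, tensorWeight n q u • (Q u w * P w' u) =
      if w = w' then tensorWeight n q w • (1 : S) else 0) :
    Matrix.trace (Q * Z * P * scalarMat S (weightD n m q)) =
      Matrix.trace (Z * scalarMat S (weightD n m q)) := by
  rw [trace_mul_weightD, trace_mul_weightD]
  calc ∑ u, tensorWeight n q u • (Q * Z * P) u u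
      = ∑ u, ∑ w, ∑ w', tensorWeight n q u • (Q u w * P w' u) * Z w w' := by
        refine Finset.sum_congr rfl fun u _ => ?_
        rw [Matrix.mul_assoc, Matrix.mul_apply, Finset.smul_sum]
        refine Finset.sum_congr rfl fun w _ => ?_
        rw [Matrix.mul_apply, Finset.mul_sum, Finset.smul_sum]
        refine Finset.sum_congr rfl fun w' _ => ?_
        rw [(hZ _ _ _ _).eq, ← mul_assoc, smul_mul_assoc]
    _ = ∑ w, ∑ w', (∑ u, tensorWeight n q u • (Q u w * P w' u)) * Z w w' := by
        rw [Finset.sum_comm]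
        refine Finset.sum_congr rfl fun w _ => ?_
        rw [Finset.sum_comm]
        exact Finset.sum_congr rfl fun w' _ => (Finset.sum_mul _ _ _).symm
    _ = _ := by
        refine Finset.sum_congr rfl fun w _ => ?_
        rw [Finset.sum_eq_single w]
        · rw [h, if_pos rfl, smul_mul_assoc, one_mul]
        · intro w' _ hw'
          rw [h, if_neg hw'.symm, zero_mul]
        · simp

theorem trace_dressed (hq : ∀ k : ℕ, 0 < k → q ^ k ≠ 1)
    {Q Y P : (Fin m → ℤ) → Matrix 𝕀 𝕀 S} (hQ : Intertwines q Q) (hY : Intertwines q Y)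
    (hP : Intertwines q P) (hc : ∀ c w w' v v', Commute (Y c w w') (P c v v'))
    (h : ∀ c w w', ∑ u, tensorWeight n q u • (Q c u w * P c w' u) =
      if w = w' then tensorWeight n q w • (1 : S) else 0) (Λ : Tab m) :
    Matrix.trace (Q (contents Λ.1) * Y (contents Λ.1) * P (contents Λ.1) *
      scalarMat S (weightD n m q * tabUnit q (RCheck n q) (tabVec Λ.1) (tabVec Λ.1))) =
    Matrix.trace (Y (contents Λ.1) *
      scalarMat S (weightD n m q * tabUnit q (RCheck n q) (tabVec Λ.1) (tabVec Λ.1))) := by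
  obtain ⟨a, ha⟩ := exists_trace_weights hq m
  have hg := tensorT_isHecke n m q S
  have f1 := fusion hq hg ha hP Λ
  have f2 := fusion hq hg ha (hQ.mul hY) Λ
  rw [tabUnit_tensorT] at f1 f2
  have hD : weightD n m q * tabUnit q (RCheck n q) (tabVec Λ.1) (tabVec Λ.1) =
      tabUnit q (RCheck n q) (tabVec Λ.1) (tabVec Λ.1) * weightD n m q :=
    weightD_commute_tabUnit _ _
  have hE := trace_mul_scalarMat (A := S) (ι := Fin m → Fin n)
  set c := contents Λ.1
  set e := tabUnit q (RCheck n q) (tabVec Λ.1) (tabVec Λ.1)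
  have hD' : scalarMat S e * scalarMat S (weightD n m q) =
      scalarMat S (weightD n m q) * scalarMat S e := by
    rw [← scalarMat_mul, ← hD, scalarMat_mul]
  rw [hD, scalarMat_mul]
  calc Matrix.trace (Q c * Y c * P c * (scalarMat S e * scalarMat S (weightD n m q)))
      = Matrix.trace (Q c * Y c * (P c * scalarMat S e) * scalarMat S (weightD n m q)) := by
        simp only [mul_assoc]
    _ = a Λ • Matrix.trace (Q c * Y c * scalarMat S e * P c * scalarMat S (weightD n m q) * scalarMat S e) := by
        rw [f1, mul_smul_comm, smul_mul_assoc, Matrix.trace_smul]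
        simp only [mul_assoc, hD']
    _ = a Λ • Matrix.trace (scalarMat S e * (Q c * Y c * scalarMat S e) * (P c * scalarMat S (weightD n m q))) := by
        rw [hE]
        simp only [mul_assoc]
    _ = Matrix.trace (Q c * (Y c * scalarMat S e) * P c * scalarMat S (weightD n m q)) := by
        rw [← Matrix.trace_smul, ← smul_mul_assoc, ← f2]
        simp only [mul_assoc]
    _ = Matrix.trace (Y c * scalarMat S e * scalarMat S (weightD n m q)) := by
        refine trace_crossing (fun w w' v v' => ?_) (h c)
        rw [Matrix.mul_apply]
        refine Commute.sum_left _ _ _ fun u _ => ?_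
        exact (hc _ _ _ _ _).mul_left (Algebra.commutes _ _)
    _ = _ := by rw [mul_assoc]

end Crossing

section Products

variable {n m : ℕ} {q : ℂˣ} {L : ℕ → Matrix (Fin n) (Fin n) (UqCri n q)} {ε : ℤ}

local notation "𝕀" => Fin m → Fin n

theorem site_list_prod_mul_reverse {S : Type*} [Ring S] {E F : Fin m → Matrix (Fin n) (Fin n) S}
    (h : ∀ a, E a * F a = 1) (l : List (Fin m)) :
    (l.map fun a => site a (E a)).prod * (l.reverse.map fun a => site a (F a)).prod = 1 := by
  induction l with
  | nil => simp
  | cons a l ih =>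
    simp only [List.reverse_cons, List.map_append, List.map_cons, List.map_nil, List.prod_append,
      List.prod_cons, List.prod_nil, mul_one]
    rw [mul_assoc, ← mul_assoc _ _ (site a (F a)), ih, one_mul, ← site_mul, h, site_one]

namespace Dressing

variable (d : Dressing n q L ε) (c : Fin m → ℤ)

/-- The product of the operators `outer` over the tensor factors. -/
def outerProd : AuxOp n m (PowerSeries ℂ) := sitesProdRev d.outer fun a => qSq q (c a)

/-- The inverse of `outerProd`. -/
def outerInvProd : AuxOp n m (PowerSeries ℂ) := sitesProd d.outerInv fun a => qSq q (c a)

/-- The product of the operators `middle` over the tensor factors. -/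
def middleProd : AuxOp n m (PowerSeries ℂ) := sitesProdRev d.middle fun a => qSq q (c a)

/-- The product of the operators `inner` over the tensor factors. -/
def innerProd : AuxOp n m (PowerSeries ℂ) := sitesProdRev d.inner fun a => qSq q (c a)

theorem outerInvProd_mul_outerProd : d.outerInvProd c * d.outerProd c = 1 :=
  site_list_prod_mul_reverse (fun _ => d.outerInv_mul_outer _) _

theorem outerProd_mul_outerInvProd : d.outerProd c * d.outerInvProd c = 1 := by
  have h := site_list_prod_mul_reverse (m := m) (fun a => d.outer_mul_outerInv (qSq q (c a)))
    (List.finRange m).reverse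
  rwa [List.reverse_reverse] at h

theorem innerProd_intertwines : Intertwines q (d.innerProd : (Fin m → ℤ) → _) :=
  fun k c => d.inner_isCoexchange.sitesProdRev_baxter k c

theorem outerInvProd_intertwines : Intertwines q (d.outerInvProd : (Fin m → ℤ) → _) := by
  intro k c
  have h := d.outer_isCoexchange.sitesProdRev_baxter k c
  change d.outerProd c * _ = _ * d.outerProd (c ∘ adjSwap k) at h
  calc d.outerInvProd c * baxter q (tensorT n q _) k c
      = d.outerInvProd c * (baxter q (tensorT n q _) k c * d.outerProd (c ∘ adjSwap k)) *
          d.outerInvProd (c ∘ adjSwap k) := by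
        rw [mul_assoc, mul_assoc, outerProd_mul_outerInvProd, mul_one]
    _ = _ := by
        rw [← h, ← mul_assoc, outerInvProd_mul_outerProd, one_mul]

theorem crossing_prod (w w' : 𝕀) :
    ∑ u, tensorWeight n q u • (d.outerInvProd c u w * d.innerProd c w' u) =
      if w = w' then tensorWeight n q w • 1 else 0 := by
  rw [← prod_crossing (m := m) (fun a => d.crossing (qSq q (c a)))]
  refine Finset.sum_congr rfl fun u _ => ?_
  rw [outerInvProd, innerProd, sitesProd, sitesProdRev, prod_site_apply _ _ (List.nodup_finRange m),
    prod_site_apply _ _ (List.nodup_reverse.2 (List.nodup_finRange m)), if_pos, if_pos]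
  · intro b hb
    simp at hb
  · intro b hb
    simp at hb

theorem left_coeff (s : ℕ) (k : ℤ) :
    ∑ x ∈ Finset.HasAntidiagonal.antidiagonal s, scalarCoeff (UqCri n q) x.1 (d.outerProd c) *
      (Matrix.scalar 𝕀 (L x.2) * AuxOp.ofMatrix (intCoeff (k - ε * x.2)
        (sitesProd (scaled (LPlus n q)) fun a => qSq q (-c a)))) =
    ∑ x ∈ Finset.HasAntidiagonal.antidiagonal s,
      AuxOp.ofMatrix (intCoeff (k - ε * x.2) (sitesProd (scaled (LPlus n q)) fun a => qSq q (-c a))) *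
        Matrix.scalar 𝕀 (L x.2) * scalarCoeff (UqCri n q) x.1 (d.middleProd c) := by
  refine coeff_relation_left (sites_relation_left fun a => ?_) s k
  have h := d.left (qSq q (c a)) (qSq_ne_zero _)
  rwa [show (qSq q (c a))⁻¹ = qSq q (-c a) by rw [qSq, qSq, ← zpow_neg, mul_neg]] at h

theorem right_coeff (s : ℕ) (k : ℤ) :
    ∑ x ∈ Finset.HasAntidiagonal.antidiagonal s, Matrix.scalar 𝕀 (L x.2) *
      (scalarCoeff (UqCri n q) x.1 (d.middleProd c) * AuxOp.ofMatrix (intCoeff (k + ε * x.2)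
        (sitesProdRev (inverseFamily n q) fun a => qSq q (c a)))) =
    ∑ x ∈ Finset.HasAntidiagonal.antidiagonal s,
      AuxOp.ofMatrix (intCoeff (k + ε * x.2) (sitesProdRev (inverseFamily n q) fun a => qSq q (c a))) *
        scalarCoeff (UqCri n q) x.1 (d.innerProd c) * Matrix.scalar 𝕀 (L x.2) := by
  have h := coeff_relation_right (sites_relation_right fun a => d.right (qSq q (c a)) (qSq_ne_zero _)) s k
  simp only [neg_mul, sub_neg_eq_add] at h
  exact h

end Dressing

end Products

end

section

/-! ### The trace of a dressed operator, coefficient by coefficient -/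

section TraceCoefficients

variable {n m : ℕ} {q : ℂˣ} {B : Type*} [Ring B]

local notation "𝕀" => Fin m → Fin n

/-- The coefficient of `ζ^u`. -/
def seriesCoeff (u : ℕ) (Z : AuxOp n m (PowerSeries B)) : AuxOp n m B :=
  AuxOp.mapEntries (PowerSeries.coeff u) Z

theorem seriesCoeff_mul (u : ℕ) (Y Z : AuxOp n m (PowerSeries B)) :
    seriesCoeff u (Y * Z) = ∑ x ∈ Finset.HasAntidiagonal.antidiagonal u,
      seriesCoeff x.1 Y * seriesCoeff x.2 Z := by
  ext w w' i j
  simp only [seriesCoeff, AuxOp.mapEntries_apply, AuxOp.mul_apply, map_sum, PowerSeries.coeff_mul,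
    Matrix.sum_apply]
  rw [Finset.sum_comm' (t' := Finset.univ) (s' := fun _ => Finset.HasAntidiagonal.antidiagonal u)
    (by simp)]
  exact Finset.sum_congr rfl fun v _ => Finset.sum_comm

/-- Operators that do not depend on `ζ`. -/
def constOp (Z : AuxOp n m B) : AuxOp n m (PowerSeries B) := AuxOp.mapEntries PowerSeries.C Z

theorem seriesCoeff_mul_constOp (u : ℕ) (Y : AuxOp n m (PowerSeries B)) (Z : AuxOp n m B) :
    seriesCoeff u (Y * constOp Z) = seriesCoeff u Y * Z := by
  ext w w' i j
  simp only [seriesCoeff, constOp, AuxOp.mapEntries_apply, AuxOp.mul_apply, map_sum,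
    PowerSeries.coeff_mul_C]

theorem seriesCoeff_constOp (u : ℕ) (Z : AuxOp n m B) :
    seriesCoeff u (constOp Z) = if u = 0 then Z else 0 := by
  ext w w' i j
  simp only [seriesCoeff, constOp, AuxOp.mapEntries_apply, PowerSeries.coeff_C]
  split_ifs <;> rfl

theorem trace_seriesCoeff (u : ℕ) (Z : AuxOp n m (PowerSeries B)) :
    Matrix.trace (seriesCoeff u Z) = (Matrix.trace Z).map (PowerSeries.coeff u) := by
  ext i j
  simp only [Matrix.trace, Matrix.sum_apply, Matrix.map_apply, map_sum]
  rfl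

variable [Algebra ℂ B] {L : ℕ → Matrix (Fin n) (Fin n) (UqCri n q)} {ε : ℤ}

theorem constOp_scalarMat (M : Matrix 𝕀 𝕀 ℂ) :
    constOp (scalarMat (Matrix (Fin n) (Fin n) B) M) =
      scalarMat (Matrix (Fin n) (Fin n) (PowerSeries B)) M := by
  ext1 w w'
  ext i j
  simp only [constOp, AuxOp.mapEntries_apply, scalarMat, Matrix.map_apply,
    Matrix.algebraMap_matrix_apply, PowerSeries.algebraMap_apply]
  split_ifs <;> simp

/-- Scalar operators over the power series ring. -/
def liftOp (B : Type*) [Ring B] [Algebra ℂ B] (P : AuxOp n m (PowerSeries ℂ)) :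
    AuxOp n m (PowerSeries B) :=
  P.map (PowerSeries.map (algebraMap ℂ B)).mapMatrix

theorem seriesCoeff_liftOp (u : ℕ) (P : AuxOp n m (PowerSeries ℂ)) :
    seriesCoeff u (liftOp B P) = scalarCoeff B u P := rfl

theorem mapMatrix_algebraMap (c : ℂ) : (PowerSeries.map (algebraMap ℂ B)).mapMatrix
      (algebraMap ℂ (Matrix (Fin n) (Fin n) (PowerSeries ℂ)) c) = algebraMap ℂ _ c := by
  ext1 i j
  rw [RingHom.mapMatrix_apply, Matrix.map_apply, Matrix.algebraMap_matrix_apply,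
    Matrix.algebraMap_matrix_apply, PowerSeries.algebraMap_apply, PowerSeries.algebraMap_apply]
  split_ifs <;> simp

theorem scalar_C_algebraMap (c : ℂ) : Matrix.scalar (Fin n) (PowerSeries.C (algebraMap ℂ B c)) =
    algebraMap ℂ (Matrix (Fin n) (Fin n) (PowerSeries B)) c := by
  ext1 i j
  rw [Matrix.algebraMap_matrix_apply, Matrix.scalar_apply, Matrix.diagonal_apply,
    PowerSeries.algebraMap_apply]

theorem constOp_ofMatrix_apply (Y : Matrix 𝕀 𝕀 B) (w w' : 𝕀) :
    constOp (AuxOp.ofMatrix (n := n) Y) w w' = Matrix.scalar (Fin n) (PowerSeries.C (Y w w')) := by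
  ext1 i j
  simp only [constOp, AuxOp.mapEntries_apply, AuxOp.ofMatrix, Matrix.map_apply, Matrix.scalar_apply,
    Matrix.diagonal_apply]
  split_ifs <;> simp

theorem liftOp_intertwines {P : (Fin m → ℤ) → AuxOp n m (PowerSeries ℂ)} (hP : Intertwines q P) :
    Intertwines q fun c => liftOp B (P c) := by
  refine hP.map (PowerSeries.map (algebraMap ℂ B)).mapMatrix.toAddMonoidHom fun c M => ?_
  change (PowerSeries.map (algebraMap ℂ B)).mapMatrix (_ * M) = _ * (PowerSeries.map _).mapMatrix M
  rw [map_mul, mapMatrix_algebraMap]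

theorem ofMatrix_intertwines {Y : (Fin m → ℤ) → Matrix 𝕀 𝕀 B} (hY : Intertwines q Y) :
    Intertwines q fun c => constOp (AuxOp.ofMatrix (n := n) (Y c)) := by
  have h := hY.map ((Matrix.scalar (Fin n)).comp (PowerSeries.C (R := B))).toAddMonoidHom fun c b => by
    change Matrix.scalar (Fin n) (PowerSeries.C (_ * b)) =
      _ * Matrix.scalar (Fin n) (PowerSeries.C b)
    rw [map_mul, map_mul, scalar_C_algebraMap]
  convert h using 2 with c
  ext1 w w'
  exact constOp_ofMatrix_apply _ _ _

theorem trace_ofMatrix_mul_scalarMat (Y : Matrix 𝕀 𝕀 B) (M : Matrix 𝕀 𝕀 ℂ) :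
    Matrix.trace (AuxOp.ofMatrix (n := n) Y * scalarMat (Matrix (Fin n) (Fin n) B) M) =
      Matrix.scalar (Fin n) (Matrix.trace (Y * scalarMat B M)) := by
  have e : scalarMat (Matrix (Fin n) (Fin n) B) M = AuxOp.ofMatrix (scalarMat B M) := by
    ext1 w w'
    ext1 i j
    simp only [scalarMat, AuxOp.ofMatrix, Matrix.map_apply, Matrix.scalar_apply,
      Matrix.diagonal_apply, Matrix.algebraMap_matrix_apply]
  rw [e, ← AuxOp.ofMatrix_mul]
  exact (AddMonoidHom.map_trace (Matrix.scalar (Fin n) : B →+* _) (Y * scalarMat B M)).symm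

theorem Dressing.trace_coeff (d : Dressing n q L ε) (hq : ∀ k : ℕ, 0 < k → q ^ k ≠ 1)
    {Y : (Fin m → ℤ) → Matrix 𝕀 𝕀 B} (hY : Intertwines q Y) (Λ : Tab m) (u : ℕ) :
    ∑ x ∈ Finset.HasAntidiagonal.antidiagonal u,
      Matrix.trace (scalarCoeff B x.1 (d.outerInvProd (contents Λ.1)) *
        AuxOp.ofMatrix (Y (contents Λ.1)) * scalarCoeff B x.2 (d.innerProd (contents Λ.1)) *
        scalarMat (Matrix (Fin n) (Fin n) B)
          (weightD n m q * tabUnit q (RCheck n q) (tabVec Λ.1) (tabVec Λ.1))) =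
      if u = 0 then Matrix.scalar (Fin n) (Matrix.trace (Y (contents Λ.1) * scalarMat B
          (weightD n m q * tabUnit q (RCheck n q) (tabVec Λ.1) (tabVec Λ.1)))) else 0 := by
  have h := trace_dressed hq (liftOp_intertwines (B := B) d.outerInvProd_intertwines)
    (ofMatrix_intertwines (n := n) hY) (liftOp_intertwines (B := B) d.innerProd_intertwines)
    (fun c w w' v v' => by
      rw [constOp_ofMatrix_apply, Matrix.scalar_apply, Commute, SemiconjBy]
      ext1 i j
      rw [Matrix.mul_diagonal, Matrix.diagonal_mul]
      ext k
      rw [PowerSeries.coeff_mul_C, PowerSeries.coeff_C_mul]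
      exact (Algebra.commutes _ _).symm)
    (fun c w w' => by
      have h := congrArg (PowerSeries.map (algebraMap ℂ B)).mapMatrix (d.crossing_prod c w w')
      simp only [Algebra.smul_def, map_sum, map_mul, mapMatrix_algebraMap, mul_one,
        apply_ite (PowerSeries.map (algebraMap ℂ B)).mapMatrix, map_zero] at h
      simp only [Algebra.smul_def, mul_one]
      exact h) Λ
  have h' := congrArg (fun M : Matrix (Fin n) (Fin n) (PowerSeries B) => M.map (PowerSeries.coeff u)) h
  simp only [← trace_seriesCoeff] at h'
  rw [← constOp_scalarMat, seriesCoeff_mul_constOp, seriesCoeff_mul_constOp, seriesCoeff_mul,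
    seriesCoeff_constOp, Finset.sum_mul, Matrix.trace_sum] at h'
  simp only [seriesCoeff_mul_constOp, seriesCoeff_liftOp] at h'
  rw [h']
  split_ifs
  · exact trace_ofMatrix_mul_scalarMat _ _
  · rw [zero_mul, Matrix.trace_zero]

end TraceCoefficients

/-! ### Convergent series -/

section Convergent

variable {W : Type*} [Ring W] [TopologicalSpace W] [IsTopologicalRing W] [T2Space W]

/-- The coefficients of the identity `A(ζ) L(ζ T^ε) Y(T) = Y(T) A'(ζ) L(ζ T^ε)` for `Y = X M`. -/
theorem tsum_relation {P P' P'' L : ℕ → W} {X M : ℤ → W} {ε : ℤ}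
    (h1 : ∀ (s : ℕ) (k : ℤ), ∑ x ∈ Finset.HasAntidiagonal.antidiagonal s,
        P x.1 * (L x.2 * X (k - ε * x.2)) =
      ∑ x ∈ Finset.HasAntidiagonal.antidiagonal s, X (k - ε * x.2) * L x.2 * P'' x.1)
    (h2 : ∀ (s : ℕ) (k : ℤ), ∑ x ∈ Finset.HasAntidiagonal.antidiagonal s,
        L x.2 * (P'' x.1 * M (k + ε * x.2)) =
      ∑ x ∈ Finset.HasAntidiagonal.antidiagonal s, M (k + ε * x.2) * P' x.1 * L x.2)
    (hs : ∀ k e : ℤ, Summable fun b : ℤ => X (k + b) * M (b + e))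
    (hs' : ∀ (i j : ℕ) (k e : ℤ), Summable fun b : ℤ => X (k + b) * (L j * P'' i) * M (b + e))
    (s : ℕ) (k : ℤ) :
    ∑ x ∈ Finset.HasAntidiagonal.antidiagonal s, P x.1 * (L x.2 * ∑' b, X (k - ε * x.2 + b) * M b) =
      ∑ x ∈ Finset.HasAntidiagonal.antidiagonal s,
        (∑' b, X (k - ε * x.2 + b) * M b) * P' x.1 * L x.2 := by
  have hs0 : ∀ k : ℤ, Summable fun b : ℤ => X (k + b) * M b := fun k => by
    simpa only [add_zero] using hs k 0
  have e1 : ∀ k b e : ℤ, X (k - e + b) = X (k + b - e) := fun k b e => by congr 1; ring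
  have a1 : ∀ x : ℕ × ℕ, Summable fun b : ℤ => P x.1 * (L x.2 * X (k + b - ε * x.2)) * M b := fun x => by
    simpa only [e1, mul_assoc] using ((hs0 (k - ε * x.2)).mul_left (L x.2)).mul_left (P x.1)
  have a2 : ∀ x : ℕ × ℕ, Summable fun b : ℤ => X (k + b - ε * x.2) * L x.2 * P'' x.1 * M b := fun x => by
    simpa only [e1, mul_assoc, add_zero] using hs' x.1 x.2 (k - ε * x.2) 0
  have a3 : ∀ x : ℕ × ℕ, Summable fun b : ℤ => X (k + b) * (L x.2 * (P'' x.1 * M (b + ε * x.2))) :=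
    fun x => by simpa only [mul_assoc] using hs' x.1 x.2 k (ε * x.2)
  have a4 : ∀ x : ℕ × ℕ, Summable fun b : ℤ => X (k + b) * (M (b + ε * x.2) * P' x.1 * L x.2) :=
    fun x => by
      simpa only [mul_assoc] using ((hs k (ε * x.2)).mul_right (P' x.1)).mul_right (L x.2)
  calc ∑ x ∈ Finset.HasAntidiagonal.antidiagonal s, P x.1 * (L x.2 * ∑' b, X (k - ε * x.2 + b) * M b)
      = ∑ x ∈ Finset.HasAntidiagonal.antidiagonal s,
          ∑' b, P x.1 * (L x.2 * X (k + b - ε * x.2)) * M b := by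
        refine Finset.sum_congr rfl fun x _ => ?_
        rw [← (hs0 _).tsum_mul_left, ← ((hs0 _).mul_left _).tsum_mul_left]
        simp only [e1, mul_assoc]
    _ = ∑ x ∈ Finset.HasAntidiagonal.antidiagonal s,
          ∑' b, X (k + b - ε * x.2) * L x.2 * P'' x.1 * M b := by
        rw [← Summable.tsum_finsetSum fun x _ => a1 x, ← Summable.tsum_finsetSum fun x _ => a2 x]
        simp only [← Finset.sum_mul, h1]
    _ = ∑ x ∈ Finset.HasAntidiagonal.antidiagonal s,
          ∑' b, X (k + b) * (L x.2 * (P'' x.1 * M (b + ε * x.2))) := by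
        refine Finset.sum_congr rfl fun x _ => ?_
        rw [← (Equiv.addRight (ε * x.2)).tsum_eq]
        refine tsum_congr fun b => ?_
        rw [Equiv.coe_addRight, ← add_assoc, add_sub_cancel_right]
        simp only [mul_assoc]
    _ = ∑ x ∈ Finset.HasAntidiagonal.antidiagonal s,
          ∑' b, X (k + b) * (M (b + ε * x.2) * P' x.1 * L x.2) := by
        rw [← Summable.tsum_finsetSum fun x _ => a3 x, ← Summable.tsum_finsetSum fun x _ => a4 x]
        simp only [← Finset.mul_sum, h2]
    _ = _ := by
        refine Finset.sum_congr rfl fun x _ => ?_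
        rw [← (hs0 _).tsum_mul_right, ← ((hs0 _).mul_right _).tsum_mul_right,
          ← (Equiv.addRight (ε * x.2)).tsum_eq (fun b => X (k - ε * x.2 + b) * M b * P' x.1 * L x.2)]
        refine tsum_congr fun b => ?_
        rw [Equiv.coe_addRight, show k - ε * x.2 + (b + ε * x.2) = k + b by ring]
        simp only [mul_assoc]

end Convergent

end

section

/-! ### Commutation with the generators -/

section Commutation

theorem sum_antidiagonal_invert {W : Type*} [Ring W] {Q P P' V G L : ℕ → W}
    (hQ : ∀ s, ∑ x ∈ Finset.HasAntidiagonal.antidiagonal s, Q x.1 * P x.2 = if s = 0 then 1 else 0)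
    (h : ∀ s, ∑ x ∈ Finset.HasAntidiagonal.antidiagonal s, P x.1 * V x.2 =
      ∑ x ∈ Finset.HasAntidiagonal.antidiagonal s, G x.2 * P' x.1 * L x.2) (t : ℕ) :
    V t = ∑ y ∈ Finset.HasAntidiagonal.antidiagonal t,
      (∑ x ∈ Finset.HasAntidiagonal.antidiagonal y.1, Q x.1 * G y.2 * P' x.2) * L y.2 := by
  have e1 : PowerSeries.mk Q * PowerSeries.mk P = 1 := by
    ext s
    rw [PowerSeries.coeff_mul, PowerSeries.coeff_one, ← hQ]
    simp only [PowerSeries.coeff_mk]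
  have e2 : PowerSeries.mk P * PowerSeries.mk V = PowerSeries.mk fun s =>
      ∑ x ∈ Finset.HasAntidiagonal.antidiagonal s, G x.2 * P' x.1 * L x.2 := by
    ext s
    rw [PowerSeries.coeff_mul, PowerSeries.coeff_mk, ← h]
    simp only [PowerSeries.coeff_mk]
  have e3 : PowerSeries.mk V = PowerSeries.mk Q * PowerSeries.mk fun s =>
      ∑ x ∈ Finset.HasAntidiagonal.antidiagonal s, G x.2 * P' x.1 * L x.2 := by
    rw [← e2, ← mul_assoc, e1, one_mul]
  have e4 := congrArg (PowerSeries.coeff t) e3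
  rw [PowerSeries.coeff_mk, PowerSeries.coeff_mul] at e4
  rw [e4]
  simp only [PowerSeries.coeff_mk, Finset.mul_sum, Finset.sum_mul]
  rw [Finset.sum_sigma', Finset.sum_sigma']
  refine Finset.sum_nbij' (fun z => ⟨(z.1.1 + z.2.1, z.2.2), (z.1.1, z.2.1)⟩)
    (fun z => ⟨(z.2.1, z.2.2 + z.1.2), (z.2.2, z.1.2)⟩) ?_ ?_ ?_ ?_ ?_
  · rintro ⟨⟨a, b⟩, ⟨c, d⟩⟩ hz
    simp only [Finset.mem_sigma, Finset.HasAntidiagonal.mem_antidiagonal, and_true] at hz ⊢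
    omega
  · rintro ⟨⟨a, b⟩, ⟨c, d⟩⟩ hz
    simp only [Finset.mem_sigma, Finset.HasAntidiagonal.mem_antidiagonal, and_true] at hz ⊢
    omega
  · rintro ⟨⟨a, b⟩, ⟨c, d⟩⟩ hz
    simp only [Finset.mem_sigma, Finset.HasAntidiagonal.mem_antidiagonal] at hz
    obtain ⟨_, rfl⟩ := hz
    rfl
  · rintro ⟨⟨a, b⟩, ⟨c, d⟩⟩ hz
    simp only [Finset.mem_sigma, Finset.HasAntidiagonal.mem_antidiagonal] at hz
    obtain ⟨_, rfl⟩ := hz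
    rfl
  · rintro ⟨⟨a, b⟩, ⟨c, d⟩⟩ _
    simp only [mul_assoc]

variable {n m : ℕ} {q : ℂˣ} {B : Type*} [Ring B] [Algebra ℂ B]
  {L : ℕ → Matrix (Fin n) (Fin n) (UqCri n q)} {ε : ℤ}

local notation "𝕀" => Fin m → Fin n

theorem trace_scalar_mul {S : Type*} [Ring S] (l : S) (Z : Matrix 𝕀 𝕀 S) :
    Matrix.trace (Matrix.scalar 𝕀 l * Z) = l * Matrix.trace Z := by
  simp only [Matrix.trace, Matrix.diag_apply, Matrix.scalar_apply, Matrix.diagonal_mul, Finset.mul_sum]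

theorem trace_mul_scalar {S : Type*} [Ring S] (l : S) (Z : Matrix 𝕀 𝕀 S) :
    Matrix.trace (Z * Matrix.scalar 𝕀 l) = Matrix.trace Z * l := by
  simp only [Matrix.trace, Matrix.diag_apply, Matrix.scalar_apply, Matrix.mul_diagonal, Finset.sum_mul]

theorem scalar_commute_scalarMat {S : Type*} [Ring S] [Algebra ℂ S] (l : S) (M : Matrix 𝕀 𝕀 ℂ) :
    Matrix.scalar 𝕀 l * scalarMat S M = scalarMat S M * Matrix.scalar 𝕀 l := by
  ext1 w w'
  rw [Matrix.scalar_apply, Matrix.diagonal_mul, Matrix.mul_diagonal]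
  exact (Algebra.commutes _ _).symm

theorem scalarCoeff_mul_eq_one {Q P : AuxOp n m (PowerSeries ℂ)} (h : Q * P = 1) (s : ℕ) :
    ∑ x ∈ Finset.HasAntidiagonal.antidiagonal s, scalarCoeff B x.1 Q * scalarCoeff B x.2 P =
      if s = 0 then 1 else 0 := by
  have h1 : liftOp B Q * liftOp B P = constOp 1 := by
    have := congrArg (PowerSeries.map (algebraMap ℂ B)).mapMatrix.mapMatrix h
    rw [map_mul, map_one] at this
    refine this.trans ?_
    ext1 w w'
    ext1 i j
    simp only [constOp, AuxOp.mapEntries_apply, Matrix.one_apply]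
    by_cases hw : w = w' <;> by_cases hi : i = j <;> simp [hw, hi, Matrix.one_apply]
  have h2 := congrArg (seriesCoeff s) h1
  rw [seriesCoeff_mul, seriesCoeff_constOp] at h2
  exact h2

theorem Dressing.commute (d : Dressing n q L ε) (hq : ∀ k : ℕ, 0 < k → q ^ k ≠ 1)
    (ι : UqCri n q →ₐ[ℂ] B) {Y : (Fin m → ℤ) → ℤ → Matrix 𝕀 𝕀 B}
    (hY : ∀ k, Intertwines q fun c => Y c k) (Λ : Tab m)
    (h : ∀ (s : ℕ) (k : ℤ), ∑ x ∈ Finset.HasAntidiagonal.antidiagonal s,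
        scalarCoeff B x.1 (d.outerProd (contents Λ.1)) * (Matrix.scalar 𝕀 ((L x.2).map ι) *
          AuxOp.ofMatrix (Y (contents Λ.1) (k - ε * x.2))) =
      ∑ x ∈ Finset.HasAntidiagonal.antidiagonal s,
        AuxOp.ofMatrix (Y (contents Λ.1) (k - ε * x.2)) *
          scalarCoeff B x.1 (d.innerProd (contents Λ.1)) * Matrix.scalar 𝕀 ((L x.2).map ι))
    (t : ℕ) (k : ℤ) (i j : Fin n) :
    Commute (ι (L t i j)) (Matrix.trace (Y (contents Λ.1) k * scalarMat B
      (weightD n m q * tabUnit q (RCheck n q) (tabVec Λ.1) (tabVec Λ.1)))) := by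
  have key := sum_antidiagonal_invert
    (Q := fun s => scalarCoeff B s (d.outerInvProd (contents Λ.1)))
    (P := fun s => scalarCoeff B s (d.outerProd (contents Λ.1)))
    (P' := fun s => scalarCoeff B s (d.innerProd (contents Λ.1)))
    (V := fun s => Matrix.scalar 𝕀 ((L s).map ι) *
      AuxOp.ofMatrix (Y (contents Λ.1) (k + ε * t - ε * s)))
    (G := fun s => AuxOp.ofMatrix (Y (contents Λ.1) (k + ε * t - ε * s)))
    (L := fun s => Matrix.scalar 𝕀 ((L s).map ι))
    (scalarCoeff_mul_eq_one (d.outerInvProd_mul_outerProd (contents Λ.1)))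
    (fun s => h s (k + ε * t)) t
  have ht := fun k u => d.trace_coeff (B := B) hq (hY k) Λ u
  set M := weightD n m q * tabUnit q (RCheck n q) (tabVec Λ.1) (tabVec Λ.1)
  set c := contents Λ.1
  have h1 := congrArg (fun Z : AuxOp n m B => Matrix.trace (Z * scalarMat _ M)) key
  simp only [mul_assoc, trace_scalar_mul, Finset.sum_mul, Matrix.trace_sum,
    scalar_commute_scalarMat] at h1
  simp only [← mul_assoc, trace_mul_scalar, ← Finset.sum_mul, ht, trace_ofMatrix_mul_scalarMat] at h1
  rw [add_sub_cancel_right, Finset.sum_eq_single (0, t)] at h1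
  · rw [if_pos rfl, add_sub_cancel_right] at h1
    have h2 := congrFun (congrFun h1 i) j
    rw [Matrix.scalar_apply, Matrix.mul_diagonal, Matrix.diagonal_mul] at h2
    exact h2
  · rintro ⟨a, b⟩ hx hne
    rw [if_neg, zero_mul]
    rintro rfl
    have := Finset.HasAntidiagonal.mem_antidiagonal.1 hx
    simp only [zero_add] at this
    exact hne (by rw [this])
  · intro hx
    exact absurd (Finset.HasAntidiagonal.mem_antidiagonal.2 (zero_add t)) hx

end Commutation

end

section

/-! ### The degree of the coefficients of `L⁻(u)⁻¹` -/

section Degree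

variable {n m : ℕ} {q : ℂˣ}

/-- Right multiplication by `x` maps `J p` to `J (p + r)`. -/
def RaisesDegree (r : ℕ) (x : UqCri n q) : Prop := ∀ p, ∀ y ∈ J n q p, y * x ∈ J n q (p + r)

theorem RaisesDegree.zero (r : ℕ) : RaisesDegree r (0 : UqCri n q) := fun p y _ => by
  rw [mul_zero]; exact zero_mem _

theorem RaisesDegree.one : RaisesDegree 0 (1 : UqCri n q) := fun p y hy => by rwa [mul_one]

theorem RaisesDegree.add {r : ℕ} {x y : UqCri n q} (hx : RaisesDegree r x) (hy : RaisesDegree r y) :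
    RaisesDegree r (x + y) := fun p z hz => by
  rw [mul_add]; exact add_mem (hx p z hz) (hy p z hz)

theorem RaisesDegree.neg {r : ℕ} {x : UqCri n q} (hx : RaisesDegree r x) : RaisesDegree r (-x) :=
  fun p z hz => by
    rw [mul_neg]; exact neg_mem (hx p z hz)

theorem RaisesDegree.mul {r s : ℕ} {x y : UqCri n q} (hx : RaisesDegree r x) (hy : RaisesDegree s y) :
    RaisesDegree (r + s) (x * y) := fun p z hz => by
  rw [← mul_assoc, ← add_assoc]
  exact hy _ _ (hx p z hz)

theorem RaisesDegree.sum {r : ℕ} {ι : Type*} {s : Finset ι} {f : ι → UqCri n q}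
    (h : ∀ i ∈ s, RaisesDegree r (f i)) : RaisesDegree r (∑ i ∈ s, f i) := fun p z hz => by
  rw [Finset.mul_sum]; exact sum_mem fun i hi => h i hi p z hz

theorem RaisesDegree.smul {r : ℕ} {x : UqCri n q} (hx : RaisesDegree r x) (c : ℂ) :
    RaisesDegree r (c • x) := fun p z hz => by
  rw [mul_smul_comm, Algebra.smul_def]; exact Ideal.mul_mem_left _ _ (hx p z hz)

theorem RaisesDegree.mem_J {r : ℕ} {x : UqCri n q} (hx : RaisesDegree r x) : x ∈ J n q r := by
  have h1 : (1 : UqCri n q) ∈ J n q 0 := by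
    have := minusWord_mem_J (n := n) (q := q) (p := 0) (w := []) (Nat.zero_le _)
    simpa [minusWord] using this
  have := hx 0 1 h1
  rwa [one_mul, zero_add] at this

theorem LMinus_raisesDegree (r : ℕ) (i j : Fin n) : RaisesDegree r (LMinus n q r i j) :=
  fun _ _ hy => J_mul_LMinus r i j hy

theorem LPlus_zero_raisesDegree (i j : Fin n) : RaisesDegree 0 (LPlus n q 0 i j) := fun p _ hy =>
  J_mul_of_words (fun w hw => J_anti n q (by omega) (minusWord_mul_LPlus_mem n q w 0 i j)) hy

/-- The elements that preserve the left ideals `J p`. -/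
def degreeZero (n : ℕ) (q : ℂˣ) : Subring (UqCri n q) where
  carrier := {x | RaisesDegree 0 x}
  zero_mem' := RaisesDegree.zero 0
  one_mem' := RaisesDegree.one
  add_mem' := RaisesDegree.add
  neg_mem' := RaisesDegree.neg
  mul_mem' {x y} hx hy := by
    have h : RaisesDegree (0 + 0) (x * y) := RaisesDegree.mul hx hy
    rwa [add_zero] at h

theorem LMinusInv_zero_mul_LMinus_zero : LMinusInv n q 0 * LMinus n q 0 = 1 := by
  have h := congrArg (PowerSeries.coeff 0) (LMinusSeries_mul_inv n q).2
  rw [PowerSeries.coeff_mul, PowerSeries.coeff_zero_one, Finset.Nat.antidiagonal_zero,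
    Finset.sum_singleton, LMinusSeries, PowerSeries.coeff_mk] at h
  exact h

theorem LMinusInv_zero_raisesDegree (i j : Fin n) : RaisesDegree 0 (LMinusInv n q 0 i j) := by
  let T : Matrix (Fin n) (Fin n) (degreeZero n q) :=
    Matrix.of fun i j => ⟨LMinus n q 0 i j, LMinus_raisesDegree 0 i j⟩
  have hT : IsUnit T := by
    refine isUnit_of_lowerTriangular T (fun i j h => ?_) fun i => ?_
    · have := freeToCri_rel (Rel.minus_zero (q := q) i j h)
      rw [map_zero] at this
      exact Subtype.ext this
    · have h1 := freeToCri_rel (Rel.plus_minus (q := q) i)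
      have h2 := freeToCri_rel (Rel.minus_plus (q := q) i)
      rw [map_mul, map_one] at h1 h2
      exact ⟨⟨⟨LMinus n q 0 i i, LMinus_raisesDegree 0 i i⟩,
        ⟨LPlus n q 0 i i, LPlus_zero_raisesDegree i i⟩, Subtype.ext h2, Subtype.ext h1⟩, rfl⟩
  obtain ⟨U, hU⟩ := hT
  have h1 : T * (↑U⁻¹ : Matrix (Fin n) (Fin n) (degreeZero n q)) = 1 := by rw [← hU, U.mul_inv]
  have h2 := congrArg (degreeZero n q).subtype.mapMatrix h1
  rw [map_mul, map_one] at h2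
  change LMinus n q 0 * _ = 1 at h2
  have h3 : LMinusInv n q 0 = (degreeZero n q).subtype.mapMatrix ↑U⁻¹ := by
    rw [← mul_one (LMinusInv n q 0), ← h2, ← mul_assoc, LMinusInv_zero_mul_LMinus_zero, one_mul]
  rw [h3]
  exact ((↑U⁻¹ : Matrix (Fin n) (Fin n) (degreeZero n q)) i j).2

theorem raisesDegree_matrix_mul {r s : ℕ} {Y Z : Matrix (Fin n) (Fin n) (UqCri n q)}
    (hY : ∀ i j, RaisesDegree r (Y i j)) (hZ : ∀ i j, RaisesDegree s (Z i j)) (i j : Fin n) :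
    RaisesDegree (r + s) ((Y * Z) i j) := by
  rw [Matrix.mul_apply]
  exact RaisesDegree.sum fun k _ => (hY i k).mul (hZ k j)

theorem LMinusInv_raisesDegree (r : ℕ) : ∀ i j, RaisesDegree r (LMinusInv n q r i j) := by
  induction r using Nat.strong_induction_on with
  | _ r ih =>
  cases r with
  | zero => exact LMinusInv_zero_raisesDegree
  | succ r =>
    have h := congrArg (PowerSeries.coeff (r + 1)) (LMinusSeries_mul_inv n q).1
    rw [PowerSeries.coeff_mul, PowerSeries.coeff_one, if_neg (Nat.succ_ne_zero r),
      Finset.Nat.antidiagonal_succ, Finset.sum_cons, Finset.sum_map, LMinusSeries,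
      PowerSeries.coeff_mk] at h
    set Z := ∑ x ∈ Finset.HasAntidiagonal.antidiagonal r,
      LMinus n q (x.1 + 1) * LMinusInv n q x.2 with hZ
    have h' : LMinus n q 0 * LMinusInv n q (r + 1) + Z = 0 := by
      rw [← h, hZ]
      congr 1
      refine Finset.sum_congr rfl fun x _ => ?_
      simp [LMinusInv]
    have hZd : ∀ i j, RaisesDegree (r + 1) (Z i j) := fun i j => by
      rw [hZ, Matrix.sum_apply]
      refine RaisesDegree.sum fun x hx => ?_
      have hx := Finset.HasAntidiagonal.mem_antidiagonal.1 hx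
      have := raisesDegree_matrix_mul (LMinus_raisesDegree (q := q) (x.1 + 1))
        (ih x.2 (by omega)) i j
      rwa [show x.1 + 1 + x.2 = r + 1 by omega] at this
    have e : LMinusInv n q (r + 1) = -(LMinusInv n q 0 * Z) := by
      rw [eq_neg_of_add_eq_zero_right h', mul_neg, neg_neg, ← mul_assoc,
        LMinusInv_zero_mul_LMinus_zero, one_mul]
    intro i j
    rw [e, Matrix.neg_apply]
    have := raisesDegree_matrix_mul LMinusInv_zero_raisesDegree hZd i j
    rw [zero_add] at this
    exact this.neg

/-- The power series whose `r`-th coefficients raise the degree by `r`. -/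
def gradedSeries (n : ℕ) (q : ℂˣ) : Subring (PowerSeries (UqCri n q)) where
  carrier := {f | ∀ r, RaisesDegree r (PowerSeries.coeff r f)}
  zero_mem' r := by rw [map_zero]; exact RaisesDegree.zero r
  one_mem' r := by
    rw [PowerSeries.coeff_one]
    split_ifs with h
    · rw [h]; exact RaisesDegree.one
    · exact RaisesDegree.zero r
  add_mem' hx hy r := by rw [map_add]; exact (hx r).add (hy r)
  neg_mem' hx r := by rw [map_neg]; exact (hx r).neg
  mul_mem' hx hy r := by
    rw [PowerSeries.coeff_mul]
    refine RaisesDegree.sum fun x hx' => ?_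
    rw [← Finset.HasAntidiagonal.mem_antidiagonal.1 hx']
    exact (hx x.1).mul (hy x.2)

theorem coeff_minus_mem_J (x : Fin m → ℂ) (w w' : Fin m → Fin n) (r : ℕ) :
    PowerSeries.coeff r (sitesProdRev (inverseFamily n q) x w w') ∈ J n q r := by
  have h : sitesProdRev (inverseFamily n q) x ∈ (gradedSeries n q).matrix := by
    refine Subring.list_prod_mem _ fun Z hZ => ?_
    obtain ⟨a, _, rfl⟩ := List.mem_map.1 hZ
    intro w w'
    rw [site, Matrix.of_apply]
    split_ifs
    · intro r
      rw [inverseFamily, scaled, Matrix.of_apply, PowerSeries.coeff_mk]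
      exact (LMinusInv_raisesDegree r _ _).smul _
    · exact zero_mem _
  exact (h w w' r).mem_J

end Degree

/-! ### Convergence in the completion -/

section Completion

variable {n m : ℕ} {q : ℂˣ}

instance (n : ℕ) (q : ℂˣ) : NonarchimedeanRing (UqCri n q) := (J_basis n q).nonarchimedean

instance (n : ℕ) (q : ℂˣ) : UniformContinuousConstSMul ℂ (UqCri n q) :=
  have : ContinuousConstSMul ℂ (UqCri n q) := ⟨fun c => by
    simp only [Algebra.smul_def]
    exact continuous_const_mul _⟩
  uniformContinuousConstSMul_of_continuousConstSMul _ _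

theorem summable_of_mem_J {α : Type*} {u : α → UqCri n q} (h : ∀ N, {a | u a ∉ J n q N}.Finite) :
    Summable fun a => (u a : UqCriCompletion n q) := by
  refine NonarchimedeanAddGroup.summable_of_tendsto_cofinite_zero ?_
  have h0 : Filter.Tendsto u Filter.cofinite (nhds 0) := by
    refine ((J_basis n q).hasBasis_nhds_zero.tendsto_right_iff).2 fun N _ => ?_
    exact h N
  have h1 := (UniformSpace.Completion.continuous_coe (UqCri n q)).continuousAt.tendsto.comp h0
  rwa [UniformSpace.Completion.coe_zero] at h1

theorem intCoeff_minus_mem_J (x : Fin m → ℂ) (w w' : Fin m → Fin n) (k : ℤ) (N : ℕ) (h : N ≤ k) :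
    intCoeff k (sitesProdRev (inverseFamily n q) x) w w' ∈ J n q N := by
  rw [intCoeff, Matrix.map_apply, coeff_ofPowerSeries, if_pos (by omega)]
  exact J_anti n q (by omega) (coeff_minus_mem_J x w w' k.toNat)

theorem intCoeff_eq_zero (f : Matrix (Fin m → Fin n) (Fin m → Fin n) (PowerSeries (UqCri n q))) {k : ℤ}
    (h : k < 0) : intCoeff k f = 0 := by
  ext w w'
  rw [intCoeff, Matrix.map_apply, coeff_ofPowerSeries, if_neg (by omega), Matrix.zero_apply]

theorem summable_mul_minus (x : Fin m → ℂ) (Z : ℤ → Matrix (Fin m → Fin n) (Fin m → Fin n) (UqCri n q))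
    (e : ℤ) (w w' : Fin m → Fin n) :
    Summable fun b : ℤ => (((Z b * intCoeff (b + e) (sitesProdRev (inverseFamily n q) x)) w w' :
      UqCri n q) : UqCriCompletion n q) := by
  refine summable_of_mem_J fun N => (Set.finite_Ico (-e) (N - e)).subset fun b hb => ?_
  by_contra hb'
  refine hb ?_
  rw [Matrix.mul_apply]
  refine sum_mem fun v _ => Ideal.mul_mem_left _ _ ?_
  by_cases h : b + e < 0
  · rw [intCoeff_eq_zero _ h, Matrix.zero_apply]
    exact zero_mem _
  · refine intCoeff_minus_mem_J _ _ _ _ _ ?_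
    by_contra h2
    exact hb' ⟨by omega, by omega⟩

theorem summable_aux_mul_minus (x : Fin m → ℂ) (Z : ℤ → AuxOp n m (UqCri n q)) (e : ℤ) :
    Summable fun b : ℤ => AuxOp.mapEntries ((↑) : UqCri n q → UqCriCompletion n q)
      (Z b * AuxOp.ofMatrix (intCoeff (b + e) (sitesProdRev (inverseFamily n q) x))) := by
  refine Pi.summable.2 fun w => Pi.summable.2 fun w' => Pi.summable.2 fun i => Pi.summable.2 fun j => ?_
  convert summable_mul_minus x (fun b => (Z b).map fun M => M i j) e w w' using 2 with b
  rw [AuxOp.mapEntries_apply, AuxOp.mul_apply, Matrix.mul_apply]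
  congr 1
  refine Finset.sum_congr rfl fun v _ => ?_
  rw [Finset.sum_eq_single j]
  · rw [AuxOp.ofMatrix, Matrix.map_apply, Matrix.scalar_apply, Matrix.diagonal_apply_eq]
    rfl
  · intro k _ hk
    rw [AuxOp.ofMatrix, Matrix.map_apply, Matrix.scalar_apply, Matrix.diagonal_apply_ne _ hk, mul_zero]
  · simp

end Completion

end

section

/-! ### The coefficients of `S_Λ(z)` are central -/

section Central

variable {n m : ℕ} {q : ℂˣ}

local notation "𝕀" => Fin m → Fin n

/-- The canonical map to the completion. -/
def toCompletion (n : ℕ) (q : ℂˣ) : UqCri n q →ₐ[ℂ] UqCriCompletion n q :=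
  { UniformSpace.Completion.coeRingHom with commutes' := fun _ => rfl }

theorem toCompletion_apply (x : UqCri n q) : toCompletion n q x = (x : UqCriCompletion n q) := rfl

/-- The product `L⁺₁(z x₁⁻¹) ⋯ L⁺_m(z x_m⁻¹)` for `x_a = q^{2c_a}`. -/
def plusMat (n : ℕ) (q : ℂˣ) (c : Fin m → ℤ) :
    Matrix (Fin m → Fin n) (Fin m → Fin n) (PowerSeries (UqCri n q)) :=
  sitesProd (scaled (LPlus n q)) fun a => qSq q (-c a)

/-- The product `L⁻_m(z q^{-n} x_m⁻¹)⁻¹ ⋯ L⁻₁(z q^{-n} x₁⁻¹)⁻¹` for `x_a = q^{2c_a}`. -/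
def minusMat (n : ℕ) (q : ℂˣ) (c : Fin m → ℤ) :
    Matrix (Fin m → Fin n) (Fin m → Fin n) (PowerSeries (UqCri n q)) :=
  sitesProdRev (inverseFamily n q) fun a => qSq q (c a)

/-- The coefficient of `z^k` in the product of the two products. -/
def mixedCoeff (n : ℕ) (q : ℂˣ) (c : Fin m → ℤ) (k : ℤ) :
    Matrix (Fin m → Fin n) (Fin m → Fin n) (UqCriCompletion n q) :=
  ∑' b : ℤ, (intCoeff (k + b) (plusMat n q c) * intCoeff b (minusMat n q c)).map (toCompletion n q)

theorem mixedCoeff_summable (c : Fin m → ℤ) (k : ℤ) : Summable fun b : ℤ =>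
    (intCoeff (k + b) (plusMat n q c) * intCoeff b (minusMat n q c)).map (toCompletion n q) := by
  refine Pi.summable.2 fun w => Pi.summable.2 fun w' => ?_
  have := summable_mul_minus (q := q) (fun a => qSq q (c a))
    (fun b => intCoeff (k + b) (plusMat n q c)) 0 w w'
  simp only [add_zero] at this
  exact this

theorem intCoeff_intertwines {X : (Fin m → ℤ) → Matrix 𝕀 𝕀 (PowerSeries (UqCri n q))}
    (hX : Intertwines q X) (k : ℤ) :
    Intertwines q fun c => (intCoeff k (X c)).map (toCompletion n q) := by
  have h := hX.map (A' := UqCriCompletion n q)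
    { toFun := fun f => toCompletion n q ((HahnSeries.ofPowerSeries ℤ (UqCri n q) f).coeff k)
      map_zero' := by simp
      map_add' := fun f g => by simp } fun c f => by
    simp only [AddMonoidHom.coe_mk, ZeroHom.coe_mk, coeff_ofPowerSeries]
    split_ifs
    · rw [PowerSeries.algebraMap_apply, PowerSeries.coeff_C_mul, map_mul, AlgHom.commutes]
    · rw [map_zero, mul_zero]
  exact h

theorem mixedCoeff_intertwines (k : ℤ) :
    Intertwines q fun c : Fin m → ℤ => mixedCoeff n q c k := by
  have hb : ∀ b : ℤ, Intertwines q fun c : Fin m → ℤ =>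
      (intCoeff (k + b) (plusMat n q c) * intCoeff b (minusMat n q c)).map (toCompletion n q) := by
    intro b
    have := (intCoeff_intertwines (n := n) (m := m) (X := plusMat n q)
      (fun k c => (LPlus_isExchange n q).sitesProd_baxter k c) (k + b)).mul
      (intCoeff_intertwines (X := minusMat n q)
      (fun k c => (inverseFamily_isCoexchange n q).sitesProdRev_baxter k c) b)
    simpa only [Matrix.map_mul] using this
  intro l c
  simp only [mixedCoeff]
  rw [← (mixedCoeff_summable c k).tsum_mul_right, ← (mixedCoeff_summable _ k).tsum_mul_left]
  exact tsum_congr fun b => hb b l c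

theorem mapEntries_scalarCoeff (s : ℕ) (P : AuxOp n m (PowerSeries ℂ)) :
    AuxOp.mapEntries (toCompletion n q) (scalarCoeff (UqCri n q) s P) =
      scalarCoeff (UqCriCompletion n q) s P := by
  ext1 w w'
  ext1 i j
  exact AlgHom.commutes (toCompletion n q) _

theorem mapEntries_ofMatrix (Z : Matrix 𝕀 𝕀 (UqCri n q)) :
    AuxOp.mapEntries (toCompletion n q) (AuxOp.ofMatrix (n := n) Z) =
      AuxOp.ofMatrix (Z.map (toCompletion n q)) := by
  ext1 w w'
  ext1 i j
  simp only [AuxOp.mapEntries_apply, AuxOp.ofMatrix, Matrix.map_apply, Matrix.scalar_apply,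
    Matrix.diagonal_apply]
  split_ifs
  · rfl
  · exact map_zero _

theorem mapEntries_scalar (l : Matrix (Fin n) (Fin n) (UqCri n q)) :
    AuxOp.mapEntries (toCompletion n q) (Matrix.scalar 𝕀 l) =
      Matrix.scalar 𝕀 (l.map (toCompletion n q)) := by
  ext1 w w'
  ext1 i j
  simp only [AuxOp.mapEntries_apply, Matrix.scalar_apply, Matrix.diagonal_apply]
  split_ifs
  · rfl
  · exact map_zero _

theorem ofMatrix_mixedCoeff (c : Fin m → ℤ) (k : ℤ) :
    AuxOp.ofMatrix (n := n) (mixedCoeff n q c k) =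
      ∑' b : ℤ, AuxOp.ofMatrix ((intCoeff (k + b) (plusMat n q c)).map (toCompletion n q)) *
        AuxOp.ofMatrix ((intCoeff b (minusMat n q c)).map (toCompletion n q)) := by
  have hc : Continuous fun Z : Matrix 𝕀 𝕀 (UqCriCompletion n q) => AuxOp.ofMatrix (n := n) Z := by
    refine continuous_matrix fun w w' => continuous_matrix fun i j => ?_
    simp only [AuxOp.ofMatrix, Matrix.map_apply, Matrix.scalar_apply, Matrix.diagonal_apply]
    split_ifs
    · exact (continuous_apply_apply w w')
    · exact continuous_const
  have h := (mixedCoeff_summable c k).map_tsum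
    (Matrix.scalar (Fin n) : UqCriCompletion n q →+* _).mapMatrix hc
  refine h.trans (tsum_congr fun b => ?_)
  rw [← AuxOp.ofMatrix_mul, ← Matrix.map_mul]
  rfl

variable {L : ℕ → Matrix (Fin n) (Fin n) (UqCri n q)} {ε : ℤ}

theorem Dressing.mixedCoeff_relation (d : Dressing n q L ε) (c : Fin m → ℤ) (s : ℕ) (k : ℤ) :
    ∑ x ∈ Finset.HasAntidiagonal.antidiagonal s,
        scalarCoeff (UqCriCompletion n q) x.1 (d.outerProd c) *
          (Matrix.scalar 𝕀 ((L x.2).map (toCompletion n q)) *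
          AuxOp.ofMatrix (mixedCoeff n q c (k - ε * x.2))) =
      ∑ x ∈ Finset.HasAntidiagonal.antidiagonal s,
        AuxOp.ofMatrix (mixedCoeff n q c (k - ε * x.2)) *
          scalarCoeff (UqCriCompletion n q) x.1 (d.innerProd c) *
          Matrix.scalar 𝕀 ((L x.2).map (toCompletion n q)) := by
  let Ψ : AuxOp n m (UqCri n q) →+* AuxOp n m (UqCriCompletion n q) :=
    (toCompletion n q).toRingHom.mapMatrix.mapMatrix
  have hΨ : ∀ Z, Ψ Z = AuxOp.mapEntries (toCompletion n q) Z := fun _ => rfl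
  have hs : ∀ (Z : ℤ → AuxOp n m (UqCri n q)) (e : ℤ), Summable fun b : ℤ =>
      Ψ (Z b * AuxOp.ofMatrix (intCoeff (b + e) (minusMat n q c))) := fun Z e =>
    summable_aux_mul_minus _ Z e
  simp only [ofMatrix_mixedCoeff]
  refine tsum_relation (P := fun i => scalarCoeff (UqCriCompletion n q) i (d.outerProd c))
    (P' := fun i => scalarCoeff (UqCriCompletion n q) i (d.innerProd c))
    (P'' := fun i => scalarCoeff (UqCriCompletion n q) i (d.middleProd c))
    (L := fun j => Matrix.scalar 𝕀 ((L j).map (toCompletion n q)))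
    (X := fun k => AuxOp.ofMatrix ((intCoeff k (plusMat n q c)).map (toCompletion n q)))
    (M := fun k => AuxOp.ofMatrix ((intCoeff k (minusMat n q c)).map (toCompletion n q)))
    (fun s k => ?_) (fun s k => ?_) (fun k e => ?_) (fun i j k e => ?_) s k
  · have h := congrArg Ψ (d.left_coeff c s k)
    simp only [map_sum, map_mul] at h
    simp only [hΨ, mapEntries_scalarCoeff, mapEntries_scalar, mapEntries_ofMatrix] at h
    exact h
  · have h := congrArg Ψ (d.right_coeff c s k)
    simp only [map_sum, map_mul] at h
    simp only [hΨ, mapEntries_scalarCoeff, mapEntries_scalar, mapEntries_ofMatrix] at h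
    exact h
  · have h := hs (fun b => AuxOp.ofMatrix (intCoeff (k + b) (plusMat n q c))) e
    simp only [map_mul] at h
    simpa only [hΨ, mapEntries_ofMatrix] using h
  · have h := hs (fun b => AuxOp.ofMatrix (intCoeff (k + b) (plusMat n q c)) *
      (Matrix.scalar 𝕀 (L j) * scalarCoeff (UqCri n q) i (d.middleProd c))) e
    simp only [map_mul] at h
    simpa only [hΨ, mapEntries_ofMatrix, mapEntries_scalar, mapEntries_scalarCoeff] using h

theorem sugawaraTerm_eq {μ : YoungDiagram} (Λ : StdTableau μ) (k : ℤ) (r : ℕ) :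
    (sugawaraTerm n q Λ k r : UqCriCompletion n q) =
      Matrix.trace ((intCoeff (k + r) (plusMat n q Λ.c) * intCoeff r (minusMat n q Λ.c)).map
        (toCompletion n q) * scalarMat _ (weightE n q Λ)) := by
  have e : sugawaraTerm n q Λ k r = Matrix.trace (intCoeff (k + r) (plusMat n q Λ.c) *
      intCoeff r (minusMat n q Λ.c) * scalarMat _ (weightE n q Λ)) := by
    rw [sugawaraTerm]
    split_ifs with h
    · rw [coeff_plusProduct, coeff_minusInvProduct]
      congr 2
      congr 1
      · ext w w'
        rw [intCoeff, Matrix.map_apply, Matrix.map_apply, coeff_ofPowerSeries, if_pos h]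
        rfl
      · ext w w'
        rw [intCoeff, Matrix.map_apply, Matrix.map_apply, coeff_ofPowerSeries, if_pos (by omega)]
        rfl
    · rw [intCoeff_eq_zero _ (by omega), zero_mul, zero_mul, Matrix.trace_zero]
  rw [e, ← toCompletion_apply]
  refine (AddMonoidHom.map_trace (toCompletion n q) _).trans ?_
  rw [Matrix.map_mul]
  congr 2

theorem sugawara_hasSum {μ : YoungDiagram} (Λ : StdTableau μ) (k : ℤ) :
    HasSum (fun r : ℕ => (sugawaraTerm n q Λ k r : UqCriCompletion n q))
      (Matrix.trace (mixedCoeff n q Λ.c k * scalarMat _ (weightE n q Λ))) := by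
  let φ : Matrix (Fin μ.card → Fin n) (Fin μ.card → Fin n) (UqCriCompletion n q) →+
      UqCriCompletion n q :=
    (Matrix.traceAddMonoidHom _ _).comp (AddMonoidHom.mulRight (scalarMat _ (weightE n q Λ)))
  have hφ : Continuous φ := (continuous_id.mul continuous_const).matrix_trace
  have h := (mixedCoeff_summable (n := n) (q := q) Λ.c k).hasSum.map φ hφ
  have h2 := (Nat.cast_injective (R := ℤ)).hasSum_iff (f := φ ∘ fun b : ℤ =>
    (intCoeff (k + b) (plusMat n q Λ.c) * intCoeff b (minusMat n q Λ.c)).map (toCompletion n q))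
    (a := φ (mixedCoeff n q Λ.c k)) fun b hb => by
      rw [Function.comp_apply, intCoeff_eq_zero (minusMat n q Λ.c), mul_zero,
        Matrix.map_zero _ (map_zero _), map_zero]
      by_contra hb'
      exact hb ⟨b.toNat, by omega⟩
  have h3 := h2.2 h
  have e : (fun r : ℕ => (sugawaraTerm n q Λ k r : UqCriCompletion n q)) = (φ ∘ fun b : ℤ =>
    (intCoeff (k + b) (plusMat n q Λ.c) * intCoeff b (minusMat n q Λ.c)).map (toCompletion n q)) ∘
      Nat.cast := funext fun r => sugawaraTerm_eq Λ k r
  rw [e]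
  exact h3

theorem sugawaraCoeff_eq {μ : YoungDiagram} (Λ : StdTableau μ) (k : ℤ) : sugawaraCoeff n q Λ k =
    (schurElement q μ)⁻¹ • Matrix.trace (mixedCoeff n q (contents Λ.toTab.1) k * scalarMat _
      (weightD n μ.card q * tabUnit q (RCheck n q) (tabVec Λ.toTab.1) (tabVec Λ.toTab.1))) := by
  rw [sugawaraCoeff, (sugawara_hasSum Λ k).tsum_eq, weightE_eq, scalarMat_smul, mul_smul_comm,
    Matrix.trace_smul]
  rfl

theorem Dressing.commute_sugawaraCoeff (d : Dressing n q L ε) (hq : ∀ k : ℕ, 0 < k → q ^ k ≠ 1)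
    {μ : YoungDiagram} (Λ : StdTableau μ) (k : ℤ) (t : ℕ) (i j : Fin n) :
    Commute (toCompletion n q (L t i j)) (sugawaraCoeff n q Λ k) := by
  rw [sugawaraCoeff_eq]
  exact (d.commute hq (toCompletion n q) mixedCoeff_intertwines Λ.toTab
    (d.mixedCoeff_relation _) t k i j).smul_right _

theorem sugawaraCoeff_mem_center (hn : 1 ≤ n) (hq : ∀ k : ℕ, 0 < k → q ^ k ≠ 1)
    {μ : YoungDiagram} (Λ : StdTableau μ) (k : ℤ) :
    sugawaraCoeff n q Λ k ∈ Subring.center (UqCriCompletion n q) := by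
  have h : ∀ x : UqCri n q, Commute (toCompletion n q x) (sugawaraCoeff n q Λ k) := by
    intro x
    obtain ⟨x, rfl⟩ := freeToCri_surjective n q x
    induction x using FreeAlgebra.induction with
    | grade0 c =>
      rw [AlgHom.commutes, AlgHom.commutes]
      exact Algebra.commutes _ _
    | grade1 g =>
      cases g with
      | plus i j r => exact (dressingPlus hn hq).commute_sugawaraCoeff hq Λ k r i j
      | minus i j r => exact (dressingMinus hn hq).commute_sugawaraCoeff hq Λ k r i j
      | qc =>
        rw [freeToCri_qc, AlgHom.commutes]
        exact Algebra.commutes _ _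
      | qcInv =>
        rw [freeToCri_qcInv, AlgHom.commutes]
        exact Algebra.commutes _ _
    | mul a b ha hb =>
      rw [map_mul, map_mul]
      exact ha.mul_left hb
    | add a b ha hb =>
      rw [map_add, map_add]
      exact ha.add_left hb
  rw [Subring.mem_center_iff]
  intro g
  induction g using UniformSpace.Completion.induction_on with
  | hp => exact isClosed_eq (continuous_id.mul continuous_const) (continuous_const.mul continuous_id)
  | ih x => exact (h x).eq

end Central

end

end

end QuantumAffine

/-- The coefficients of the Laurent series `S_Λ(z)` are well-defined (the series defining them
converge), belong to the center of the completed quantum affine algebra at the critical level, and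
depend only on the shape of the standard tableau `Λ`. -/
theorem theorem3p1 (q : ℂˣ) (hq : ∀ k : ℕ, 0 < k → q ^ k ≠ 1) (n : ℕ) (hn : 1 ≤ n)
    (μ : YoungDiagram) (hμ : μ.colLen 0 ≤ n) :
    (∀ (Λ : QuantumAffine.StdTableau μ) (k : ℤ),
      Summable (fun r : ℕ =>
        (QuantumAffine.sugawaraTerm n q Λ k r : QuantumAffine.UqCriCompletion n q)) ∧
      QuantumAffine.sugawaraCoeff n q Λ k ∈
        Subring.center (QuantumAffine.UqCriCompletion n q)) ∧
    (∀ Λ Λ' : QuantumAffine.StdTableau μ,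
      QuantumAffine.sugawaraCoeff n q Λ = QuantumAffine.sugawaraCoeff n q Λ') := by
  refine ⟨fun Λ k => ⟨(QuantumAffine.sugawara_hasSum Λ k).summable,
    QuantumAffine.sugawaraCoeff_mem_center hn hq Λ k⟩, fun Λ Λ' => ?_⟩
  funext k
  rw [QuantumAffine.sugawaraCoeff, QuantumAffine.sugawaraCoeff,
    QuantumAffine.sugawaraTerm_eq_of_shape hq Λ Λ']
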